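/- **Conventions.** Let $\langle n\rangle=\{1,\dots,n\}$, and let $\mathbb S_n$ be its group of permutations. A *dg-operad* is a symmetric operad of homologically graded differential abelian groups, given by right actions $x\mapsto x^\sigma$ of $\mathbb S_n$ on $P(n)$, an identity $\mathrm{id}\in P(1)_0$, partial compositions $\circ_a$ of degree $0$, and a boundary $\partial$ of degree $-1$ with $\partial^2=0$. The actions commute with $\partial$, the partial compositions are equivariant and satisfy $(x\circ_a y)\circ_{a-1+b}z=x\circ_a(y\circ_b z)$, and, for $a<b$ and $y\in P(n)$, $(x\circ_a y)\circ_{b+n-1}z=(-1)^{\deg y\deg z}(x\circ_b z)\circ_a y$; moreover $\partial(x\circ_a y)=\partial x\circ_a y+(-1)^{\deg x}x\circ_a\partial y$. Homomorphisms of dg-operads preserve arity, degree and all of this structure. For $a\in\langle m\rangle$, let $\alpha:\langle n\rangle\hookrightarrow\langle m+n-1\rangle$, $\alpha(j)=j+a-1$, and let $\beta:\langle m+n-1\rangle\to\langle m\rangle$ be the weakly increasing surjection that collapses the image of $\alpha$ to $a$ and is injective off that image. **Trees.** A tree of arity $n$ is a planar rooted tree $T$ with vertex set $\langle n\rangle$.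 Write $u\le_T v$ if $u$ is an ancestor of $v$ or $u=v$. Write $u\vartriangleleft_T v$ if $u$ is to the left of $v$ (so exactly one of $u=v$, $u<_Tv$, $v<_Tu$, $u\vartriangleleft_T v$, $v\vartriangleleft_T u$ holds). If $S,T$ are trees of arities $m,n$ and $a\in\langle m\rangle$, an *extension of $S$ by $T$ at $a$* is a tree $U$ of arity $m+n-1$ such that $(r,s)$ is an edge of $T$ iff $(\alpha r,\alpha s)$ is an edge of $U$; $r\vartriangleleft_T s$ iff $\alpha r\vartriangleleft_U\alpha s$; for each edge $(u,w)$ of $U$ either $(\beta u,\beta w)$ is an edge of $S$ or $\beta u=\beta w=a$; and $\beta u\vartriangleleft_S\beta w$ implies $u\vartriangleleft_U w$. **Words.** A word of arity $n$ is a finite sequence $W$ in $\langle n\rangle$ in which every element of $\langle n\rangle$ occurs, with no consecutive repetition, and not of the form $\dots u\dots v\dots u\dots v\dots$ with $u\ne v$. Its degree is its length minus $n$. The *$\downarrow$ order* on $\langle n\rangle$ is the order of first occurrence in $W$. A *caesura* is a letter of $W$ whose vertex occurs again later; $v$ is *interposed* if $W=\dots uv\dots u\dots$ for some $u$. If the vertex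 of a letter $\underline a$ of $W$ is repeated, let $\partial_{\underline a}W$ be $W$ with $\underline a$ deleted, and let $\mathrm{sgn}_W(\underline a)=(-1)^k$ if $\underline a$ is the $k$-th caesura, and $\mathrm{sgn}_W(\underline a)=(-1)^{k+1}$ if $\underline a$ is the last occurrence of $a$ and the previous occurrence of $a$ is the $k$-th caesura. If $V,W$ are words of arities $m,n$ and $a\in\langle m\rangle$, an *extension of $V$ by $W$ at $a$* is a word $X$ of arity $m+n-1$ such that: deleting the letters not in the image of $\alpha$ and then eliminating consecutive repetitions gives $W$ relabelled by $\alpha$; whenever two letters in the image of $\alpha$ are separated in $X$ by one or more letters, none of which is in the image of $\alpha$, they are equal; and applying $\beta$ to $X$ and eliminating consecutive repetitions gives $V$. Its sign $\mathrm{sgn}_{V,W,a}(X)$ is the sign of the permutation that takes the list consisting of the interposed vertices of $V$ in $\downarrow$ order followed by those of $W$ in $\downarrow$ order to $\downarrow$ order in $X$; here an interposed $w$ of $W$ is identified with $\alpha w$, an interposed $v\neq a$ of $V$ with $\beta^{-1}(v)$, and $a$ (if interposed in $V$) with $\alpha$ of the first letter of $W$. **Quilts.** A *quilt* of arity $n$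 is a pair $Q=(W,T)$ of a word and a tree of arity $n\ge1$ such that $W=\dots u\dots v\dots$ implies $v\not<_T u$, and $W=\dots u\dots v\dots u\dots$ implies $v\vartriangleleft_T u$ or $v=u$. Put $\deg Q=\deg W$. Let $\mathrm{Quilt}(n)$ be the free graded abelian group on the quilts of arity $n$. Let $Q^\sigma$ be $Q$ with each $u$ replaced by $\sigma^{-1}(u)$; let $\partial(W,T)=\sum_{\underline a}\mathrm{sgn}_W(\underline a)\,(\partial_{\underline a}W,T)$, summed over the letters $\underline a$ of $W$ whose vertex is repeated; let $(V,S)\circ_a(W,T)=\sum_{X,U}\mathrm{sgn}_{V,W,a}(X)\,(X,U)$, summed over all extensions $X$ of $V$ by $W$ at $a$ and $U$ of $S$ by $T$ at $a$; and let the identity be the quilt of arity $1$. **$L_\infty$.** $L_\infty$ is the dg-operad generated by elements $\ell_n\in L_\infty(n)$, $n\ge2$, with $\deg\ell_n=n-2$, subject to $\ell_n^\sigma=\mathrm{sgn}(\sigma)\,\ell_n$ for $\sigma\in\mathbb S_n$ and $$0=\partial\ell_n+\sum_{\substack{p,q\ge2\\p+q=n+1}}\ \sum_{\sigma\in\mathrm{Sh}_{p-1,q}}(-1)^{(p-1)q}\,\mathrm{sgn}(\sigma)\,(\ell_p\circ_p\ell_q)^{\sigma^{-1}},$$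 where $\mathrm{Sh}_{p-1,q}\subset\mathbb S_n$ is the set of permutations that are increasing on $\{1,\dots,p-1\}$ and on $\{p,\dots,n\}$. **Theorem.** With these operations $\mathrm{Quilt}$ is a dg-operad. For $n\ge2$ let $$L^0_n=\sum_{Q}\mathrm{sgn}_{\mathcal K}(Q)\,Q,$$ where the sum is over all *maximal* quilts $Q$ of arity $n$, i.e. those with $\deg Q=n-2$, and $\mathrm{sgn}_{\mathcal K}(Q)$ is $(-1)^{1+n(n-1)/2}$ times the sign of the permutation from the numerical order of $\langle n\rangle$ to the $\downarrow$ order. Then for all $n\ge2$ $$0=\partial L^0_n+\sum_{\substack{p,q\ge2\\p+q=n+1}}\ \sum_{\sigma\in\mathrm{Sh}_{p-1,q}}(-1)^{(p-1)q}\,\mathrm{sgn}(\sigma)\,(L^0_p\circ_pL^0_q)^{\sigma^{-1}}$$ in $\mathrm{Quilt}$, and there exists a unique dg-operad homomorphism $\mathcal K:L_\infty\to\mathrm{Quilt}$ such that $\mathcal K(\ell_n)=L^0_n$ for all $n\ge2$. -/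

import Mathlib

namespace QuiltOp

/-! ## Blocks of labels

The labels `1, …, n` are represented by `Fin n`, so all labels are shifted down by one.
When `l + 1 = m + n` and `i : Fin m`, replacing the point `i` by `n` consecutive points
gives `Fin n ↪ Fin l ↠ Fin m`. -/

/-- The inclusion `Fin n ↪ Fin l` of the block that replaces `i`. -/
def blockIn {m n l : ℕ} (hl : l + 1 = m + n) (i : Fin m) (j : Fin n) : Fin l :=
  ⟨i.1 + j.1, by omega⟩

/-- The weakly increasing map `Fin l ↠ Fin m` that collapses the block to `i`. -/
def blockOut {m n l : ℕ} (hl : l + 1 = m + n) (i : Fin m) (k : Fin l) : Fin m :=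
  if h₁ : k.1 < i.1 then ⟨k.1, by omega⟩
  else if h₂ : k.1 < i.1 + n then i
  else ⟨k.1 + 1 - n, by omega⟩

/-! ## Differential graded operads of abelian groups -/

/-- The data of a (homologically graded) dg-operad of abelian groups: groups `P(n)_d`, right
actions of the symmetric groups, an identity, partial compositions `x ∘ᵢ y` and a boundary
operator of degree `-1`. Arities and degrees of results are free variables that are tied to the
others by equations. -/
structure DGOperadData where
  carrier : ℕ → ℤ → Type
  grp : ∀ n d, AddCommGroup (carrier n d)
  one : carrier 1 0
  act : ∀ {n : ℕ} {d : ℤ}, Equiv.Perm (Fin n) → carrier n d → carrier n d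
  comp : ∀ {m n l : ℕ} {d e f : ℤ}, l + 1 = m + n → d + e = f → Fin m →
    carrier m d → carrier n e → carrier l f
  bd : ∀ {n : ℕ} {d e : ℤ}, e + 1 = d → carrier n d → carrier n e

attribute [instance] DGOperadData.grp

/-- The axioms of a dg-operad, in terms of partial compositions. -/
structure IsDGOperad (P : DGOperadData) : Prop where
  act_add : ∀ {n : ℕ} {d : ℤ} (σ : Equiv.Perm (Fin n)) (x y : P.carrier n d),
    P.act σ (x + y) = P.act σ x + P.act σ y
  act_one : ∀ {n : ℕ} {d : ℤ} (x : P.carrier n d), P.act 1 x = x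
  act_mul : ∀ {n : ℕ} {d : ℤ} (σ τ : Equiv.Perm (Fin n)) (x : P.carrier n d),
    P.act (σ * τ) x = P.act τ (P.act σ x)
  comp_add_left : ∀ {m n l : ℕ} {d e f : ℤ} (hl : l + 1 = m + n) (hf : d + e = f) (i : Fin m)
    (x x' : P.carrier m d) (y : P.carrier n e),
    P.comp hl hf i (x + x') y = P.comp hl hf i x y + P.comp hl hf i x' y
  comp_add_right : ∀ {m n l : ℕ} {d e f : ℤ} (hl : l + 1 = m + n) (hf : d + e = f) (i : Fin m)
    (x : P.carrier m d) (y y' : P.carrier n e),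
    P.comp hl hf i x (y + y') = P.comp hl hf i x y + P.comp hl hf i x y'
  one_comp : ∀ {n : ℕ} {d : ℤ} (hl : n + 1 = 1 + n) (hf : 0 + d = d) (i : Fin 1)
    (x : P.carrier n d), P.comp hl hf i P.one x = x
  comp_one : ∀ {n : ℕ} {d : ℤ} (hl : n + 1 = n + 1) (hf : d + 0 = d) (i : Fin n)
    (x : P.carrier n d), P.comp hl hf i x P.one = x
  /-- Sequential associativity. -/
  comp_seq : ∀ {m n k l₁ l₂ l : ℕ} {d e g f₁ f₂ f : ℤ}
    (h₁ : l₁ + 1 = m + n) (h₂ : l + 1 = l₁ + k) (h₃ : l₂ + 1 = n + k) (h₄ : l + 1 = m + l₂)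
    (g₁ : d + e = f₁) (g₂ : f₁ + g = f) (g₃ : e + g = f₂) (g₄ : d + f₂ = f)
    (i : Fin m) (j : Fin n) (x : P.carrier m d) (y : P.carrier n e) (z : P.carrier k g),
    P.comp h₂ g₂ (blockIn h₁ i j) (P.comp h₁ g₁ i x y) z =
      P.comp h₄ g₄ i x (P.comp h₃ g₃ j y z)
  /-- Parallel associativity, with the Koszul sign; `j'` is the label of the composite
  `x ∘ᵢ y` that comes from the label `j ≠ i` of `x`, and `i'` is the label of `x ∘ⱼ z` that
  comes from the label `i`. -/
  comp_par : ∀ {m n k l₁ l₂ l : ℕ} {d e g f₁ f₂ f : ℤ}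
    (h₁ : l₁ + 1 = m + n) (h₂ : l + 1 = l₁ + k) (h₃ : l₂ + 1 = m + k) (h₄ : l + 1 = l₂ + n)
    (g₁ : d + e = f₁) (g₂ : f₁ + g = f) (g₃ : d + g = f₂) (g₄ : f₂ + e = f)
    (i j : Fin m) (i' : Fin l₂) (j' : Fin l₁), i ≠ j →
    blockOut h₁ i j' = j → blockOut h₃ j i' = i →
    ∀ (x : P.carrier m d) (y : P.carrier n e) (z : P.carrier k g),
    P.comp h₂ g₂ j' (P.comp h₁ g₁ i x y) z =
      (e * g).negOnePow • P.comp h₄ g₄ i' (P.comp h₃ g₃ j x z) y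
  /-- Equivariance; `ρ` is the permutation that acts on labels over `k ≠ i` as `σ` does on
  the `k`, and that moves the block at `i` to the block at `σ i`, acting inside it as `τ`. -/
  comp_act : ∀ {m n l : ℕ} {d e f : ℤ} (hl : l + 1 = m + n) (hf : d + e = f) (i : Fin m)
    (σ : Equiv.Perm (Fin m)) (τ : Equiv.Perm (Fin n)) (ρ : Equiv.Perm (Fin l)),
    (∀ j, ρ (blockIn hl i j) = blockIn hl (σ i) (τ j)) →
    (∀ k, blockOut hl (σ i) (ρ k) = σ (blockOut hl i k)) →
    ∀ (x : P.carrier m d) (y : P.carrier n e),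
    P.comp hl hf i (P.act σ x) (P.act τ y) = P.act ρ (P.comp hl hf (σ i) x y)
  bd_add : ∀ {n : ℕ} {d e : ℤ} (h : e + 1 = d) (x y : P.carrier n d),
    P.bd h (x + y) = P.bd h x + P.bd h y
  bd_bd : ∀ {n : ℕ} {d e f : ℤ} (h : e + 1 = d) (h' : f + 1 = e) (x : P.carrier n d),
    P.bd h' (P.bd h x) = 0
  bd_act : ∀ {n : ℕ} {d e : ℤ} (h : e + 1 = d) (σ : Equiv.Perm (Fin n)) (x : P.carrier n d),
    P.bd h (P.act σ x) = P.act σ (P.bd h x)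
  /-- The boundary is a graded derivation. -/
  bd_comp : ∀ {m n l : ℕ} {d e f d' e' f' : ℤ} (hl : l + 1 = m + n) (hf : d + e = f)
    (hd' : d' + 1 = d) (he' : e' + 1 = e) (hf' : f' + 1 = f)
    (h₁ : d' + e = f') (h₂ : d + e' = f')
    (i : Fin m) (x : P.carrier m d) (y : P.carrier n e),
    P.bd hf' (P.comp hl hf i x y) =
      P.comp hl h₁ i (P.bd hd' x) y + d.negOnePow • P.comp hl h₂ i x (P.bd he' y)

/-- Homomorphisms of dg-operads. -/
structure DGOperadHom (P Q : DGOperadData) where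
  toFun : ∀ (n : ℕ) (d : ℤ), P.carrier n d →+ Q.carrier n d
  map_one : toFun 1 0 P.one = Q.one
  map_act : ∀ {n : ℕ} {d : ℤ} (σ : Equiv.Perm (Fin n)) (x : P.carrier n d),
    toFun n d (P.act σ x) = Q.act σ (toFun n d x)
  map_comp : ∀ {m n l : ℕ} {d e f : ℤ} (hl : l + 1 = m + n) (hf : d + e = f) (i : Fin m)
    (x : P.carrier m d) (y : P.carrier n e),
    toFun l f (P.comp hl hf i x y) = Q.comp hl hf i (toFun m d x) (toFun n e y)
  map_bd : ∀ {n : ℕ} {d e : ℤ} (h : e + 1 = d) (x : P.carrier n d),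
    toFun n e (P.bd h x) = Q.bd h (toFun n d x)

/-! ## The `L∞` relations -/

/-- The pairs `(p, q)` with `p, q ≥ 2` and `p + q = n + 1`. -/
def arityPairs (n : ℕ) : Finset (ℕ × ℕ) :=
  (Finset.range (n + 1) ×ˢ Finset.range (n + 1)).filter fun x =>
    x.1 + x.2 = n + 1 ∧ 2 ≤ x.1 ∧ 2 ≤ x.2

theorem arityPairs_spec {n : ℕ} {x : ℕ × ℕ} (hx : x ∈ arityPairs n) :
    x.1 + x.2 = n + 1 ∧ 2 ≤ x.1 ∧ 2 ≤ x.2 := by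
  exact (Finset.mem_filter.1 hx).2

/-- The `(k, n - k)`-shuffles in the symmetric group on `n` letters: permutations that are
increasing on the first `k` letters and on the remaining ones. -/
def shuffles (n k : ℕ) : Finset (Equiv.Perm (Fin n)) :=
  Finset.univ.filter fun σ =>
    (∀ i j : Fin n, i < j → j.1 < k → σ i < σ j) ∧ (∀ i j : Fin n, k ≤ i.1 → i < j → σ i < σ j)

/-- The sign `(-1)^((p-1)q) sgn σ`. -/
def linfSign {n : ℕ} (p q : ℕ) (σ : Equiv.Perm (Fin n)) : ℤˣ :=
  (-1) ^ ((p - 1) * q) * Equiv.Perm.sign σ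

/-- `∂ℓₙ + ∑_{p+q=n+1} ∑_{σ ∈ Sh(p-1,q)} (-1)^((p-1)q) sgn σ (ℓ_p ∘_p ℓ_q)^(σ⁻¹)`,
for a family of elements `ℓₙ` of arity `n ≥ 2` and degree `n - 2`. -/
def linfDefect (P : DGOperadData) (ℓ : ∀ n : ℕ, 2 ≤ n → P.carrier n ((n : ℤ) - 2))
    (n : ℕ) (hn : 2 ≤ n) : P.carrier n ((n : ℤ) - 3) :=
  P.bd (by omega) (ℓ n hn) +
    ∑ x ∈ (arityPairs n).attach, ∑ σ ∈ shuffles n (x.1.1 - 1),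
      linfSign x.1.1 x.1.2 σ • P.act σ⁻¹
        (P.comp (m := x.1.1) (n := x.1.2) (arityPairs_spec x.2).1.symm
          (by have := (arityPairs_spec x.2).1; omega)
          ⟨x.1.1 - 1, by have := (arityPairs_spec x.2).2.1; omega⟩
          (ℓ x.1.1 (arityPairs_spec x.2).2.1) (ℓ x.1.2 (arityPairs_spec x.2).2.2))

/-! ## The dg-operad `L∞`, by generators and relations -/

/-- Formal expressions in the generators `ℓₙ` and the operations of a dg-operad. -/
inductive LTerm : ℕ → ℤ → Type
  | gen (n : ℕ) (hn : 2 ≤ n) : LTerm n ((n : ℤ) - 2)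
  | one : LTerm 1 0
  | zero {n : ℕ} {d : ℤ} : LTerm n d
  | add {n : ℕ} {d : ℤ} (s t : LTerm n d) : LTerm n d
  | neg {n : ℕ} {d : ℤ} (t : LTerm n d) : LTerm n d
  | act {n : ℕ} {d : ℤ} (σ : Equiv.Perm (Fin n)) (t : LTerm n d) : LTerm n d
  | comp {m n l : ℕ} {d e f : ℤ} (hl : l + 1 = m + n) (hf : d + e = f) (i : Fin m)
      (s : LTerm m d) (t : LTerm n e) : LTerm l f
  | bd {n : ℕ} {d e : ℤ} (h : e + 1 = d) (t : LTerm n d) : LTerm n e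

namespace LTerm

/-- The expression `± t`. -/
def signed {n : ℕ} {d : ℤ} (s : ℤˣ) (t : LTerm n d) : LTerm n d := if s = 1 then t else neg t

/-- The sum of a list of expressions. -/
def sum {n : ℕ} {d : ℤ} (L : List (LTerm n d)) : LTerm n d := L.foldr add zero

/-- The expression `linfDefect` in the generators. -/
noncomputable def defect (n : ℕ) (hn : 2 ≤ n) : LTerm n ((n : ℤ) - 3) :=
  add (bd (by omega) (gen n hn))
    (sum ((arityPairs n).attach.toList.map fun x =>
      sum ((shuffles n (x.1.1 - 1)).toList.map fun σ =>
        signed (linfSign x.1.1 x.1.2 σ) (act σ⁻¹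
          (comp (m := x.1.1) (n := x.1.2) (arityPairs_spec x.2).1.symm
            (by have := (arityPairs_spec x.2).1; omega)
            ⟨x.1.1 - 1, by have := (arityPairs_spec x.2).2.1; omega⟩
            (gen x.1.1 (arityPairs_spec x.2).2.1) (gen x.1.2 (arityPairs_spec x.2).2.2))))))

end LTerm

open LTerm in
/-- The smallest congruence on formal expressions that contains the axioms of dg-operads, the
antisymmetry of the generators and the `L∞` relations. -/
inductive LRel : ∀ {n : ℕ} {d : ℤ}, LTerm n d → LTerm n d → Prop
  | refl {n : ℕ} {d : ℤ} (t : LTerm n d) : LRel t t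
  | symm {n : ℕ} {d : ℤ} {s t : LTerm n d} : LRel s t → LRel t s
  | trans {n : ℕ} {d : ℤ} {s t u : LTerm n d} : LRel s t → LRel t u → LRel s u
  | add_congr {n : ℕ} {d : ℤ} {s s' t t' : LTerm n d} :
      LRel s s' → LRel t t' → LRel (add s t) (add s' t')
  | neg_congr {n : ℕ} {d : ℤ} {t t' : LTerm n d} : LRel t t' → LRel (neg t) (neg t')
  | act_congr {n : ℕ} {d : ℤ} (σ : Equiv.Perm (Fin n)) {t t' : LTerm n d} :
      LRel t t' → LRel (act σ t) (act σ t')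
  | comp_congr {m n l : ℕ} {d e f : ℤ} (hl : l + 1 = m + n) (hf : d + e = f) (i : Fin m)
      {s s' : LTerm m d} {t t' : LTerm n e} :
      LRel s s' → LRel t t' → LRel (comp hl hf i s t) (comp hl hf i s' t')
  | bd_congr {n : ℕ} {d e : ℤ} (h : e + 1 = d) {t t' : LTerm n d} :
      LRel t t' → LRel (bd h t) (bd h t')
  | add_assoc {n : ℕ} {d : ℤ} (s t u : LTerm n d) :
      LRel (add (add s t) u) (add s (add t u))
  | add_comm {n : ℕ} {d : ℤ} (s t : LTerm n d) : LRel (add s t) (add t s)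
  | zero_add {n : ℕ} {d : ℤ} (t : LTerm n d) : LRel (add zero t) t
  | neg_add {n : ℕ} {d : ℤ} (t : LTerm n d) : LRel (add (neg t) t) zero
  | act_add {n : ℕ} {d : ℤ} (σ : Equiv.Perm (Fin n)) (s t : LTerm n d) :
      LRel (act σ (add s t)) (add (act σ s) (act σ t))
  | act_one {n : ℕ} {d : ℤ} (t : LTerm n d) : LRel (act 1 t) t
  | act_mul {n : ℕ} {d : ℤ} (σ τ : Equiv.Perm (Fin n)) (t : LTerm n d) :
      LRel (act (σ * τ) t) (act τ (act σ t))
  | comp_add_left {m n l : ℕ} {d e f : ℤ} (hl : l + 1 = m + n) (hf : d + e = f) (i : Fin m)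
      (s s' : LTerm m d) (t : LTerm n e) :
      LRel (comp hl hf i (add s s') t) (add (comp hl hf i s t) (comp hl hf i s' t))
  | comp_add_right {m n l : ℕ} {d e f : ℤ} (hl : l + 1 = m + n) (hf : d + e = f) (i : Fin m)
      (s : LTerm m d) (t t' : LTerm n e) :
      LRel (comp hl hf i s (add t t')) (add (comp hl hf i s t) (comp hl hf i s t'))
  | one_comp {n : ℕ} {d : ℤ} (hl : n + 1 = 1 + n) (hf : 0 + d = d) (i : Fin 1)
      (t : LTerm n d) : LRel (comp hl hf i one t) t
  | comp_one {n : ℕ} {d : ℤ} (hl : n + 1 = n + 1) (hf : d + 0 = d) (i : Fin n)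
      (t : LTerm n d) : LRel (comp hl hf i t one) t
  | comp_seq {m n k l₁ l₂ l : ℕ} {d e g f₁ f₂ f : ℤ}
      (h₁ : l₁ + 1 = m + n) (h₂ : l + 1 = l₁ + k) (h₃ : l₂ + 1 = n + k) (h₄ : l + 1 = m + l₂)
      (g₁ : d + e = f₁) (g₂ : f₁ + g = f) (g₃ : e + g = f₂) (g₄ : d + f₂ = f)
      (i : Fin m) (j : Fin n) (s : LTerm m d) (t : LTerm n e) (u : LTerm k g) :
      LRel (comp h₂ g₂ (blockIn h₁ i j) (comp h₁ g₁ i s t) u)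
        (comp h₄ g₄ i s (comp h₃ g₃ j t u))
  | comp_par {m n k l₁ l₂ l : ℕ} {d e g f₁ f₂ f : ℤ}
      (h₁ : l₁ + 1 = m + n) (h₂ : l + 1 = l₁ + k) (h₃ : l₂ + 1 = m + k) (h₄ : l + 1 = l₂ + n)
      (g₁ : d + e = f₁) (g₂ : f₁ + g = f) (g₃ : d + g = f₂) (g₄ : f₂ + e = f)
      (i j : Fin m) (i' : Fin l₂) (j' : Fin l₁) (hij : i ≠ j)
      (hj : blockOut h₁ i j' = j) (hi : blockOut h₃ j i' = i)
      (s : LTerm m d) (t : LTerm n e) (u : LTerm k g) :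
      LRel (comp h₂ g₂ j' (comp h₁ g₁ i s t) u)
        (signed (e * g).negOnePow (comp h₄ g₄ i' (comp h₃ g₃ j s u) t))
  | comp_act {m n l : ℕ} {d e f : ℤ} (hl : l + 1 = m + n) (hf : d + e = f) (i : Fin m)
      (σ : Equiv.Perm (Fin m)) (τ : Equiv.Perm (Fin n)) (ρ : Equiv.Perm (Fin l))
      (hρ : ∀ j, ρ (blockIn hl i j) = blockIn hl (σ i) (τ j))
      (hρ' : ∀ k, blockOut hl (σ i) (ρ k) = σ (blockOut hl i k))
      (s : LTerm m d) (t : LTerm n e) :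
      LRel (comp hl hf i (act σ s) (act τ t)) (act ρ (comp hl hf (σ i) s t))
  | bd_add {n : ℕ} {d e : ℤ} (h : e + 1 = d) (s t : LTerm n d) :
      LRel (bd h (add s t)) (add (bd h s) (bd h t))
  | bd_bd {n : ℕ} {d e f : ℤ} (h : e + 1 = d) (h' : f + 1 = e) (t : LTerm n d) :
      LRel (bd h' (bd h t)) zero
  | bd_act {n : ℕ} {d e : ℤ} (h : e + 1 = d) (σ : Equiv.Perm (Fin n)) (t : LTerm n d) :
      LRel (bd h (act σ t)) (act σ (bd h t))
  | bd_comp {m n l : ℕ} {d e f d' e' f' : ℤ} (hl : l + 1 = m + n) (hf : d + e = f)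
      (hd' : d' + 1 = d) (he' : e' + 1 = e) (hf' : f' + 1 = f)
      (h₁ : d' + e = f') (h₂ : d + e' = f')
      (i : Fin m) (s : LTerm m d) (t : LTerm n e) :
      LRel (bd hf' (comp hl hf i s t))
        (add (comp hl h₁ i (bd hd' s) t) (signed d.negOnePow (comp hl h₂ i s (bd he' t))))
  | gen_act (n : ℕ) (hn : 2 ≤ n) (σ : Equiv.Perm (Fin n)) :
      LRel (act σ (gen n hn)) (signed (Equiv.Perm.sign σ) (gen n hn))
  | gen_defect (n : ℕ) (hn : 2 ≤ n) : LRel (defect n hn) zero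

instance LTerm.setoid (n : ℕ) (d : ℤ) : Setoid (LTerm n d) where
  r := LRel
  iseqv := ⟨LRel.refl, LRel.symm, LRel.trans⟩

/-- The group `L∞(n)_d`. -/
def LGroup (n : ℕ) (d : ℤ) : Type := Quotient (LTerm.setoid n d)

/-- The class of a formal expression. -/
def LGroup.mk {n : ℕ} {d : ℤ} (t : LTerm n d) : LGroup n d := Quotient.mk _ t

theorem LGroup.sound {n : ℕ} {d : ℤ} {s t : LTerm n d} (h : LRel s t) :
    LGroup.mk s = LGroup.mk t := Quotient.sound h

instance LGroup.hasAdd (n : ℕ) (d : ℤ) : Add (LGroup n d) where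
  add := Quotient.map₂ LTerm.add fun _ _ h _ _ h' => LRel.add_congr h h'

instance LGroup.hasZero (n : ℕ) (d : ℤ) : Zero (LGroup n d) where
  zero := LGroup.mk LTerm.zero

instance LGroup.hasNeg (n : ℕ) (d : ℤ) : Neg (LGroup n d) where
  neg := Quotient.map LTerm.neg fun _ _ h => LRel.neg_congr h

instance LGroup.addCommGroup (n : ℕ) (d : ℤ) : AddCommGroup (LGroup n d) where
  add_assoc := by rintro ⟨s⟩ ⟨t⟩ ⟨u⟩; exact LGroup.sound (LRel.add_assoc s t u)
  add_comm := by rintro ⟨s⟩ ⟨t⟩; exact LGroup.sound (LRel.add_comm s t)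
  zero_add := by rintro ⟨s⟩; exact LGroup.sound (LRel.zero_add s)
  add_zero := by
    rintro ⟨s⟩; exact LGroup.sound ((LRel.add_comm s _).trans (LRel.zero_add s))
  neg_add_cancel := by rintro ⟨s⟩; exact LGroup.sound (LRel.neg_add s)
  nsmul := nsmulRec
  zsmul := zsmulRec

theorem LGroup.mk_signed {n : ℕ} {d : ℤ} (s : ℤˣ) (t : LTerm n d) :
    LGroup.mk (LTerm.signed s t) = s • LGroup.mk t := by
  rcases Int.units_eq_one_or s with rfl | rfl
  · simp [LTerm.signed]
  · have h : ((-1 : ℤˣ)) ≠ 1 := by decide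
    simp only [LTerm.signed, h, if_false, Units.smul_def, Units.val_neg, Units.val_one,
      neg_smul, one_smul]
    rfl

theorem LGroup.mk_sum {n : ℕ} {d : ℤ} (L : List (LTerm n d)) :
    LGroup.mk (LTerm.sum L) = (L.map LGroup.mk).sum := by
  induction L with
  | nil => rfl
  | cons t L ih =>
    rw [List.map_cons, List.sum_cons, ← ih]
    rfl

/-- The dg-operad `L∞`. -/
def linf : DGOperadData where
  carrier := LGroup
  grp := LGroup.addCommGroup
  one := LGroup.mk LTerm.one
  act σ := Quotient.map (LTerm.act σ) fun _ _ h => LRel.act_congr σ h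
  comp hl hf i := Quotient.map₂ (LTerm.comp hl hf i) fun _ _ h _ _ h' =>
    LRel.comp_congr hl hf i h h'
  bd h := Quotient.map (LTerm.bd h) fun _ _ h' => LRel.bd_congr h h'

/-- The generator `ℓₙ` of `L∞`. -/
def ell (n : ℕ) (hn : 2 ≤ n) : linf.carrier n ((n : ℤ) - 2) := LGroup.mk (LTerm.gen n hn)

theorem linf_isDGOperad : IsDGOperad linf where
  act_add := by rintro n d σ ⟨s⟩ ⟨t⟩; exact LGroup.sound (LRel.act_add σ s t)
  act_one := by rintro n d ⟨s⟩; exact LGroup.sound (LRel.act_one s)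
  act_mul := by rintro n d σ τ ⟨s⟩; exact LGroup.sound (LRel.act_mul σ τ s)
  comp_add_left := by
    rintro m n l d e f hl hf i ⟨s⟩ ⟨s'⟩ ⟨t⟩
    exact LGroup.sound (LRel.comp_add_left hl hf i s s' t)
  comp_add_right := by
    rintro m n l d e f hl hf i ⟨s⟩ ⟨t⟩ ⟨t'⟩
    exact LGroup.sound (LRel.comp_add_right hl hf i s t t')
  one_comp := by rintro n d hl hf i ⟨t⟩; exact LGroup.sound (LRel.one_comp hl hf i t)
  comp_one := by rintro n d hl hf i ⟨t⟩; exact LGroup.sound (LRel.comp_one hl hf i t)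
  comp_seq := by
    rintro m n k l₁ l₂ l d e g f₁ f₂ f h₁ h₂ h₃ h₄ g₁ g₂ g₃ g₄ i j ⟨s⟩ ⟨t⟩ ⟨u⟩
    exact LGroup.sound (LRel.comp_seq h₁ h₂ h₃ h₄ g₁ g₂ g₃ g₄ i j s t u)
  comp_par := by
    rintro m n k l₁ l₂ l d e g f₁ f₂ f h₁ h₂ h₃ h₄ g₁ g₂ g₃ g₄ i j i' j' hij hj hi ⟨s⟩ ⟨t⟩ ⟨u⟩
    exact (LGroup.sound
      (LRel.comp_par h₁ h₂ h₃ h₄ g₁ g₂ g₃ g₄ i j i' j' hij hj hi s t u)).trans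
      (LGroup.mk_signed _ _)
  comp_act := by
    rintro m n l d e f hl hf i σ τ ρ hρ hρ' ⟨s⟩ ⟨t⟩
    exact LGroup.sound (LRel.comp_act hl hf i σ τ ρ hρ hρ' s t)
  bd_add := by rintro n d e h ⟨s⟩ ⟨t⟩; exact LGroup.sound (LRel.bd_add h s t)
  bd_bd := by rintro n d e f h h' ⟨t⟩; exact LGroup.sound (LRel.bd_bd h h' t)
  bd_act := by rintro n d e h σ ⟨t⟩; exact LGroup.sound (LRel.bd_act h σ t)
  bd_comp := by
    rintro m n l d e f d' e' f' hl hf hd' he' hf' h₁ h₂ i ⟨s⟩ ⟨t⟩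
    refine (LGroup.sound (LRel.bd_comp hl hf hd' he' hf' h₁ h₂ i s t)).trans ?_
    exact congrArg (LGroup.mk (LTerm.comp hl h₁ i (LTerm.bd hd' s) t) + ·)
      (LGroup.mk_signed _ _)

theorem ell_act (n : ℕ) (hn : 2 ≤ n) (σ : Equiv.Perm (Fin n)) :
    linf.act σ (ell n hn) = Equiv.Perm.sign σ • ell n hn :=
  (LGroup.sound (LRel.gen_act n hn σ)).trans (LGroup.mk_signed _ _)

theorem ell_defect (n : ℕ) (hn : 2 ≤ n) : linfDefect linf ell n hn = 0 := by
  refine Eq.trans ?_ (LGroup.sound (LRel.gen_defect n hn))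
  have key : ∀ {s t : LTerm n ((n : ℤ) - 3)} {y : LGroup n ((n : ℤ) - 3)},
      y = LGroup.mk t → LGroup.mk s + y = LGroup.mk (LTerm.add s t) := by
    rintro s t y rfl
    rfl
  refine key ?_
  refine Eq.trans ?_ (LGroup.mk_sum _).symm
  rw [List.map_map]
  refine (Finset.sum_map_toList (M := LGroup n ((n : ℤ) - 3)) _ _).symm.trans ?_
  refine congrArg List.sum (List.map_congr_left fun x _ => ?_)
  refine Eq.trans ?_ (LGroup.mk_sum _).symm
  rw [List.map_map]
  refine (Finset.sum_map_toList (M := LGroup n ((n : ℤ) - 3)) _ _).symm.trans ?_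
  refine congrArg List.sum (List.map_congr_left fun σ _ => ?_)
  exact (LGroup.mk_signed _ _).symm

/-! ## Planar rooted trees -/

/-- Planar rooted trees with vertex set `Fin n`. The relation `left` is the strict part
`u ⊲ v` of the horizontal order; the vertical order `u ≤ v` (the root is the minimum) is
generated by the edges, which point from parents to children. -/
@[ext] structure PTree (n : ℕ) where
  edge : Fin n → Fin n → Prop
  left : Fin n → Fin n → Prop
  left_irrefl : ∀ u, ¬ left u u
  left_trans : ∀ u v w, left u v → left v w → left u w
  edge_irrefl : ∀ u, ¬ edge u u
  le_antisymm : ∀ u v, Relation.ReflTransGen edge u v → Relation.ReflTransGen edge v u → u = v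
  root : ∃! r, ∀ u, Relation.ReflTransGen edge u r → u = r
  edge_minimal : ∀ u v, edge u v → ∀ t, Relation.ReflTransGen edge u t →
    Relation.ReflTransGen edge t v → t = u ∨ t = v
  comparable : ∀ u v, (left u v ∨ left v u) ↔
    (¬ Relation.ReflTransGen edge u v ∧ ¬ Relation.ReflTransGen edge v u)
  inherit : ∀ u v u' v', left u v → Relation.ReflTransGen edge u u' →
    Relation.ReflTransGen edge v v' → left u' v'

namespace PTree

/-- The vertical order. -/
def le {n : ℕ} (T : PTree n) (u v : Fin n) : Prop := Relation.ReflTransGen T.edge u v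

/-- The strict vertical order. -/
def lt {n : ℕ} (T : PTree n) (u v : Fin n) : Prop := T.le u v ∧ u ≠ v

theorem reflTransGen_perm {n : ℕ} (E : Fin n → Fin n → Prop) (σ : Equiv.Perm (Fin n))
    (u v : Fin n) : Relation.ReflTransGen (fun a b => E (σ a) (σ b)) u v ↔
      Relation.ReflTransGen E (σ u) (σ v) := by
  constructor
  · exact fun h => Relation.ReflTransGen.lift σ (fun _ _ h => h) _ _ h
  · intro h
    have := Relation.ReflTransGen.lift (p := fun a b => E (σ a) (σ b)) σ.symm
      (fun a b h => by simpa [Function.onFun] using h) _ _ h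
    simpa [Function.onFun] using this

/-- The tree `T^σ`, in which `u` is replaced by `σ⁻¹ u`. -/
def relabel {n : ℕ} (σ : Equiv.Perm (Fin n)) (T : PTree n) : PTree n where
  edge u v := T.edge (σ u) (σ v)
  left u v := T.left (σ u) (σ v)
  left_irrefl u := T.left_irrefl _
  left_trans u v w := T.left_trans _ _ _
  edge_irrefl u := T.edge_irrefl _
  le_antisymm u v h h' := σ.injective
    (T.le_antisymm _ _ ((reflTransGen_perm _ σ _ _).1 h) ((reflTransGen_perm _ σ _ _).1 h'))
  root := by
    obtain ⟨r, hr, hu⟩ := T.root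
    refine ⟨σ.symm r, fun u h => ?_, fun s hs => ?_⟩
    · rw [reflTransGen_perm] at h
      rw [Equiv.apply_symm_apply] at h
      exact (Equiv.eq_symm_apply σ).2 (hr _ h)
    · refine (Equiv.eq_symm_apply σ).2 (hu _ fun u h => ?_)
      have := hs (σ.symm u) ((reflTransGen_perm _ σ _ _).2 (by simpa using h))
      simp [← this]
  edge_minimal u v h t h₁ h₂ := by
    rw [reflTransGen_perm] at h₁ h₂
    exact (T.edge_minimal _ _ h _ h₁ h₂).imp (fun h => σ.injective h) (fun h => σ.injective h)
  comparable u v := by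
    rw [reflTransGen_perm, reflTransGen_perm]
    exact T.comparable _ _
  inherit u v u' v' h h₁ h₂ := by
    rw [reflTransGen_perm] at h₁ h₂
    exact T.inherit _ _ _ _ h h₁ h₂

/-- The tree with one vertex. -/
def unit : PTree 1 where
  edge _ _ := False
  left _ _ := False
  left_irrefl _ h := h
  left_trans _ _ _ h _ := h
  edge_irrefl _ h := h
  le_antisymm u v _ _ := Subsingleton.elim u v
  root := ⟨0, fun u _ => Subsingleton.elim u 0, fun u _ => Subsingleton.elim u 0⟩
  edge_minimal _ _ h := h.elim
  comparable u v := by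
    obtain rfl : u = v := Subsingleton.elim u v
    simp [Relation.ReflTransGen.refl]
  inherit _ _ _ _ h := h.elim

/-- `U` is an extension of `S` by `T` at `i`: `T` is a subtree of `U`, and contracting it to
the vertex `i` gives `S`. -/
structure IsExt {m n l : ℕ} (hl : l + 1 = m + n) (i : Fin m)
    (S : PTree m) (T : PTree n) (U : PTree l) : Prop where
  edge_sub : ∀ r s, T.edge r s ↔ U.edge (blockIn hl i r) (blockIn hl i s)
  left_sub : ∀ r s, T.left r s ↔ U.left (blockIn hl i r) (blockIn hl i s)
  edge_quot : ∀ u w, U.edge u w → S.edge (blockOut hl i u) (blockOut hl i w) ∨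
    (blockOut hl i u = i ∧ blockOut hl i w = i)
  left_quot : ∀ u w, S.left (blockOut hl i u) (blockOut hl i w) → U.left u w

end PTree

/-! ## Words -/

/-- Words over `Fin n` in which every letter occurs, without consecutive repetitions and
without interlacing. Here `[u, u] <:+: W` says that `W = …uu…`, and `[u, v, u, v].Sublist W`
that `W = …u…v…u…v…`. -/
@[ext] structure Word (n : ℕ) where
  letters : List (Fin n)
  surjective : ∀ u, u ∈ letters
  nondegenerate : ∀ u, ¬ [u, u] <:+: letters
  no_interlacing : ∀ u v, u ≠ v → ¬ [u, v, u, v].Sublist letters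

/-- The sign of the permutation that sorts a list of distinct natural numbers: the parity of
its number of inversions. -/
def listSign : List ℕ → ℤ
  | [] => 1
  | a :: L => (-1) ^ L.countP (· < a) * listSign L

/-- The letters of a list in the order of their first occurrences. -/
def downOrder {n : ℕ} (W : List (Fin n)) : List (Fin n) := W.reverse.dedup.reverse

/-- `v` is interposed in `W` when `W = …uv…u…` for some `u`. -/
def Interposed {n : ℕ} (W : List (Fin n)) (v : Fin n) : Prop :=
  ∃ (u : Fin n) (W₁ W₂ : List (Fin n)), W = W₁ ++ u :: v :: W₂ ∧ u ∈ W₂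

open Classical in
/-- The interposed vertices of `W`, in the order of their first occurrences. -/
noncomputable def interposedList {n : ℕ} (W : List (Fin n)) : List (Fin n) :=
  (downOrder W).filter fun v => Interposed W v

/-- The letter of `W` at position `k` is a caesura when the same vertex occurs later. -/
def IsCaesura {n : ℕ} (W : List (Fin n)) (k : Fin W.length) : Prop :=
  ∃ j : Fin W.length, k < j ∧ W.get j = W.get k

/-- The vertex at position `k` is repeated in `W`. -/
def IsRepeated {n : ℕ} (W : List (Fin n)) (k : Fin W.length) : Prop :=
  ∃ j : Fin W.length, j ≠ k ∧ W.get j = W.get k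

open Classical in
/-- The sign with which deleting the letter at position `k` enters the boundary of `W`: it is
`(-1)^r` for the `r`-th caesura, and `(-1)^(r+1)` for a last occurrence of a vertex whose
previous occurrence is the `r`-th caesura. -/
noncomputable def faceSign {n : ℕ} (W : List (Fin n)) (k : Fin W.length) : ℤ :=
  if IsCaesura W k then
    (-1) ^ (Finset.univ.filter fun i : Fin W.length => IsCaesura W i ∧ i ≤ k).card
  else
    (-1) ^ ((Finset.univ.filter fun i : Fin W.length => IsCaesura W i ∧
      ∃ j : Fin W.length, j < k ∧ W.get j = W.get k ∧ i ≤ j).card + 1)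

/-- `X` is an extension of the word `V` by the word `W` at `i`. The operation
`List.destutter (· ≠ ·)` eliminates consecutive repetitions. -/
structure IsWordExt {m n l : ℕ} (hl : l + 1 = m + n) (i : Fin m)
    (V : List (Fin m)) (W : List (Fin n)) (X : List (Fin l)) : Prop where
  sub : (X.filter fun x => ∃ j, blockIn hl i j = x).destutter (· ≠ ·) = W.map (blockIn hl i)
  /-- Where letters outside the block have been deleted between two letters of the block,
  these two letters are equal. -/
  gap : ∀ (r s : Fin n) (Y : List (Fin l)), Y ≠ [] → (∀ y ∈ Y, ∀ j, blockIn hl i j ≠ y) →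
    (blockIn hl i r :: (Y ++ [blockIn hl i s])) <:+: X → r = s
  quot : (X.map (blockOut hl i)).destutter (· ≠ ·) = V

/-- The sign of an extension `X` of `V` by `W` at `i`: list the interposed vertices of `V` in
the order of first occurrence, then those of `W`, identify them with vertices of `X`, and take
the sign of the shuffle to the order of first occurrence in `X`. An interposed vertex `w` of `W`
is identified with `blockIn w`, and an interposed vertex `v` of `V` with that vertex of `X` over
`v` that occurs first (for `v ≠ i` there is only one, and for `v = i` it is `blockIn w`, where
`w` is the first letter of `W`). -/
noncomputable def extSign {m n l : ℕ} (hl : l + 1 = m + n) (i : Fin m)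
    (V : List (Fin m)) (W : List (Fin n)) (X : List (Fin l)) : ℤ :=
  listSign
    ((interposedList V).map (fun v => X.findIdx fun x => blockOut hl i x = v) ++
      (interposedList W).map (fun w => X.idxOf (blockIn hl i w)))

/-- The word `W^σ`, in which `u` is replaced by `σ⁻¹ u`. -/
def Word.relabel {n : ℕ} (σ : Equiv.Perm (Fin n)) (W : Word n) : Word n where
  letters := W.letters.map σ.symm
  surjective u := List.mem_map.2 ⟨σ u, W.surjective _, by simp⟩
  nondegenerate u h := W.nondegenerate (σ u) (by simpa using h.map σ)
  no_interlacing u v huv h := W.no_interlacing (σ u) (σ v) (fun e => huv (σ.injective e))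
    (by simpa using h.map σ)

/-- The word with one letter. -/
def Word.unit : Word 1 where
  letters := [0]
  surjective u := by simp [Subsingleton.elim u 0]
  nondegenerate u h := by simpa using h.length_le
  no_interlacing u v huv := (huv (Subsingleton.elim u v)).elim

/-! ## Quilts -/

/-- Quilts of arity `n`. -/
@[ext] structure Quilt (n : ℕ) where
  word : Word n
  tree : PTree n
  vert : ∀ u v, [u, v].Sublist word.letters → ¬ tree.lt v u
  horiz : ∀ u v, [u, v, u].Sublist word.letters → tree.left v u ∨ v = u

/-- The degree of a quilt is the length of its word minus its arity. -/
def Quilt.deg {n : ℕ} (Q : Quilt n) : ℤ := (Q.word.letters.length : ℤ) - n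

/-- The quilt `Q^σ`. -/
def Quilt.relabel {n : ℕ} (σ : Equiv.Perm (Fin n)) (Q : Quilt n) : Quilt n where
  word := Q.word.relabel σ
  tree := Q.tree.relabel σ
  vert u v h h' := Q.vert (σ u) (σ v) (by simpa [Word.relabel] using h.map σ)
    ⟨(PTree.reflTransGen_perm _ σ _ _).1 h'.1, fun e => h'.2 (σ.injective e)⟩
  horiz u v h := (Q.horiz (σ u) (σ v) (by simpa [Word.relabel] using h.map σ)).imp
    (fun h => h) (fun e => σ.injective e)

/-- The quilt with one vertex. -/
def Quilt.unit : Quilt 1 where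
  word := Word.unit
  tree := PTree.unit
  vert _ _ _ h := h.2 (Subsingleton.elim _ _)
  horiz _ _ _ := Or.inr (Subsingleton.elim _ _)

/-- Quilts of arity `n` and degree `d`. -/
abbrev GQuilt (n : ℕ) (d : ℤ) : Type := {Q : Quilt n // Q.deg = d}

instance GQuilt.finite (n : ℕ) (d : ℤ) : Finite (GQuilt n d) := by
  have hfin : Finite {L : List (Fin n) // L.length = (n + d).toNat} :=
    (List.finite_length_eq (Fin n) ((n + d).toNat)).to_subtype
  have hlen : ∀ Q : GQuilt n d, Q.1.word.letters.length = (n + d).toNat := by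
    intro Q
    have := Q.2
    simp only [Quilt.deg] at this
    omega
  refine Finite.of_injective
    (β := {L : List (Fin n) // L.length = (n + d).toNat} ×
      (Fin n → Fin n → Prop) × (Fin n → Fin n → Prop))
    (fun Q => (⟨Q.1.word.letters, hlen Q⟩, Q.1.tree.edge, Q.1.tree.left)) ?_
  intro Q R h
  simp only [Prod.mk.injEq, Subtype.mk.injEq] at h
  exact Subtype.ext (Quilt.ext (Word.ext h.1) (PTree.ext h.2.1 h.2.2))

noncomputable instance GQuilt.fintype (n : ℕ) (d : ℤ) : Fintype (GQuilt n d) :=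
  Fintype.ofFinite _

/-- The action of the symmetric groups preserves the degree. -/
def GQuilt.relabel {n : ℕ} {d : ℤ} (σ : Equiv.Perm (Fin n)) (Q : GQuilt n d) : GQuilt n d :=
  ⟨Q.1.relabel σ, by
    refine Eq.trans ?_ Q.2
    simp [Quilt.deg, Quilt.relabel, Word.relabel]⟩

/-- The unit quilt, in degree `0`. -/
def GQuilt.unit : GQuilt 1 0 := ⟨Quilt.unit, by simp [Quilt.deg, Quilt.unit, Word.unit]⟩

/-- `R` is an extension of `P` by `Q` at `i`. -/
def Quilt.IsExt {m n l : ℕ} (hl : l + 1 = m + n) (i : Fin m)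
    (P : Quilt m) (Q : Quilt n) (R : Quilt l) : Prop :=
  IsWordExt hl i P.word.letters Q.word.letters R.word.letters ∧
    PTree.IsExt hl i P.tree Q.tree R.tree

open Classical in
/-- The composition `P ∘ᵢ Q` of two quilts: the signed sum of the extensions of `P` by `Q` at
`i`. (A pair of a word extension and a tree extension is always a quilt, of degree
`deg P + deg Q`, so all such pairs occur in this sum.) -/
noncomputable def Quilt.comp {m n l : ℕ} (hl : l + 1 = m + n) (f : ℤ) (i : Fin m)
    (P : Quilt m) (Q : Quilt n) : GQuilt l f →₀ ℤ :=
  ∑ R : GQuilt l f, if Quilt.IsExt hl i P Q R.1 then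
    Finsupp.single R (extSign hl i P.word.letters Q.word.letters R.1.word.letters) else 0

open Classical in
/-- The boundary of a quilt: the signed sum, over the positions `k` in its word of repeated
vertices, of the quilts obtained by deleting the letter at position `k` from the word. (The
result of such a deletion is always a quilt, of degree `deg Q - 1`.) -/
noncomputable def Quilt.bd {n : ℕ} (e : ℤ) (Q : Quilt n) : GQuilt n e →₀ ℤ :=
  ∑ k : Fin Q.word.letters.length, ∑ R : GQuilt n e,
    if IsRepeated Q.word.letters k ∧ R.1.word.letters = Q.word.letters.eraseIdx k ∧
      R.1.tree = Q.tree then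
    Finsupp.single R (faceSign Q.word.letters k) else 0

/-- The quilt operad: `Quilt(n)_d` is the free abelian group on the quilts of arity `n` and
degree `d`. -/
noncomputable def quiltOperad : DGOperadData where
  carrier n d := GQuilt n d →₀ ℤ
  grp _ _ := inferInstance
  one := Finsupp.single GQuilt.unit 1
  act σ x := x.mapDomain (GQuilt.relabel σ)
  comp {_ _ _ _ _ f} hl _ i x y :=
    x.sum fun P a => y.sum fun Q b => (a * b) • Quilt.comp hl f i P.1 Q.1
  bd {_ _ e} _ x := x.sum fun Q a => a • Quilt.bd e Q.1

/-- `(-1)^(1 + n(n-1)/2)` times the sign of the permutation from the numerical order of the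
vertices to the order of first occurrence in the word. -/
def Quilt.sgnK {n : ℕ} (Q : Quilt n) : ℤ :=
  (-1) ^ (1 + n * (n - 1) / 2) *
    listSign ((List.finRange n).map fun u => Q.word.letters.idxOf u)

/-- The signed sum of all maximal quilts of arity `n`, that is, those of degree `n - 2`. -/
noncomputable def L0 (n : ℕ) : quiltOperad.carrier n ((n : ℤ) - 2) :=
  (∑ Q : GQuilt n ((n : ℤ) - 2), Finsupp.single Q Q.1.sgnK : GQuilt n ((n : ℤ) - 2) →₀ ℤ)

end QuiltOp

/-! Operad axioms. Words are treated as lists, and the two signed operations on them are recursions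
on the first letter: `faceSum` for the boundary and `extSum` for the extensions of one word by
another. Both are phrased dually, as the sum of the values of a test function on the results. In
this form `∂² = 0` (`faceSum_faceSum`), the Leibniz rule (`extSum_faceSum`) and the two
associativity laws (`extSum_seq`, `extSum_par`) become inductions on lists. Their signs are governed
by the number of caesuras, which is additive under extension and drops by one under a face. Trees
carry no signs. A tree amounts to its vertical and horizontal orders, extensions are characterised
by these orders (`IsExtOrder`), and the intermediate tree of an iterated extension is induced by the
final one, hence unique (`IsExt.quot_unique`). The recursions agree with the positional definitions
by `sum_faceSign`, `listExt_iff`, `extSum_single` and `Reduced.interposedList`. Evaluation of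
functionals then gives `quiltOperad_isDGOperad`.

Homomorphism. Since `L∞` is given by generators and relations, `existsUnique_hom` asks only for
antisymmetry of `L0` and for the `L∞` relations. Antisymmetry holds because relabelling permutes the
maximal quilts and multiplies their signs by the sign of the permutation (`L0_act`).

The `L∞` relations. In the word of a quilt the root `r` occurs once, at the start; let `F` be the
rest. A cut of `F` is a place where everything before it is finished and something new starts: the
letter before it never recurs and the letter after it has not occurred. Between two consecutive
letters of `F`, exactly one of three things happens: the first is a caesura, the second is a
repetition, or there is a cut. Counting gives (number of cuts) + degree = `n - 2`
(`Quilt.length_cuts`). So a quilt is maximal iff `F` has no cut, while a quilt `R` of degree `n -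
3`, where the relation lives, has exactly one. Write `F = G S | T H`, where `c` is the letter before
the cut and `S` runs from the first to the last `c`, and `b` is the letter after the cut and `T`
runs from the first to the last `b`. Either `G` and `H` are both empty, or `G` ends with the letter
with which `H` starts.

The coefficient of `R` in the relation is now explicit, up to a common sign `ε`. A maximal quilt
with face `R` arises by closing the cut, in one of three ways: repeating at the cut the letter that
surrounds it (possible iff `G` is nonempty, sign `+`), adding a `b` before `S` (iff `c` is left of
`b`, sign `-`), or adding a `c` after `T` (iff `b` is left of `c`, sign `-`); see
`Quilt.HasCut.evalAt_bd_L0`. A composition of maximal quilts contains `R` iff its block of labels is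
either `r` together with `S`, when `G` is empty (sign `+`), or `c` together with the descendants of
`c` in `T`, when `c ≤ b` (sign `-`); see `Quilt.HasCut.evalAt_comp_L0`. Shuffles amount to subsets,
so each block is counted once (`sum_shuffles`). The total is `ε (1 - [c ⊲ b] - [b ⊲ c] - [c ≤ b])`,
which vanishes because `b < c` is excluded by the vertical condition on quilts. -/

namespace QuiltOp

/-! ## Signed sums over the faces of a list -/

section Lists

set_option linter.unusedSectionVars false

variable {α β γ δ : Type*} [DecidableEq α] [DecidableEq β] [DecidableEq γ] [DecidableEq δ]

/-- The number of caesuras of a list. -/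
def caesuras : List α → ℕ
  | [] => 0
  | a :: L => (if a ∈ L then 1 else 0) + caesuras L

/-- The signed sum of the values of `φ` at the faces of a list. -/
def faceSum : List α → (List α → ℤ) → ℤ
  | [], _ => 0
  | a :: L, φ => (if a ∈ L then -φ L else 0) + (if L.count a = 1 then φ (a :: L.erase a) else 0) +
      (-1) ^ (if a ∈ L then 1 else 0) * faceSum L fun M => φ (a :: M)

/-- `M` arises from `L` by deleting a letter that occurs more than once. -/
def IsFace (L M : List α) : Prop :=
  ∃ L₁ a L₂, L = L₁ ++ a :: L₂ ∧ M = L₁ ++ L₂ ∧ a ∈ M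

theorem IsFace.cons {a : α} {L M : List α} (h : IsFace L M) : IsFace (a :: L) (a :: M) := by
  obtain ⟨L₁, b, L₂, rfl, rfl, hb⟩ := h
  exact ⟨a :: L₁, b, L₂, rfl, rfl, List.mem_cons_of_mem _ hb⟩

theorem IsFace.mem_iff {L M : List α} (h : IsFace L M) (x : α) : x ∈ M ↔ x ∈ L := by
  obtain ⟨L₁, b, L₂, rfl, rfl, hb⟩ := h
  simp only [List.mem_append, List.mem_cons] at hb ⊢
  constructor
  · tauto
  · rintro (h | rfl | h) <;> tauto

theorem IsFace.ne_nil {L M : List α} (h : IsFace L M) : M ≠ [] := by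
  obtain ⟨L₁, b, L₂, rfl, rfl, hb⟩ := h
  exact List.ne_nil_of_mem hb

/-- Every letter is either a caesura or the last occurrence of its vertex. This turns the degree of
a quilt into a number of caesuras, the quantity in which the signs are expressed. -/
theorem caesuras_add_card (L : List α) : caesuras L + L.toFinset.card = L.length := by
  induction L with
  | nil => simp [caesuras]
  | cons a L ih =>
    by_cases h : a ∈ L
    · simp [caesuras, h]; omega
    · simp [caesuras, h]; omega

theorem IsFace.caesuras {L M : List α} (h : IsFace L M) :
    caesuras M + 1 = QuiltOp.caesuras L := by
  have h₁ := caesuras_add_card L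
  have h₂ := caesuras_add_card M
  have h₃ : M.toFinset = L.toFinset := by
    ext x
    simp [h.mem_iff]
  obtain ⟨L₁, b, L₂, rfl, rfl, hb⟩ := h
  simp only [List.length_append, List.length_cons] at h₁ h₂
  rw [h₃] at h₂
  omega

theorem isFace_cons_erase {a : α} {L : List α} (h : a ∈ L) : IsFace (a :: L) (a :: L.erase a) := by
  obtain ⟨L₁, L₂, h₁, rfl, h₂⟩ := List.exists_erase_eq h
  rw [h₂]
  exact ⟨a :: L₁, a, L₂, rfl, rfl, by simp⟩

theorem count_ne_one {a : α} {L : List α} (h : a ∉ L) : L.count a ≠ 1 := by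
  rw [List.count_eq_zero.2 h]; decide

/-- A face has the same vertices as the list and one caesura fewer, so test functions can be
simplified with these facts before they are summed. -/
theorem faceSum_congr {L : List α} {φ ψ : List α → ℤ} (h : ∀ M, IsFace L M → φ M = ψ M) :
    faceSum L φ = faceSum L ψ := by
  induction L generalizing φ ψ with
  | nil => rfl
  | cons a L ih =>
    simp only [faceSum]
    rw [ih fun M hM => h _ hM.cons]
    by_cases ha : a ∈ L
    · rw [h L ⟨[], a, L, rfl, rfl, ha⟩, h _ (isFace_cons_erase ha)]
    · simp [ha, count_ne_one]

theorem faceSum_add (L : List α) (φ ψ : List α → ℤ) :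
    faceSum L (fun M => φ M + ψ M) = faceSum L φ + faceSum L ψ := by
  induction L generalizing φ ψ with
  | nil => simp [faceSum]
  | cons a L ih => simp only [faceSum, ih]; split_ifs <;> ring

theorem faceSum_mul (L : List α) (c : ℤ) (φ : List α → ℤ) :
    faceSum L (fun M => c * φ M) = c * faceSum L φ := by
  induction L generalizing φ with
  | nil => simp [faceSum]
  | cons a L ih => simp only [faceSum, ih]; split_ifs <;> ring

theorem faceSum_zero (L : List α) : faceSum L (fun _ => 0) = 0 := by
  simpa using faceSum_mul L 0 fun _ => 0

theorem faceSum_map (h : α → β) (L : List α) (hh : ∀ x ∈ L, ∀ y ∈ L, h x = h y → x = y)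
    (φ : List β → ℤ) : faceSum (L.map h) φ = faceSum L fun M => φ (M.map h) := by
  induction L generalizing φ with
  | nil => rfl
  | cons a L ih =>
    have hL : ∀ x ∈ L, ∀ y ∈ L, h x = h y → x = y := fun x hx y hy =>
      hh x (List.mem_cons_of_mem _ hx) y (List.mem_cons_of_mem _ hy)
    have ha : ∀ y ∈ L, h y = h a → y = a := fun y hy e =>
      hh y (List.mem_cons_of_mem _ hy) a List.mem_cons_self e
    have h₁ : h a ∈ L.map h ↔ a ∈ L := by
      simp only [List.mem_map]
      exact ⟨fun ⟨y, hy, e⟩ => ha y hy e ▸ hy, fun e => ⟨a, e, rfl⟩⟩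
    have h₂ : (L.map h).count (h a) = L.count a := by
      rw [List.count, List.countP_map, List.count]
      refine List.countP_congr fun y hy => ?_
      simp only [Function.comp, beq_iff_eq]
      exact ⟨ha y hy, fun e => e ▸ rfl⟩
    have h₃ : (L.map h).erase (h a) = (L.erase a).map h := by
      clear ih hh h₁ h₂
      induction L with
      | nil => rfl
      | cons b L ihL =>
        by_cases hb : b = a
        · simp [hb]
        · have : h b ≠ h a := fun e => hb (ha b List.mem_cons_self e)
          rw [List.map_cons, List.erase_cons_tail (by simpa using this),
            List.erase_cons_tail (by simpa using hb), List.map_cons,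
            ihL (fun x hx y hy => hL x (List.mem_cons_of_mem _ hx) y (List.mem_cons_of_mem _ hy))
              (fun y hy => ha y (List.mem_cons_of_mem _ hy))]
    simp only [List.map_cons, faceSum, h₁, h₂, h₃, ih hL]

/-- Erasing a letter that occurs once commutes with taking faces. -/
theorem faceSum_erase {a : α} {L : List α} (h : L.count a = 1) (φ : List α → ℤ) :
    faceSum (L.erase a) φ = faceSum L fun M => φ (M.erase a) := by
  induction L generalizing φ with
  | nil => simp at h
  | cons b L ih =>
    by_cases hb : b = a
    · subst hb
      have hc : b ∉ L := by simpa [List.count_eq_zero] using h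
      simp [faceSum, hc, count_ne_one]
    · have hc : L.count a = 1 := by simpa [List.count_cons, hb] using h
      rw [List.erase_cons_tail (by simpa using hb)]
      have hm : b ∈ L.erase a ↔ b ∈ L := List.mem_erase_of_ne hb
      have hn : (L.erase a).count b = L.count b := List.count_erase_of_ne hb
      have hbeq : ((b == a) = false) := by simpa using hb
      simp only [faceSum, hm, hn, ih hc, List.erase_cons, hbeq, Bool.false_eq_true, if_false,
        List.erase_comm b a]

/-- If a letter occurs twice, deleting both occurrences in either order cancels. -/
theorem faceSum_count_two {a : α} {L : List α} (h : L.count a = 2) (φ : List α → ℤ) :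
    faceSum L (fun M => if M.count a = 1 then φ (M.erase a) else 0) = 0 := by
  induction L generalizing φ with
  | nil => simp at h
  | cons b L ih =>
    by_cases hb : b = a
    · subst hb
      have hc : L.count b = 1 := by simpa using h
      have hm : b ∈ L := List.count_pos_iff.1 (by omega)
      have he : (L.erase b).count b = 0 := by simp [hc]
      have : faceSum L (fun M => if (b :: M).count b = 1 then φ ((b :: M).erase b) else 0) = 0 := by
        refine Eq.trans (faceSum_congr fun M hM => ?_) (faceSum_zero L)
        have := List.count_pos_iff.2 ((hM.mem_iff b).2 hm)
        refine if_neg ?_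
        rw [List.count_cons_self]; omega
      simp only [faceSum, this]
      simp [hm, hc]
    · have hc : L.count a = 2 := by simpa [List.count_cons, hb] using h
      have hbeq : ((b == a) = false) := by simpa using hb
      have hn : ∀ M : List α, (b :: M).count a = M.count a := by simp [hb]
      have hne : (L.erase b).count a = L.count a := List.count_erase_of_ne (Ne.symm hb)
      simp only [faceSum, hn, hne, hc, List.erase_cons, hbeq, Bool.false_eq_true, if_false]
      rw [ih hc fun M => φ (b :: M)]
      simp

/-- Induction on the list. If the head `a` recurs, deleting it before or after a face of the tail
gives opposite signs. The other terms that involve `a` delete its last occurrence in a second step;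
they cancel by `faceSum_erase` or `faceSum_count_two`, depending on how often `a` recurs. -/
theorem faceSum_faceSum (L : List α) (φ : List α → ℤ) :
    faceSum L (fun M => faceSum M φ) = 0 := by
  induction L generalizing φ with
  | nil => rfl
  | cons a L ih =>
    by_cases ha : a ∈ L
    · have hpos := List.count_pos_iff.2 ha
      -- Second faces that treat `a` as fixed vanish by induction. There remain those that delete
      -- the head, and those that delete the only other `a` of `M`.
      have key : faceSum L (fun M => faceSum (a :: M) φ) =
          -faceSum L φ + faceSum L (fun M => if M.count a = 1 then φ (a :: M.erase a) else 0) := by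
        have h₁ : ∀ M, IsFace L M → faceSum (a :: M) φ =
            (-1) * φ M + ((if M.count a = 1 then φ (a :: M.erase a) else 0) +
              (-1) * faceSum M fun N => φ (a :: N)) := by
          intro M hM
          simp only [faceSum, (hM.mem_iff a).2 ha, if_true]
          ring
        rw [faceSum_congr h₁, faceSum_add, faceSum_add, faceSum_mul, faceSum_mul, ih]
        ring
      by_cases hc : L.count a = 1
      · have h₂ : faceSum L (fun M => if M.count a = 1 then φ (a :: M.erase a) else 0) =
            faceSum L (fun M => φ (a :: M.erase a)) := by
          refine faceSum_congr fun M hM => ?_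
          rw [if_pos]
          have h₁ := List.count_pos_iff.2 ((hM.mem_iff a).2 ha)
          obtain ⟨L₁, b, L₂, rfl, rfl, -⟩ := hM
          simp only [List.count_append, List.count_cons] at hc h₁ ⊢
          omega
        have h₃ : faceSum (a :: L.erase a) φ = faceSum L fun M => φ (a :: M.erase a) := by
          have h₄ : a ∉ L.erase a := by
            rw [← List.count_eq_zero, List.count_erase_self, hc]
          have h₅ : (L.erase a).count a ≠ 1 := by
            rw [List.count_erase_self, hc]; decide
          rw [faceSum, if_neg h₄, if_neg h₅, if_neg h₄, faceSum_erase hc]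
          ring
        rw [faceSum, key, h₂, if_pos ha, if_pos hc, if_pos ha, h₃]
        ring
      · have h₂ : faceSum L (fun M => if M.count a = 1 then φ (a :: M.erase a) else 0) = 0 := by
          -- With two further occurrences of `a` the deletions cancel in pairs; with three or more,
          -- every face still contains at least two.
          by_cases hc₂ : L.count a = 2
          · exact faceSum_count_two hc₂ fun M => φ (a :: M)
          · refine Eq.trans (faceSum_congr fun M hM => if_neg ?_) (faceSum_zero L)
            obtain ⟨L₁, b, L₂, rfl, rfl, -⟩ := hM
            simp only [List.count_append, List.count_cons] at hc hc₂ hpos ⊢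
            split_ifs at hc hc₂ hpos <;> omega
        rw [faceSum, key, h₂, if_pos ha, if_neg hc, if_pos ha]
        ring
    · have h₁ : ∀ M, IsFace L M → faceSum (a :: M) φ = faceSum M fun N => φ (a :: N) := by
        intro M hM
        have hM' : a ∉ M := fun h => ha ((hM.mem_iff a).1 h)
        simp [faceSum, hM', count_ne_one]
      have hc := count_ne_one ha
      rw [faceSum, faceSum_congr h₁, ih, if_neg ha, if_neg hc]
      ring

theorem caesuras_map (h : α → β) (L : List α) (hh : ∀ x ∈ L, ∀ y ∈ L, h x = h y → x = y) :
    caesuras (L.map h) = caesuras L := by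
  induction L with
  | nil => rfl
  | cons a L ih =>
    have h₁ : h a ∈ L.map h ↔ a ∈ L := by
      simp only [List.mem_map]
      exact ⟨fun ⟨y, hy, e⟩ => hh y (List.mem_cons_of_mem _ hy) a List.mem_cons_self e ▸ hy,
        fun e => ⟨a, e, rfl⟩⟩
    simp only [List.map_cons, caesuras, h₁, ih fun x hx y hy =>
      hh x (List.mem_cons_of_mem _ hx) y (List.mem_cons_of_mem _ hy)]

/-- As the letters are disjoint, no occurrence in one part affects which letters of the other are
repeated. Only the numbering of the caesuras of `M` is shifted, by the caesuras of `L`. -/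
theorem faceSum_append {L M : List α} (h : ∀ x ∈ L, x ∉ M) (φ : List α → ℤ) :
    faceSum (L ++ M) φ = faceSum L (fun L' => φ (L' ++ M)) +
      (-1) ^ caesuras L * faceSum M fun M' => φ (L ++ M') := by
  induction L generalizing φ with
  | nil => simp [faceSum, caesuras]
  | cons a L ih =>
    have ha : a ∉ M := h a List.mem_cons_self
    have hc : (L ++ M).count a = L.count a := by
      rw [List.count_append, List.count_eq_zero.2 ha, add_zero]
    simp only [List.cons_append, faceSum, caesuras, List.mem_append, ha, or_false, hc,
      ih fun x hx => h x (List.mem_cons_of_mem _ hx), pow_add]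
    by_cases hL : a ∈ L
    · rw [List.erase_append_left _ hL]
      ring
    · simp only [hL, if_false, count_ne_one hL]
      ring

end Lists

end QuiltOp

namespace QuiltOp

/-! ## Signed sums over the extensions of a list by a list -/

section Extensions

set_option linter.unusedSectionVars false

variable {α β γ δ : Type*} [DecidableEq α] [DecidableEq β] [DecidableEq γ] [DecidableEq δ]

/-- The signed sum of the values of `φ` at the extensions of the first list by the second at `i`.
Here `f` embeds the letters other than `i` of the first list and `g` embeds the letters of the
second list. -/
def extSum (i : α) (f : α → γ) (g : β → γ) : List α → List β → (List γ → ℤ) → ℤ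
  | [], _, φ => φ []
  | v :: V, [], φ => if v = i then 0 else extSum i f g V [] fun X => φ (f v :: X)
  | v :: V, w :: W, φ =>
    -- At a letter `i` of the first list, `g w` is written. Either this visit to the block ends and
    -- the next one resumes with the same `w`, where the last visit must have used up `W`; or the
    -- visit continues with the next letter of `W`. In the second case, if `w` is a caesura, the
    -- letter after it is interposed and comes in the result before the vertices that are still to
    -- be interposed from `v :: V`. There are `caesuras (v :: V)` of these, whence the sign of the
    -- shuffle.
    if v = i then
      (if i ∈ V ∨ W = [] then extSum i f g V (w :: W) fun X => φ (g w :: X) else 0) +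
        (-1) ^ ((if w ∈ W then 1 else 0) * caesuras (v :: V)) *
          extSum i f g (v :: V) W fun X => φ (g w :: X)
    else extSum i f g V (w :: W) fun X => φ (f v :: X)
termination_by V W => V.length + W.length

/-- `X` is one of the extensions that contribute to `extSum`. -/
inductive ExtRel (i : α) (f : α → γ) (g : β → γ) : List α → List β → List γ → Prop
  | nil (W : List β) : ExtRel i f g [] W []
  | other {v : α} {V : List α} {W : List β} {X : List γ} :
      v ≠ i → ExtRel i f g V W X → ExtRel i f g (v :: V) W (f v :: X)
  | step {V : List α} {w : β} {W : List β} {X : List γ} :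
      i ∈ V ∨ W = [] → ExtRel i f g V (w :: W) X → ExtRel i f g (i :: V) (w :: W) (g w :: X)
  | next {V : List α} {w : β} {W : List β} {X : List γ} :
      ExtRel i f g (i :: V) W X → ExtRel i f g (i :: V) (w :: W) (g w :: X)

/-- The embeddings `f` (off `i`) and `g` are injective and have disjoint images. -/
structure Separated (i : α) (f : α → γ) (g : β → γ) : Prop where
  left : ∀ u v, u ≠ i → v ≠ i → f u = f v → u = v
  right : Function.Injective g
  ne : ∀ v w, v ≠ i → f v ≠ g w

variable {i : α} {f : α → γ} {g : β → γ}

theorem extSum_nil (W : List β) (φ : List γ → ℤ) : extSum i f g [] W φ = φ [] := by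
  rw [extSum]

theorem extSum_other {v : α} (h : v ≠ i) (V : List α) (W : List β) (φ : List γ → ℤ) :
    extSum i f g (v :: V) W φ = extSum i f g V W fun X => φ (f v :: X) := by
  cases W <;> rw [extSum, if_neg h]

theorem extSum_block_nil (V : List α) (φ : List γ → ℤ) : extSum i f g (i :: V) [] φ = 0 := by
  rw [extSum, if_pos rfl]

theorem extSum_block (V : List α) (w : β) (W : List β) (φ : List γ → ℤ) :
    extSum i f g (i :: V) (w :: W) φ =
      (if i ∈ V ∨ W = [] then extSum i f g V (w :: W) fun X => φ (g w :: X) else 0) +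
        (-1) ^ ((if w ∈ W then 1 else 0) * caesuras (i :: V)) *
          extSum i f g (i :: V) W fun X => φ (g w :: X) := by
  rw [extSum, if_pos rfl]

theorem extSum_congr {V : List α} {W : List β} {φ ψ : List γ → ℤ}
    (h : ∀ X, ExtRel i f g V W X → φ X = ψ X) : extSum i f g V W φ = extSum i f g V W ψ := by
  induction V generalizing W φ ψ with
  | nil => rw [extSum_nil, extSum_nil, h _ (.nil W)]
  | cons v V ih =>
    rcases eq_or_ne v i with rfl | hv
    · induction W generalizing φ ψ with
      | nil => rw [extSum_block_nil, extSum_block_nil]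
      | cons w W ihW =>
        rw [extSum_block, extSum_block, ihW fun X hX => h _ (.next hX)]
        by_cases hi : v ∈ V ∨ W = []
        · rw [ih fun X hX => h _ (.step hi hX)]
        · rw [if_neg hi, if_neg hi]
    · rw [extSum_other hv, extSum_other hv, ih fun X hX => h _ (.other hv hX)]

theorem extSum_add (V : List α) (W : List β) (φ ψ : List γ → ℤ) :
    extSum i f g V W (fun X => φ X + ψ X) = extSum i f g V W φ + extSum i f g V W ψ := by
  induction V generalizing W φ ψ with
  | nil => simp only [extSum_nil]
  | cons v V ih =>
    rcases eq_or_ne v i with rfl | hv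
    · induction W generalizing φ ψ with
      | nil => simp only [extSum_block_nil, add_zero]
      | cons w W ihW =>
        simp only [extSum_block, ihW, ih]
        split_ifs <;> ring
    · simp only [extSum_other hv, ih]

theorem extSum_mul (V : List α) (W : List β) (c : ℤ) (φ : List γ → ℤ) :
    extSum i f g V W (fun X => c * φ X) = c * extSum i f g V W φ := by
  induction V generalizing W φ with
  | nil => simp only [extSum_nil]
  | cons v V ih =>
    rcases eq_or_ne v i with rfl | hv
    · induction W generalizing φ with
      | nil => simp only [extSum_block_nil, mul_zero]
      | cons w W ihW =>
        simp only [extSum_block, ihW, ih]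
        split_ifs <;> ring
    · simp only [extSum_other hv, ih]

theorem extSum_zero (V : List α) (W : List β) : extSum i f g V W (fun _ => 0) = 0 := by
  simpa using extSum_mul (i := i) (f := f) (g := g) V W 0 fun _ => 0

theorem extSum_sum {κ : Type*} (s : Finset κ) (V : List α) (W : List β) (φ : κ → List γ → ℤ) :
    extSum i f g V W (fun X => ∑ k ∈ s, φ k X) = ∑ k ∈ s, extSum i f g V W (φ k) := by
  classical
  induction s using Finset.induction_on with
  | empty => simpa using extSum_zero V W
  | insert a s ha ih => simp only [Finset.sum_insert ha, extSum_add, ih]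

theorem extSum_of_notMem {V : List α} (h : i ∉ V) (W : List β) (φ : List γ → ℤ) :
    extSum i f g V W φ = φ (V.map f) := by
  induction V generalizing φ with
  | nil => rw [extSum_nil]; rfl
  | cons v V ih =>
    simp only [List.mem_cons, not_or] at h
    rw [extSum_other (Ne.symm h.1), ih h.2]
    rfl

/-- The only visit to the block must run through all of `W`. Each interposed letter of `W` then
passes each interposed letter of `V`. -/
theorem extSum_single_block {V : List α} (h : i ∉ V) {W : List β} (hW : W ≠ [])
    (φ : List γ → ℤ) : extSum i f g (i :: V) W φ =
      (-1) ^ (caesuras W * caesuras V) * φ (W.map g ++ V.map f) := by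
  induction W generalizing φ with
  | nil => exact absurd rfl hW
  | cons w W ih =>
    rw [extSum_block, extSum_of_notMem h]
    rcases eq_or_ne W [] with rfl | hW'
    · simp [extSum_block_nil, caesuras]
    · rw [if_neg (by simp [h, hW']), ih hW']
      simp only [caesuras, h, if_false, zero_add, List.map_cons, List.cons_append, add_mul, pow_add,
        mul_assoc]

theorem ExtRel.eq_map {V : List α} {W : List β} {X : List γ} (h : ExtRel i f g V W X)
    (hV : i ∉ V) : X = V.map f := by
  induction h with
  | nil W => rfl
  | other _ _ ih => simp [ih (fun h => hV (List.mem_cons_of_mem _ h))]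
  | step => simp at hV
  | next => simp at hV

theorem ExtRel.count_left (hs : Separated i f g) {V : List α} {W : List β} {X : List γ}
    (h : ExtRel i f g V W X) {v : α} (hv : v ≠ i) : X.count (f v) = V.count v := by
  induction h with
  | nil W => rfl
  | other hu _ ih =>
    rw [List.count_cons, List.count_cons, ih]
    congr 1
    simp only [beq_iff_eq]
    exact if_congr ⟨fun e => hs.left _ _ hu hv e, fun e => e ▸ rfl⟩ rfl rfl
  | step _ _ ih =>
    rw [List.count_cons_of_ne (hs.ne _ _ hv).symm, List.count_cons_of_ne hv.symm, ih]
  | next _ ih => rw [List.count_cons_of_ne (hs.ne _ _ hv).symm, ih]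

theorem ExtRel.mem_left (hs : Separated i f g) {V : List α} {W : List β} {X : List γ}
    (h : ExtRel i f g V W X) {v : α} (hv : v ≠ i) : f v ∈ X ↔ v ∈ V := by
  classical
  rw [← List.count_pos_iff, h.count_left hs hv, List.count_pos_iff]

theorem ExtRel.mem_right (hs : Separated i f g) {V : List α} {W : List β} {X : List γ}
    (h : ExtRel i f g V W X) (w : β) : g w ∈ X ↔ i ∈ V ∧ w ∈ W := by
  induction h with
  | nil W => simp
  | other hu _ ih =>
    rw [List.mem_cons, ih, List.mem_cons]
    simp [(hs.ne _ w hu).symm, hu.symm]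
  | step hc _ ih =>
    rw [List.mem_cons, ih, hs.right.eq_iff]
    rcases hc with hc | rfl <;> simp_all
  | next _ ih =>
    rw [List.mem_cons, ih, hs.right.eq_iff]
    simp

/-- Leaving the block and resuming it duplicates a letter of `W`; no letter of `W` is ever lost. -/
theorem ExtRel.count_right_le (hs : Separated i f g) {V : List α} {W : List β} {X : List γ}
    (h : ExtRel i f g V W X) (hV : i ∈ V) (w : β) : W.count w ≤ X.count (g w) := by
  induction h with
  | nil W => simp at hV
  | other hu _ ih =>
    rw [List.count_cons_of_ne (hs.ne _ _ hu)]
    exact ih (by simpa [hu.symm] using hV)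
  | @step V u W X hc _ ih =>
    rcases hc with hc | rfl
    · exact (ih hc).trans (List.count_le_count_cons)
    · rw [List.count_singleton, List.count_cons]
      simp only [beq_iff_eq, hs.right.eq_iff]
      omega
  | next _ ih =>
    rw [List.count_cons, List.count_cons]
    simp only [beq_iff_eq, hs.right.eq_iff]
    have := ih hV
    omega

/-- Additivity of the degree. A letter `g w` at which the block is left is a caesura because `w` is
resumed later, so it inherits the caesura of `i` in `V`; an advance in `W` inherits that of `w`. -/
theorem ExtRel.caesuras (hs : Separated i f g) {V : List α} {W : List β} {X : List γ}
    (h : ExtRel i f g V W X) :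
    caesuras X = QuiltOp.caesuras V + if i ∈ V then QuiltOp.caesuras W else 0 := by
  induction h with
  | nil W => simp [QuiltOp.caesuras]
  | @other v V W X hu hX ih =>
    have : i ∈ v :: V ↔ i ∈ V := by simp [hu.symm]
    simp only [QuiltOp.caesuras, ih, hX.mem_left hs hu, this]
    omega
  | @step V u W X hc hX ih =>
    simp only [QuiltOp.caesuras, ih, hX.mem_right hs]
    rcases hc with hc | rfl
    · simp only [hc, List.mem_cons, true_or, and_self, if_true]
      omega
    · by_cases hV : i ∈ V <;> simp [hV, QuiltOp.caesuras]
  | next hX ih =>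
    simp only [QuiltOp.caesuras, ih, hX.mem_right hs, List.mem_cons, true_or, true_and, if_true]
    omega

theorem ExtRel.eq_nil_iff {V : List α} {W : List β} {X : List γ} (h : ExtRel i f g V W X) :
    X = [] ↔ V = [] := by
  cases h <;> simp

theorem extSum_empty {V : List α} (hV : i ∈ V) (φ : List γ → ℤ) : extSum i f g V [] φ = 0 := by
  induction V generalizing φ with
  | nil => simp at hV
  | cons v V ih =>
    rcases eq_or_ne v i with rfl | hv
    · exact extSum_block_nil _ _
    · rw [extSum_other hv, ih (by simpa [hv.symm] using hV)]

/-! ### Naturality -/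

theorem extSum_comp (h : γ → δ) (V : List α) (W : List β) (φ : List δ → ℤ) :
    extSum i f g V W (fun X => φ (X.map h)) = extSum i (h ∘ f) (h ∘ g) V W φ := by
  induction V generalizing W φ with
  | nil => simp only [extSum_nil, List.map_nil]
  | cons v V ih =>
    rcases eq_or_ne v i with rfl | hv
    · induction W generalizing φ with
      | nil => simp only [extSum_block_nil]
      | cons w W ihW =>
        simp only [extSum_block, List.map_cons]
        rw [ih (w :: W) fun X => φ (h (g w) :: X), ihW fun X => φ (h (g w) :: X)]
        rfl
    · simp only [extSum_other hv, List.map_cons]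
      exact ih W fun X => φ (h (f v) :: X)

theorem extSum_map {α' β' : Type*} [DecidableEq α'] [DecidableEq β'] {a : α' → α} {b : β' → β}
    (ha : Function.Injective a) (hb : Function.Injective b) (i' : α') (hi : a i' = i)
    (V : List α') (W : List β') (φ : List γ → ℤ) :
    extSum i f g (V.map a) (W.map b) φ = extSum i' (f ∘ a) (g ∘ b) V W φ := by
  subst hi
  induction V generalizing W φ with
  | nil => simp only [extSum_nil, List.map_nil]
  | cons v V ih =>
    rcases eq_or_ne v i' with rfl | hv
    · induction W generalizing φ with
      | nil => simp only [extSum_block_nil, List.map_nil, List.map_cons]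
      | cons w W ihW =>
        have h₁ := ih (w :: W) fun X => φ (g (b w) :: X)
        have h₂ := ihW fun X => φ (g (b w) :: X)
        have h₃ := caesuras_map a (v :: V) fun _ _ _ _ e => ha e
        rw [List.map_cons] at h₁ h₂ h₃
        rw [List.map_cons, List.map_cons, extSum_block, extSum_block, h₁, h₂, h₃]
        simp only [List.mem_map_of_injective ha, List.mem_map_of_injective hb,
          List.map_eq_nil_iff, Function.comp]
    · have hv' : a v ≠ a i' := fun e => hv (ha e)
      rw [List.map_cons, extSum_other hv, extSum_other hv', ih W]
      rfl

theorem extSum_congr_maps {f' : α → γ} {g' : β → γ} (hf : ∀ v, v ≠ i → f v = f' v)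
    (hg : ∀ w, g w = g' w) (V : List α) (W : List β) (φ : List γ → ℤ) :
    extSum i f g V W φ = extSum i f' g' V W φ := by
  obtain rfl : g = g' := funext hg
  induction V generalizing W φ with
  | nil => simp only [extSum_nil]
  | cons v V ih =>
    rcases eq_or_ne v i with rfl | hv
    · induction W generalizing φ with
      | nil => simp only [extSum_block_nil]
      | cons w W ihW => simp only [extSum_block, ih, ihW]
    · simp only [extSum_other hv, ih, hf v hv]

/-! ### Units -/

theorem extSum_unit_left (W : List β) (hW : W ≠ []) (φ : List γ → ℤ) :
    extSum i f g [i] W φ = φ (W.map g) := by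
  rw [extSum_single_block (by simp) hW]
  simp [caesuras]

theorem extSum_unit_right (V : List α) (w : β) (φ : List γ → ℤ) (h : α → γ)
    (hf : ∀ v, v ≠ i → f v = h v) (hi : h i = g w) :
    extSum i f g V [w] φ = φ (V.map h) := by
  induction V generalizing φ with
  | nil => rw [extSum_nil]; rfl
  | cons v V ih =>
    rcases eq_or_ne v i with rfl | hv
    · rw [extSum_block, extSum_block_nil, if_pos (Or.inr rfl), ih, List.map_cons, hi]
      ring
    · rw [extSum_other hv, ih, List.map_cons, hf v hv]

end Extensions

end QuiltOp

namespace QuiltOp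

/-! ## The boundary is a derivation -/

section Derivation

set_option linter.unusedSectionVars false

variable {α β γ : Type*} [DecidableEq α] [DecidableEq β] [DecidableEq γ]
  {i : α} {f : α → γ} {g : β → γ}

theorem Separated.injOn_left (hs : Separated i f g) {V : List α} (hV : i ∉ V) :
    ∀ x ∈ V, ∀ y ∈ V, f x = f y → x = y := fun x hx y hy =>
  hs.left x y (fun e => hV (e ▸ hx)) (fun e => hV (e ▸ hy))

theorem ExtRel.count_single (hs : Separated i f g) {V : List α} {w : β} {X : List γ}
    (h : ExtRel i f g V [w] X) : X.count (g w) = V.count i := by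
  generalize hW : [w] = W at h
  induction h with
  | nil W => rfl
  | other hu _ ih =>
    rw [List.count_cons_of_ne (hs.ne _ _ hu), List.count_cons_of_ne hu, ih hW]
  | step _ _ ih =>
    obtain ⟨rfl, rfl⟩ := List.cons_eq_cons.1 hW
    rw [List.count_cons_self, List.count_cons_self, ih rfl]
  | next h =>
    obtain ⟨rfl, rfl⟩ := List.cons_eq_cons.1 hW
    cases h with
    | other h => exact absurd rfl h

/-- Deleting the only letter of the second list. -/
theorem extSum_erase_single (hs : Separated i f g) (V : List α) (w : β) (φ : List γ → ℤ) :
    extSum i f g V [w] (fun X => if X.count (g w) = 1 then φ (X.erase (g w)) else 0) =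
      if V.count i = 1 then φ ((V.erase i).map f) else 0 := by
  induction V generalizing φ with
  | nil => simp [extSum_nil]
  | cons v V ih =>
    rcases eq_or_ne v i with rfl | hv
    · rw [extSum_block, extSum_block_nil, if_pos (Or.inr rfl), mul_zero, add_zero,
        extSum_congr fun X hX => by
          rw [List.count_cons_self, hX.count_single hs, List.erase_cons_head]]
      by_cases hc : V.count v + 1 = 1
      · have : v ∉ V := List.count_eq_zero.1 (by omega)
        simp only [List.count_cons_self, hc, if_true, List.erase_cons_head, extSum_of_notMem this]
      · simp only [List.count_cons_self, hc, if_false, extSum_zero]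
    · rw [extSum_other hv, List.count_cons_of_ne hv, List.erase_cons_tail (by simpa using hv),
        List.map_cons, ← ih fun X => φ (f v :: X)]
      refine extSum_congr fun X _ => ?_
      rw [List.count_cons_of_ne (hs.ne _ _ hv),
        List.erase_cons_tail (by simpa using hs.ne _ _ hv)]

/-- Deleting an unrepeated letter of the second list. -/
theorem extSum_erase (hs : Separated i f g) {V : List α} (hV : i ∈ V) {w : β} {W : List β}
    (hc : W.count w = 1) (hW : W.erase w ≠ []) (φ : List γ → ℤ) :
    extSum i f g V W (fun X => if X.count (g w) = 1 then φ (X.erase (g w)) else 0) =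
      extSum i f g V (W.erase w) φ := by
  induction V generalizing W φ with
  | nil => simp at hV
  | cons v V ih =>
    rcases eq_or_ne v i with rfl | hv
    · induction W generalizing φ with
      | nil => simp at hc
      | cons y W ihW =>
        rcases eq_or_ne y w with rfl | hy
        · have hyW : y ∉ W := by simpa [List.count_eq_zero] using hc
          rw [List.erase_cons_head] at hW ⊢
          rw [extSum_block, if_neg hyW, zero_mul, pow_zero, one_mul]
          -- If the block is left after `y` and visited again, it resumes with `y`, so that `g y`
          -- occurs at least twice.
          have h₁ : (if v ∈ V ∨ W = [] then extSum v f g V (y :: W) fun X =>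
              if (g y :: X).count (g y) = 1 then φ ((g y :: X).erase (g y)) else 0 else 0) = 0 := by
            split_ifs with h
            · refine (extSum_congr fun X hX => if_neg ?_).trans (extSum_zero _ _)
              have := List.count_pos_iff.2 ((hX.mem_right hs y).2
                ⟨h.resolve_right hW, List.mem_cons_self⟩)
              rw [List.count_cons_self]; omega
            · rfl
          rw [h₁, zero_add]
          refine extSum_congr fun X hX => ?_
          have : X.count (g y) = 0 := List.count_eq_zero.2 fun h => hyW ((hX.mem_right hs y).1 h).2
          rw [List.count_cons_self, this, List.erase_cons_head, if_pos rfl]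
        · have hc' : W.count w = 1 := by rwa [List.count_cons_of_ne hy] at hc
          have hgy : g y ≠ g w := fun e => hy (hs.right e)
          have hwW : w ∈ W := List.count_pos_iff.1 (by omega)
          have hW₀ : W ≠ [] := List.ne_nil_of_mem hwW
          have e : (y :: W).erase w = y :: W.erase w := List.erase_cons_tail (by simpa using hy)
          have h₁ : ∀ X : List γ, (if (g y :: X).count (g w) = 1 then φ ((g y :: X).erase (g w))
              else 0) = if X.count (g w) = 1 then φ (g y :: X.erase (g w)) else 0 := fun X => by
            rw [List.count_cons_of_ne hgy, List.erase_cons_tail (by simpa using hgy)]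
          simp only [e, extSum_block, h₁, List.mem_erase_of_ne hy]
          -- The extra term compensates for the case `W = [w]`: after erasing `w`, the letter `y` is
          -- last and may end the final visit to the block, which was forbidden before.
          have key : extSum v f g (v :: V) W
              (fun X => if X.count (g w) = 1 then φ (g y :: X.erase (g w)) else 0) =
              (if W.erase w = [] ∧ v ∉ V then φ (g y :: V.map f) else 0) +
              extSum v f g (v :: V) (W.erase w) fun X => φ (g y :: X) := by
            by_cases hW' : W.erase w = []
            · obtain rfl : W = [w] := by
                obtain ⟨L₁, L₂, -, rfl, h⟩ := List.exists_erase_eq hwW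
                rw [h, List.append_eq_nil_iff] at hW'
                rw [hW'.1, hW'.2]; rfl
              rw [extSum_erase_single hs _ _ fun X => φ (g y :: X), hW', extSum_block_nil]
              simp [List.count_eq_zero]
            · rw [ihW hc' hW' fun X => φ (g y :: X)]
              simp [hW']
          rw [key]
          by_cases hv : v ∈ V
          · have h₂ := ih hv (W := y :: W) (by rwa [List.count_cons_of_ne hy])
              (by rw [e]; simp) fun X => φ (g y :: X)
            rw [e] at h₂
            simp only [hv, true_or, if_true, h₂, not_true, and_false, if_false, zero_add]
          · by_cases hW' : W.erase w = []
            · have hyW : y ∉ W := fun h => by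
                have := (List.mem_erase_of_ne hy).2 h
                simp [hW'] at this
              simp [hv, hW₀, hW', extSum_block_nil, hyW, extSum_of_notMem hv]
            · simp [hv, hW₀, hW']
    · rw [extSum_other hv, extSum_other hv, ← ih (by simpa [hv.symm] using hV) hc hW]
      refine extSum_congr fun X _ => ?_
      rw [List.count_cons_of_ne (hs.ne _ _ hv),
        List.erase_cons_tail (by simpa using hs.ne _ _ hv)]

/-- The boundary of an extension, when the letters of the second list stay in one piece. -/
theorem extSum_faceSum_single (hs : Separated i f g) {V : List α} (hV : i ∉ V) {W : List β}
    (hW : W ≠ []) (φ : List γ → ℤ) :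
    extSum i f g (i :: V) W (fun X => faceSum X φ) =
      faceSum (i :: V) (fun V' => extSum i f g V' W φ) +
        (-1) ^ caesuras (i :: V) * faceSum W fun W' => extSum i f g (i :: V) W' φ := by
  have hd : ∀ x ∈ W.map g, x ∉ V.map f := by
    rintro _ hx hy
    obtain ⟨w, -, rfl⟩ := List.mem_map.1 hx
    obtain ⟨v, hv, h⟩ := List.mem_map.1 hy
    exact hs.ne v w (fun e => hV (e ▸ hv)) h
  rw [extSum_single_block hV hW, faceSum_append hd, faceSum_map g W fun x _ y _ e => hs.right e,
    faceSum_map f V (hs.injOn_left hV), caesuras_map g W fun x _ y _ e => hs.right e]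
  have h₁ : faceSum (i :: V) (fun V' => extSum i f g V' W φ) =
      (-1) ^ (caesuras W * (caesuras V + 1)) * faceSum V fun V' => φ (W.map g ++ V'.map f) := by
    rw [faceSum, if_neg hV, if_neg (count_ne_one hV), if_neg hV, pow_zero, one_mul, zero_add,
      zero_add, ← faceSum_mul]
    refine faceSum_congr fun V' h' => ?_
    rw [extSum_single_block (fun h => hV ((h'.mem_iff i).1 h)) hW, ← h'.caesuras]
    congr 1
    rw [show caesuras W * (caesuras V' + 1 + 1) = caesuras W * caesuras V' + caesuras W * 2 by ring,
      pow_add, pow_mul' _ _ 2]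
    simp
  have h₂ : faceSum W (fun W' => extSum i f g (i :: V) W' φ) =
      (-1) ^ ((caesuras W + 1) * caesuras V) * faceSum W fun W' => φ (W'.map g ++ V.map f) := by
    rw [← faceSum_mul]
    refine faceSum_congr fun W' h' => ?_
    rw [extSum_single_block hV h'.ne_nil, ← h'.caesuras]
    congr 1
    rw [show (caesuras W' + 1 + 1) * caesuras V = caesuras W' * caesuras V + caesuras V * 2 by ring,
      pow_add, pow_mul' _ _ 2]
    simp
  rw [h₁, h₂]
  simp only [caesuras, hV, if_false, zero_add, mul_add, add_mul, pow_add, one_mul, mul_one]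
  have h₃ : ((-1 : ℤ) ^ caesuras V) * (-1) ^ caesuras V = 1 := by
    rw [← mul_pow]; simp
  linear_combination (-1 : ℤ) ^ (caesuras W * caesuras V) *
    faceSum W (fun W' => φ (W'.map g ++ V.map f)) * (-h₃)

theorem caesuras_erase {a : α} {L : List α} (h : L.count a = 1) :
    caesuras (L.erase a) = caesuras L := by
  induction L with
  | nil => simp at h
  | cons b L ih =>
    by_cases hb : b = a
    · subst hb
      have : b ∉ L := by simpa [List.count_eq_zero] using h
      simp [caesuras, this]
    · have hc : L.count a = 1 := by rwa [List.count_cons_of_ne hb] at h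
      simp only [List.erase_cons_tail (by simpa using hb : ¬(b == a) = true), caesuras, ih hc,
        List.mem_erase_of_ne hb]

/-- The derivation property of the boundary. -/
theorem extSum_faceSum (hs : Separated i f g) {V : List α} (hV : i ∈ V) {W : List β}
    (hW : W ≠ []) (φ : List γ → ℤ) :
    extSum i f g V W (fun X => faceSum X φ) =
      faceSum V (fun V' => extSum i f g V' W φ) +
        (-1) ^ caesuras V * faceSum W fun W' => extSum i f g V W' φ := by
  induction V generalizing W φ with
  | nil => simp at hV
  | cons v V ih =>
    rcases eq_or_ne v i with rfl | hv
    · by_cases hvV : v ∈ V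
      swap
      · exact extSum_faceSum_single hs hvV hW φ
      have hcs : caesuras (v :: V) = caesuras V + 1 := by simp [caesuras, hvV, add_comm]
      have hcs' : ∀ V', IsFace V V' → caesuras (v :: V') = caesuras V := fun V' h => by
        simp [caesuras, (h.mem_iff v).2 hvV, ← h.caesuras, add_comm]
      induction W generalizing φ with
      | nil => exact absurd rfl hW
      | cons w W ihW =>
        -- Both sides are expanded along the first letter `g w` of the extension. `A` and `B` are
        -- boundaries in the two branches of `extSum`, `R₁` and `R₂` the two boundary terms on the
        -- right, and `R₃` the boundary of the first list in the induction hypothesis for `W`. `T`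
        -- evaluates the deletion of a second, last copy of `g w`.
        set ψ : List γ → ℤ := fun X => φ (g w :: X) with hψ
        set s : ℤ := (-1) ^ caesuras V with hsdef
        have hss : s * s = 1 := by rw [hsdef, ← mul_pow]; simp
        -- the first branch, where the block is interrupted after `w`
        have A : extSum v f g V (w :: W) (fun X => faceSum (g w :: X) φ) =
            -extSum v f g V (w :: W) φ +
            (if w ∈ W then 0 else extSum v f g V (w :: W) fun X =>
              if X.count (g w) = 1 then ψ (X.erase (g w)) else 0) -
            extSum v f g V (w :: W) fun X => faceSum X ψ := by
          have : ∀ X, ExtRel v f g V (w :: W) X → faceSum (g w :: X) φ = (-1) * φ X +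
              ((if w ∈ W then 0 else 1) * (if X.count (g w) = 1 then ψ (X.erase (g w)) else 0) +
                (-1) * faceSum X ψ) := by
            intro X hX
            have h₁ : g w ∈ X := (hX.mem_right hs w).2 ⟨hvV, List.mem_cons_self⟩
            have h₂ := hX.count_right_le hs hvV w
            rw [faceSum, if_pos h₁, if_pos h₁]
            by_cases hwW : w ∈ W
            · have := List.count_pos_iff.2 hwW
              rw [List.count_cons_self] at h₂
              rw [if_neg (by omega : ¬ X.count (g w) = 1)]
              simp only [hwW, if_true, ψ]
              ring
            · simp only [hwW, if_false, ψ]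
              ring
          rw [extSum_congr this, extSum_add, extSum_add, extSum_mul, extSum_mul, extSum_mul]
          split_ifs <;> ring
        have IA := ih hvV (W := w :: W) (by simp) ψ
        have RA : faceSum (w :: W) (fun W' => extSum v f g V W' ψ) =
            (if w ∈ W then -extSum v f g V W ψ else 0) +
            (if W.count w = 1 then extSum v f g V (w :: W.erase w) ψ else 0) +
            (-1) ^ (if w ∈ W then 1 else 0) * faceSum W fun W' => extSum v f g V (w :: W') ψ := rfl
        have R₁ : faceSum (v :: V) (fun V' => extSum v f g V' (w :: W) φ) =
            -extSum v f g V (w :: W) φ +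
            (if V.count v = 1 then extSum v f g (v :: V.erase v) (w :: W) φ else 0) -
            (faceSum V (fun V' => extSum v f g V' (w :: W) ψ) +
              (if w ∈ W then s else 1) * faceSum V fun V' => extSum v f g (v :: V') W ψ) := by
          rw [faceSum, if_pos hvV, if_pos hvV]
          rw [faceSum_congr (ψ := fun M => extSum v f g M (w :: W) ψ +
            (if w ∈ W then s else 1) * extSum v f g (v :: M) W ψ), faceSum_add, faceSum_mul]
          · ring
          · intro M hM
            rw [extSum_block, if_pos (Or.inl ((hM.mem_iff v).2 hvV)), hcs' M hM]
            by_cases hwW : w ∈ W <;> simp [hwW, hsdef, ψ]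
        -- A second list with one letter is separate because the induction hypothesis on `W` needs a
        -- nonempty list.
        rcases eq_or_ne W [] with rfl | hW'
        · rw [extSum_block, if_pos (Or.inl hvV), extSum_block_nil, A, IA, RA, R₁]
          simp only [List.not_mem_nil, if_false, extSum_erase_single hs, extSum_block_nil,
            faceSum_zero, faceSum, List.count_nil]
          by_cases hc : V.count v = 1
          · have hn : v ∉ V.erase v := by rw [← List.count_eq_zero, List.count_erase_self, hc]
            rw [if_pos hc, if_pos hc, extSum_single_block hn (by simp)]
            simp [caesuras, ψ]
          · simp [hc]
        have hi₂ := ihW hW' ψ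
        have R₃ : faceSum (v :: V) (fun V' => extSum v f g V' W ψ) = -extSum v f g V W ψ +
            (if V.count v = 1 then extSum v f g (v :: V.erase v) W ψ else 0) -
            faceSum V (fun V' => extSum v f g (v :: V') W ψ) := by
          rw [faceSum, if_pos hvV, if_pos hvV]
          ring
        have hE : V.count v = 1 → extSum v f g (v :: V.erase v) (w :: W) φ =
            (if w ∈ W then s else 1) * extSum v f g (v :: V.erase v) W ψ := by
          intro hc
          have hn : v ∉ V.erase v := by rw [← List.count_eq_zero, List.count_erase_self, hc]
          have : caesuras (v :: V.erase v) = caesuras V := by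
            simp [caesuras, hn, caesuras_erase hc]
          rw [extSum_block, if_neg (by simp [hn, hW']), this]
          by_cases hwW : w ∈ W <;> simp [hwW, hsdef, ψ]
        by_cases hwW : w ∈ W
        · -- `w` is repeated in the second list
          have B : extSum v f g (v :: V) W (fun X => faceSum (g w :: X) φ) =
              -extSum v f g (v :: V) W φ +
              (extSum v f g (v :: V) W fun X =>
                if X.count (g w) = 1 then φ (g w :: X.erase (g w)) else 0) -
              extSum v f g (v :: V) W fun X => faceSum X ψ := by
            have : ∀ X, ExtRel v f g (v :: V) W X → faceSum (g w :: X) φ = (-1) * φ X +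
                ((if X.count (g w) = 1 then φ (g w :: X.erase (g w)) else 0) +
                  (-1) * faceSum X ψ) := by
              intro X hX
              have h₁ : g w ∈ X := (hX.mem_right hs w).2 ⟨List.mem_cons_self, hwW⟩
              rw [faceSum, if_pos h₁, if_pos h₁]
              ring
            rw [extSum_congr this, extSum_add, extSum_add, extSum_mul, extSum_mul]
            ring
          have R₂ : faceSum (w :: W) (fun W' => extSum v f g (v :: V) W' φ) =
              -extSum v f g (v :: V) W φ +
              (if W.count w = 1 then extSum v f g (v :: V) (w :: W.erase w) φ else 0) -
              (faceSum W (fun W' => extSum v f g V (w :: W') ψ) -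
                s * faceSum W fun W' => extSum v f g (v :: V) W' ψ) := by
            rw [faceSum, if_pos hwW, if_pos hwW]
            rw [faceSum_congr (ψ := fun M => extSum v f g V (w :: M) ψ +
              (-s) * extSum v f g (v :: V) M ψ), faceSum_add, faceSum_mul]
            · ring
            · intro M hM
              rw [extSum_block, if_pos (Or.inl hvV), if_pos ((hM.mem_iff w).2 hwW), hcs]
              simp only [hsdef, one_mul, pow_succ, ψ]
              ring
          -- After the erasure, `g w` is followed by an extension by `W.erase w`. These are the
          -- extensions by `w :: W.erase w` in which the block is not left after `w`, so the other
          -- branch is subtracted.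
          have T : (extSum v f g (v :: V) W fun X =>
                if X.count (g w) = 1 then φ (g w :: X.erase (g w)) else 0) =
              if W.count w = 1 then extSum v f g (v :: V) (w :: W.erase w) φ -
                extSum v f g V (w :: W.erase w) ψ else 0 := by
            by_cases hc : W.count w = 1
            · have hn : w ∉ W.erase w := by rw [← List.count_eq_zero, List.count_erase_self, hc]
              rw [if_pos hc, extSum_block, if_pos (Or.inl hvV), if_neg hn, zero_mul, pow_zero,
                one_mul, add_sub_cancel_left]
              by_cases hWe : W.erase w = []
              · obtain rfl : W = [w] := by
                  obtain ⟨L₁, L₂, -, rfl, h⟩ := List.exists_erase_eq hwW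
                  rw [h, List.append_eq_nil_iff] at hWe
                  rw [hWe.1, hWe.2]; rfl
                rw [extSum_erase_single hs _ _ ψ, hWe, extSum_block_nil, if_neg]
                have := List.count_pos_iff.2 hvV
                rw [List.count_cons_self]; omega
              · exact extSum_erase hs List.mem_cons_self hc hWe ψ
            · rw [if_neg hc]
              refine (extSum_congr fun X hX => if_neg ?_).trans (extSum_zero _ _)
              have h₁ := hX.count_right_le hs List.mem_cons_self w
              have := List.count_pos_iff.2 hwW
              omega
          rw [extSum_block, if_pos (Or.inl hvV), A, IA, RA, B, T, hi₂, R₁, R₂, R₃, hcs]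
          simp only [hwW, if_true, one_mul, pow_succ]
          rw [← hsdef]
          by_cases hc₁ : V.count v = 1
          · rw [hE hc₁]
            simp only [hc₁, if_true, hwW]
            split_ifs <;> ring
          · simp only [hc₁, if_false]
            split_ifs <;> ring
        · have hcW := count_ne_one hwW
          have B : extSum v f g (v :: V) W (fun X => faceSum (g w :: X) φ) =
              extSum v f g (v :: V) W fun X => faceSum X ψ := by
            refine extSum_congr fun X hX => ?_
            have h₁ : g w ∉ X := fun h => hwW ((hX.mem_right hs w).1 h).2
            rw [faceSum, if_neg h₁, if_neg h₁, if_neg (count_ne_one h₁)]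
            simp [ψ]
          have R₂ : faceSum (w :: W) (fun W' => extSum v f g (v :: V) W' φ) =
              faceSum W (fun W' => extSum v f g V (w :: W') ψ) +
                faceSum W fun W' => extSum v f g (v :: V) W' ψ := by
            rw [faceSum, if_neg hwW, if_neg hwW, if_neg hcW, ← faceSum_add]
            rw [zero_add, zero_add, pow_zero, one_mul]
            refine faceSum_congr fun M hM => ?_
            rw [extSum_block, if_pos (Or.inl hvV), if_neg fun h => hwW ((hM.mem_iff w).1 h),
              zero_mul, pow_zero, one_mul]
          -- Writing `w` before and after an interruption of the block and deleting the second copy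
          -- leaves an extension of `V` by `W` behind `g w`. This cancels the term of `R₃` in which
          -- the first `i` has been deleted.
          have T : (extSum v f g V (w :: W) fun X =>
              if X.count (g w) = 1 then ψ (X.erase (g w)) else 0) = extSum v f g V W ψ := by
            have := extSum_erase hs hvV (w := w) (W := w :: W)
              (by rw [List.count_cons_self, List.count_eq_zero.2 hwW]) (by simpa using hW') ψ
            rwa [List.erase_cons_head] at this
          rw [extSum_block, if_pos (Or.inl hvV), A, T, IA, RA, B, hi₂, R₁, R₂, R₃, hcs]
          simp only [hwW, hcW, if_false, zero_mul, pow_zero, one_mul, pow_succ]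
          rw [← hsdef]
          by_cases hc₁ : V.count v = 1
          · rw [hE hc₁]
            simp only [hc₁, if_true, hwW, if_false]
            ring
          · simp only [hc₁, if_false]
            ring
    · have hV' : i ∈ V := by simpa [hv.symm] using hV
      -- Away from the block, `f v` recurs in `X` as often as `v` does in `V`, so the faces at the
      -- first letter correspond one to one.
      have key : ∀ X, ExtRel i f g V W X → faceSum (f v :: X) φ =
          (if v ∈ V then (-1) else 0) * φ X +
          ((if V.count v = 1 then 1 else 0) * φ (f v :: X.erase (f v)) +
            (-1) ^ (if v ∈ V then 1 else 0) * faceSum X fun M => φ (f v :: M)) := by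
        intro X hX
        simp only [faceSum, hX.mem_left hs hv, hX.count_left hs hv]
        split_ifs <;> ring
      have erase : V.count v = 1 → ∀ χ : List γ → ℤ,
          extSum i f g V W (fun X => χ (X.erase (f v))) = extSum i f g (V.erase v) W χ := by
        intro hc χ
        have aux : ∀ (V : List α) (W : List β) (χ : List γ → ℤ), V.count v = 1 →
            extSum i f g V W (fun X => χ (X.erase (f v))) = extSum i f g (V.erase v) W χ := by
          clear! V W φ χ
          intro V
          induction V with
          | nil => intro W χ hc; simp at hc
          | cons u V ih =>
            intro W χ hc
            rcases eq_or_ne u v with rfl | huv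
            · rw [extSum_other hv, List.erase_cons_head]
              simp only [List.erase_cons_head]
            · have hc' : V.count v = 1 := by rwa [List.count_cons_of_ne huv] at hc
              rw [List.erase_cons_tail (by simpa using huv)]
              rcases eq_or_ne u i with rfl | hu
              · induction W generalizing χ with
                | nil => rw [extSum_block_nil, extSum_block_nil]
                | cons w W ihW =>
                  have hcs : caesuras (u :: V.erase v) = caesuras (u :: V) := by
                    rw [← caesuras_erase hc, List.erase_cons_tail (by simpa using huv)]
                  have he : ∀ X : List γ, (g w :: X).erase (f v) = g w :: X.erase (f v) :=
                    fun X => List.erase_cons_tail (by simpa using (hs.ne v w hv).symm)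
                  simp only [extSum_block, he, hcs, List.mem_erase_of_ne huv]
                  rw [ihW fun X => χ (g w :: X), ih (w :: W) (fun X => χ (g w :: X)) hc']
              · have he : ∀ X : List γ, (f u :: X).erase (f v) = f u :: X.erase (f v) :=
                  fun X => List.erase_cons_tail (by simpa using fun e => huv (hs.left u v hu hv e))
                rw [extSum_other hu, extSum_other hu]
                simp only [he]
                exact ih W (fun X => χ (f u :: X)) hc'
        exact aux V W χ hc
      rw [extSum_other hv, extSum_congr key, extSum_add, extSum_add, extSum_mul, extSum_mul,
        extSum_mul, ih hV' hW]
      rw [faceSum, caesuras, pow_add]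
      simp only [extSum_other hv]
      by_cases hc : V.count v = 1
      · rw [erase hc fun X => φ (f v :: X)]
        simp only [hc, if_true]
        split_ifs <;> ring
      · simp only [hc, if_false]
        split_ifs <;> ring

end Derivation

end QuiltOp

namespace QuiltOp

/-! ## Associativity of extensions -/

section Associativity

set_option linter.unusedSectionVars false
set_option linter.unusedSimpArgs false

variable {α β γ δ δ' ζ : Type*} [DecidableEq α] [DecidableEq β] [DecidableEq γ] [DecidableEq δ]
  [DecidableEq δ'] [DecidableEq ζ]

/-- Sequential associativity. -/
theorem extSum_seq {i : α} {j : β} {f₁ : α → δ} {g₁ : β → δ} {f₂ : δ → γ} {g₂ : ζ → γ}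
    {f₃ : β → δ'} {g₃ : ζ → δ'} {f₄ : α → γ} {g₄ : δ' → γ}
    (hs₁ : Separated i f₁ g₁) (hs₃ : Separated j f₃ g₃)
    (hf : ∀ v, v ≠ i → f₂ (f₁ v) = f₄ v) (hfg : ∀ w, w ≠ j → f₂ (g₁ w) = g₄ (f₃ w))
    (hg : ∀ z, g₂ z = g₄ (g₃ z)) {V : List α} (hV : i ∈ V) (W : List β) {Z : List ζ} (hZ : Z ≠ [])
    (φ : List γ → ℤ) :
    extSum i f₁ g₁ V W (fun Y => extSum (g₁ j) f₂ g₂ Y Z φ) =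
      extSum j f₃ g₃ W Z fun Y => extSum i f₄ g₄ V Y φ := by
  induction V generalizing W Z φ with
  | nil => simp at hV
  | cons v V ih =>
    rcases eq_or_ne v i with rfl | hv
    swap
    · have hV' : i ∈ V := by simpa [hv.symm] using hV
      rw [extSum_other hv]
      simp only [extSum_other (hs₁.ne v j hv), extSum_other hv, hf v hv]
      exact ih hV' W hZ _
    -- Once `i` no longer occurs, no further letter of the inserted lists is written, and both sides
    -- evaluate at a relabelling of `V`.
    have hempty : v ∉ V → ∀ (w : β) (Z : List ζ) (φ : List γ → ℤ) (Y' : List δ'),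
        extSum v f₁ g₁ V [w] (fun Y => extSum (g₁ j) f₂ g₂ Y Z φ) = extSum v f₄ g₄ V Y' φ := by
      intro hvV w Z φ Y'
      rw [extSum_of_notMem hvV, extSum_of_notMem hvV, extSum_of_notMem, List.map_map]
      · congr 1
        refine List.map_congr_left fun u hu => hf u fun e => hvV (e ▸ hu)
      · intro h
        obtain ⟨u, hu, h⟩ := List.mem_map.1 h
        exact hs₁.ne u j (fun e => hvV (e ▸ hu)) h
    induction W generalizing Z φ with
    | nil => rw [extSum_block_nil, extSum_nil, extSum_block_nil]
    | cons w W ihW =>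
      rcases eq_or_ne w j with rfl | hw
      swap
      · have hg₁ : g₁ w ≠ g₁ j := fun e => hw (hs₁.right e)
        rw [extSum_block, extSum_other hw]
        simp only [extSum_other hg₁, hfg w hw]
        have key : ∀ Y, ExtRel j f₃ g₃ W Z Y → extSum v f₄ g₄ (v :: V) (f₃ w :: Y) φ =
            (if v ∈ V ∨ W = [] then 1 else 0) *
              (extSum v f₄ g₄ V (f₃ w :: Y) fun X => φ (g₄ (f₃ w) :: X)) +
            (-1) ^ ((if w ∈ W then 1 else 0) * caesuras (v :: V)) *
              extSum v f₄ g₄ (v :: V) Y fun X => φ (g₄ (f₃ w) :: X) := by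
          intro Y hY
          simp only [extSum_block, hY.mem_left hs₃ hw, hY.eq_nil_iff]
          split_ifs <;> ring
        rw [extSum_congr key, extSum_add, extSum_mul, extSum_mul, ihW hZ]
        congr 1
        by_cases hvV : v ∈ V
        · rw [ih hvV (w :: W) hZ, extSum_other hw]
          simp [hvV]
        · rcases eq_or_ne W [] with rfl | hW
          · rw [extSum_nil, hempty hvV w Z _ [f₃ w]]
            simp
          · simp [hvV, hW]
      -- All three current letters now lie in the nested block. Each side unfolds twice, and its
      -- terms are matched according to which of the lists `V`, `W`, `Z` is advanced. The signs
      -- agree because the caesuras of an extension are those of its two constituents together.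
      · induction Z generalizing φ with
        | nil => exact absurd rfl hZ
        | cons z Z ihZ =>
          set ψ : List γ → ℤ := fun X => φ (g₂ z :: X) with hψ
          -- the left hand side
          have A : ∀ Y, ExtRel v f₁ g₁ V (w :: W) Y → v ∈ V →
              extSum (g₁ w) f₂ g₂ (g₁ w :: Y) (z :: Z) φ =
              extSum (g₁ w) f₂ g₂ Y (z :: Z) ψ +
              (-1) ^ ((if z ∈ Z then 1 else 0) * (caesuras (v :: V) + caesuras (w :: W))) *
                extSum (g₁ w) f₂ g₂ (g₁ w :: Y) Z ψ := by
            intro Y hY hvV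
            have h₁ : g₁ w ∈ Y := (hY.mem_right hs₁ w).2 ⟨hvV, List.mem_cons_self⟩
            have h₂ : caesuras (g₁ w :: Y) = caesuras (v :: V) + caesuras (w :: W) := by
              rw [caesuras, caesuras, hY.caesuras hs₁]
              simp [h₁, hvV, add_assoc]
            rw [extSum_block, if_pos (Or.inl h₁), h₂]
          have B : ∀ Y, ExtRel v f₁ g₁ (v :: V) W Y →
              extSum (g₁ w) f₂ g₂ (g₁ w :: Y) (z :: Z) φ =
              (if w ∈ W ∨ Z = [] then 1 else 0) * extSum (g₁ w) f₂ g₂ Y (z :: Z) ψ +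
              (-1) ^ ((if z ∈ Z then 1 else 0) * (caesuras (v :: V) + caesuras (w :: W))) *
                extSum (g₁ w) f₂ g₂ (g₁ w :: Y) Z ψ := by
            intro Y hY
            have h₁ : g₁ w ∈ Y ↔ w ∈ W := by simp [hY.mem_right hs₁ w]
            have h₂ : caesuras (g₁ w :: Y) = caesuras (v :: V) + caesuras (w :: W) := by
              rw [caesuras, hY.caesuras hs₁]
              simp [h₁, caesuras]
              omega
            simp only [extSum_block, h₁, h₂]
            split_ifs <;> ring
          have C : ∀ Y, ExtRel w f₃ g₃ W (z :: Z) Y → (w ∈ W ∨ Z = []) →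
              extSum v f₄ g₄ (v :: V) (g₃ z :: Y) φ =
              (if v ∈ V ∨ W = [] then 1 else 0) * extSum v f₄ g₄ V (g₃ z :: Y) ψ +
              (-1) ^ ((if w ∈ W then 1 else 0) * caesuras (v :: V)) *
                extSum v f₄ g₄ (v :: V) Y ψ := by
            intro Y hY hc
            have h₁ : g₃ z ∈ Y ↔ w ∈ W := by
              rw [hY.mem_right hs₃]; simp
            simp only [extSum_block, h₁, hY.eq_nil_iff, hψ, hg]
            split_ifs <;> ring
          have D : ∀ Y, ExtRel w f₃ g₃ (w :: W) Z Y →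
              extSum v f₄ g₄ (v :: V) (g₃ z :: Y) φ =
              (if v ∈ V then 1 else 0) * extSum v f₄ g₄ V (g₃ z :: Y) ψ +
              (-1) ^ ((if z ∈ Z then 1 else 0) * caesuras (v :: V)) *
                extSum v f₄ g₄ (v :: V) Y ψ := by
            intro Y hY
            have h₁ : g₃ z ∈ Y ↔ z ∈ Z := by
              rw [hY.mem_right hs₃]; simp
            simp only [extSum_block, h₁, hY.eq_nil_iff, hψ, hg]
            simp only [reduceCtorEq, or_false]
            split_ifs <;> ring
          -- the induction hypotheses
          have I₁ : v ∈ V → extSum v f₁ g₁ V (w :: W)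
              (fun Y => extSum (g₁ w) f₂ g₂ Y (z :: Z) ψ) =
              (if w ∈ W ∨ Z = [] then 1 else 0) *
                extSum w f₃ g₃ W (z :: Z) (fun Y => extSum v f₄ g₄ V (g₃ z :: Y) ψ) +
              (-1) ^ ((if z ∈ Z then 1 else 0) * caesuras (w :: W)) *
                extSum w f₃ g₃ (w :: W) Z fun Y => extSum v f₄ g₄ V (g₃ z :: Y) ψ := by
            intro hvV
            rw [ih hvV (w :: W) hZ, extSum_block]
            split_ifs <;> ring
          have I₂ := ihW hZ ψ
          have I₃ : extSum v f₁ g₁ (v :: V) (w :: W)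
              (fun Y => extSum (g₁ w) f₂ g₂ Y Z ψ) =
              extSum w f₃ g₃ (w :: W) Z fun Y => extSum v f₄ g₄ (v :: V) Y ψ := by
            rcases eq_or_ne Z [] with rfl | hZ'
            · rw [extSum_block_nil, extSum_congr (ψ := fun _ => 0), extSum_zero]
              intro Y hY
              exact extSum_empty ((hY.mem_right hs₁ w).2 ⟨List.mem_cons_self, List.mem_cons_self⟩) _
            · exact ihZ hZ' ψ
          rw [extSum_block] at I₃
          rw [extSum_block, extSum_congr B, extSum_add, extSum_mul, extSum_mul, I₂]
          rw [extSum_block (V := W), extSum_congr D, extSum_add, extSum_mul, extSum_mul, ← I₃]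
          have hR : (if w ∈ W ∨ Z = [] then extSum w f₃ g₃ W (z :: Z) fun Y =>
              extSum v f₄ g₄ (v :: V) (g₃ z :: Y) φ else 0) =
              (if w ∈ W ∨ Z = [] then 1 else 0) *
              ((if v ∈ V ∨ W = [] then 1 else 0) *
                extSum w f₃ g₃ W (z :: Z) (fun Y => extSum v f₄ g₄ V (g₃ z :: Y) ψ) +
              (-1) ^ ((if w ∈ W then 1 else 0) * caesuras (v :: V)) *
                extSum w f₃ g₃ W (z :: Z) fun Y => extSum v f₄ g₄ (v :: V) Y ψ) := by
            by_cases hc : w ∈ W ∨ Z = []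
            · rw [if_pos hc, if_pos hc, extSum_congr fun Y hY => C Y hY hc, extSum_add, extSum_mul,
                extSum_mul, one_mul]
            · rw [if_neg hc, if_neg hc, zero_mul]
          rw [hR]
          by_cases hvV : v ∈ V
          · rw [if_pos (Or.inl hvV), extSum_congr fun Y hY => A Y hY hvV, extSum_add, extSum_mul,
              I₁ hvV]
            simp only [hvV, true_or, if_true, mul_add, pow_add]
            ring
          · rcases eq_or_ne W [] with rfl | hW
            · have h₁ : caesuras [w] = 0 := rfl
              have A' : ∀ Y, ExtRel v f₁ g₁ V [w] Y →
                  extSum (g₁ w) f₂ g₂ (g₁ w :: Y) (z :: Z) φ =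
                  (if Z = [] then 1 else 0) * extSum (g₁ w) f₂ g₂ Y (z :: Z) ψ +
                  (-1) ^ ((if z ∈ Z then 1 else 0) * (caesuras (v :: V) + caesuras [w])) *
                    extSum (g₁ w) f₂ g₂ (g₁ w :: Y) Z ψ := by
                intro Y hY
                have h₁ : g₁ w ∉ Y := fun h => hvV ((hY.mem_right hs₁ w).1 h).1
                have h₂ : caesuras (g₁ w :: Y) = caesuras (v :: V) + caesuras [w] := by
                  rw [caesuras, hY.caesuras hs₁]
                  simp [h₁, caesuras, hvV]
                simp only [extSum_block, h₁, h₂]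
                simp only [false_or]
                split_ifs <;> ring
              rw [if_pos (Or.inr rfl), extSum_congr A', extSum_add, extSum_mul, extSum_mul,
                hempty hvV w (z :: Z) ψ [g₃ z], extSum_nil, extSum_block_nil, h₁]
              simp only [hvV, List.not_mem_nil, false_or, or_true, if_true, if_false, zero_mul,
                extSum_block_nil, pow_zero, extSum_nil, mul_zero, add_zero, mul_add, pow_add]
              ring
            · simp only [hvV, hW, false_or, if_false, mul_add, pow_add]
              ring

/-- Parallel associativity. -/
theorem extSum_par {i j : α} (hij : i ≠ j) {f₁ : α → δ} {g₁ : β → δ} {f₂ : δ → γ} {g₂ : ζ → γ}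
    {f₃ : α → δ'} {g₃ : ζ → δ'} {f₄ : δ' → γ} {g₄ : β → γ}
    (hs₁ : Separated i f₁ g₁) (hs₃ : Separated j f₃ g₃)
    (hf : ∀ v, v ≠ i → v ≠ j → f₂ (f₁ v) = f₄ (f₃ v)) (hg₁ : ∀ w, f₂ (g₁ w) = g₄ w)
    (hg₃ : ∀ z, f₄ (g₃ z) = g₂ z) (V : List α) {W : List β} (hW : W ≠ [])
    {Z : List ζ} (hZ : Z ≠ []) (φ : List γ → ℤ) :
    extSum i f₁ g₁ V W (fun Y => extSum (f₁ j) f₂ g₂ Y Z φ) =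
      (-1) ^ (if i ∈ V ∧ j ∈ V then caesuras W * caesuras Z else 0) *
      extSum j f₃ g₃ V Z fun Y => extSum (f₃ i) f₄ g₄ Y W φ := by
  induction V generalizing W Z φ with
  | nil => simp only [extSum_nil]; simp
  | cons v V ih =>
    rcases eq_or_ne v i with rfl | hvi
    · have hjm : j ∈ v :: V ↔ j ∈ V := by simp [hij.symm]
      have hgf : ∀ w, g₁ w ≠ f₁ j := fun w => (hs₁.ne j w hij.symm).symm
      induction W generalizing φ with
      | nil => exact absurd rfl hW
      | cons w W ihW =>
        rw [extSum_block, extSum_other hij]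
        simp only [extSum_other (hgf w), hg₁]
        set ψ : List γ → ℤ := fun X => φ (g₄ w :: X) with hψ
        -- Here the Koszul sign arises: if `Z` has already been inserted, an interposed letter of
        -- `W` must also pass the interposed letters of `Z`.
        have key : ∀ Y, ExtRel j f₃ g₃ V Z Y → extSum (f₃ v) f₄ g₄ (f₃ v :: Y) (w :: W) φ =
            (if v ∈ V ∨ W = [] then 1 else 0) * extSum (f₃ v) f₄ g₄ Y (w :: W) ψ +
            (-1) ^ ((if w ∈ W then 1 else 0) *
              (caesuras (v :: V) + if j ∈ V then caesuras Z else 0)) *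
              extSum (f₃ v) f₄ g₄ (f₃ v :: Y) W ψ := by
          intro Y hY
          have h₁ := hY.mem_left hs₃ hij
          have h₂ : caesuras (f₃ v :: Y) = caesuras (v :: V) + if j ∈ V then caesuras Z else 0 := by
            simp only [caesuras, h₁, hY.caesuras hs₃]
            omega
          simp only [extSum_block, h₁, h₂]
          split_ifs <;> ring
        rw [extSum_congr key, extSum_add, extSum_mul, extSum_mul]
        have h₁ : extSum v f₁ g₁ (v :: V) W (fun Y => extSum (f₁ j) f₂ g₂ Y Z ψ) =
            (-1) ^ (if j ∈ V then caesuras W * caesuras Z else 0) *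
            extSum j f₃ g₃ V Z fun Y => extSum (f₃ v) f₄ g₄ (f₃ v :: Y) W ψ := by
          rcases eq_or_ne W [] with rfl | hW'
          · rw [extSum_block_nil, extSum_congr (ψ := fun _ => 0), extSum_zero, mul_zero]
            exact fun Y _ => extSum_block_nil _ _
          · rw [ihW hW' ψ, extSum_other hij]
            simp [hij.symm]
        rw [h₁, ih hW hZ]
        simp only [hjm, List.mem_cons_self, true_and]
        have h₂ : caesuras (w :: W) = (if w ∈ W then 1 else 0) + caesuras W := rfl
        have h₃ : ∀ k : ℕ, ((-1 : ℤ) ^ k) * (-1) ^ k = 1 := fun k => by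
          rw [← mul_pow]; simp
        rw [h₂]
        have h₄ : v ∉ V → W = [] → caesuras W = 0 ∧ w ∉ W := by
          rintro - rfl
          simp [caesuras]
        -- Only signs are left. If `w` is a caesura and `j` occurs in `V`, the additional factor
        -- from `key` is `(-1) ^ caesuras Z`, which is also the factor by which the Koszul signs for
        -- `w :: W` and `W` differ; `h₃` removes the square.
        by_cases hjV : j ∈ V <;> by_cases hwW : w ∈ W <;> by_cases hvV : v ∈ V <;>
          by_cases hW' : W = [] <;>
          simp only [hjV, hwW, hvV, hW', and_self, and_true, and_false, if_true, if_false,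
            true_or, false_or, or_true, or_self, zero_mul, one_mul, pow_zero,
            pow_add, add_mul, mul_add, zero_add, add_zero, caesuras, List.not_mem_nil] at h₄ ⊢ <;>
          first
          | ring1
          | linear_combination ((-1) ^ caesuras V * (-1 : ℤ) ^ (caesuras W * caesuras Z) *
              extSum j f₃ g₃ V Z fun Y => extSum (f₃ v) f₄ g₄ (f₃ v :: Y) W ψ) * h₃ (caesuras Z)
          | linear_combination (-(-1) ^ caesuras V * (-1 : ℤ) ^ (caesuras W * caesuras Z) *
              extSum j f₃ g₃ V Z fun Y => extSum (f₃ v) f₄ g₄ (f₃ v :: Y) W ψ) * h₃ (caesuras Z)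
    · rcases eq_or_ne v j with rfl | hvj
      · have him : i ∈ v :: V ↔ i ∈ V := by simp [hij]
        have hgf : ∀ w, g₃ w ≠ f₃ i := fun w => (hs₃.ne i w hij).symm
        induction Z generalizing φ with
        | nil => exact absurd rfl hZ
        | cons z Z ihZ =>
          rw [extSum_block (f := f₃), extSum_other hij.symm]
          simp only [extSum_other (hgf z), hg₃]
          set ψ : List γ → ℤ := fun X => φ (g₂ z :: X) with hψ
          have key : ∀ Y, ExtRel i f₁ g₁ V W Y → extSum (f₁ v) f₂ g₂ (f₁ v :: Y) (z :: Z) φ =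
              (if v ∈ V ∨ Z = [] then 1 else 0) * extSum (f₁ v) f₂ g₂ Y (z :: Z) ψ +
              (-1) ^ ((if z ∈ Z then 1 else 0) *
                (caesuras (v :: V) + if i ∈ V then caesuras W else 0)) *
                extSum (f₁ v) f₂ g₂ (f₁ v :: Y) Z ψ := by
            intro Y hY
            have h₁ := hY.mem_left hs₁ hij.symm
            have h₂ : caesuras (f₁ v :: Y) =
                caesuras (v :: V) + if i ∈ V then caesuras W else 0 := by
              simp only [caesuras, h₁, hY.caesuras hs₁]
              omega
            simp only [extSum_block, h₁, h₂]
            split_ifs <;> ring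
          rw [extSum_congr key, extSum_add, extSum_mul, extSum_mul]
          have h₁ : extSum i f₁ g₁ V W (fun Y => extSum (f₁ v) f₂ g₂ (f₁ v :: Y) Z ψ) =
              (-1) ^ (if i ∈ V then caesuras W * caesuras Z else 0) *
              extSum v f₃ g₃ (v :: V) Z fun Y => extSum (f₃ i) f₄ g₄ Y W ψ := by
            rcases eq_or_ne Z [] with rfl | hZ'
            · rw [extSum_block_nil, extSum_congr (ψ := fun _ => 0), extSum_zero, mul_zero]
              exact fun Y _ => extSum_block_nil _ _
            · have := ihZ hZ' ψ
              rw [extSum_other hij.symm] at this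
              rw [this]
              simp [hij]
          rw [h₁, ih hW hZ]
          simp only [him, List.mem_cons_self, and_true]
          have h₂ : caesuras (z :: Z) = (if z ∈ Z then 1 else 0) + caesuras Z := rfl
          have h₃ : ∀ k : ℕ, ((-1 : ℤ) ^ k) * (-1) ^ k = 1 := fun k => by
            rw [← mul_pow]; simp
          rw [h₂]
          have h₄ : v ∉ V → Z = [] → caesuras Z = 0 ∧ z ∉ Z := by
            rintro - rfl
            simp [caesuras]
          by_cases hjV : i ∈ V <;> by_cases hwW : z ∈ Z <;> by_cases hvV : v ∈ V <;>
            by_cases hW' : Z = [] <;>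
            simp only [hjV, hwW, hvV, hW', and_self, and_true, and_false, if_true, if_false,
              true_or, false_or, or_true, or_self, zero_mul, one_mul, pow_zero, mul_one,
              pow_add, add_mul, mul_add, zero_add, add_zero, caesuras, List.not_mem_nil] at h₄ ⊢ <;>
            ring
      · rw [extSum_other hvi, extSum_other hvj]
        have h₁ : f₁ v ≠ f₁ j := fun e => hvj (hs₁.left v j hvi hij.symm e)
        have h₂ : f₃ v ≠ f₃ i := fun e => hvi (hs₃.left v i hvj hij e)
        simp only [extSum_other h₁, extSum_other h₂, hf v hvi hvj, List.mem_cons, hvi.symm,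
          hvj.symm, false_or]
        exact ih hW hZ _

end Associativity

end QuiltOp

namespace QuiltOp

/-! ## Blocks of labels -/

section Blocks

/-- The section of `blockOut` that sends `i` to the element `r` of the block. -/
def blockSec {m n l : ℕ} (hl : l + 1 = m + n) (i : Fin m) (r : Fin n) (v : Fin m) : Fin l :=
  if v = i then blockIn hl i r
  else if h : v.1 < i.1 then ⟨v.1, by omega⟩
  else ⟨v.1 + n - 1, by have := r.2; omega⟩

variable {m n l : ℕ} (hl : l + 1 = m + n) (i : Fin m)

theorem blockSec_val (r : Fin n) (v : Fin m) : (blockSec hl i r v).1 =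
    if v.1 = i.1 then i.1 + r.1 else if v.1 < i.1 then v.1 else v.1 + n - 1 := by
  simp only [blockSec, Fin.ext_iff]
  split_ifs <;> rfl

theorem blockIn_val (j : Fin n) : (blockIn hl i j).1 = i.1 + j.1 := rfl

theorem blockSec_self (r : Fin n) : blockSec hl i r i = blockIn hl i r := if_pos rfl

theorem blockOut_blockIn (j : Fin n) : blockOut hl i (blockIn hl i j) = i := by
  have := j.2
  rw [blockOut, dif_neg (by simp [blockIn]), dif_pos (by simp [blockIn])]

theorem blockOut_blockSec (r : Fin n) (v : Fin m) : blockOut hl i (blockSec hl i r v) = v := by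
  have := r.2
  rcases lt_trichotomy v.1 i.1 with h | h | h
  · have hv : v ≠ i := fun e => by simp [e] at h
    simp [blockOut, blockSec, hv, h]
  · obtain rfl : v = i := Fin.ext h
    rw [blockSec_self, blockOut_blockIn]
  · have hv : v ≠ i := fun e => by simp [e] at h
    have h₁ : ¬ v.1 < i.1 := by omega
    have h₂ : ¬ v.1 + n - 1 < i.1 := by omega
    have h₃ : ¬ v.1 + n - 1 < i.1 + n := by omega
    simp only [blockOut, blockSec, hv, h₁, if_false, dif_neg, not_false_eq_true, h₂, h₃]
    ext
    simp only
    omega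

theorem blockIn_injective : Function.Injective (blockIn hl i) := by
  intro s t h
  simp only [blockIn, Fin.mk.injEq] at h
  exact Fin.ext (by omega)

theorem blockOut_eq_self_iff (k : Fin l) : blockOut hl i k = i ↔ ∃ j, blockIn hl i j = k := by
  constructor
  · intro h
    have hk := k.2
    refine ⟨⟨k.1 - i.1, ?_⟩, ?_⟩
    all_goals
      simp only [blockOut] at h
      split_ifs at h with h₁ h₂ <;> simp only [Fin.ext_iff, blockIn] at h ⊢ <;> omega
  · rintro ⟨j, rfl⟩
    exact blockOut_blockIn hl i j

theorem blockSec_blockOut (r : Fin n) {k : Fin l} (h : blockOut hl i k ≠ i) :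
    blockSec hl i r (blockOut hl i k) = k := by
  have hk := k.2
  have hr := r.2
  rw [blockSec, if_neg h]
  simp only [blockOut] at h ⊢
  by_cases h₁ : k.1 < i.1
  · simp [h₁]
  · by_cases h₂ : k.1 < i.1 + n
    · simp [h₁, h₂] at h
    · have h₃ : ¬ k.1 + 1 - n < i.1 := by omega
      simp only [h₁, h₂, dif_neg, not_false_eq_true, h₃]
      ext
      simp only
      omega

theorem block_cases (r : Fin n) (k : Fin l) :
    (∃ j, k = blockIn hl i j) ∨ ∃ v, v ≠ i ∧ k = blockSec hl i r v := by
  by_cases h : blockOut hl i k = i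
  · obtain ⟨j, hj⟩ := (blockOut_eq_self_iff hl i k).1 h
    exact Or.inl ⟨j, hj.symm⟩
  · exact Or.inr ⟨_, h, (blockSec_blockOut hl i r h).symm⟩

theorem blockSec_injective (r : Fin n) : Function.Injective (blockSec hl i r) :=
  Function.LeftInverse.injective (blockOut_blockSec hl i r)

theorem separated_block (r : Fin n) : Separated i (blockSec hl i r) (blockIn hl i) where
  left _ _ _ _ h := blockSec_injective hl i r h
  right := blockIn_injective hl i
  ne v w hv h := hv (by rw [← blockOut_blockSec hl i r v, h, blockOut_blockIn])

end Blocks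

/-! ### Nested and parallel blocks of labels -/

section BlockComposition

variable {m n k l₁ l₂ l : ℕ} (h₁ : l₁ + 1 = m + n) (h₂ : l + 1 = l₁ + k)

theorem blockIn_blockIn (h₃ : l₂ + 1 = n + k) (h₄ : l + 1 = m + l₂) (i : Fin m) (j : Fin n)
    (z : Fin k) : blockIn h₂ (blockIn h₁ i j) z = blockIn h₄ i (blockIn h₃ j z) := by
  simp [blockIn, add_assoc]

theorem blockSec_blockIn (h₃ : l₂ + 1 = n + k) (h₄ : l + 1 = m + l₂) (i : Fin m) (j : Fin n)
    (r : Fin k) (w : Fin n) :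
    blockSec h₂ (blockIn h₁ i j) r (blockIn h₁ i w) = blockIn h₄ i (blockSec h₃ j r w) := by
  have := r.2
  apply Fin.ext
  simp only [blockSec_val, blockIn_val]
  grind

theorem blockSec_blockSec (h₃ : l₂ + 1 = n + k) (h₄ : l + 1 = m + l₂) (i : Fin m) (j : Fin n)
    (r : Fin k) (s : Fin n) (v : Fin m) :
    blockSec h₂ (blockIn h₁ i j) r (blockSec h₁ i s v) = blockSec h₄ i (blockSec h₃ j r s) v := by
  by_cases h : v = i
  · subst h
    rw [blockSec_self, blockSec_self, blockSec_blockIn]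
  · have h' : v.1 ≠ i.1 := fun e => h (Fin.ext e)
    have := j.2
    apply Fin.ext
    simp only [blockSec_val, blockIn_val]
    split_ifs <;> omega

theorem blockOut_blockOut (h₃ : l₂ + 1 = n + k) (h₄ : l + 1 = m + l₂) (i : Fin m) (j : Fin n)
    (r : Fin k) (x : Fin l) :
    blockOut h₁ i (blockOut h₂ (blockIn h₁ i j) x) = blockOut h₄ i x := by
  rcases block_cases h₄ i (blockSec h₃ j r j) x with ⟨y, rfl⟩ | ⟨v, hv, rfl⟩
  · rw [blockOut_blockIn]
    rcases block_cases h₃ j r y with ⟨z, rfl⟩ | ⟨w, hw, rfl⟩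
    · rw [← blockIn_blockIn h₁ h₂ h₃ h₄, blockOut_blockIn, blockOut_blockIn]
    · rw [← blockSec_blockIn h₁ h₂ h₃ h₄, blockOut_blockSec, blockOut_blockIn]
  · rw [blockOut_blockSec, ← blockSec_blockSec h₁ h₂ h₃ h₄, blockOut_blockSec, blockOut_blockSec]

theorem blockOut_blockIn_comm (h₃ : l₂ + 1 = n + k) (h₄ : l + 1 = m + l₂) (i : Fin m) (j : Fin n)
    (r : Fin k) (y : Fin l₂) :
    blockOut h₂ (blockIn h₁ i j) (blockIn h₄ i y) = blockIn h₁ i (blockOut h₃ j y) := by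
  rcases block_cases h₃ j r y with ⟨z, rfl⟩ | ⟨w, hw, rfl⟩
  · rw [← blockIn_blockIn h₁ h₂ h₃ h₄, blockOut_blockIn, blockOut_blockIn]
  · rw [← blockSec_blockIn h₁ h₂ h₃ h₄, blockOut_blockSec, blockOut_blockSec]

variable (h₃ : l₂ + 1 = m + k) (h₄ : l + 1 = l₂ + n)

theorem blockSec_par_in {i j : Fin m} (hij : i ≠ j) (r : Fin k) (s : Fin n) (w : Fin n) :
    blockSec h₂ (blockSec h₁ i s j) r (blockIn h₁ i w) = blockIn h₄ (blockSec h₃ j r i) w := by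
  have h' : i.1 ≠ j.1 := fun e => hij (Fin.ext e)
  have := r.2
  have := w.2
  apply Fin.ext
  simp only [blockSec_val, blockIn_val]
  split_ifs <;> omega

theorem blockSec_par {i j : Fin m} (hij : i ≠ j) (r : Fin k) (s : Fin n) (v : Fin m) :
    blockSec h₂ (blockSec h₁ i s j) r (blockSec h₁ i s v) =
      blockSec h₄ (blockSec h₃ j r i) s (blockSec h₃ j r v) := by
  by_cases hvi : v = i
  · subst hvi
    rw [blockSec_self h₁, blockSec_self h₄, blockSec_par_in h₁ h₂ h₃ h₄ hij]
  · by_cases hvj : v = j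
    · subst hvj
      rw [blockSec_self h₂, blockSec_self h₃, ← blockSec_par_in h₃ h₄ h₁ h₂ hij.symm]
    · have h' : i.1 ≠ j.1 := fun e => hij (Fin.ext e)
      have := r.2
      have := s.2
      have a₁ : v.1 ≠ i.1 := fun e => hvi (Fin.ext e)
      have a₂ : v.1 ≠ j.1 := fun e => hvj (Fin.ext e)
      apply Fin.ext
      simp only [blockSec_val]
      grind

end BlockComposition

end QuiltOp

namespace QuiltOp

/-! ## Planar trees as pairs of orders -/

namespace PTree

variable {n : ℕ} (T : PTree n)

theorem le_refl (u : Fin n) : T.le u u := Relation.ReflTransGen.refl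

variable {T}

theorem le_trans {u v w : Fin n} (h : T.le u v) (h' : T.le v w) : T.le u w :=
  Relation.ReflTransGen.trans h h'

theorem le_of_edge {u v : Fin n} (h : T.edge u v) : T.le u v := Relation.ReflTransGen.single h

theorem le_antisymm' {u v : Fin n} (h : T.le u v) (h' : T.le v u) : u = v :=
  T.le_antisymm u v h h'

theorem left_or (u v : Fin n) : T.le u v ∨ T.le v u ∨ T.left u v ∨ T.left v u := by
  have := T.comparable u v
  unfold le
  tauto

theorem left_not_le {u v : Fin n} (h : T.left u v) : ¬ T.le u v ∧ ¬ T.le v u :=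
  (T.comparable u v).1 (Or.inl h)

theorem left_asymm {u v : Fin n} (h : T.left u v) (h' : T.left v u) : False :=
  T.left_irrefl u (T.left_trans _ _ _ h h')

theorem left_of_le_of_left {u v u' v' : Fin n} (h : T.left u v) (hu : T.le u u')
    (hv : T.le v v') : T.left u' v' := T.inherit u v u' v' h hu hv

theorem le_total_of_le {u v w : Fin n} (hu : T.le u w) (hv : T.le v w) : T.le u v ∨ T.le v u := by
  rcases left_or (T := T) u v with h | h | h | h
  · exact Or.inl h
  · exact Or.inr h
  · exact (T.left_irrefl w (left_of_le_of_left h hu hv)).elim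
  · exact (T.left_irrefl w (left_of_le_of_left h hv hu)).elim

/-- An edge is a covering pair of the vertical order, so a tree is determined by its two orders and
may be constructed from them. -/
theorem edge_iff {u v : Fin n} : T.edge u v ↔
    T.le u v ∧ u ≠ v ∧ ∀ t, T.le u t → T.le t v → t = u ∨ t = v := by
  constructor
  · intro h
    exact ⟨le_of_edge h, fun e => T.edge_irrefl u (by rwa [← e] at h), T.edge_minimal u v h⟩
  · rintro ⟨h, hne, hmin⟩
    rcases Relation.ReflTransGen.cases_head h with rfl | ⟨t, ht, htv⟩
    · exact absurd rfl hne
    · rcases hmin t (le_of_edge ht) htv with rfl | rfl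
      · exact (T.edge_irrefl _ ht).elim
      · exact ht

theorem ext_le {S : PTree n} (h : ∀ u v, S.le u v ↔ T.le u v)
    (h' : ∀ u v, S.left u v ↔ T.left u v) : S = T := by
  refine PTree.ext ?_ ?_
  · funext u v
    exact propext (by simp only [edge_iff, h])
  · funext u v
    exact propext (h' u v)

variable (T) in
-- A minimal ancestor of `u` has no proper ancestor, so it is the unique vertex with this property.
theorem exists_root : ∃ r, ∀ u, T.le r u := by
  obtain ⟨r, -, hu⟩ := T.root
  refine ⟨r, fun u => ?_⟩
  have wf : WellFounded T.lt := by
    have : IsTrans (Fin n) T.lt := ⟨fun a b c h h' => ⟨le_trans h.1 h'.1, fun e => h.2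
      (le_antisymm' h.1 (e ▸ h'.1))⟩⟩
    have : Std.Irrefl T.lt := ⟨fun a h => h.2 rfl⟩
    exact Finite.wellFounded_of_trans_of_irrefl _
  obtain ⟨t, ht, hmin⟩ := wf.has_min {t | T.le t u} ⟨u, T.le_refl u⟩
  have : t = r := by
    refine hu t fun s hs => ?_
    by_contra hne
    exact hmin s (le_trans hs ht) ⟨hs, hne⟩
  exact this ▸ ht

/-- A partial order on a finite type is generated by its covering relation. -/
theorem reflTransGen_cover {α : Type*} [Finite α] (R : α → α → Prop) (refl : ∀ a, R a a)
    (trans : ∀ a b c, R a b → R b c → R a c) (antisymm : ∀ a b, R a b → R b a → a = b) (u v : α) :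
    Relation.ReflTransGen
      (fun u v => R u v ∧ u ≠ v ∧ ∀ t, R u t → R t v → t = u ∨ t = v) u v ↔ R u v := by
  constructor
  · intro h
    induction h with
    | refl => exact refl u
    | tail _ h ih => exact trans _ _ _ ih h.1
  · have wf : WellFounded fun a b => R a b ∧ a ≠ b := by
      have : IsTrans α fun a b => R a b ∧ a ≠ b := ⟨fun a b c h h' =>
        ⟨trans _ _ _ h.1 h'.1, fun e => h.2 (antisymm _ _ h.1 (e ▸ h'.1))⟩⟩
      have : Std.Irrefl fun a b => R a b ∧ a ≠ b := ⟨fun a h => h.2 rfl⟩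
      exact Finite.wellFounded_of_trans_of_irrefl _
    have wf' : WellFounded fun a b => R b a ∧ b ≠ a := by
      have : IsTrans α fun a b => R b a ∧ b ≠ a := ⟨fun a b c h h' =>
        ⟨trans _ _ _ h'.1 h.1, fun e => h.2 (antisymm _ _ h.1 (e ▸ h'.1))⟩⟩
      have : Std.Irrefl fun a b => R b a ∧ b ≠ a := ⟨fun a h => h.2 rfl⟩
      exact Finite.wellFounded_of_trans_of_irrefl _
    intro h
    induction v using wf.induction with
    | _ v ih =>
      by_cases huv : u = v
      · rw [huv]
      obtain ⟨t, ⟨ht, htv⟩, hmax⟩ := wf'.has_min {t | R u t ∧ R t v ∧ t ≠ v}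
        ⟨u, refl u, h, huv⟩
      refine (ih t htv ht).tail ⟨htv.1, htv.2, fun s hs hsv => ?_⟩
      by_cases h₁ : s = v
      · exact Or.inr h₁
      · by_cases h₂ : s = t
        · exact Or.inl h₂
        · exact (hmax s ⟨trans _ _ _ ht hs, hsv, h₁⟩ ⟨hs, Ne.symm h₂⟩).elim

variable {l : ℕ}

/-- The tree induced on a set of vertices with a least element. -/
def restrict (U : PTree l) (g : Fin n → Fin l) (hg : Function.Injective g) (r : Fin n)
    (hr : ∀ s, U.le (g r) (g s)) : PTree n :=
  have key := reflTransGen_cover (fun u v => U.le (g u) (g v)) (fun _ => U.le_refl _)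
    (fun _ _ _ => le_trans) (fun _ _ h h' => hg (le_antisymm' h h'))
  { edge := fun u v => U.le (g u) (g v) ∧ u ≠ v ∧
      ∀ t, U.le (g u) (g t) → U.le (g t) (g v) → t = u ∨ t = v
    left := fun u v => U.left (g u) (g v)
    left_irrefl := fun _ => U.left_irrefl _
    left_trans := fun _ _ _ => U.left_trans _ _ _
    edge_irrefl := fun _ h => h.2.1 rfl
    le_antisymm := fun u v h h' => hg (le_antisymm' ((key u v).1 h) ((key v u).1 h'))
    root := ⟨r, fun u h => hg (le_antisymm' ((key u r).1 h) (hr u)),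
      fun s hs => (hs r ((key r s).2 (hr s))).symm⟩
    edge_minimal := fun u v h t h₁ h₂ => h.2.2 t ((key u t).1 h₁) ((key t v).1 h₂)
    comparable := fun u v => by
      rw [key, key]
      exact U.comparable _ _
    inherit := fun u v u' v' h h₁ h₂ =>
      U.inherit _ _ _ _ h ((key u u').1 h₁) ((key v v').1 h₂) }

theorem restrict_le {U : PTree l} {g : Fin n → Fin l} {hg : Function.Injective g} {r : Fin n}
    {hr : ∀ s, U.le (g r) (g s)} (u v : Fin n) :
    (U.restrict g hg r hr).le u v ↔ U.le (g u) (g v) :=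
  reflTransGen_cover (fun u v => U.le (g u) (g v)) (fun _ => U.le_refl _)
    (fun _ _ _ => le_trans) (fun _ _ h h' => hg (le_antisymm' h h')) u v

theorem restrict_left {U : PTree l} {g : Fin n → Fin l} {hg : Function.Injective g} {r : Fin n}
    {hr : ∀ s, U.le (g r) (g s)} (u v : Fin n) :
    (U.restrict g hg r hr).left u v ↔ U.left (g u) (g v) := Iff.rfl

/-! ## Extensions of trees in terms of orders -/

/-- The orders of an extension of trees; `r` is the root of the subtree. -/
structure IsExtOrder {m n l : ℕ} (hl : l + 1 = m + n) (i : Fin m)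
    (S : PTree m) (T : PTree n) (U : PTree l) (r : Fin n) : Prop where
  le_sub : ∀ s t, T.le s t ↔ U.le (blockIn hl i s) (blockIn hl i t)
  left_sub : ∀ s t, T.left s t ↔ U.left (blockIn hl i s) (blockIn hl i t)
  le_quot : ∀ x y, S.le x y ↔ U.le (blockSec hl i r x) (blockSec hl i r y)
  left_quot : ∀ x y, S.left x y ↔ U.left (blockSec hl i r x) (blockSec hl i r y)
  convex : ∀ s t k, U.le (blockIn hl i s) k → U.le k (blockIn hl i t) → blockOut hl i k = i

section

variable {m n l : ℕ} {hl : l + 1 = m + n} {i : Fin m} {S : PTree m} {T : PTree n} {U : PTree l}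
  {r : Fin n}

theorem IsExt.le_out (h : IsExt hl i S T U) {u w : Fin l} (huw : U.le u w) :
    S.le (blockOut hl i u) (blockOut hl i w) := by
  induction huw with
  | refl => exact S.le_refl _
  | tail _ h' ih =>
    rcases h.edge_quot _ _ h' with h' | ⟨h₁, h₂⟩
    · exact le_trans ih (le_of_edge h')
    · exact (h₁.trans h₂.symm) ▸ ih

/-- Paths in `U` collapse to paths in `S`, which makes the block convex and thus keeps paths between
block vertices inside `T`. Conversely an ancestor in `S` lifts to an ancestor in `U`; if it is `i`,
the lift may be replaced by the root of the block. -/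
theorem IsExt.isExtOrder (h : IsExt hl i S T U) (hr : ∀ s, T.le r s) :
    IsExtOrder hl i S T U r := by
  have hconv : ∀ s t k, U.le (blockIn hl i s) k → U.le k (blockIn hl i t) →
      blockOut hl i k = i := by
    intro s t k h₁ h₂
    have h₁ := h.le_out h₁
    have h₂ := h.le_out h₂
    rw [blockOut_blockIn] at h₁ h₂
    exact le_antisymm' h₂ h₁
  have hsub : ∀ s t, T.le s t ↔ U.le (blockIn hl i s) (blockIn hl i t) := by
    intro s t
    constructor
    · intro hst
      exact Relation.ReflTransGen.lift (blockIn hl i) (fun a b hab => (h.edge_sub a b).1 hab) _ _ hst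
    · intro hst
      generalize hx : blockIn hl i s = x at hst
      change Relation.ReflTransGen U.edge x (blockIn hl i t) at hst
      induction hst using Relation.ReflTransGen.head_induction_on generalizing s with
      | refl => rw [blockIn_injective hl i hx]; exact T.le_refl _
      | head h₁ h₂ ih =>
        subst hx
        obtain ⟨s', rfl⟩ := (blockOut_eq_self_iff hl i _).1 (hconv s t _ (le_of_edge h₁) h₂)
        exact le_trans (le_of_edge ((h.edge_sub _ _).2 h₁)) (ih s' rfl)
  -- The path from the root of `U` to `w` is followed edge by edge. An edge that collapses to an
  -- edge of `S` adds no new ancestor except its end; an edge inside the block adds none.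
  have hpath : ∀ w x, S.le x (blockOut hl i w) → ∃ u, blockOut hl i u = x ∧ U.le u w := by
    intro w
    obtain ⟨ρ, hρ⟩ := U.exists_root
    have := hρ w
    induction this with
    | refl =>
      intro x hx
      refine ⟨ρ, le_antisymm' ?_ hx, U.le_refl _⟩
      have := h.le_out (hρ (blockSec hl i r x))
      rwa [blockOut_blockSec] at this
    | @tail k w _ hkw ih =>
      intro x hx
      rcases h.edge_quot _ _ hkw with h' | ⟨h₁, h₂⟩
      · rcases le_total_of_le hx (le_of_edge h') with h₁ | h₁
        · obtain ⟨u, hu, huk⟩ := ih x h₁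
          exact ⟨u, hu, le_trans huk (le_of_edge hkw)⟩
        · rcases S.edge_minimal _ _ h' x h₁ hx with rfl | rfl
          · exact ⟨k, rfl, le_of_edge hkw⟩
          · exact ⟨w, rfl, U.le_refl _⟩
      · rw [h₂, ← h₁] at hx
        obtain ⟨u, hu, huk⟩ := ih x hx
        exact ⟨u, hu, le_trans huk (le_of_edge hkw)⟩
  have hle : ∀ x y, S.le x y ↔ U.le (blockSec hl i r x) (blockSec hl i r y) := by
    intro x y
    constructor
    · intro hxy
      rw [← blockOut_blockSec hl i r y] at hxy
      obtain ⟨u, hu, huy⟩ := hpath _ _ hxy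
      refine le_trans ?_ huy
      rw [← hu]
      by_cases hi : blockOut hl i u = i
      · obtain ⟨j, rfl⟩ := (blockOut_eq_self_iff hl i u).1 hi
        rw [hi, blockSec_self]
        exact (hsub _ _).1 (hr j)
      · rw [blockSec_blockOut hl i r hi]
        exact U.le_refl _
    · intro hxy
      have := h.le_out hxy
      rwa [blockOut_blockSec, blockOut_blockSec] at this
  refine ⟨hsub, h.left_sub, hle, fun x y => ⟨fun hxy => h.left_quot _ _ ?_, fun hxy => ?_⟩, hconv⟩
  · rwa [blockOut_blockSec, blockOut_blockSec]
  -- The horizontal condition in the definition is one-sided. Its converse follows since exactly one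
  -- of the possible relations holds in `S`, and all others are excluded in `U`.
  · have h₁ := left_not_le hxy
    rw [← hle, ← hle] at h₁
    rcases left_or (T := S) x y with h₂ | h₂ | h₂ | h₂
    · exact (h₁.1 h₂).elim
    · exact (h₁.2 h₂).elim
    · exact h₂
    · refine (left_asymm hxy (h.left_quot _ _ ?_)).elim
      rwa [blockOut_blockSec, blockOut_blockSec]

theorem IsExtOrder.sec_le (h : IsExtOrder hl i S T U r) (hr : ∀ s, T.le r s) (u : Fin l) :
    U.le (blockSec hl i r (blockOut hl i u)) u := by
  by_cases hi : blockOut hl i u = i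
  · obtain ⟨j, rfl⟩ := (blockOut_eq_self_iff hl i u).1 hi
    rw [hi, blockSec_self]
    exact (h.le_sub _ _).1 (hr j)
  · rw [blockSec_blockOut hl i r hi]
    exact U.le_refl _

theorem IsExtOrder.le_out (h : IsExtOrder hl i S T U r) (hr : ∀ s, T.le r s) {u w : Fin l}
    (huw : U.le u w) : S.le (blockOut hl i u) (blockOut hl i w) := by
  rw [h.le_quot]
  by_cases hw : blockOut hl i w = i
  · by_cases hu : blockOut hl i u = i
    · rw [hw, hu]; exact U.le_refl _
    · rw [blockSec_blockOut hl i r hu]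
      obtain ⟨j, rfl⟩ := (blockOut_eq_self_iff hl i w).1 hw
      rw [hw, blockSec_self]
      rcases le_total_of_le huw ((h.le_sub _ _).1 (hr j)) with h₁ | h₁
      · exact h₁
      · exact (hu (h.convex _ _ _ h₁ huw)).elim
  · rw [blockSec_blockOut hl i r hw]
    exact le_trans (h.sec_le hr u) huw

/-- Edges are coverings, so coverings have to be compared. Within the block this is convexity.
Elsewhere a vertex between two collapsed ones is lifted to `U`, with the block represented by its
root, and the lift lies between the original ones. -/
theorem IsExtOrder.isExt (h : IsExtOrder hl i S T U r) (hr : ∀ s, T.le r s) :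
    IsExt hl i S T U where
  edge_sub s t := by
    rw [edge_iff, edge_iff, ← h.le_sub, (blockIn_injective hl i).ne_iff]
    refine and_congr_right fun _ => and_congr_right fun _ => ⟨fun H k hk hk' => ?_,
      fun H k hk hk' => ?_⟩
    · obtain ⟨j, rfl⟩ := (blockOut_eq_self_iff hl i k).1 (h.convex _ _ _ hk hk')
      rw [← h.le_sub] at hk hk'
      exact (H j hk hk').imp (congrArg _) (congrArg _)
    · exact (H _ ((h.le_sub _ _).1 hk) ((h.le_sub _ _).1 hk')).imp
        (fun e => blockIn_injective hl i e) (fun e => blockIn_injective hl i e)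
  left_sub := h.left_sub
  edge_quot u w huw := by
    rw [edge_iff] at huw
    obtain ⟨huw, hne, hmin⟩ := huw
    by_cases hb : blockOut hl i u = i ∧ blockOut hl i w = i
    · exact Or.inr hb
    refine Or.inl (edge_iff.2 ⟨h.le_out hr huw, fun e => ?_, fun t ht ht' => ?_⟩)
    · by_cases hu : blockOut hl i u = i
      · exact hb ⟨hu, e ▸ hu⟩
      · rw [← blockSec_blockOut hl i r hu, e, blockSec_blockOut hl i r (e ▸ hu)] at hne
        exact hne rfl
    · by_contra! hcon
      rw [h.le_quot] at ht ht'
      have h₁ : U.le (blockSec hl i r t) w := le_trans ht' (h.sec_le hr w)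
      by_cases hu : blockOut hl i u = i
      · rcases le_total_of_le huw h₁ with h₂ | h₂
        · rcases hmin _ h₂ h₁ with h₃ | h₃
          · exact hcon.1 (by rw [← h₃, blockOut_blockSec])
          · exact hcon.2 (by rw [← h₃, blockOut_blockSec])
        · obtain ⟨j, rfl⟩ := (blockOut_eq_self_iff hl i u).1 hu
          rw [hu, blockSec_self] at ht
          have := h.convex _ _ _ ht h₂
          rw [blockOut_blockSec] at this
          exact hcon.1 (this.trans hu.symm)
      · rw [blockSec_blockOut hl i r hu] at ht
        rcases hmin _ ht h₁ with h₃ | h₃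
        · exact hcon.1 (by rw [← h₃, blockOut_blockSec])
        · exact hcon.2 (by rw [← h₃, blockOut_blockSec])
  left_quot u w huw := left_of_le_of_left ((h.left_quot _ _).1 huw) (h.sec_le hr u) (h.sec_le hr w)

theorem IsExtOrder.root (h : IsExtOrder hl i S T U r) (hr : ∀ s, T.le r s) {ρ : Fin m}
    (hρ : ∀ x, S.le ρ x) (u : Fin l) : U.le (blockSec hl i r ρ) u :=
  le_trans ((h.le_quot _ _).1 (hρ _)) (h.sec_le hr u)

/-- The orders of the subtree and of the quotient are read off from `U`. Sums over intermediate
trees thus have at most one term. -/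
theorem IsExt.quot_unique {S' : PTree m} {T' : PTree n} (h : IsExt hl i S T U)
    (h' : IsExt hl i S' T' U) : S = S' ∧ T = T' := by
  obtain ⟨r, hr⟩ := T.exists_root
  have h₁ := h.isExtOrder hr
  have hT : T = T' := by
    obtain ⟨r', hr'⟩ := T'.exists_root
    have h₂ := h'.isExtOrder hr'
    exact ext_le (fun u v => by rw [h₁.le_sub, h₂.le_sub]) fun u v => by
      rw [h₁.left_sub, h₂.left_sub]
  subst hT
  have h₂ := h'.isExtOrder hr
  exact ⟨ext_le (fun u v => by rw [h₁.le_quot, h₂.le_quot]) fun u v => by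
    rw [h₁.left_quot, h₂.left_quot], rfl⟩

end

/-! ### Associativity of extensions of trees -/

section Associativity

variable {m n k l₁ l₂ l : ℕ} (h₁ : l₁ + 1 = m + n) (h₂ : l + 1 = l₁ + k)

/-- The missing intermediate tree is induced by `Z`: in one direction on the outer block, in the
other on the vertices outside the inner block together with the root of that block. -/
theorem isExt_seq (h₃ : l₂ + 1 = n + k) (h₄ : l + 1 = m + l₂) (i : Fin m) (j : Fin n)
    (S : PTree m) (T : PTree n) (R : PTree k) (Z : PTree l) :
    (∃ Y, IsExt h₁ i S T Y ∧ IsExt h₂ (blockIn h₁ i j) Y R Z) ↔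
      ∃ Y, IsExt h₃ j T R Y ∧ IsExt h₄ i S Y Z := by
  obtain ⟨t, ht⟩ := T.exists_root
  obtain ⟨r, hr⟩ := R.exists_root
  have e₁ := fun w => blockSec_blockIn h₁ h₂ h₃ h₄ i j r w
  have e₂ := fun v => blockSec_blockSec h₁ h₂ h₃ h₄ i j r t v
  have e₃ := fun z => blockIn_blockIn h₁ h₂ h₃ h₄ i j z
  constructor
  · rintro ⟨Y, hY, hZ⟩
    replace hY := hY.isExtOrder ht
    replace hZ := hZ.isExtOrder hr
    have hroot : ∀ y, Z.le (blockIn h₄ i (blockSec h₃ j r t)) (blockIn h₄ i y) := by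
      have key : ∀ w, Z.le (blockIn h₄ i (blockSec h₃ j r t)) (blockIn h₄ i (blockSec h₃ j r w)) :=
        fun w => by
          rw [← e₁, ← e₁, ← hZ.le_quot, ← hY.le_sub]
          exact ht w
      intro y
      rcases block_cases h₃ j r y with ⟨z, rfl⟩ | ⟨w, -, rfl⟩
      · refine le_trans (key j) ?_
        rw [blockSec_self, ← e₃, ← e₃, ← hZ.le_sub]
        exact hr z
      · exact key w
    refine ⟨Z.restrict (blockIn h₄ i) (blockIn_injective _ _) _ hroot,
      IsExtOrder.isExt (r := r) ⟨fun a b => ?_, fun a b => ?_, fun a b => ?_, fun a b => ?_,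
        fun a b y ha hb => ?_⟩ hr,
      IsExtOrder.isExt (r := blockSec h₃ j r t) ⟨fun a b => restrict_le _ _,
        fun a b => restrict_left _ _, fun a b => ?_, fun a b => ?_, fun a b y ha hb => ?_⟩
        fun y => (restrict_le _ _).2 (hroot y)⟩
    · rw [restrict_le, ← e₃, ← e₃, hZ.le_sub]
    · rw [restrict_left, ← e₃, ← e₃, hZ.left_sub]
    · rw [restrict_le, ← e₁, ← e₁, ← hZ.le_quot, hY.le_sub]
    · rw [restrict_left, ← e₁, ← e₁, ← hZ.left_quot, hY.left_sub]
    · rw [restrict_le, ← e₃] at ha hb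
      have := hZ.convex _ _ _ ha hb
      rw [blockOut_blockIn_comm h₁ h₂ h₃ h₄ i j r] at this
      exact blockIn_injective _ _ this
    · rw [← e₂, ← e₂, ← hZ.le_quot, hY.le_quot]
    · rw [← e₂, ← e₂, ← hZ.left_quot, hY.left_quot]
    · have ha := hZ.le_out hr ha
      have hb := hZ.le_out hr hb
      rw [blockOut_blockIn_comm h₁ h₂ h₃ h₄ i j r] at ha hb
      rw [← blockOut_blockOut h₁ h₂ h₃ h₄ i j r]
      exact hY.convex _ _ _ ha hb
  · rintro ⟨Y, hY, hZ⟩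
    replace hY := hY.isExtOrder hr
    have hY' := fun y => hY.root hr ht y
    replace hZ := hZ.isExtOrder hY'
    obtain ⟨ρ, hρ⟩ := S.exists_root
    have hroot : ∀ y, Z.le (blockSec h₂ (blockIn h₁ i j) r (blockSec h₁ i t ρ))
        (blockSec h₂ (blockIn h₁ i j) r y) := fun y => by
      rw [e₂]
      exact hZ.root hY' hρ _
    refine ⟨Z.restrict (blockSec h₂ (blockIn h₁ i j) r) (blockSec_injective _ _ _) _ hroot,
      IsExtOrder.isExt (r := t) ⟨fun a b => ?_, fun a b => ?_, fun a b => ?_, fun a b => ?_,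
        fun a b y ha hb => ?_⟩ ht,
      IsExtOrder.isExt (r := r) ⟨fun a b => ?_, fun a b => ?_, fun a b => restrict_le _ _,
        fun a b => restrict_left _ _, fun a b y ha hb => ?_⟩ hr⟩
    · rw [restrict_le, e₁, e₁, ← hZ.le_sub, hY.le_quot]
    · rw [restrict_left, e₁, e₁, ← hZ.left_sub, hY.left_quot]
    · rw [restrict_le, e₂, e₂, hZ.le_quot]
    · rw [restrict_left, e₂, e₂, hZ.left_quot]
    · rw [restrict_le, e₁] at ha hb
      have := hZ.convex _ _ _ ha hb
      rwa [← blockOut_blockOut h₁ h₂ h₃ h₄ i j r, blockOut_blockSec] at this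
    · rw [e₃, e₃, ← hZ.le_sub, hY.le_sub]
    · rw [e₃, e₃, ← hZ.left_sub, hY.left_sub]
    · rw [e₃] at ha hb
      obtain ⟨y, rfl⟩ := (blockOut_eq_self_iff h₄ i y).1 (hZ.convex _ _ _ ha hb)
      rw [← hZ.le_sub] at ha hb
      rw [blockOut_blockIn_comm h₁ h₂ h₃ h₄ i j r, hY.convex _ _ _ ha hb]

/-- The new intermediate tree is induced by `Z`, with the block of `T` represented by its root. One
implication suffices, as the situation is symmetric in the two insertions. -/
theorem isExt_par (h₃ : l₂ + 1 = m + k) (h₄ : l + 1 = l₂ + n) {i j : Fin m} (hij : i ≠ j)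
    {i' : Fin l₂} {j' : Fin l₁} (hj : blockOut h₁ i j' = j) (hi : blockOut h₃ j i' = i)
    (S : PTree m) (T : PTree n) (R : PTree k) (Z : PTree l) :
    (∃ Y, IsExt h₁ i S T Y ∧ IsExt h₂ j' Y R Z) → ∃ Y, IsExt h₃ j S R Y ∧ IsExt h₄ i' Y T Z := by
  obtain ⟨t, ht⟩ := T.exists_root
  obtain ⟨r, hr⟩ := R.exists_root
  obtain rfl : blockSec h₁ i t j = j' := by
    rw [← hj, blockSec_blockOut]
    rwa [hj, ne_comm]
  obtain rfl : blockSec h₃ j r i = i' := by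
    rw [← hi, blockSec_blockOut]
    rwa [hi]
  have e₁ := fun w => blockSec_par_in h₁ h₂ h₃ h₄ hij r t w
  have e₂ := fun v => blockSec_par h₁ h₂ h₃ h₄ hij r t v
  have e₃ := fun z => blockSec_par_in h₃ h₄ h₁ h₂ hij.symm t r z
  rintro ⟨Y, hY, hZ⟩
  replace hY := hY.isExtOrder ht
  replace hZ := hZ.isExtOrder hr
  obtain ⟨ρ, hρ⟩ := S.exists_root
  have hroot : ∀ y, Z.le (blockSec h₄ (blockSec h₃ j r i) t (blockSec h₃ j r ρ))
      (blockSec h₄ (blockSec h₃ j r i) t y) := fun y => by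
    rw [← e₂]
    exact hZ.root hr (fun y => hY.root ht hρ y) _
  refine ⟨Z.restrict (blockSec h₄ (blockSec h₃ j r i) t) (blockSec_injective _ _ _) _ hroot,
    IsExtOrder.isExt (r := r) ⟨fun a b => ?_, fun a b => ?_, fun a b => ?_, fun a b => ?_,
      fun a b y ha hb => ?_⟩ hr,
    IsExtOrder.isExt (r := t) ⟨fun a b => ?_, fun a b => ?_, fun a b => restrict_le _ _,
      fun a b => restrict_left _ _, fun a b y ha hb => ?_⟩ ht⟩
  · rw [restrict_le, e₃, e₃, hZ.le_sub]
  · rw [restrict_left, e₃, e₃, hZ.left_sub]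
  · rw [restrict_le, ← e₂, ← e₂, ← hZ.le_quot, hY.le_quot]
  · rw [restrict_left, ← e₂, ← e₂, ← hZ.left_quot, hY.left_quot]
  · rw [restrict_le, e₃] at ha hb
    have h := hZ.convex _ _ _ ha hb
    rcases block_cases h₃ j r y with ⟨z, rfl⟩ | ⟨v, hv, rfl⟩
    · exact blockOut_blockIn _ _ _
    · rw [← e₂, blockOut_blockSec] at h
      exact (hv (blockSec_injective _ _ _ h)).elim
  · rw [← e₁, ← e₁, ← hZ.le_quot, hY.le_sub]
  · rw [← e₁, ← e₁, ← hZ.left_quot, hY.left_sub]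
  · rw [← e₁] at ha hb
    have ha := hZ.le_out hr ha
    have hb := hZ.le_out hr hb
    rw [blockOut_blockSec] at ha hb
    obtain ⟨w, hw⟩ := (blockOut_eq_self_iff _ _ _).1 (hY.convex _ _ _ ha hb)
    have hne : blockOut h₂ (blockSec h₁ i t j) y ≠ blockSec h₁ i t j := by
      rw [← hw]
      exact ((separated_block h₁ i t).ne j w hij.symm).symm
    rw [← blockSec_blockOut _ _ r hne, ← hw, e₁, blockOut_blockIn]

end Associativity

/-! ### Relabelling and units for trees -/

theorem relabel_le (σ : Equiv.Perm (Fin n)) (u v : Fin n) :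
    (T.relabel σ).le u v ↔ T.le (σ u) (σ v) := reflTransGen_perm _ _ _ _

theorem relabel_relabel (σ τ : Equiv.Perm (Fin n)) : (T.relabel σ).relabel τ = T.relabel (σ * τ) :=
  rfl

theorem relabel_one : T.relabel 1 = T := rfl

theorem isExt_relabel {m n l : ℕ} (hl : l + 1 = m + n) (i : Fin m) (σ : Equiv.Perm (Fin m))
    (τ : Equiv.Perm (Fin n)) (ρ : Equiv.Perm (Fin l))
    (hρ : ∀ j, ρ (blockIn hl i j) = blockIn hl (σ i) (τ j))
    (hρ' : ∀ k, blockOut hl (σ i) (ρ k) = σ (blockOut hl i k))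
    (S : PTree m) (T : PTree n) (U : PTree l) :
    IsExt hl i (S.relabel σ) (T.relabel τ) (U.relabel ρ) ↔ IsExt hl (σ i) S T U := by
  constructor
  · rintro ⟨h₁, h₂, h₃, h₄⟩
    refine ⟨fun a b => ?_, fun a b => ?_, fun a b h => ?_, fun a b h => ?_⟩
    · have := h₁ (τ.symm a) (τ.symm b)
      simpa [relabel, hρ] using this
    · have := h₂ (τ.symm a) (τ.symm b)
      simpa [relabel, hρ] using this
    · have := h₃ (ρ.symm a) (ρ.symm b) (by simpa [relabel] using h)
      have e : ∀ a, σ (blockOut hl i (ρ.symm a)) = blockOut hl (σ i) a := fun a => by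
        rw [← hρ', Equiv.apply_symm_apply]
      rw [← e, ← e, σ.injective.eq_iff, σ.injective.eq_iff]
      exact this
    · have := h₄ (ρ.symm a) (ρ.symm b) (by simpa [relabel, ← hρ'] using h)
      simpa [relabel] using this
  · rintro ⟨h₁, h₂, h₃, h₄⟩
    refine ⟨fun a b => ?_, fun a b => ?_, fun a b h => ?_, fun a b h => ?_⟩
    · simpa [relabel, hρ] using h₁ (τ a) (τ b)
    · simpa [relabel, hρ] using h₂ (τ a) (τ b)
    · have := h₃ (ρ a) (ρ b) h
      simpa [relabel, hρ'] using this
    · exact h₄ (ρ a) (ρ b) (by simpa [relabel, hρ'] using h)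

theorem isExt_unit_left (hl : n + 1 = 1 + n) (i : Fin 1) (T U : PTree n) :
    IsExt hl i PTree.unit T U ↔ U = T := by
  have hin : ∀ j, blockIn hl i j = j := fun j => Fin.ext (by simp [blockIn])
  constructor
  · intro h
    refine PTree.ext ?_ ?_ <;> funext u v
    · simpa [hin] using (h.edge_sub u v).symm
    · simpa [hin] using (h.left_sub u v).symm
  · rintro rfl
    exact ⟨fun _ _ => by rw [hin, hin], fun _ _ => by rw [hin, hin],
      fun _ _ _ => Or.inr ⟨Subsingleton.elim _ _, Subsingleton.elim _ _⟩, fun _ _ h => h.elim⟩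

theorem isExt_unit_right (hl : n + 1 = n + 1) (i : Fin n) (S U : PTree n) :
    IsExt hl i S PTree.unit U ↔ U = S := by
  have hsec : ∀ j, blockSec hl i 0 j = j := fun j => Fin.ext (by
    rw [blockSec_val]
    have := j.2
    simp only [Fin.isValue, Fin.val_zero, add_zero]
    split_ifs <;> omega)
  constructor
  · intro h
    have h := h.isExtOrder (r := 0) fun s => by
      rw [Subsingleton.elim s 0]; exact le_refl _ _
    exact ext_le (fun u v => by rw [h.le_quot, hsec, hsec]) fun u v => by
      rw [h.left_quot, hsec, hsec]
  · rintro rfl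
    refine IsExtOrder.isExt (r := 0) ⟨fun a b => ?_, fun a b => ?_, fun a b => ?_, fun a b => ?_,
      fun a b k h₁ h₂ => ?_⟩ fun s => ?_
    · rw [Subsingleton.elim a b]; exact iff_of_true (le_refl _ _) (le_refl _ _)
    · rw [Subsingleton.elim a b]; exact iff_of_false (left_irrefl _ _) (left_irrefl _ _)
    · rw [hsec, hsec]
    · rw [hsec, hsec]
    · rw [Subsingleton.elim b a] at h₂
      rw [← le_antisymm' h₁ h₂, blockOut_blockIn]
    · rw [Subsingleton.elim s 0]; exact le_refl _ _

instance finite : Finite (PTree n) :=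
  Finite.of_injective (β := (Fin n → Fin n → Prop) × (Fin n → Fin n → Prop))
    (fun T => (T.edge, T.left)) fun S T h => by
      simp only [Prod.mk.injEq] at h
      exact PTree.ext h.1 h.2

noncomputable instance fintype : Fintype (PTree n) := Fintype.ofFinite _

end PTree

end QuiltOp

namespace QuiltOp

/-! ## The boundary of a list in terms of positions -/

section FaceSign

variable {n : ℕ}

theorem isCaesura_zero (a : Fin n) (L : List (Fin n)) :
    IsCaesura (a :: L) (0 : Fin (L.length + 1)) ↔ a ∈ L := by
  rw [List.mem_iff_get]
  constructor
  · rintro ⟨j, hj, h⟩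
    obtain ⟨k, rfl⟩ := Fin.exists_succ_eq.2 (Fin.pos_iff_ne_zero.1 hj)
    exact ⟨k, h⟩
  · rintro ⟨k, h⟩
    exact ⟨k.succ, Fin.succ_pos k, h⟩

theorem isCaesura_succ (a : Fin n) (L : List (Fin n)) (k : Fin L.length) :
    IsCaesura (a :: L) (k.succ : Fin (L.length + 1)) ↔ IsCaesura L k := by
  constructor
  · rintro ⟨j, hj, h⟩
    obtain ⟨j, rfl⟩ := Fin.exists_succ_eq.2 (Fin.pos_iff_ne_zero.1 ((Fin.succ_pos k).trans hj))
    exact ⟨j, Fin.succ_lt_succ_iff.1 hj, h⟩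
  · rintro ⟨j, hj, h⟩
    exact ⟨j.succ, Fin.succ_lt_succ_iff.2 hj, h⟩

theorem isRepeated_zero (a : Fin n) (L : List (Fin n)) :
    IsRepeated (a :: L) (0 : Fin (L.length + 1)) ↔ a ∈ L := by
  rw [← isCaesura_zero]
  exact ⟨fun ⟨j, hj, h⟩ => ⟨j, Fin.pos_iff_ne_zero.2 hj, h⟩, fun ⟨j, hj, h⟩ =>
    ⟨j, Fin.pos_iff_ne_zero.1 hj, h⟩⟩

theorem isRepeated_succ (a : Fin n) (L : List (Fin n)) (k : Fin L.length) :
    IsRepeated (a :: L) (k.succ : Fin (L.length + 1)) ↔ L.get k = a ∨ IsRepeated L k := by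
  constructor
  · rintro ⟨j, hj, h⟩
    rcases Fin.eq_zero_or_eq_succ j with rfl | ⟨j, rfl⟩
    · exact Or.inl h.symm
    · exact Or.inr ⟨j, fun e => hj (e ▸ rfl), h⟩
  · rintro (h | ⟨j, hj, h⟩)
    · exact ⟨0, (Fin.succ_ne_zero k).symm, h.symm⟩
    · exact ⟨j.succ, fun e => hj (Fin.succ_injective _ e), h⟩

theorem exists_lt_of_isRepeated {L : List (Fin n)} {k : Fin L.length} (h : IsRepeated L k)
    (h' : ¬ IsCaesura L k) : ∃ j, j < k ∧ L.get j = L.get k := by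
  obtain ⟨j, hj, e⟩ := h
  rcases lt_or_gt_of_ne hj with hlt | hlt
  · exact ⟨j, hlt, e⟩
  · exact (h' ⟨j, hlt, e⟩).elim

theorem faceSign_zero {a : Fin n} {L : List (Fin n)} (h : a ∈ L) :
    faceSign (a :: L) (0 : Fin (L.length + 1)) = -1 := by
  classical
  rw [faceSign, if_pos ((isCaesura_zero a L).2 h)]
  have : (Finset.univ.filter fun i : Fin (a :: L).length =>
      IsCaesura (a :: L) i ∧ i ≤ (0 : Fin (L.length + 1))) = {(0 : Fin (L.length + 1))} := by
    ext i
    simp only [Finset.mem_filter, Finset.mem_univ, true_and, Finset.mem_singleton]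
    constructor
    · exact fun h => Fin.le_zero_iff.1 h.2
    · rintro rfl
      exact ⟨(isCaesura_zero a L).2 h, le_refl _⟩
  rw [this, Finset.card_singleton, pow_one]

/-- Prefixing `a` shifts the numbering of the caesuras by one exactly if `a` is itself a caesura.
That the position is already repeated in `L` ensures that, for a last occurrence, the previous one
is not the new head. -/
theorem faceSign_succ {a : Fin n} {L : List (Fin n)} {k : Fin L.length} (h : IsRepeated L k) :
    faceSign (a :: L) (k.succ : Fin (L.length + 1)) =
      (-1) ^ (if a ∈ L then 1 else 0) * faceSign L k := by
  classical
  have ha : ∀ p : Prop, p → ((IsCaesura (a :: L) (0 : Fin (L.length + 1)) ∧ p) ↔ a ∈ L) :=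
    fun p hp => by rw [isCaesura_zero]; exact and_iff_left hp
  by_cases hc : IsCaesura L k
  · rw [faceSign, if_pos ((isCaesura_succ a L k).2 hc), faceSign, if_pos hc, ← pow_add]
    congr 1
    refine (Fin.card_filter_univ_succ _).trans ?_
    have h₀ : (IsCaesura (a :: L) (0 : Fin (L.length + 1)) ∧
        (0 : Fin (L.length + 1)) ≤ k.succ) ↔ a ∈ L := ha _ (Fin.zero_le _)
    simp only [h₀, isCaesura_succ, Fin.succ_le_succ_iff]
    split_ifs <;> simp [add_comm]
  · rw [faceSign, if_neg (fun h => hc ((isCaesura_succ a L k).1 h)), faceSign, if_neg hc,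
      ← pow_add, ← add_assoc]
    congr 2
    obtain ⟨j, hj, e⟩ := exists_lt_of_isRepeated h hc
    refine (Fin.card_filter_univ_succ _).trans ?_
    have h₁ : ∀ i : Fin L.length, (∃ j : Fin (a :: L).length, j < (k.succ : Fin (L.length + 1)) ∧
        (a :: L).get j = (a :: L).get (k.succ : Fin (L.length + 1)) ∧
        (i.succ : Fin (L.length + 1)) ≤ j) ↔ ∃ j : Fin L.length, j < k ∧ L.get j = L.get k ∧ i ≤ j := by
      intro i
      constructor
      · rintro ⟨j, hj, e, hi⟩
        obtain ⟨j, rfl⟩ := Fin.exists_succ_eq.2 (Fin.pos_iff_ne_zero.1 ((Fin.succ_pos i).trans_le hi))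
        exact ⟨j, Fin.succ_lt_succ_iff.1 hj, e, Fin.succ_le_succ_iff.1 hi⟩
      · rintro ⟨j, hj, e, hi⟩
        exact ⟨j.succ, Fin.succ_lt_succ_iff.2 hj, e, Fin.succ_le_succ_iff.2 hi⟩
    have h₀ : (IsCaesura (a :: L) (0 : Fin (L.length + 1)) ∧
        ∃ j : Fin (a :: L).length, j < (k.succ : Fin (L.length + 1)) ∧
        (a :: L).get j = (a :: L).get (k.succ : Fin (L.length + 1)) ∧
        (0 : Fin (L.length + 1)) ≤ j) ↔ a ∈ L :=
      ha _ ⟨j.succ, Fin.succ_lt_succ_iff.2 hj, e, Fin.zero_le _⟩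
    simp only [h₀, isCaesura_succ, h₁]
    split_ifs <;> simp [add_comm]

/-- The vertex is repeated only because of the new head, which is the first caesura; the exponent is
`1 + 1`. -/
theorem faceSign_succ_of_eq {a : Fin n} {L : List (Fin n)} {k : Fin L.length} (h : L.get k = a)
    (hr : ¬ IsRepeated L k) : faceSign (a :: L) (k.succ : Fin (L.length + 1)) = 1 := by
  classical
  have hc : ¬ IsCaesura L k := fun ⟨j, hj, e⟩ => hr ⟨j, hj.ne', e⟩
  rw [faceSign, if_neg (fun h => hc ((isCaesura_succ a L k).1 h))]
  have : (Finset.univ.filter fun i : Fin (a :: L).length => IsCaesura (a :: L) i ∧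
      ∃ j : Fin (a :: L).length, j < (k.succ : Fin (L.length + 1)) ∧
        (a :: L).get j = (a :: L).get (k.succ : Fin (L.length + 1)) ∧ i ≤ j) =
      {(0 : Fin (L.length + 1))} := by
    ext i
    simp only [Finset.mem_filter, Finset.mem_univ, true_and, Finset.mem_singleton]
    constructor
    · rintro ⟨-, j, hj, e, hi⟩
      rcases Fin.eq_zero_or_eq_succ j with rfl | ⟨j, rfl⟩
      · exact Fin.le_zero_iff.1 hi
      · exact (hr ⟨j, (Fin.succ_lt_succ_iff.1 hj).ne, e⟩).elim
    · rintro rfl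
      exact ⟨(isCaesura_zero a L).2 (h ▸ List.get_mem L k), 0, Fin.succ_pos k, h.symm, le_refl _⟩
  rw [this, Finset.card_singleton]
  rfl

open Classical in
theorem sum_erase_unrepeated (a : Fin n) (L : List (Fin n)) (φ : List (Fin n) → ℤ) :
    ∑ k : Fin L.length, (if L.get k = a ∧ ¬ IsRepeated L k then φ (L.eraseIdx k) else 0) =
      if L.count a = 1 then φ (L.erase a) else 0 := by
  induction L generalizing φ with
  | nil => simp
  | cons b L ih =>
    refine (Fin.sum_univ_succ _).trans ?_
    have h₀ : ((b :: L).get (0 : Fin (L.length + 1)) = a ∧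
        ¬ IsRepeated (b :: L) (0 : Fin (L.length + 1))) ↔ b = a ∧ b ∉ L := by
      rw [isRepeated_zero]; rfl
    have h₁ : ∀ k : Fin L.length, ((b :: L).get (k.succ : Fin (L.length + 1)) = a ∧
        ¬ IsRepeated (b :: L) (k.succ : Fin (L.length + 1))) ↔
          b ≠ a ∧ L.get k = a ∧ ¬ IsRepeated L k := by
      intro k
      rw [isRepeated_succ]
      change L.get k = a ∧ _ ↔ _
      constructor
      · rintro ⟨rfl, h⟩
        push Not at h
        exact ⟨h.1.symm, rfl, h.2⟩
      · rintro ⟨h, rfl, h'⟩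
        exact ⟨rfl, fun h'' => h''.elim (fun e => h e.symm) h'⟩
    simp only [h₀, h₁]
    by_cases hb : b = a
    · subst hb
      simp [List.count_eq_zero]
    · have := ih fun M => φ (b :: M)
      simp only [hb, false_and, if_false, zero_add, ne_eq, not_false_iff, true_and,
        List.count_cons_of_ne hb, List.erase_cons_tail (by simpa using hb : ¬ (b == a) = true)]
      exact this

open Classical in
/-- The boundary formula in terms of positions agrees with `faceSum`. -/
theorem sum_faceSign (L : List (Fin n)) (φ : List (Fin n) → ℤ) :
    ∑ k : Fin L.length, (if IsRepeated L k then faceSign L k * φ (L.eraseIdx k) else 0) =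
      faceSum L φ := by
  induction L generalizing φ with
  | nil => simp [faceSum]
  | cons a L ih =>
    refine (Fin.sum_univ_succ _).trans ?_
    rw [faceSum, add_assoc, ← sum_erase_unrepeated a L fun M => φ (a :: M),
      ← ih fun M => φ (a :: M), Finset.mul_sum, ← Finset.sum_add_distrib]
    congr 1
    · by_cases h : a ∈ L
      · rw [if_pos ((isRepeated_zero a L).2 h), faceSign_zero h, if_pos h]
        simp
      · rw [if_neg (fun h' => h ((isRepeated_zero a L).1 h')), if_neg h]
    · refine Finset.sum_congr rfl fun k _ => ?_
      by_cases hr : IsRepeated L k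
      · have hn : ¬ (L.get k = a ∧ ¬ IsRepeated L k) := fun h => h.2 hr
        rw [if_pos ((isRepeated_succ a L k).2 (Or.inr hr)), faceSign_succ hr,
          if_neg hn, if_pos hr, zero_add, mul_assoc]
        rfl
      · by_cases he : L.get k = a
        · rw [if_pos ((isRepeated_succ a L k).2 (Or.inl he)), faceSign_succ_of_eq he hr,
            if_pos ⟨he, hr⟩, if_neg hr, mul_zero, add_zero, one_mul]
          rfl
        · rw [if_neg (fun h => ((isRepeated_succ a L k).1 h).elim he hr),
            if_neg (fun h => he h.1), if_neg hr, mul_zero, add_zero]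

end FaceSign
end QuiltOp

namespace QuiltOp

/-! ## Eliminating consecutive repetitions -/

section Destutter

set_option linter.unusedSectionVars false

variable {α β γ : Type*} [DecidableEq α] [DecidableEq β] [DecidableEq γ]

theorem destutter_cons_of_head {a : α} {L M : List α}
    (h : L.destutter (· ≠ ·) = a :: M) : (a :: L).destutter (· ≠ ·) = a :: M := by
  cases L with
  | nil => simp at h
  | cons b L =>
    rw [List.destutter_cons'] at h
    rw [List.destutter_cons']
    have hb : b = a := by
      have : ∀ (L : List α) (b a : α) (M : List α), L.destutter' (· ≠ ·) b = a :: M → b = a := by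
        intro L
        induction L with
        | nil => intro b a M h; simp at h; exact h.1
        | cons c L ih =>
          intro b a M h
          rw [List.destutter'_cons] at h
          split_ifs at h with hc
          · simp at h; exact h.1
          · exact ih _ _ _ h
      exact this _ _ _ _ h
    subst hb
    rwa [List.destutter'_cons, if_neg (by simp)]

theorem destutter_cons_of_ne {a : α} {L : List α} (h : ∀ b ∈ L.head?, a ≠ b) :
    (a :: L).destutter (· ≠ ·) = a :: L.destutter (· ≠ ·) := by
  cases L with
  | nil => simp
  | cons b L =>
    rw [List.destutter_cons_cons, if_pos (h b (by simp)), List.destutter_cons']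

theorem head?_destutter (L : List α) : (L.destutter (· ≠ ·)).head? = L.head? := by
  induction L with
  | nil => rfl
  | cons a L ih =>
    cases L with
    | nil => rfl
    | cons b L =>
      by_cases h : a = b
      · subst h
        obtain ⟨M, hM⟩ : ∃ M, (a :: L).destutter (· ≠ ·) = a :: M := by
          simp only [List.head?_cons] at ih
          exact ⟨_, List.eq_cons_of_mem_head? ih⟩
        rw [destutter_cons_of_head hM]
        rfl
      · rw [destutter_cons_of_ne (by simpa using h)]
        rfl

/-- A list without consecutive repetitions takes at most one letter from each run of equal letters.
In this way the patterns `uv`, `uvu` and `uvuv` pass from an extension to its two constituents. -/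
theorem sublist_destutter {l L : List α} (hl : l.IsChain (· ≠ ·)) (h : l.Sublist L) :
    l.Sublist (L.destutter (· ≠ ·)) := by
  induction L generalizing l with
  | nil => simpa using h
  | cons a L ih =>
    by_cases hh : ∀ b ∈ L.head?, a ≠ b
    · rw [destutter_cons_of_ne hh]
      cases h with
      | cons _ h => exact (ih hl h).cons _
      | cons_cons _ h => exact (ih hl.tail h).cons_cons _
    · push Not at hh
      obtain ⟨b, hb, rfl⟩ := hh
      obtain ⟨M, hM⟩ : ∃ M, L.destutter (· ≠ ·) = a :: M := by
        rw [← head?_destutter] at hb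
        exact ⟨_, List.eq_cons_of_mem_head? hb⟩
      rw [destutter_cons_of_head hM]
      cases h with
      | cons _ h => exact hM ▸ ih hl h
      | @cons_cons l' _ _ h =>
        have := ih hl.tail h
        rw [hM] at this
        refine List.Sublist.cons_cons _ ?_
        simp only [List.tail_cons] at this
        cases l' with
        | nil => simp
        | cons c l' =>
          have hc : a ≠ c := by simpa using (List.isChain_cons_cons.1 hl).1
          cases this with
          | cons _ h => exact h
          | cons_cons _ h => exact absurd rfl hc

theorem isChain_ne_iff (L : List α) : L.IsChain (· ≠ ·) ↔ ∀ u, ¬ [u, u] <:+: L := by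
  induction L with
  | nil => simp
  | cons a L ih =>
    rw [List.isChain_cons, ih]
    constructor
    · rintro ⟨h₁, h₂⟩ u h
      rcases List.infix_cons_iff.1 h with h | h
      · rw [List.cons_prefix_cons] at h
        obtain ⟨rfl, t, rfl⟩ := h
        exact h₁ u (by simp) rfl
      · exact h₂ u h
    · intro h
      refine ⟨?_, fun u hu => h u (List.infix_cons hu)⟩
      rintro b hb rfl
      cases L with
      | nil => simp at hb
      | cons c L =>
        simp only [List.head?_cons, Option.mem_def, Option.some.injEq] at hb
        subst hb
        exact h c ⟨[], L, rfl⟩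

/-- The conditions on a list in the definition of words, except for surjectivity. -/
structure Reduced (L : List α) : Prop where
  chain : L.IsChain (· ≠ ·)
  noInterlacing : ∀ u v, u ≠ v → ¬ [u, v, u, v].Sublist L

theorem Reduced.tail {a : α} {L : List α} (h : Reduced (a :: L)) : Reduced L :=
  ⟨h.chain.tail, fun u v huv hs => h.noInterlacing u v huv (hs.cons _)⟩

theorem Word.reduced {n : ℕ} (W : Word n) : Reduced W.letters :=
  ⟨(isChain_ne_iff _).2 W.nondegenerate, W.no_interlacing⟩

theorem Word.ne_nil {n : ℕ} (W : Word n) (i : Fin n) : W.letters ≠ [] :=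
  List.ne_nil_of_mem (W.surjective i)

theorem Word.caesuras_add {n : ℕ} (W : Word n) : caesuras W.letters + n = W.letters.length := by
  have := caesuras_add_card W.letters
  rwa [Finset.eq_univ_of_forall (s := W.letters.toFinset)
    (fun u => List.mem_toFinset.2 (W.surjective u)), Finset.card_univ, Fintype.card_fin] at this

theorem Quilt.deg_eq {n : ℕ} (Q : Quilt n) : Q.deg = caesuras Q.word.letters := by
  have := Q.word.caesuras_add
  rw [Quilt.deg]
  omega

end Destutter

/-! ## Extensions of lists along a collapse of letters -/

section Collapse

set_option linter.unusedSectionVars false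

variable {α β γ : Type*} [DecidableEq α] [DecidableEq β] [DecidableEq γ]

/-- `p` collapses the image of `g` to `i` and is inverse to `f` off `i`. -/
structure Collapse (i : α) (p : γ → α) (f : α → γ) (g : β → γ) : Prop where
  out_left : ∀ v, v ≠ i → p (f v) = v
  out_right : ∀ w, p (g w) = i
  block : ∀ x, p x = i → ∃ w, g w = x
  sec : ∀ x, p x ≠ i → f (p x) = x
  inj : Function.Injective g

variable {i : α} {p : γ → α} {f : α → γ} {g : β → γ}

theorem Collapse.separated (hc : Collapse i p f g) : Separated i f g where
  left u v hu hv h := by rw [← hc.out_left u hu, ← hc.out_left v hv, h]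
  right := hc.inj
  ne v w hv h := hv (by rw [← hc.out_left v hv, h, hc.out_right])

theorem Collapse.eq_of_eq (hc : Collapse i p f g) {x y : γ} (h : p x = p y) (hx : p x ≠ i) :
    x = y := by
  rw [← hc.sec x hx, ← hc.sec y (h ▸ hx), h]

/-- The conditions in the definition of extensions of words. -/
structure ListExt (i : α) (p : γ → α) (g : β → γ) (V : List α) (W : List β) (X : List γ) :
    Prop where
  sub : (X.filter fun x => p x = i).destutter (· ≠ ·) = W.map g
  gap : ∀ (r s : β) (Y : List γ), Y ≠ [] → (∀ y ∈ Y, p y ≠ i) →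
    (g r :: (Y ++ [g s])) <:+: X → r = s
  quot : (X.map p).destutter (· ≠ ·) = V

theorem ExtRel.map_out (hc : Collapse i p f g) {V : List α} {W : List β} {X : List γ}
    (h : ExtRel i f g V W X) (hV : V.IsChain (· ≠ ·)) :
    (X.map p).destutter (· ≠ ·) = V := by
  induction h with
  | nil => rfl
  | @other v V W X hv _ ih =>
    have := ih hV.tail
    rw [List.map_cons, hc.out_left v hv, destutter_cons_of_ne, this]
    rw [← head?_destutter, this]
    exact (List.isChain_cons.1 hV).1
  | @step V w W X _ _ ih =>
    have := ih hV.tail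
    rw [List.map_cons, hc.out_right, destutter_cons_of_ne, this]
    rw [← head?_destutter, this]
    exact (List.isChain_cons.1 hV).1
  | next _ ih =>
    rw [List.map_cons, hc.out_right]
    exact destutter_cons_of_head (ih hV)

theorem ExtRel.filter_block (hc : Collapse i p f g) {V : List α} {W : List β} {X : List γ}
    (h : ExtRel i f g V W X) (hi : i ∈ V) (hW : W.IsChain (· ≠ ·)) :
    (X.filter fun x => p x = i).destutter (· ≠ ·) = W.map g := by
  induction h with
  | nil => simp at hi
  | @other v V W X hv _ ih =>
    rw [List.filter_cons_of_neg (by simpa [hc.out_left v hv] using hv)]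
    exact ih (by simpa [hv.symm] using hi) hW
  | @step V w W X h hX ih =>
    rw [List.filter_cons_of_pos (by simp [hc.out_right])]
    by_cases hi' : i ∈ V
    · have := ih hi' hW
      rw [List.map_cons] at this ⊢
      exact destutter_cons_of_head this
    · obtain rfl := h.resolve_left hi'
      have : X.filter (fun x => p x = i) = [] := by
        rw [hX.eq_map hi', List.filter_eq_nil_iff]
        intro x hx
        obtain ⟨v, hv, rfl⟩ := List.mem_map.1 hx
        have : v ≠ i := fun e => hi' (e ▸ hv)
        simpa [hc.out_left v this] using this
      rw [this]
      simp
  | @next V w W X hX ih =>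
    rw [List.filter_cons_of_pos (by simp [hc.out_right])]
    have := ih hi hW.tail
    rw [destutter_cons_of_ne, this]
    · rfl
    · rw [← head?_destutter, this]
      simp only [List.head?_map, Option.mem_map]
      rintro _ ⟨w', hw', rfl⟩
      exact fun e => (List.isChain_cons.1 hW).1 w' hw' (hc.inj e)

/-- The first block letter that is written is the current letter of `W`, whatever is written before
it. -/
theorem ExtRel.eq_of_prefix (hc : Collapse i p f g) {V : List α} {W : List β} {X : List γ}
    (h : ExtRel i f g V W X) {w : β} {W' : List β} (hW : W = w :: W') {Y : List γ} {s : β}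
    (hY : ∀ y ∈ Y, p y ≠ i) (hX : Y ++ [g s] <+: X) : s = w := by
  induction h generalizing Y with
  | nil => simp at hX
  | @other v V W X hv _ ih =>
    cases Y with
    | nil =>
      simp only [List.nil_append, List.cons_prefix_cons] at hX
      exact (hc.separated.ne v s hv hX.1.symm).elim
    | cons y Y =>
      simp only [List.cons_append, List.cons_prefix_cons] at hX
      exact ih hW (fun y hy => hY y (List.mem_cons_of_mem _ hy)) hX.2
  | step =>
    cases Y with
    | nil =>
      simp only [List.nil_append, List.cons_prefix_cons] at hX
      rw [List.cons_eq_cons] at hW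
      rw [← hW.1]
      exact hc.inj hX.1
    | cons y Y =>
      simp only [List.cons_append, List.cons_prefix_cons] at hX
      exact (hY y (by simp) (hX.1 ▸ hc.out_right _)).elim
  | next =>
    cases Y with
    | nil =>
      simp only [List.nil_append, List.cons_prefix_cons] at hX
      rw [List.cons_eq_cons] at hW
      rw [← hW.1]
      exact hc.inj hX.1
    | cons y Y =>
      simp only [List.cons_append, List.cons_prefix_cons] at hX
      exact (hY y (by simp) (hX.1 ▸ hc.out_right _)).elim

/-- The first letter of an extension. -/
theorem ExtRel.head? {V : List α} {W : List β} {X : List γ} (h : ExtRel i f g V W X) {v : α}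
    (hv : V.head? = some v) :
    if v = i then ∃ w, W.head? = some w ∧ X.head? = some (g w) else X.head? = some (f v) := by
  cases h with
  | nil => simp at hv
  | other hu =>
    simp only [List.head?_cons, Option.some.injEq] at hv
    subst hv
    simp [hu]
  | step => simp only [List.head?_cons, Option.some.injEq] at hv; simp [hv]
  | next => simp only [List.head?_cons, Option.some.injEq] at hv; simp [hv]

/-- An interruption of the block can only come from the constructor `step`, which keeps `w` as the
current letter. -/
theorem ExtRel.gap (hc : Collapse i p f g) {V : List α} {W : List β} {X : List γ}
    (h : ExtRel i f g V W X) {r s : β} {Y : List γ} (hY : ∀ y ∈ Y, p y ≠ i) (hY' : Y ≠ [])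
    (hX : (g r :: (Y ++ [g s])) <:+: X) : r = s := by
  induction h with
  | nil => simp at hX
  | @other v V W X hv _ ih =>
    rcases List.infix_cons_iff.1 hX with hX | hX
    · exact (hc.separated.ne v r hv (List.cons_prefix_cons.1 hX).1.symm).elim
    · exact ih hX
  | @step V w W X _ hX' ih =>
    rcases List.infix_cons_iff.1 hX with hX | hX
    · obtain ⟨h₁, h₂⟩ := List.cons_prefix_cons.1 hX
      rw [hX'.eq_of_prefix hc rfl hY h₂]
      exact hc.inj h₁
    · exact ih hX
  | @next V w W X hX' ih =>
    rcases List.infix_cons_iff.1 hX with hX | hX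
    · obtain ⟨h₁, h₂⟩ := List.cons_prefix_cons.1 hX
      have := hX'.head? (v := i) rfl
      rw [if_pos rfl] at this
      obtain ⟨w', -, hw'⟩ := this
      cases Y with
      | nil => exact absurd rfl hY'
      | cons y Y =>
        obtain ⟨t, rfl⟩ := h₂
        simp only [List.cons_append, List.head?_cons, Option.some.injEq] at hw'
        exact (hY y (by simp) (hw' ▸ hc.out_right _)).elim
    · exact ih hX

theorem ExtRel.listExt (hc : Collapse i p f g) {V : List α} {W : List β} {X : List γ}
    (h : ExtRel i f g V W X) (hi : i ∈ V) (hV : V.IsChain (· ≠ ·)) (hW : W.IsChain (· ≠ ·)) :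
    ListExt i p g V W X :=
  ⟨h.filter_block hc hi hW, fun _ _ _ h₁ h₂ h₃ => h.gap hc h₂ h₁ h₃, h.map_out hc hV⟩

/-- The list `X` is parsed from the left, and the letter after a block letter decides the
constructor: `next` if it also lies in the block, `step` otherwise. The condition on `W` is demanded
only if `i` occurs in `V`, since in the induction the block may already be finished. -/
theorem extRel_of_destutter (hc : Collapse i p f g) {X : List γ} (hX : X.IsChain (· ≠ ·))
    (hgap : ∀ (r s : β) (Y : List γ), Y ≠ [] → (∀ y ∈ Y, p y ≠ i) →
      (g r :: (Y ++ [g s])) <:+: X → r = s) {V : List α} {W : List β}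
    (hV : (X.map p).destutter (· ≠ ·) = V)
    (hW : i ∈ V → (X.filter fun x => p x = i).destutter (· ≠ ·) = W.map g) :
    ExtRel i f g V W X := by
  induction X generalizing V W with
  | nil =>
    simp only [List.map_nil, List.destutter_nil] at hV
    subst hV
    exact .nil W
  | cons x X ih =>
    have ih' := fun {V W} => @ih hX.tail
      (fun r s Y h₁ h₂ h₃ => hgap r s Y h₁ h₂ (List.infix_cons h₃)) V W
    have hhead := (List.isChain_cons.1 hX).1
    by_cases hx : p x = i
    · obtain ⟨w, rfl⟩ := hc.block x hx
      -- In the first case the visit to the block ends with this letter.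
      by_cases hh : ∀ b ∈ (X.map p).head?, i ≠ b
      · rw [List.map_cons, hc.out_right, destutter_cons_of_ne hh] at hV
        subst hV
        have hW := hW (by simp)
        rw [List.filter_cons_of_pos (by simp [hc.out_right])] at hW
        -- If the block is visited again, `hgap` says that the visit resumes with `w`; otherwise `W`
        -- is exhausted.
        by_cases hb : ∃ y ∈ X, p y = i
        · obtain ⟨Y, y, X', hY, hy, rfl⟩ : ∃ Y y X', (∀ y ∈ Y, p y ≠ i) ∧ p y = i ∧
              X = Y ++ y :: X' := by
            refine ⟨X.takeWhile (fun y => p y ≠ i), ?_⟩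
            have hne : X.dropWhile (fun y => p y ≠ i) ≠ [] := by
              rw [Ne, List.dropWhile_eq_nil_iff]
              push Not
              obtain ⟨y, hy, hy'⟩ := hb
              exact ⟨y, hy, by simp [hy']⟩
            obtain ⟨y, X', hyX⟩ := List.exists_cons_of_ne_nil hne
            refine ⟨y, X', fun y hy => by simpa using List.mem_takeWhile_imp hy, ?_, ?_⟩
            · have := List.head_dropWhile_not (fun y => decide (p y ≠ i)) hne
              simp only [hyX, List.head_cons] at this
              simpa using this
            · rw [← hyX, List.takeWhile_append_dropWhile]
          obtain ⟨s, rfl⟩ := hc.block y hy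
          have hY' : Y ≠ [] := by
            rintro rfl
            exact hh i (by simp [hy]) rfl
          obtain rfl : w = s := hgap w s Y hY' hY ⟨[], X', by simp⟩
          have hf : (Y ++ g w :: X').filter (fun x => p x = i) =
              g w :: X'.filter fun x => p x = i := by
            rw [List.filter_append, List.filter_eq_nil_iff.2 (by simpa using hY),
              List.filter_cons_of_pos (by simp [hc.out_right]), List.nil_append]
          obtain ⟨M, hM⟩ : ∃ M, (g w :: X'.filter fun x => p x = i).destutter (· ≠ ·) =
              g w :: M := by
            have := head?_destutter (g w :: X'.filter fun x => p x = i)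
            exact ⟨_, List.eq_cons_of_mem_head? this⟩
          rw [hf, destutter_cons_of_head hM] at hW
          obtain ⟨w', W', rfl⟩ : ∃ w' W', W = w' :: W' := by
            cases W with
            | nil => simp at hW
            | cons w' W' => exact ⟨w', W', rfl⟩
          have hw : g w = g w' := (List.cons_eq_cons.1 hW).1
          obtain rfl := hc.inj hw
          refine .step (Or.inl ?_) (ih' rfl fun _ => ?_)
          · rw [← hc.out_right w]
            have : p (g w) ∈ (Y ++ g w :: X').map p := List.mem_map.2 ⟨_, by simp, rfl⟩
            exact List.singleton_sublist.1 (sublist_destutter (List.isChain_singleton _)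
              (List.singleton_sublist.2 this))
          · rw [hf, hM, hW]
        · have hf : X.filter (fun x => p x = i) = [] := by
            rw [List.filter_eq_nil_iff]
            push Not at hb
            simpa using hb
          rw [hf] at hW
          have : W = [w] := by
            refine List.map_injective_iff.2 hc.inj ?_
            simpa using hW.symm
          subst this
          refine .step (Or.inr rfl) (ih' rfl fun h => ?_)
          have := (List.destutter_sublist _ _).subset h
          obtain ⟨y, hy, hy'⟩ := List.mem_map.1 this
          exact (hb ⟨y, hy, hy'⟩).elim
      · push Not at hh
        obtain ⟨b, hb, rfl⟩ := hh
        obtain ⟨V', hV'⟩ : ∃ M, (X.map p).destutter (· ≠ ·) = i :: M := by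
          rw [← head?_destutter] at hb
          exact ⟨_, List.eq_cons_of_mem_head? hb⟩
        rw [List.map_cons, hc.out_right, destutter_cons_of_head hV'] at hV
        subst hV
        have hW := hW (by simp)
        rw [List.filter_cons_of_pos (by simp [hc.out_right]), destutter_cons_of_ne] at hW
        · obtain ⟨w', W', rfl⟩ : ∃ w' W', W = w' :: W' := by
            cases W with
            | nil => simp at hW
            | cons w' W' => exact ⟨w', W', rfl⟩
          rw [List.map_cons, List.cons_eq_cons] at hW
          obtain rfl := hc.inj hW.1
          exact .next (ih' hV' fun _ => hW.2)
        · cases X with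
          | nil => simp at hb
          | cons y X =>
            simp only [List.map_cons, List.head?_cons, Option.mem_def, Option.some.injEq] at hb
            rw [List.filter_cons_of_pos (by simpa using hb)]
            exact hhead
    · rw [List.map_cons, destutter_cons_of_ne] at hV
      · have := hc.sec x hx
        rw [← hV]
        refine (congrArg (fun y => ExtRel i f g _ W (y :: X)) this).mp
          (.other hx (ih' rfl fun h => ?_))
        rw [← hW (by rw [← hV]; exact List.mem_cons_of_mem _ h),
          List.filter_cons_of_neg (by simpa using hx)]
      · simp only [List.head?_map, Option.mem_map]
        rintro _ ⟨y, hy, rfl⟩ e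
        exact hhead y hy (hc.eq_of_eq e hx)

theorem listExt_iff (hc : Collapse i p f g) {V : List α} {W : List β} {X : List γ} (hi : i ∈ V)
    (hV : V.IsChain (· ≠ ·)) (hW : W.IsChain (· ≠ ·)) (hX : X.IsChain (· ≠ ·)) :
    ListExt i p g V W X ↔ ExtRel i f g V W X :=
  ⟨fun h => extRel_of_destutter hc hX h.gap h.quot fun _ => h.sub, fun h => h.listExt hc hi hV hW⟩

/-- Extensions of reduced lists by reduced lists are reduced. -/
theorem ExtRel.isChain (hc : Collapse i p f g) {V : List α} {W : List β} {X : List γ}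
    (h : ExtRel i f g V W X) (hV : V.IsChain (· ≠ ·)) (hW : W.IsChain (· ≠ ·)) :
    X.IsChain (· ≠ ·) := by
  induction h with
  | nil => simp
  | @other v V W X hv hX ih =>
    refine List.isChain_cons.2 ⟨?_, ih hV.tail hW⟩
    rintro y hy rfl
    cases V with
    | nil => simp [hX.eq_nil_iff.2 rfl] at hy
    | cons u V =>
      have hu : v ≠ u := (List.isChain_cons_cons.1 hV).1
      have := hX.head? (v := u) rfl
      split_ifs at this with h
      · obtain ⟨w, -, hw⟩ := this
        rw [hy, Option.some.injEq] at hw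
        exact hc.separated.ne _ _ hv hw
      · rw [hy, Option.some.injEq] at this
        exact hu (hc.separated.left _ _ hv h this)
  | @step V w W X _ hX ih =>
    refine List.isChain_cons.2 ⟨?_, ih hV.tail hW⟩
    rintro y hy rfl
    cases V with
    | nil => simp [hX.eq_nil_iff.2 rfl] at hy
    | cons u V =>
      have hu : i ≠ u := (List.isChain_cons_cons.1 hV).1
      have := hX.head? (v := u) rfl
      rw [if_neg hu.symm, hy, Option.some.injEq] at this
      exact hc.separated.ne _ _ hu.symm this.symm
  | @next V w W X hX ih =>
    refine List.isChain_cons.2 ⟨?_, ih hV hW.tail⟩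
    rintro y hy rfl
    have := hX.head? (v := i) rfl
    rw [if_pos rfl] at this
    obtain ⟨w', hw', h⟩ := this
    rw [hy, Option.some.injEq] at h
    exact (List.isChain_cons.1 hW).1 _ hw' (hc.inj h)

theorem ExtRel.sublist_left (hc : Collapse i p f g) {V : List α} {W : List β} {X l : List γ}
    (h : ExtRel i f g V W X) (hV : V.IsChain (· ≠ ·)) (hl : l.Sublist X)
    (hl' : (l.map p).IsChain (· ≠ ·)) : (l.map p).Sublist V := by
  have := sublist_destutter hl' (hl.map p)
  rwa [h.map_out hc hV] at this

theorem ExtRel.sublist_right (hc : Collapse i p f g) {V : List α} {W l : List β} {X : List γ}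
    (h : ExtRel i f g V W X) (hi : i ∈ V) (hW : W.IsChain (· ≠ ·)) (hl : (l.map g).Sublist X)
    (hl' : l.IsChain (· ≠ ·)) : l.Sublist W := by
  have h₁ : (l.map g).IsChain (· ≠ ·) :=
    List.isChain_map_of_isChain g (fun a b hab e => hab (hc.inj e)) hl'
  have h₂ := hl.filter fun x => p x = i
  rw [List.filter_eq_self.2 (by simp [hc.out_right])] at h₂
  have := sublist_destutter h₁ h₂
  rw [h.filter_block hc hi hW] at this
  obtain ⟨l', h, e⟩ := List.sublist_map_iff.1 this
  rwa [List.map_injective_iff.2 hc.inj e]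

/-- An interlaced pair either lies inside the block and appears in `W`, or has different images
under `p` and appears in `V`. -/
theorem ExtRel.reduced (hc : Collapse i p f g) {V : List α} {W : List β} {X : List γ}
    (h : ExtRel i f g V W X) (hi : i ∈ V) (hV : Reduced V) (hW : Reduced W) : Reduced X := by
  refine ⟨h.isChain hc hV.chain hW.chain, fun x y hxy hs => ?_⟩
  by_cases he : p x = p y
  · have hx : p x = i := by
      by_contra hx
      exact hxy (hc.eq_of_eq he hx)
    obtain ⟨r, rfl⟩ := hc.block x hx
    obtain ⟨s, rfl⟩ := hc.block y (he ▸ hx)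
    have hrs : r ≠ s := fun e => hxy (e ▸ rfl)
    exact hW.noInterlacing r s hrs (h.sublist_right hc hi hW.chain (l := [r, s, r, s]) hs
      (by simp [hrs, hrs.symm]))
  · refine hV.noInterlacing _ _ he (h.sublist_left hc hV.chain hs ?_)
    simp [he, Ne.symm he]

end Collapse
end QuiltOp

namespace QuiltOp

/-! ## Signs of extensions -/

theorem listSign_map_succ (L : List ℕ) : listSign (L.map (· + 1)) = listSign L := by
  induction L with
  | nil => rfl
  | cons a L ih => simp [listSign, ih, List.countP_map, Function.comp_def]

theorem listSign_insert {a : ℕ} {L₁ L₂ : List ℕ} (h₁ : ∀ b ∈ L₁, a < b) (h₂ : ∀ b ∈ L₂, a < b) :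
    listSign (L₁ ++ a :: L₂) = (-1) ^ L₁.length * listSign (L₁ ++ L₂) := by
  induction L₁ with
  | nil =>
    have : L₂.countP (· < a) = 0 :=
      List.countP_eq_zero.2 fun b hb => by simpa using (h₂ b hb).le
    simp [listSign, this]
  | cons b L₁ ih =>
    simp only [List.cons_append, listSign, ih fun c hc => h₁ c (List.mem_cons_of_mem _ hc),
      List.countP_append, List.countP_cons, List.length_cons]
    rw [if_pos (by simpa using h₁ b (by simp))]
    ring

theorem listSign_mul_self (L : List ℕ) : listSign L * listSign L = 1 := by
  induction L with
  | nil => rfl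
  | cons a L ih =>
    rw [listSign, mul_mul_mul_comm, ih, ← mul_pow]
    simp

/-! ### The recursion computes the signs of extensions -/

section Interposed

set_option linter.unusedSectionVars false

variable {α β γ : Type*} [DecidableEq α] [DecidableEq β] [DecidableEq γ]

/-- The letters that follow caesuras. -/
def afterCaesuras : List α → List α
  | [] => []
  | a :: L => (if a ∈ L then L.take 1 else []) ++ afterCaesuras L

theorem length_afterCaesuras (L : List α) : (afterCaesuras L).length = caesuras L := by
  induction L with
  | nil => rfl
  | cons a L ih =>
    rw [afterCaesuras, caesuras, List.length_append, ih]
    split_ifs with h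
    · have := List.length_pos_of_mem h
      rw [List.length_take]
      omega
    · rfl

theorem mem_afterCaesuras {L : List α} (hL : L.IsChain (· ≠ ·)) {x : α}
    (h : x ∈ afterCaesuras L) : ∃ u, u ≠ x ∧ [u, x, u].Sublist L := by
  induction L with
  | nil => simp [afterCaesuras] at h
  | cons a L ih =>
    rw [afterCaesuras, List.mem_append] at h
    rcases h with h | h
    · split_ifs at h with ha
      · cases L with
        | nil => simp at ha
        | cons b L =>
          simp only [List.take_succ_cons, List.take_zero, List.mem_singleton] at h
          subst h
          have hab : a ≠ x := (List.isChain_cons_cons.1 hL).1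
          refine ⟨a, hab, List.Sublist.cons_cons _ (List.Sublist.cons_cons _ ?_)⟩
          simpa [hab] using ha
      · simp at h
    · obtain ⟨u, hu, hs⟩ := ih hL.tail h
      exact ⟨u, hu, hs.cons _⟩

theorem Reduced.head_notMem {a : α} {L : List α} (hL : Reduced (a :: L)) :
    a ∉ afterCaesuras (a :: L) := by
  intro h
  rw [afterCaesuras, List.mem_append] at h
  rcases h with h | h
  · split_ifs at h
    · cases L with
      | nil => simp at h
      | cons b L =>
        simp only [List.take_succ_cons, List.take_zero, List.mem_singleton] at h
        exact (List.isChain_cons_cons.1 hL.chain).1 h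
    · simp at h
  · obtain ⟨u, hu, hs⟩ := mem_afterCaesuras hL.tail.chain h
    exact hL.noInterlacing a u hu.symm (hs.cons_cons a)

theorem Reduced.head_notMem' {a : α} {L : List α} (hL : Reduced (a :: L)) :
    a ∉ afterCaesuras L :=
  fun h => hL.head_notMem (by rw [afterCaesuras]; exact List.mem_append_right _ h)

variable {i : α} {p : γ → α} {f : α → γ} {g : β → γ}

/-- The position of the first letter over `v`. -/
def posOver (p : γ → α) (X : List γ) (v : α) : ℕ := X.findIdx fun x => p x = v

theorem posOver_cons_self {x : γ} (X : List γ) : posOver p (x :: X) (p x) = 0 := by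
  simp [posOver, List.findIdx_cons]

theorem posOver_cons_of_ne {x : γ} {v : α} (h : p x ≠ v) (X : List γ) :
    posOver p (x :: X) v = posOver p X v + 1 := by
  simp [posOver, List.findIdx_cons, h]

/-- The sign of an extension of lists. -/
def listExtSign (i : α) (p : γ → α) (g : β → γ) (V : List α) (W : List β) (X : List γ) : ℤ :=
  listSign ((afterCaesuras V).map (posOver p X) ++
    if i ∈ V then (afterCaesuras W).map fun w => X.idxOf (g w) else [])

theorem map_posOver_cons {x : γ} {X : List γ} {L : List α} (h : p x ∉ L) :
    L.map (posOver p (x :: X)) = (L.map (posOver p X)).map (· + 1) := by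
  rw [List.map_map]
  exact List.map_congr_left fun v hv => posOver_cons_of_ne (fun e => h (by rwa [e])) _

theorem map_idxOf_cons {x : γ} {X : List γ} {L : List β} (h : ∀ w ∈ L, g w ≠ x) :
    (L.map fun w => (x :: X).idxOf (g w)) = (L.map fun w => X.idxOf (g w)).map (· + 1) := by
  rw [List.map_map]
  exact List.map_congr_left fun w hw => List.idxOf_cons_ne _ (h w hw).symm

/-- The two branches of `extSum` never produce the same list: after `step` the next letter lies
outside the block, because `V` has no consecutive repetitions, and after `next` it lies inside. -/
theorem ExtRel.not_extRel_step (hc : Collapse i p f g) {V : List α} {W W' : List β} {X : List γ}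
    (hV : (i :: V).IsChain (· ≠ ·)) (h : ExtRel i f g V W X) : ¬ ExtRel i f g (i :: V) W' X := by
  intro h'
  have := h'.head? (v := i) rfl
  rw [if_pos rfl] at this
  obtain ⟨w, -, hw⟩ := this
  cases V with
  | nil => simp [h.eq_nil_iff.2 rfl] at hw
  | cons v V =>
    have hv := (List.isChain_cons_cons.1 hV).1
    have := h.head? (v := v) rfl
    rw [if_neg hv.symm, hw, Option.some.injEq] at this
    exact hc.separated.ne v w hv.symm this.symm

theorem extSum_single_eq_zero {V : List α} {W : List β} {X : List γ}
    (h : ¬ ExtRel i f g V W X) : extSum i f g V W (fun Y => if Y = X then 1 else 0) = 0 := by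
  refine (extSum_congr fun Y hY => if_neg ?_).trans (extSum_zero V W)
  rintro rfl
  exact h hY

/-- Induction along the construction of `X`. A caesura at the front of `V` or `W` adds one
interposed vertex, namely the very next letter of `X`, which has the smallest position of all. If it
belongs to `V` it is also first in the list to be sorted; if it belongs to `W` it has to pass all
interposed vertices of `V`, which is the sign in `extSum`. -/
theorem extSum_single (hc : Collapse i p f g) {V : List α} {W : List β} {X : List γ}
    (h : ExtRel i f g V W X) (hV : Reduced V) (hW : Reduced W) :
    extSum i f g V W (fun Y => if Y = X then 1 else 0) = listExtSign i p g V W X := by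
  induction h with
  | nil W => simp [extSum_nil, listExtSign, afterCaesuras, listSign]
  | @other v V W X hv hX ih =>
    rw [extSum_other hv]
    simp only [List.cons.injEq, true_and]
    rw [ih hV.tail hW]
    have hpf := hc.out_left v hv
    have hmem : i ∈ v :: V ↔ i ∈ V := by simp [hv.symm]
    have e₁ : (afterCaesuras V).map (posOver p (f v :: X)) =
        ((afterCaesuras V).map (posOver p X)).map (· + 1) :=
      map_posOver_cons (by rw [hpf]; exact hV.head_notMem')
    have e₂ : (if i ∈ V then (afterCaesuras W).map fun w => (f v :: X).idxOf (g w) else []) =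
        (if i ∈ V then (afterCaesuras W).map fun w => X.idxOf (g w) else []).map (· + 1) := by
      split_ifs
      · exact map_idxOf_cons fun w _ => (hc.separated.ne v w hv).symm
      · rfl
    simp only [listExtSign, hmem, afterCaesuras]
    rw [List.map_append, List.append_assoc, e₁, e₂, ← List.map_append]
    by_cases hvV : v ∈ V
    · cases V with
      | nil => simp at hvV
      | cons u V =>
        have hvu : v ≠ u := (List.isChain_cons_cons.1 hV.chain).1
        rw [if_pos hvV, List.take_succ_cons, List.take_zero, List.map_singleton,
          List.singleton_append, posOver_cons_of_ne (by rwa [hpf])]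
        have hpu : posOver p X u = 0 := by
          have := hX.head? (v := u) rfl
          split_ifs at this with h
          · obtain ⟨w, -, hw⟩ := this
            rw [List.eq_cons_of_mem_head? hw, ← show p (g w) = u by rw [hc.out_right, h],
              posOver_cons_self]
          · rw [List.eq_cons_of_mem_head? this]
            nth_rw 2 [← hc.out_left u h]
            rw [posOver_cons_self]
        rw [hpu, ← List.nil_append ((0 + 1) :: _), listSign_insert (by simp)]
        · rw [List.length_nil, pow_zero, one_mul, List.nil_append, listSign_map_succ]
        · simp only [List.map_append, List.mem_append, List.mem_map]
          -- It remains to see that no other interposed vertex has position `0` in `X`: the first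
          -- letter of a reduced list is not interposed in it.
          have key : ∀ k : ℕ, k ≠ 0 → 0 + 1 < k + 1 := by omega
          rintro _ (⟨_, ⟨x, hx, rfl⟩, rfl⟩ | ⟨_, hx, rfl⟩)
          · refine key _ fun h0 => ?_
            have hxu : x ≠ u := fun e => hV.tail.head_notMem (e ▸ hx)
            have := hX.head? (v := u) rfl
            split_ifs at this with h
            · obtain ⟨w, -, hw⟩ := this
              rw [List.eq_cons_of_mem_head? hw,
                posOver_cons_of_ne (by rw [hc.out_right, ← h]; exact hxu.symm)] at h0
              omega
            · rw [List.eq_cons_of_mem_head? this,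
                posOver_cons_of_ne (by rw [hc.out_left u h]; exact hxu.symm)] at h0
              omega
          · refine key _ ?_
            rintro rfl
            split_ifs at hx with hi
            · obtain ⟨w, hw, h0⟩ := List.mem_map.1 hx
              have := hX.head? (v := u) rfl
              split_ifs at this with h
              · obtain ⟨w', hw', hw''⟩ := this
                have hne : w' ≠ w := by
                  rintro rfl
                  have hred := hW
                  rw [List.eq_cons_of_mem_head? hw'] at hred hw
                  exact hred.head_notMem hw
                rw [List.eq_cons_of_mem_head? hw'',
                  List.idxOf_cons_ne _ (fun e => hne (hc.inj e))] at h0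
                omega
              · rw [List.eq_cons_of_mem_head? this,
                  List.idxOf_cons_ne _ (hc.separated.ne u w h)] at h0
                omega
            · simp at hx
    · rw [if_neg hvV, List.map_nil, List.nil_append, listSign_map_succ]
  | @step V w W X hiW hX ih =>
    rw [extSum_block, if_pos hiW]
    simp only [List.cons.injEq, true_and]
    rw [ih hV.tail hW]
    have e₀ := extSum_single_eq_zero (hX.not_extRel_step hc hV.chain (W' := W))
    have hpg := hc.out_right w
    rw [e₀, mul_zero, add_zero]
    have e₁ : (afterCaesuras V).map (posOver p (g w :: X)) =
        ((afterCaesuras V).map (posOver p X)).map (· + 1) :=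
      map_posOver_cons (by rw [hpg]; exact hV.head_notMem')
    have e₂ : ((afterCaesuras (w :: W)).map fun w' => (g w :: X).idxOf (g w')) =
        ((afterCaesuras (w :: W)).map fun w' => X.idxOf (g w')).map (· + 1) :=
      map_idxOf_cons fun w' hw' e => hW.head_notMem (hc.inj e ▸ hw')
    simp only [listExtSign, List.mem_cons, true_or, if_true]
    rw [afterCaesuras.eq_2 i V, List.map_append, List.append_assoc, e₁, e₂, ← List.map_append]
    by_cases hiV : i ∈ V
    · cases V with
      | nil => simp at hiV
      | cons u V =>
        have hvu : i ≠ u := (List.isChain_cons_cons.1 hV.chain).1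
        have hXu := hX.head? (v := u) rfl
        rw [if_neg hvu.symm] at hXu
        rw [if_pos hiV, if_pos hiV, List.take_succ_cons, List.take_zero, List.map_singleton,
          List.singleton_append, posOver_cons_of_ne (by rwa [hpg])]
        have hpu : posOver p X u = 0 := by
          rw [List.eq_cons_of_mem_head? hXu]
          nth_rw 2 [← hc.out_left u hvu.symm]
          rw [posOver_cons_self]
        rw [hpu, ← List.nil_append ((0 + 1) :: _), listSign_insert (by simp)]
        · rw [List.length_nil, pow_zero, one_mul, List.nil_append, listSign_map_succ]
        · simp only [List.map_append, List.mem_append, List.mem_map]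
          have key : ∀ k : ℕ, k ≠ 0 → 0 + 1 < k + 1 := by omega
          rintro _ (⟨_, ⟨x, hx, rfl⟩, rfl⟩ | ⟨_, ⟨x, hx, rfl⟩, rfl⟩)
          · refine key _ fun h0 => ?_
            have hxu : x ≠ u := fun e => hV.tail.head_notMem (e ▸ hx)
            rw [List.eq_cons_of_mem_head? hXu,
              posOver_cons_of_ne (by rw [hc.out_left u hvu.symm]; exact hxu.symm)] at h0
            omega
          · refine key _ fun h0 => ?_
            rw [List.eq_cons_of_mem_head? hXu,
              List.idxOf_cons_ne _ (hc.separated.ne u x hvu.symm)] at h0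
            omega
    · obtain rfl := hiW.resolve_left hiV
      rw [if_neg hiV, if_neg hiV]
      have e₃ : afterCaesuras [w] = [] := by simp [afterCaesuras]
      rw [e₃, List.map_nil, List.map_nil, List.append_nil, List.nil_append,
        listSign_map_succ]
  | @next V w W X hX ih =>
    rw [extSum_block]
    simp only [List.cons.injEq, true_and]
    rw [ih hV hW.tail]
    have e₀ := extSum_single_eq_zero (W := w :: W)
      fun hY => hY.not_extRel_step hc hV.chain hX
    have hpg := hc.out_right w
    rw [e₀, ite_self, zero_add]
    have e₁ : (afterCaesuras (i :: V)).map (posOver p (g w :: X)) =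
        ((afterCaesuras (i :: V)).map (posOver p X)).map (· + 1) :=
      map_posOver_cons (by rw [hpg]; exact hV.head_notMem)
    have e₂ : ((afterCaesuras W).map fun w' => (g w :: X).idxOf (g w')) =
        ((afterCaesuras W).map fun w' => X.idxOf (g w')).map (· + 1) :=
      map_idxOf_cons fun w' hw' e => hW.head_notMem' (hc.inj e ▸ hw')
    simp only [listExtSign, List.mem_cons, true_or, if_true]
    rw [afterCaesuras.eq_2 w W, List.map_append, e₁, e₂]
    by_cases hwW : w ∈ W
    · cases W with
      | nil => simp at hwW
      | cons u W =>
        have hvu : w ≠ u := (List.isChain_cons_cons.1 hW.chain).1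
        have hXu := hX.head? (v := i) rfl
        rw [if_pos rfl] at hXu
        obtain ⟨u', hu', hXu⟩ := hXu
        obtain rfl : u = u' := by simpa using hu'
        rw [if_pos hwW, if_pos hwW, List.take_succ_cons, List.take_zero, List.map_singleton,
          List.singleton_append, one_mul, List.idxOf_cons_ne _ (fun e => hvu (hc.inj e)),
          List.eq_cons_of_mem_head? hXu, List.idxOf_cons_self, listSign_insert]
        · rw [← List.map_append, listSign_map_succ, List.length_map, List.length_map,
            length_afterCaesuras]
        · simp only [List.mem_map]
          have key : ∀ k : ℕ, k ≠ 0 → 0 + 1 < k + 1 := by omega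
          rintro _ ⟨_, ⟨x, hx, rfl⟩, rfl⟩
          refine key _ fun h0 => ?_
          have hxu : i ≠ x := fun e => hV.head_notMem (e ▸ hx)
          rw [posOver_cons_of_ne (by rwa [hc.out_right])] at h0
          omega
        · simp only [List.mem_map]
          have key : ∀ k : ℕ, k ≠ 0 → 0 + 1 < k + 1 := by omega
          rintro _ ⟨_, ⟨x, hx, rfl⟩, rfl⟩
          refine key _ fun h0 => ?_
          have hxu : u ≠ x := fun e => hW.tail.head_notMem (e ▸ hx)
          rw [List.idxOf_cons_ne _ (fun e => hxu (hc.inj e))] at h0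
          omega
    · rw [if_neg hwW, if_neg hwW, zero_mul, pow_zero, one_mul, List.map_nil, List.nil_append,
        ← List.map_append, listSign_map_succ]

theorem extSum_eq_sum {V : List α} {W : List β} (s : Finset (List γ))
    (hs : ∀ X, ExtRel i f g V W X → X ∈ s) (φ : List γ → ℤ) :
    extSum i f g V W φ = ∑ X ∈ s, extSum i f g V W (fun Y => if Y = X then 1 else 0) * φ X := by
  have : ∀ X ∈ s, extSum i f g V W (fun Y => if Y = X then 1 else 0) * φ X =
      extSum i f g V W fun Y => φ X * if Y = X then 1 else 0 := by
    intro X _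
    rw [extSum_mul, mul_comm]
  rw [Finset.sum_congr rfl this, ← extSum_sum]
  refine extSum_congr fun X hX => ?_
  rw [Finset.sum_eq_single X]
  · simp
  · intro Y _ hY
    simp [hY.symm]
  · exact fun h => absurd (hs X hX) h

end Interposed

/-! ### Interposed vertices and the definitions for words -/

section InterposedList

variable {n : ℕ}

theorem downOrder_cons (a : Fin n) (L : List (Fin n)) :
    downOrder (a :: L) = a :: (downOrder L).filter (· ≠ a) := by
  have : ∀ L : List (Fin n), (L ++ [a]).dedup = (L.dedup).filter (· ≠ a) ++ [a] := by
    intro L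
    induction L with
    | nil => simp
    | cons b L ih =>
      rw [List.cons_append]
      by_cases hb : b ∈ L
      · rw [List.dedup_cons_of_mem (by simp [hb]), ih, List.dedup_cons_of_mem hb]
      · by_cases hba : b = a
        · rw [List.dedup_cons_of_mem (by simp [hba]), ih, List.dedup_cons_of_notMem hb,
            List.filter_cons_of_neg (by simp [hba])]
        · rw [List.dedup_cons_of_notMem (by simp [hb, hba]), ih, List.dedup_cons_of_notMem hb,
            List.filter_cons_of_pos (by simp [hba]), List.cons_append]
  rw [downOrder, List.reverse_cons, this, List.reverse_append, List.reverse_singleton,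
    List.singleton_append, downOrder, List.filter_reverse]

theorem interposed_cons {a v : Fin n} {L : List (Fin n)} (hva : v ≠ a) :
    Interposed (a :: L) v ↔ (a ∈ L ∧ L.head? = some v) ∨ Interposed L v := by
  constructor
  · rintro ⟨u, W₁, W₂, h, hu⟩
    cases W₁ with
    | nil =>
      rw [List.nil_append, List.cons_eq_cons] at h
      obtain ⟨rfl, rfl⟩ := h
      exact Or.inl ⟨List.mem_cons_of_mem _ hu, rfl⟩
    | cons b W₁ =>
      rw [List.cons_append, List.cons_eq_cons] at h
      exact Or.inr ⟨u, W₁, W₂, h.2, hu⟩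
  · rintro (⟨ha, hv⟩ | ⟨u, W₁, W₂, rfl, hu⟩)
    · obtain ⟨W₂, rfl⟩ : ∃ W₂, L = v :: W₂ := ⟨_, List.eq_cons_of_mem_head? hv⟩
      exact ⟨a, [], W₂, rfl, by simpa [hva.symm] using ha⟩
    · exact ⟨u, a :: W₁, W₂, rfl, hu⟩

theorem Reduced.not_interposed_head {a : Fin n} {L : List (Fin n)} (h : Reduced (a :: L)) :
    ¬ Interposed (a :: L) a := by
  rintro ⟨u, W₁, W₂, e, hu⟩
  have hua : u ≠ a := by
    rintro rfl
    exact (isChain_ne_iff _).1 h.chain u ⟨W₁, W₂, by rw [e]; simp⟩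
  cases W₁ with
  | nil =>
    rw [List.nil_append, List.cons_eq_cons] at e
    exact hua e.1.symm
  | cons b W₁ =>
    rw [List.cons_append, List.cons_eq_cons] at e
    refine h.noInterlacing a u hua.symm (List.Sublist.cons_cons _ ?_)
    rw [e.2]
    refine List.sublist_append_of_sublist_right ?_
    simpa using hu

theorem mem_downOrder {L : List (Fin n)} {v : Fin n} : v ∈ downOrder L ↔ v ∈ L := by
  simp [downOrder]

theorem nodup_downOrder (L : List (Fin n)) : (downOrder L).Nodup := by
  simpa [downOrder] using List.nodup_dedup L.reverse

/-- If the head recurs, the next letter becomes interposed; it was not so before, being the first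
letter of a reduced list, and it precedes all others in order of first occurrence. If the head does
not recur, nothing changes. -/
theorem Reduced.interposedList {L : List (Fin n)} (h : Reduced L) :
    interposedList L = afterCaesuras L := by
  classical
  induction L with
  | nil => rfl
  | cons a L ih =>
    have ih := ih h.tail
    simp only [QuiltOp.interposedList] at ih ⊢
    rw [downOrder_cons, List.filter_cons_of_neg (by simpa using h.not_interposed_head),
      List.filter_filter, afterCaesuras, ← ih]
    by_cases haL : a ∈ L
    · cases L with
      | nil => simp at haL
      | cons b L =>
        have hab : a ≠ b := (List.isChain_cons_cons.1 h.chain).1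
        have hb := h.tail.not_interposed_head
        rw [if_pos haL, List.take_succ_cons, List.take_zero, List.singleton_append,
          downOrder_cons, List.filter_cons_of_pos, List.filter_cons_of_neg (by simpa using hb)]
        · congr 1
          refine List.filter_congr fun v hv => ?_
          have hvb : v ≠ b := by
            have := (List.mem_filter.1 hv).2
            simpa using this
          by_cases hva : v = a
          · subst hva
            have : ¬ Interposed (b :: L) v := fun hI =>
              h.not_interposed_head (by
                obtain ⟨u, W₁, W₂, e, hu⟩ := hI
                exact ⟨u, v :: W₁, W₂, by rw [e]; rfl, hu⟩)
            simp [this]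
          · simp [hva, interposed_cons hva, hvb.symm]
        · simp [hab.symm, interposed_cons hab.symm, haL]
    · rw [if_neg haL, List.nil_append]
      refine List.filter_congr fun v hv => ?_
      have hva : v ≠ a := fun e => haL (e ▸ mem_downOrder.1 hv)
      simp [hva, interposed_cons hva, haL]

theorem collapse_block {m n l : ℕ} (hl : l + 1 = m + n) (i : Fin m) (r : Fin n) :
    Collapse i (blockOut hl i) (blockSec hl i r) (blockIn hl i) where
  out_left v _ := blockOut_blockSec hl i r v
  out_right w := blockOut_blockIn hl i w
  block _ hx := (blockOut_eq_self_iff hl i _).1 hx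
  sec _ hx := blockSec_blockOut hl i r hx
  inj := blockIn_injective hl i

theorem extSign_eq {m n l : ℕ} (hl : l + 1 = m + n) (i : Fin m) {V : List (Fin m)}
    {W : List (Fin n)} (hV : Reduced V) (hW : Reduced W) (hi : i ∈ V) (X : List (Fin l)) :
    extSign hl i V W X = listExtSign i (blockOut hl i) (blockIn hl i) V W X := by
  rw [extSign, listExtSign, hV.interposedList, hW.interposedList, if_pos hi]
  rfl

theorem isWordExt_iff_listExt {m n l : ℕ} (hl : l + 1 = m + n) (i : Fin m) (V : List (Fin m))
    (W : List (Fin n)) (X : List (Fin l)) :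
    IsWordExt hl i V W X ↔ ListExt i (blockOut hl i) (blockIn hl i) V W X := by
  have hf : (X.filter fun x => ∃ j, blockIn hl i j = x) = X.filter fun x => blockOut hl i x = i :=
    List.filter_congr fun x _ => by simp [blockOut_eq_self_iff]
  have hY : ∀ y, (∀ j, blockIn hl i j ≠ y) ↔ blockOut hl i y ≠ i := by
    intro y
    rw [Ne, blockOut_eq_self_iff]
    push Not
    rfl
  constructor
  · intro h
    refine ⟨hf ▸ h.sub, fun r s Y h₁ h₂ => h.gap r s Y h₁ fun y hy => (hY y).2 (h₂ y hy), h.quot⟩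
  · intro h
    refine ⟨hf ▸ h.sub, fun r s Y h₁ h₂ => h.gap r s Y h₁ fun y hy => (hY y).1 (h₂ y hy), h.quot⟩

theorem isWordExt_iff {m n l : ℕ} (hl : l + 1 = m + n) (i : Fin m) (r : Fin n) (V : Word m)
    (W : Word n) {X : List (Fin l)} (hX : X.IsChain (· ≠ ·)) :
    IsWordExt hl i V.letters W.letters X ↔
      ExtRel i (blockSec hl i r) (blockIn hl i) V.letters W.letters X := by
  rw [isWordExt_iff_listExt]
  exact listExt_iff (collapse_block hl i r) (V.surjective i) V.reduced.chain W.reduced.chain hX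

end InterposedList
end QuiltOp

namespace QuiltOp

/-! ## Composition and boundary of quilts as functionals -/

section Closure

variable {m n l : ℕ}

/-- The root of a tree. -/
noncomputable def PTree.rootVertex (T : PTree n) : Fin n := T.exists_root.choose

theorem PTree.rootVertex_le (T : PTree n) (u : Fin n) : T.le T.rootVertex u :=
  T.exists_root.choose_spec u

theorem PTree.not_lt_iff {T : PTree n} {u v : Fin n} : ¬ T.lt v u ↔ (T.le v u → u = v) := by
  rw [PTree.lt, not_and, not_not]
  exact forall_congr' fun _ => eq_comm

/-- A pair of extensions is a quilt. -/
theorem exists_quilt_of_ext (hl : l + 1 = m + n) (i : Fin m) (P : Quilt m) (Q : Quilt n)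
    {X : List (Fin l)} {U : PTree l} (hX : ExtRel i (blockSec hl i Q.tree.rootVertex)
      (blockIn hl i) P.word.letters Q.word.letters X) (hU : PTree.IsExt hl i P.tree Q.tree U) :
    ∃ R : Quilt l, R.word.letters = X ∧ R.tree = U ∧ R.deg = P.deg + Q.deg := by
  have hc := collapse_block hl i Q.tree.rootVertex
  have hi := P.word.surjective i
  have hred := hX.reduced hc hi P.word.reduced Q.word.reduced
  have hPc := P.word.reduced.chain
  have hQc := Q.word.reduced.chain
  have hsurj : ∀ x, x ∈ X := by
    intro x
    by_cases hx : blockOut hl i x = i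
    · obtain ⟨w, rfl⟩ := hc.block x hx
      exact (hX.mem_right hc.separated w).2 ⟨hi, Q.word.surjective w⟩
    · rw [← hc.sec x hx]
      exact (hX.mem_left hc.separated hx).2 (P.word.surjective _)
  refine ⟨⟨⟨X, hsurj, (isChain_ne_iff X).1 hred.chain, hred.noInterlacing⟩, U, ?_, ?_⟩, rfl, rfl,
    ?_⟩
  · intro u v huv
    rw [PTree.not_lt_iff]
    intro hle
    by_contra hne
    by_cases he : blockOut hl i u = blockOut hl i v
    · have hu : blockOut hl i u = i := by
        by_contra h
        exact hne (hc.eq_of_eq he h)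
      obtain ⟨r, rfl⟩ := hc.block u hu
      obtain ⟨s, rfl⟩ := hc.block v (he ▸ hu)
      have hrs : r ≠ s := fun e => hne (e ▸ rfl)
      have h₁ := hX.sublist_right hc hi hQc (l := [r, s]) huv (by simp [hrs])
      have h₂ := (hU.isExtOrder Q.tree.rootVertex_le).le_sub s r
      exact hrs (PTree.not_lt_iff.1 (Q.vert r s h₁) (h₂.2 hle))
    · have h₁ := hX.sublist_left hc hPc huv (by simp [he])
      exact he (PTree.not_lt_iff.1 (P.vert _ _ h₁) (hU.le_out hle))
  · intro u v huv
    by_cases hne : v = u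
    · exact Or.inr hne
    refine Or.inl ?_
    by_cases he : blockOut hl i u = blockOut hl i v
    · have hu : blockOut hl i u = i := by
        by_contra h
        exact hne (hc.eq_of_eq he h).symm
      obtain ⟨r, rfl⟩ := hc.block u hu
      obtain ⟨s, rfl⟩ := hc.block v (he ▸ hu)
      have hrs : r ≠ s := fun e => hne (e ▸ rfl)
      have h₁ := hX.sublist_right hc hi hQc (l := [r, s, r]) huv (by simp [hrs, hrs.symm])
      exact (hU.left_sub s r).1 ((Q.horiz r s h₁).resolve_right hrs.symm)
    · have h₁ := hX.sublist_left hc hPc huv (by simp [he, Ne.symm he])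
      exact hU.left_quot _ _ ((P.horiz _ _ h₁).resolve_right (Ne.symm he))
  · have := hX.caesuras hc.separated
    rw [if_pos hi] at this
    rw [Quilt.deg_eq, Quilt.deg_eq, Quilt.deg_eq, ← Nat.cast_add, ← this]

theorem isFace_eraseIdx {L : List (Fin n)} {k : Fin L.length} (h : IsRepeated L k) :
    IsFace L (L.eraseIdx k) := by
  refine ⟨L.take k, L[k], L.drop (k + 1), ?_, List.eraseIdx_eq_take_drop_succ L k, ?_⟩
  · refine (List.take_append_drop k.1 L).symm.trans ?_
    rw [List.drop_eq_getElem_cons k.2]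
    rfl
  · obtain ⟨j, hj, e⟩ := h
    have e' : L[j] = L[k] := e
    rw [← e']
    exact List.mem_eraseIdx_iff_getElem.2 ⟨j, j.2, fun h => hj (Fin.ext h), rfl⟩

theorem IsFace.sublist {L M : List (Fin n)} (h : IsFace L M) : M.Sublist L := by
  obtain ⟨L₁, a, L₂, rfl, rfl, -⟩ := h
  exact List.Sublist.append (List.Sublist.refl _) (List.sublist_cons_self _ _)

/-- Deleting `a` could create `bb` only from `bab`. As `a` is repeated, a further `a` on either side
would then be interlaced with these two letters `b`. -/
theorem IsFace.reduced {L M : List (Fin n)} (h : IsFace L M) (hL : Reduced L) : Reduced M := by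
  refine ⟨?_, fun u v huv hs => hL.noInterlacing u v huv (hs.trans h.sublist)⟩
  obtain ⟨L₁, a, L₂, rfl, rfl, ha⟩ := h
  have hch := hL.chain
  rw [List.isChain_append] at hch ⊢
  obtain ⟨h₁, h₂, h₃⟩ := hch
  refine ⟨h₁, h₂.tail, ?_⟩
  rintro b hb c hc rfl
  obtain ⟨L₂, rfl⟩ : ∃ L, L₂ = b :: L := ⟨_, List.eq_cons_of_mem_head? hc⟩
  have hba : b ≠ a := h₃ b hb a (by simp)
  obtain ⟨L₁, rfl⟩ : ∃ L, L₁ = L ++ [b] := by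
    refine ⟨L₁.dropLast, (List.dropLast_append_getLast? b hb).symm⟩
  simp only [List.append_assoc, List.mem_append, List.mem_cons, List.not_mem_nil, or_false,
    hba.symm, false_or] at ha
  rcases ha with ha | ha
  · refine hL.noInterlacing a b hba.symm ?_
    have : [a].Sublist L₁ := List.singleton_sublist.2 ha
    simpa using this.append (show [b, a, b].Sublist ([b] ++ a :: b :: L₂) by simp)
  · refine hL.noInterlacing b a hba ?_
    have : [a].Sublist L₂ := List.singleton_sublist.2 ha
    have h' : [b, a, b, a].Sublist ([b] ++ a :: b :: L₂) := by simpa using ha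
    simpa using (List.nil_sublist L₁).append h'

/-- A face of the word of a quilt is the word of a quilt. -/
theorem exists_quilt_of_isFace (Q : Quilt n) {M : List (Fin n)} (h : IsFace Q.word.letters M) :
    ∃ R : Quilt n, R.word.letters = M ∧ R.tree = Q.tree ∧ R.deg + 1 = Q.deg := by
  have hred := h.reduced Q.word.reduced
  refine ⟨⟨⟨M, fun u => (h.mem_iff u).2 (Q.word.surjective u), (isChain_ne_iff M).1 hred.chain,
    hred.noInterlacing⟩, Q.tree, fun u v huv => Q.vert u v (huv.trans h.sublist),
    fun u v huv => Q.horiz u v (huv.trans h.sublist)⟩, rfl, rfl, ?_⟩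
  rw [Quilt.deg_eq, Quilt.deg_eq, ← h.caesuras]
  push_cast
  rfl

theorem GQuilt.ext' {d : ℤ} {P Q : GQuilt n d} (h : P.1.word.letters = Q.1.word.letters)
    (h' : P.1.tree = Q.1.tree) : P = Q :=
  Subtype.ext (Quilt.ext (Word.ext h) h')

end Closure

/-! ### Evaluation of functionals on quilts -/

section Pairing

variable {m n l : ℕ} {d e f : ℤ}

/-- The value at `x` of the linear functional whose value at a quilt `(W, T)` is `φ W T`. -/
noncomputable def pair (φ : List (Fin n) → PTree n → ℤ) (x : GQuilt n d →₀ ℤ) : ℤ :=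
  Finsupp.linearCombination ℤ (fun Q : GQuilt n d => φ Q.1.word.letters Q.1.tree) x

theorem pair_single (φ : List (Fin n) → PTree n → ℤ) (Q : GQuilt n d) (a : ℤ) :
    pair φ (Finsupp.single Q a) = a * φ Q.1.word.letters Q.1.tree := by
  simp [pair, Finsupp.linearCombination_single]

theorem pair_add (φ : List (Fin n) → PTree n → ℤ) (x y : GQuilt n d →₀ ℤ) :
    pair φ (x + y) = pair φ x + pair φ y := map_add _ _ _

theorem pair_zero (φ : List (Fin n) → PTree n → ℤ) : pair φ (0 : GQuilt n d →₀ ℤ) = 0 :=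
  map_zero _

theorem pair_smul (φ : List (Fin n) → PTree n → ℤ) (a : ℤ) (x : GQuilt n d →₀ ℤ) :
    pair φ (a • x) = a * pair φ x := map_smul _ _ _

theorem pair_units_smul (φ : List (Fin n) → PTree n → ℤ) (a : ℤˣ) (x : GQuilt n d →₀ ℤ) :
    pair φ (a • x) = a * pair φ x := by
  rw [Units.smul_def, pair_smul]

theorem pair_sum {κ : Type*} (φ : List (Fin n) → PTree n → ℤ) (s : Finset κ)
    (x : κ → GQuilt n d →₀ ℤ) : pair φ (∑ k ∈ s, x k) = ∑ k ∈ s, pair φ (x k) := map_sum _ _ _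

theorem pair_apply (φ : List (Fin n) → PTree n → ℤ) (x : GQuilt n d →₀ ℤ) :
    pair φ x = x.sum fun Q a => a * φ Q.1.word.letters Q.1.tree := rfl

theorem pair_congr {φ ψ : List (Fin n) → PTree n → ℤ}
    (h : ∀ Q : GQuilt n d, φ Q.1.word.letters Q.1.tree = ψ Q.1.word.letters Q.1.tree)
    (x : GQuilt n d →₀ ℤ) : pair φ x = pair ψ x := by
  rw [pair_apply, pair_apply]
  exact Finsupp.sum_congr fun Q _ => by rw [h]

theorem pair_fun_add (φ ψ : List (Fin n) → PTree n → ℤ) (x : GQuilt n d →₀ ℤ) :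
    pair (fun W T => φ W T + ψ W T) x = pair φ x + pair ψ x := by
  simp only [pair_apply, mul_add]
  exact Finsupp.sum_add

theorem pair_fun_mul (c : ℤ) (φ : List (Fin n) → PTree n → ℤ) (x : GQuilt n d →₀ ℤ) :
    pair (fun W T => c * φ W T) x = c * pair φ x := by
  simp only [pair_apply, mul_left_comm _ c]
  exact (Finsupp.mul_sum _ _).symm

/-- Linear functionals commute with the pairing. -/
theorem pair_swap {ι : Type*} (F : (ι → ℤ) → ℤ) (hadd : ∀ φ ψ, F (fun k => φ k + ψ k) = F φ + F ψ)
    (hmul : ∀ c φ, F (fun k => c * φ k) = c * F φ) (ψ : ι → List (Fin n) → PTree n → ℤ)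
    (x : GQuilt n d →₀ ℤ) : F (fun k => pair (ψ k) x) = pair (fun W T => F fun k => ψ k W T) x := by
  induction x using Finsupp.induction_linear with
  | zero => simpa [pair_zero] using hmul 0 fun _ => 0
  | add x y hx hy => simp only [pair_add, hadd, hx, hy]
  | single Q a => simp only [pair_single, hmul]

open Classical in
theorem pair_indicator (Q : GQuilt n d) (x : GQuilt n d →₀ ℤ) :
    pair (fun W T => if W = Q.1.word.letters ∧ T = Q.1.tree then 1 else 0) x = x Q := by
  induction x using Finsupp.induction_linear with
  | zero => simp [pair_zero]
  | add x y hx hy => rw [pair_add, hx, hy, Finsupp.add_apply]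
  | single R a =>
    rw [pair_single, Finsupp.single_apply]
    by_cases hRQ : R = Q
    · simp [hRQ]
    · have : ¬ (R.1.word.letters = Q.1.word.letters ∧ R.1.tree = Q.1.tree) :=
        fun h => hRQ (GQuilt.ext' h.1 h.2)
      simp [hRQ, this]

/-- Indicator functions recover the coefficients. Hence each identity in the operad may be proved
for an arbitrary test function, where the recursions on lists apply. -/
theorem pair_ext {x y : GQuilt n d →₀ ℤ} (h : ∀ φ, pair φ x = pair φ y) : x = y := by
  ext Q
  rw [← pair_indicator, ← pair_indicator, h]

theorem pair_act (φ : List (Fin n) → PTree n → ℤ) (σ : Equiv.Perm (Fin n))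
    (x : GQuilt n d →₀ ℤ) : pair φ (quiltOperad.act σ x) =
      pair (fun W T => φ (W.map σ.symm) (T.relabel σ)) x := by
  exact Finsupp.linearCombination_mapDomain _ _ _

open Classical in
-- Every face of the word of a quilt is again the word of a quilt, so each repeated letter
-- contributes exactly one summand, and the sum is the one of `sum_faceSign`.
theorem pair_bd (φ : List (Fin n) → PTree n → ℤ) (h : e + 1 = d) (x : GQuilt n d →₀ ℤ) :
    pair φ (quiltOperad.bd h x) = pair (fun W T => faceSum W fun M => φ M T) x := by
  have key : ∀ Q : GQuilt n d, pair φ (Quilt.bd e Q.1) =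
      faceSum Q.1.word.letters fun M => φ M Q.1.tree := by
    intro Q
    rw [Quilt.bd, pair_sum, ← sum_faceSign]
    refine Finset.sum_congr rfl fun k _ => ?_
    rw [pair_sum]
    by_cases hk : IsRepeated Q.1.word.letters k
    · obtain ⟨R, hR₁, hR₂, hR₃⟩ := exists_quilt_of_isFace Q.1 (isFace_eraseIdx hk)
      have hd : R.deg = e := by
        have := Q.2
        omega
      rw [Finset.sum_eq_single (⟨R, hd⟩ : GQuilt n e)]
      · rw [if_pos ⟨hk, hR₁, hR₂⟩, if_pos hk, pair_single, hR₁, hR₂]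
      · intro R' _ hne
        rw [if_neg, pair_zero]
        rintro ⟨-, h₁, h₂⟩
        exact hne (GQuilt.ext' (h₁.trans hR₁.symm) (h₂.trans hR₂.symm))
      · simp
    · simp [hk, pair_zero]
  change pair φ (x.sum fun Q a => a • Quilt.bd e Q.1) = _
  rw [Finsupp.sum, pair_sum, pair_apply, Finsupp.sum]
  simp only [pair_smul, key]

open Classical in
/-- The signed sum of the values of `φ` at the extensions of a pair of a list and a tree by
another one. -/
noncomputable def compSum (hl : l + 1 = m + n) (i : Fin m) (V : List (Fin m)) (S : PTree m)
    (W : List (Fin n)) (T : PTree n) (φ : List (Fin l) → PTree l → ℤ) : ℤ :=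
  ∑ U : PTree l, if PTree.IsExt hl i S T U then
    extSum i (blockSec hl i T.rootVertex) (blockIn hl i) V W fun X => φ X U else 0

/-- The representative of the block matters only at `i`, where the embedding of the outer labels is
never evaluated. -/
theorem compSum_congr_root (hl : l + 1 = m + n) (i : Fin m) (r r' : Fin n) (V : List (Fin m))
    (W : List (Fin n)) (φ : List (Fin l) → ℤ) :
    extSum i (blockSec hl i r) (blockIn hl i) V W φ =
      extSum i (blockSec hl i r') (blockIn hl i) V W φ := by
  refine extSum_congr_maps (fun v hv => ?_) (fun _ => rfl) V W φ
  rw [blockSec, blockSec, if_neg hv, if_neg hv]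

open Classical in
-- Every pair of extensions is a quilt of the right degree, so the sum over quilts splits into a sum
-- over trees and one over words. The coefficient of a word is its sign by `extSum_single`.
theorem pair_quiltComp (hl : l + 1 = m + n) (i : Fin m) (P : Quilt m) (Q : Quilt n)
    (hf : P.deg + Q.deg = f) (φ : List (Fin l) → PTree l → ℤ) :
    pair φ (Quilt.comp hl f i P Q) =
      compSum hl i P.word.letters P.tree Q.word.letters Q.tree φ := by
  have hi := P.word.surjective i
  have hc := collapse_block hl i Q.tree.rootVertex
  have key : ∀ U : PTree l, (if PTree.IsExt hl i P.tree Q.tree U then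
      extSum i (blockSec hl i Q.tree.rootVertex) (blockIn hl i) P.word.letters Q.word.letters
        (fun X => φ X U) else 0) = ∑ R : GQuilt l f, if R.1.tree = U then
          pair φ (if Quilt.IsExt hl i P Q R.1 then Finsupp.single R
            (extSign hl i P.word.letters Q.word.letters R.1.word.letters) else 0) else 0 := by
    intro U
    by_cases hU : PTree.IsExt hl i P.tree Q.tree U
    · rw [if_pos hU, ← Finset.sum_filter,
        extSum_eq_sum ((Finset.univ.filter fun R : GQuilt l f => R.1.tree = U).image
          fun R => R.1.word.letters), Finset.sum_image]
      · refine Finset.sum_congr rfl fun R hR => ?_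
        have hRU : R.1.tree = U := (Finset.mem_filter.1 hR).2
        have hiff : Quilt.IsExt hl i P Q R.1 ↔ ExtRel i (blockSec hl i Q.tree.rootVertex)
            (blockIn hl i) P.word.letters Q.word.letters R.1.word.letters := by
          rw [Quilt.IsExt, hRU, isWordExt_iff hl i Q.tree.rootVertex _ _ R.1.word.reduced.chain]
          exact and_iff_left hU
        by_cases hR : ExtRel i (blockSec hl i Q.tree.rootVertex)
            (blockIn hl i) P.word.letters Q.word.letters R.1.word.letters
        · rw [if_pos (hiff.2 hR), pair_single, extSum_single hc hR P.word.reduced Q.word.reduced,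
            extSign_eq hl i P.word.reduced Q.word.reduced hi, hRU]
        · rw [if_neg (fun h => hR (hiff.1 h)), pair_zero, extSum_single_eq_zero hR, zero_mul]
      · intro R hR R' hR' h
        exact GQuilt.ext' h ((Finset.mem_filter.1 hR).2.trans (Finset.mem_filter.1 hR').2.symm)
      · intro X hX
        obtain ⟨R, h₁, h₂, h₃⟩ := exists_quilt_of_ext hl i P Q hX hU
        exact Finset.mem_image.2 ⟨⟨R, h₃.trans hf⟩, by simp [h₂], h₁⟩
    · rw [if_neg hU]
      refine (Finset.sum_eq_zero fun R _ => ?_).symm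
      split_ifs with h₁ h₂
      · exact absurd (h₁ ▸ h₂.2) hU
      · exact pair_zero _
      · rfl
  rw [compSum, Finset.sum_congr rfl fun U _ => key U, Finset.sum_comm, Quilt.comp, pair_sum]
  refine Finset.sum_congr rfl fun R _ => ?_
  rw [Finset.sum_ite_eq, if_pos (Finset.mem_univ _)]

theorem pair_comp (hl : l + 1 = m + n) (hf : d + e = f) (i : Fin m) (x : GQuilt m d →₀ ℤ)
    (y : GQuilt n e →₀ ℤ) (φ : List (Fin l) → PTree l → ℤ) :
    pair φ (quiltOperad.comp hl hf i x y) =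
      pair (fun V S => pair (fun W T => compSum hl i V S W T φ) y) x := by
  change pair φ (x.sum fun P a => y.sum fun Q b => (a * b) • Quilt.comp hl f i P.1 Q.1) = _
  rw [Finsupp.sum, pair_sum, pair_apply, Finsupp.sum]
  refine Finset.sum_congr rfl fun P _ => ?_
  rw [Finsupp.sum, pair_sum, pair_apply, Finsupp.sum, Finset.mul_sum]
  refine Finset.sum_congr rfl fun Q _ => ?_
  rw [pair_smul, pair_quiltComp hl i P.1 Q.1 (by rw [P.2, Q.2, hf]), mul_assoc]

theorem compSum_add (hl : l + 1 = m + n) (i : Fin m) (V : List (Fin m)) (S : PTree m)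
    (W : List (Fin n)) (T : PTree n) (φ ψ : List (Fin l) → PTree l → ℤ) :
    compSum hl i V S W T (fun X U => φ X U + ψ X U) =
      compSum hl i V S W T φ + compSum hl i V S W T ψ := by
  rw [compSum, compSum, compSum, ← Finset.sum_add_distrib]
  refine Finset.sum_congr rfl fun U _ => ?_
  rw [extSum_add]
  split_ifs <;> simp

theorem compSum_mul (hl : l + 1 = m + n) (i : Fin m) (V : List (Fin m)) (S : PTree m)
    (W : List (Fin n)) (T : PTree n) (c : ℤ) (φ : List (Fin l) → PTree l → ℤ) :
    compSum hl i V S W T (fun X U => c * φ X U) = c * compSum hl i V S W T φ := by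
  rw [compSum, compSum, Finset.mul_sum]
  refine Finset.sum_congr rfl fun U _ => ?_
  rw [extSum_mul]
  split_ifs <;> simp

theorem compSum_pair {k : ℕ} {g : ℤ} (hl : l + 1 = m + n) (i : Fin m) (V : List (Fin m))
    (S : PTree m) (W : List (Fin n)) (T : PTree n)
    (ψ : List (Fin l) → PTree l → List (Fin k) → PTree k → ℤ) (z : GQuilt k g →₀ ℤ) :
    compSum hl i V S W T (fun X U => pair (ψ X U) z) =
      pair (fun Z R => compSum hl i V S W T fun X U => ψ X U Z R) z :=
  pair_swap (ι := List (Fin l) × PTree l) (fun φ => compSum hl i V S W T fun X U => φ (X, U))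
    (fun _ _ => compSum_add _ _ _ _ _ _ _ _) (fun _ _ => compSum_mul _ _ _ _ _ _ _ _)
    (fun k => ψ k.1 k.2) z

end Pairing
end QuiltOp

namespace QuiltOp

/-! ## The quilt operad is a dg-operad -/

section Operad

variable {m n k l l₁ l₂ : ℕ}

theorem sum_ite_exists {ι : Type*} [Fintype ι] {p : ι → Prop} [DecidablePred p]
    [Decidable (∃ x, p x)] (hp : ∀ x y, p x → p y → x = y) (c : ℤ) :
    ∑ x, (if p x then c else 0) = if ∃ x, p x then c else 0 := by
  by_cases h : ∃ x, p x
  · obtain ⟨x, hx⟩ := h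
    rw [if_pos ⟨x, hx⟩, Finset.sum_eq_single x, if_pos hx]
    · exact fun y _ hy => if_neg fun h => hy (hp _ _ h hx)
    · simp
  · rw [if_neg h]
    exact Finset.sum_eq_zero fun x _ => if_neg fun hx => h ⟨x, hx⟩

open Classical in
-- The final tree determines the intermediate one, so the sum over intermediate trees collapses to
-- an existence condition, and trees and words can be treated separately.
theorem compSum_compSum_left (h₁ : l₁ + 1 = m + n) (h₂ : l + 1 = l₁ + k) (i : Fin m) (j' : Fin l₁)
    (V : List (Fin m)) (S : PTree m) (W : List (Fin n)) (T : PTree n) (Z : List (Fin k))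
    (R : PTree k) (φ : List (Fin l) → PTree l → ℤ) :
    compSum h₁ i V S W T (fun Y Y' => compSum h₂ j' Y Y' Z R φ) =
      ∑ U : PTree l, if ∃ Y, PTree.IsExt h₁ i S T Y ∧ PTree.IsExt h₂ j' Y R U then
        extSum i (blockSec h₁ i T.rootVertex) (blockIn h₁ i) V W (fun Y =>
          extSum j' (blockSec h₂ j' R.rootVertex) (blockIn h₂ j') Y Z fun X => φ X U) else 0 := by
  have e : ∀ U : PTree l, ∑ Y : PTree l₁,
      (if PTree.IsExt h₁ i S T Y ∧ PTree.IsExt h₂ j' Y R U then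
        extSum i (blockSec h₁ i T.rootVertex) (blockIn h₁ i) V W (fun Y =>
          extSum j' (blockSec h₂ j' R.rootVertex) (blockIn h₂ j') Y Z fun X => φ X U) else 0) =
      if ∃ Y, PTree.IsExt h₁ i S T Y ∧ PTree.IsExt h₂ j' Y R U then
        extSum i (blockSec h₁ i T.rootVertex) (blockIn h₁ i) V W (fun Y =>
          extSum j' (blockSec h₂ j' R.rootVertex) (blockIn h₂ j') Y Z fun X => φ X U) else 0 :=
    fun U => sum_ite_exists (fun Y Y' h h' => by exact (h.2.quot_unique h'.2).1) _
  rw [← Finset.sum_congr rfl fun U _ => e U, Finset.sum_comm, compSum]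
  refine Finset.sum_congr rfl fun Y _ => ?_
  by_cases hY : PTree.IsExt h₁ i S T Y
  · simp only [hY, if_true, true_and, compSum]
    rw [extSum_sum]
    refine Finset.sum_congr rfl fun U _ => ?_
    split_ifs
    · rfl
    · exact extSum_zero _ _
  · simp [hY]

theorem compSum_seq (h₁ : l₁ + 1 = m + n) (h₂ : l + 1 = l₁ + k) (h₃ : l₂ + 1 = n + k)
    (h₄ : l + 1 = m + l₂) (i : Fin m) (j : Fin n) (P : Quilt m) (Q : Quilt n) (R : Quilt k)
    (φ : List (Fin l) → PTree l → ℤ) :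
    compSum h₁ i P.word.letters P.tree Q.word.letters Q.tree (fun Y Y' =>
      compSum h₂ (blockIn h₁ i j) Y Y' R.word.letters R.tree φ) =
    compSum h₃ j Q.word.letters Q.tree R.word.letters R.tree (fun Y Y' =>
      compSum h₄ i P.word.letters P.tree Y Y' φ) := by
  classical
  rw [compSum_compSum_left]
  have hi := P.word.surjective i
  set q := Q.tree.rootVertex
  set r := R.tree.rootVertex
  have e' : compSum h₃ j Q.word.letters Q.tree R.word.letters R.tree (fun Y Y' =>
      compSum h₄ i P.word.letters P.tree Y Y' φ) = ∑ U : PTree l, ∑ Y : PTree l₂,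
      (if PTree.IsExt h₃ j Q.tree R.tree Y ∧ PTree.IsExt h₄ i P.tree Y U then
        extSum j (blockSec h₃ j r) (blockIn h₃ j) Q.word.letters R.word.letters (fun Y =>
          extSum i (blockSec h₄ i (blockSec h₃ j r q)) (blockIn h₄ i) P.word.letters Y
            fun X => φ X U) else 0) := by
    rw [Finset.sum_comm, compSum]
    refine Finset.sum_congr rfl fun Y _ => ?_
    by_cases hY : PTree.IsExt h₃ j Q.tree R.tree Y
    · simp only [hY, if_true, true_and, compSum]
      rw [extSum_sum]
      refine Finset.sum_congr rfl fun U _ => ?_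
      split_ifs
      · exact extSum_congr fun X _ => compSum_congr_root _ _ _ _ _ _ _
      · exact extSum_zero _ _
    · simp [hY]
  rw [e']
  refine Finset.sum_congr rfl fun U _ => ?_
  rw [sum_ite_exists (fun Y Y' h h' => by exact (h.2.quot_unique h'.2).2)]
  simp only [PTree.isExt_seq h₁ h₂ h₃ h₄]
  split_ifs
  · exact extSum_seq (separated_block h₁ i q) (separated_block h₃ j r)
      (fun v _ => blockSec_blockSec h₁ h₂ h₃ h₄ i j r q v)
      (fun w _ => blockSec_blockIn h₁ h₂ h₃ h₄ i j r w)
      (fun z => blockIn_blockIn h₁ h₂ h₃ h₄ i j z) hi _ (R.word.ne_nil r) _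
  · rfl

theorem compSum_par (h₁ : l₁ + 1 = m + n) (h₂ : l + 1 = l₁ + k) (h₃ : l₂ + 1 = m + k)
    (h₄ : l + 1 = l₂ + n) {i j : Fin m} (hij : i ≠ j) {i' : Fin l₂} {j' : Fin l₁}
    (hj : blockOut h₁ i j' = j) (hi : blockOut h₃ j i' = i) (P : Quilt m) (Q : Quilt n)
    (R : Quilt k) (φ : List (Fin l) → PTree l → ℤ) :
    compSum h₁ i P.word.letters P.tree Q.word.letters Q.tree (fun Y Y' =>
      compSum h₂ j' Y Y' R.word.letters R.tree φ) =
    (-1) ^ (caesuras Q.word.letters * caesuras R.word.letters) *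
      compSum h₃ j P.word.letters P.tree R.word.letters R.tree (fun Y Y' =>
        compSum h₄ i' Y Y' Q.word.letters Q.tree φ) := by
  classical
  rw [compSum_compSum_left, compSum_compSum_left, Finset.mul_sum]
  refine Finset.sum_congr rfl fun U _ => ?_
  have hiff := Iff.intro (PTree.isExt_par h₁ h₂ h₃ h₄ hij hj hi P.tree Q.tree R.tree U)
    (PTree.isExt_par h₃ h₄ h₁ h₂ hij.symm hi hj P.tree R.tree Q.tree U)
  simp only [hiff, mul_ite, mul_zero]
  set q := Q.tree.rootVertex
  set r := R.tree.rootVertex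
  obtain rfl : blockSec h₁ i q j = j' := by
    rw [← hj, blockSec_blockOut]
    rw [hj]
    exact hij.symm
  obtain rfl : blockSec h₃ j r i = i' := by
    rw [← hi, blockSec_blockOut]
    rw [hi]
    exact hij
  split_ifs
  · have := extSum_par hij (separated_block h₁ i q) (separated_block h₃ j r)
      (fun v _ _ => blockSec_par h₁ h₂ h₃ h₄ hij r q v)
      (fun w => blockSec_par_in h₁ h₂ h₃ h₄ hij r q w)
      (fun z => blockSec_par_in h₃ h₄ h₁ h₂ hij.symm q r z) P.word.letters
      (Q.word.ne_nil q) (R.word.ne_nil r) (fun X => φ X U)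
    rwa [if_pos ⟨P.word.surjective i, P.word.surjective j⟩] at this
  · rfl

theorem compSum_relabel (hl : l + 1 = m + n) (i : Fin m) (σ : Equiv.Perm (Fin m))
    (τ : Equiv.Perm (Fin n)) (ρ : Equiv.Perm (Fin l))
    (hρ : ∀ j, ρ (blockIn hl i j) = blockIn hl (σ i) (τ j))
    (hρ' : ∀ k, blockOut hl (σ i) (ρ k) = σ (blockOut hl i k)) (V : List (Fin m)) (S : PTree m)
    (W : List (Fin n)) (T : PTree n) (φ : List (Fin l) → PTree l → ℤ) :
    compSum hl i (V.map σ.symm) (S.relabel σ) (W.map τ.symm) (T.relabel τ) φ =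
      compSum hl (σ i) V S W T fun X U => φ (X.map ρ.symm) (U.relabel ρ) := by
  classical
  let e : PTree l ≃ PTree l :=
    { toFun := PTree.relabel ρ
      invFun := PTree.relabel ρ.symm
      left_inv := fun U => by
        rw [PTree.relabel_relabel]
        have : ρ * ρ.symm = 1 := mul_inv_cancel ρ
        rw [this, PTree.relabel_one]
      right_inv := fun U => by
        rw [PTree.relabel_relabel]
        have : ρ.symm * ρ = 1 := inv_mul_cancel ρ
        rw [this, PTree.relabel_one] }
  rw [compSum, compSum, ← Equiv.sum_comp e]
  refine Finset.sum_congr rfl fun U _ => ?_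
  have hiff : PTree.IsExt hl i (S.relabel σ) (T.relabel τ) (e U) ↔ PTree.IsExt hl (σ i) S T U :=
    PTree.isExt_relabel hl i σ τ ρ hρ hρ' S T U
  rw [hiff]
  split_ifs
  · rw [extSum_map σ.symm.injective τ.symm.injective (σ i) (by simp)]
    refine Eq.trans ?_ (extSum_comp (⇑ρ.symm) V W fun X => φ X (e U)).symm
    refine extSum_congr_maps (fun v hv => ?_) (fun w => ?_) _ _ _
    · have := hρ' (blockSec hl i (T.relabel τ).rootVertex (σ.symm v))
      rw [blockOut_blockSec, Equiv.apply_symm_apply] at this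
      simp only [Function.comp_apply]
      rw [Equiv.eq_symm_apply]
      refine (blockSec_blockOut hl (σ i) T.rootVertex (by rwa [this])).symm.trans ?_
      rw [this]
    · simp only [Function.comp_apply]
      rw [Equiv.eq_symm_apply, hρ, Equiv.apply_symm_apply]
  · rfl

/-- The boundary does not affect trees, so for each extension of trees this is the derivation
property for lists. -/
theorem compSum_faceSum (hl : l + 1 = m + n) (i : Fin m) (P : Quilt m) (Q : Quilt n)
    (φ : List (Fin l) → PTree l → ℤ) :
    compSum hl i P.word.letters P.tree Q.word.letters Q.tree (fun X U =>
      faceSum X fun M => φ M U) =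
    faceSum P.word.letters (fun V => compSum hl i V P.tree Q.word.letters Q.tree φ) +
      (-1) ^ caesuras P.word.letters * faceSum Q.word.letters
        fun W => compSum hl i P.word.letters P.tree W Q.tree φ := by
  classical
  have key : ∀ (j : ℕ) (L : List (Fin j)) (F : PTree l → List (Fin j) → ℤ),
      faceSum L (fun M => ∑ U, F U M) = ∑ U, faceSum L (F U) := by
    intro j L F
    have h : ∀ s : Finset (PTree l), faceSum L (fun M => ∑ U ∈ s, F U M) =
        ∑ U ∈ s, faceSum L (F U) := by
      intro s
      induction s using Finset.induction_on with
      | empty => simp [faceSum_zero]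
      | insert a s ha ih => simp only [Finset.sum_insert ha, faceSum_add, ih]
    exact h _
  simp only [compSum, key]
  rw [Finset.mul_sum, ← Finset.sum_add_distrib]
  refine Finset.sum_congr rfl fun U _ => ?_
  split_ifs
  · exact extSum_faceSum (separated_block hl i _) (P.word.surjective i)
      (Q.word.ne_nil Q.tree.rootVertex) _
  · rw [faceSum_zero, faceSum_zero, mul_zero, add_zero]

/-- The functional `pair φ` on the groups of the quilt operad. -/
noncomputable def evalAt {d : ℤ} (φ : List (Fin n) → PTree n → ℤ) (x : quiltOperad.carrier n d) :
    ℤ := pair φ x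

section EvalAt

variable {d e f g : ℤ}

theorem evalAt_add (φ : List (Fin n) → PTree n → ℤ) (x y : quiltOperad.carrier n d) :
    evalAt φ (x + y) = evalAt φ x + evalAt φ y := pair_add φ x y

theorem evalAt_zero (φ : List (Fin n) → PTree n → ℤ) :
    evalAt φ (0 : quiltOperad.carrier n d) = 0 := pair_zero φ

theorem evalAt_units_smul (φ : List (Fin n) → PTree n → ℤ) (a : ℤˣ)
    (x : quiltOperad.carrier n d) : evalAt φ (a • x) = a * evalAt φ x := pair_units_smul φ a x

theorem evalAt_sum {κ : Type*} (φ : List (Fin n) → PTree n → ℤ) (s : Finset κ)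
    (x : κ → quiltOperad.carrier n d) : evalAt φ (∑ k ∈ s, x k) = ∑ k ∈ s, evalAt φ (x k) :=
  pair_sum φ s x

theorem evalAt_congr {φ ψ : List (Fin n) → PTree n → ℤ}
    (h : ∀ Q : GQuilt n d, φ Q.1.word.letters Q.1.tree = ψ Q.1.word.letters Q.1.tree)
    (x : quiltOperad.carrier n d) : evalAt φ x = evalAt ψ x := pair_congr h x

theorem evalAt_fun_add (φ ψ : List (Fin n) → PTree n → ℤ) (x : quiltOperad.carrier n d) :
    evalAt (fun W T => φ W T + ψ W T) x = evalAt φ x + evalAt ψ x := pair_fun_add φ ψ x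

theorem evalAt_fun_mul (c : ℤ) (φ : List (Fin n) → PTree n → ℤ) (x : quiltOperad.carrier n d) :
    evalAt (fun W T => c * φ W T) x = c * evalAt φ x := pair_fun_mul c φ x

theorem evalAt_swap {ι : Type*} (F : (ι → ℤ) → ℤ)
    (hadd : ∀ φ ψ, F (fun k => φ k + ψ k) = F φ + F ψ)
    (hmul : ∀ c φ, F (fun k => c * φ k) = c * F φ) (ψ : ι → List (Fin n) → PTree n → ℤ)
    (x : quiltOperad.carrier n d) :
    F (fun k => evalAt (ψ k) x) = evalAt (fun W T => F fun k => ψ k W T) x :=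
  pair_swap F hadd hmul ψ x

open Classical in
theorem evalAt_ext_indicator {x y : quiltOperad.carrier n d} (h : ∀ Q : GQuilt n d,
    evalAt (fun W T => if W = Q.1.word.letters ∧ T = Q.1.tree then 1 else 0) x =
      evalAt (fun W T => if W = Q.1.word.letters ∧ T = Q.1.tree then 1 else 0) y) : x = y := by
  refine Finsupp.ext (M := ℤ) fun Q => ?_
  refine (pair_indicator Q x).symm.trans (Eq.trans ?_ (pair_indicator Q y))
  have := h Q
  unfold evalAt at this
  convert this

theorem evalAt_ext {x y : quiltOperad.carrier n d} (h : ∀ φ, evalAt φ x = evalAt φ y) : x = y :=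
  pair_ext h

theorem evalAt_act (φ : List (Fin n) → PTree n → ℤ) (σ : Equiv.Perm (Fin n))
    (x : quiltOperad.carrier n d) : evalAt φ (quiltOperad.act σ x) =
      evalAt (fun W T => φ (W.map σ.symm) (T.relabel σ)) x := pair_act φ σ x

theorem evalAt_bd (φ : List (Fin n) → PTree n → ℤ) (h : e + 1 = d)
    (x : quiltOperad.carrier n d) : evalAt φ (quiltOperad.bd h x) =
      evalAt (fun W T => faceSum W fun M => φ M T) x := pair_bd φ h x

theorem evalAt_comp (hl : l + 1 = m + n) (hf : d + e = f) (i : Fin m)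
    (x : quiltOperad.carrier m d) (y : quiltOperad.carrier n e)
    (φ : List (Fin l) → PTree l → ℤ) : evalAt φ (quiltOperad.comp hl hf i x y) =
      evalAt (fun V S => evalAt (fun W T => compSum hl i V S W T φ) y) x :=
  pair_comp hl hf i x y φ

theorem evalAt_one (φ : List (Fin 1) → PTree 1 → ℤ) :
    evalAt φ quiltOperad.one = φ [0] PTree.unit := (pair_single φ _ 1).trans (one_mul _)

theorem compSum_evalAt (hl : l + 1 = m + n) (i : Fin m) (V : List (Fin m))
    (S : PTree m) (W : List (Fin n)) (T : PTree n)
    (ψ : List (Fin l) → PTree l → List (Fin k) → PTree k → ℤ) (z : quiltOperad.carrier k g) :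
    compSum hl i V S W T (fun X U => evalAt (ψ X U) z) =
      evalAt (fun Z R => compSum hl i V S W T fun X U => ψ X U Z R) z :=
  compSum_pair hl i V S W T ψ z

theorem evalAt_faceSum (L : List (Fin m)) (ψ : List (Fin m) → List (Fin n) → PTree n → ℤ)
    (x : quiltOperad.carrier n d) :
    faceSum L (fun M => evalAt (ψ M) x) = evalAt (fun W T => faceSum L fun M => ψ M W T) x :=
  evalAt_swap (faceSum L) (faceSum_add L) (faceSum_mul L) ψ x

end EvalAt

theorem negOnePow_natCast (a : ℕ) : ((a : ℤ).negOnePow : ℤ) = (-1) ^ a := by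
  rw [Int.coe_negOnePow_natCast]

/-- Each axiom is tested against an arbitrary functional and reduced to single quilts. Signs in
terms of degrees become signs in terms of caesuras through `Quilt.deg_eq`. -/
theorem quiltOperad_isDGOperad : IsDGOperad quiltOperad where
  act_add σ x y := Finsupp.mapDomain_add
  act_one x := evalAt_ext fun φ => by
    rw [evalAt_act]
    exact evalAt_congr (fun Q => by rw [PTree.relabel_one]; simp [Equiv.Perm.one_def]) x
  act_mul σ τ x := evalAt_ext fun φ => by
    rw [evalAt_act, evalAt_act, evalAt_act]
    refine evalAt_congr (fun Q => ?_) x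
    rw [PTree.relabel_relabel, List.map_map]
    rfl
  comp_add_left hl hf i x x' y := evalAt_ext fun φ => by
    rw [evalAt_add, evalAt_comp, evalAt_comp, evalAt_comp, evalAt_add]
  comp_add_right hl hf i x y y' := evalAt_ext fun φ => by
    rw [evalAt_add, evalAt_comp, evalAt_comp, evalAt_comp, ← evalAt_fun_add]
    exact evalAt_congr (fun Q => evalAt_add _ _ _) x
  one_comp hl hf i x := evalAt_ext fun φ => by
    classical
    rw [evalAt_comp, evalAt_one]
    refine evalAt_congr (fun Q => ?_) x
    simp only [compSum, PTree.isExt_unit_left]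
    rw [Finset.sum_ite_eq' , if_pos (Finset.mem_univ _), Subsingleton.elim (0 : Fin 1) i,
      extSum_unit_left _ (Q.1.word.ne_nil Q.1.tree.rootVertex)]
    congr 1
    refine (List.map_congr_left fun a _ => ?_).trans (List.map_id _)
    exact Fin.ext (by simp [blockIn])
  comp_one hl hf i x := evalAt_ext fun φ => by
    classical
    rw [evalAt_comp]
    refine evalAt_congr (fun Q => ?_) x
    rw [evalAt_one]
    simp only [compSum, PTree.isExt_unit_right]
    rw [Finset.sum_ite_eq', if_pos (Finset.mem_univ _), extSum_unit_right _ _ _ id, List.map_id]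
    · intro v _
      apply Fin.ext
      rw [blockSec_val]
      have := v.2
      simp only [Fin.val_eq_zero, add_zero, id]
      split_ifs <;> omega
    · exact Fin.ext (by simp [blockIn])
  comp_seq h₁ h₂ h₃ h₄ g₁ g₂ g₃ g₄ i j x y z := evalAt_ext fun φ => by
    rw [evalAt_comp, evalAt_comp, evalAt_comp]
    refine evalAt_congr (fun P => ?_) x
    rw [evalAt_comp]
    refine evalAt_congr (fun Q => ?_) y
    rw [compSum_evalAt]
    exact evalAt_congr (fun R => compSum_seq h₁ h₂ h₃ h₄ i j P.1 Q.1 R.1 φ) z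
  comp_par {m n k l₁ l₂ l d e g f₁ f₂ f} h₁ h₂ h₃ h₄ g₁ g₂ g₃ g₄ i j i' j' hij hj hi x y z :=
      evalAt_ext fun φ => by
    rw [evalAt_comp, evalAt_comp]
    refine Eq.trans ?_ (evalAt_units_smul φ _ _).symm
    rw [evalAt_comp, evalAt_comp, ← evalAt_fun_mul]
    refine evalAt_congr (fun P => ?_) x
    simp only [compSum_evalAt]
    -- On the right hand side `z` is inserted before `y`; the two evaluations are interchanged so
    -- that the sides can be compared term by term.
    have hswap := evalAt_swap (ι := List (Fin k) × PTree k) (d := e) (fun ψ =>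
      evalAt (fun Z R => ψ (Z, R)) z) (fun _ _ => evalAt_fun_add _ _ z) (fun _ _ => evalAt_fun_mul _ _ z)
      (fun ZR W T => compSum h₃ j P.1.word.letters P.1.tree ZR.1 ZR.2 fun Y Y' =>
        compSum h₄ i' Y Y' W T φ) y
    rw [hswap, ← evalAt_fun_mul]
    refine evalAt_congr (fun Q => ?_) y
    rw [← evalAt_fun_mul]
    refine evalAt_congr (fun R => ?_) z
    have hsign : ((e * g).negOnePow : ℤ) =
        (-1) ^ (caesuras Q.1.word.letters * caesuras R.1.word.letters) := by
      rw [← negOnePow_natCast, Nat.cast_mul, ← Quilt.deg_eq, ← Quilt.deg_eq, Q.2, R.2]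
    rw [compSum_par h₁ h₂ h₃ h₄ hij hj hi, hsign]
  comp_act hl hf i σ τ ρ hρ hρ' x y := evalAt_ext fun φ => by
    rw [evalAt_comp, evalAt_act, evalAt_act, evalAt_comp]
    refine evalAt_congr (fun P => ?_) x
    rw [evalAt_act]
    exact evalAt_congr (fun Q => compSum_relabel hl i σ τ ρ hρ hρ' _ _ _ _ φ) y
  bd_add h x y := evalAt_ext fun φ => by
    rw [evalAt_add, evalAt_bd, evalAt_bd, evalAt_bd, evalAt_add]
  bd_bd h h' x := evalAt_ext fun φ => by
    rw [evalAt_bd, evalAt_bd]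
    -- The zero functional is written as a multiple, so that `evalAt_fun_mul` evaluates it.
    refine Eq.trans (evalAt_congr (ψ := fun _ _ => 0 * 0) (fun Q => ?_) x) ?_
    · exact faceSum_faceSum _ _
    · rw [evalAt_fun_mul, zero_mul]
      exact (evalAt_zero φ).symm
  bd_act h σ x := evalAt_ext fun φ => by
    rw [evalAt_bd, evalAt_act, evalAt_act, evalAt_bd]
    exact evalAt_congr (fun Q => faceSum_map _ _ (fun _ _ _ _ e => σ.symm.injective e) _) x
  bd_comp {m n l d e f d' e' f'} hl hf hd' he' hf' h₁ h₂ i x y := evalAt_ext fun φ => by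
    rw [evalAt_bd, evalAt_comp, evalAt_add]
    refine Eq.trans ?_ (congrArg₂ (· + ·) rfl (evalAt_units_smul φ _ _).symm)
    rw [evalAt_comp, evalAt_comp, evalAt_bd, ← evalAt_fun_mul, ← evalAt_fun_add]
    refine evalAt_congr (fun P => ?_) x
    rw [evalAt_faceSum, evalAt_bd, ← evalAt_fun_mul, ← evalAt_fun_add]
    refine evalAt_congr (fun Q => ?_) y
    have hsign : (d.negOnePow : ℤ) = (-1) ^ caesuras P.1.word.letters := by
      rw [← negOnePow_natCast, ← Quilt.deg_eq, P.2]
    rw [compSum_faceSum, hsign]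

end Operad
end QuiltOp

namespace QuiltOp

/-! ## The universal property of `L∞` -/

section Universal

variable {P : DGOperadData}

/-- The value of a formal expression. -/
def LTerm.eval (P : DGOperadData) (ℓ : ∀ n : ℕ, 2 ≤ n → P.carrier n ((n : ℤ) - 2)) :
    ∀ {n : ℕ} {d : ℤ}, LTerm n d → P.carrier n d
  | _, _, .gen n hn => ℓ n hn
  | _, _, .one => P.one
  | _, _, .zero => 0
  | _, _, .add s t => LTerm.eval P ℓ s + LTerm.eval P ℓ t
  | _, _, .neg t => -LTerm.eval P ℓ t
  | _, _, .act σ t => P.act σ (LTerm.eval P ℓ t)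
  | _, _, .comp hl hf i s t => P.comp hl hf i (LTerm.eval P ℓ s) (LTerm.eval P ℓ t)
  | _, _, .bd h t => P.bd h (LTerm.eval P ℓ t)

variable {ℓ : ∀ n : ℕ, 2 ≤ n → P.carrier n ((n : ℤ) - 2)}

theorem LTerm.eval_signed {n : ℕ} {d : ℤ} (s : ℤˣ) (t : LTerm n d) :
    LTerm.eval P ℓ (LTerm.signed s t) = s • LTerm.eval P ℓ t := by
  rcases Int.units_eq_one_or s with rfl | rfl
  · rw [LTerm.signed, if_pos rfl, one_smul]
  · rw [LTerm.signed, if_neg (by decide), LTerm.eval, Units.neg_smul, one_smul]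

theorem LTerm.eval_sum {n : ℕ} {d : ℤ} (L : List (LTerm n d)) :
    LTerm.eval P ℓ (LTerm.sum L) = (L.map (LTerm.eval P ℓ)).sum := by
  induction L with
  | nil => rfl
  | cons t L ih =>
    rw [List.map_cons, List.sum_cons, ← ih]
    rfl

theorem LTerm.eval_defect (n : ℕ) (hn : 2 ≤ n) :
    LTerm.eval P ℓ (LTerm.defect n hn) = linfDefect P ℓ n hn := by
  rw [LTerm.defect, LTerm.eval, linfDefect]
  congr 1
  rw [LTerm.eval_sum, List.map_map, ← Finset.sum_map_toList]
  refine congrArg List.sum (List.map_congr_left fun x _ => ?_)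
  rw [Function.comp_apply, LTerm.eval_sum, List.map_map, ← Finset.sum_map_toList]
  refine congrArg List.sum (List.map_congr_left fun σ _ => ?_)
  rw [Function.comp_apply, LTerm.eval_signed]
  rfl

/-- Besides the laws of a congruence and of abelian groups, the generating relations are the operad
axioms and the two assumptions on the generators, and each holds for the values. -/
theorem LRel.eval_eq (hP : IsDGOperad P)
    (hact : ∀ (n : ℕ) (hn : 2 ≤ n) (σ : Equiv.Perm (Fin n)),
      P.act σ (ℓ n hn) = Equiv.Perm.sign σ • ℓ n hn)
    (hdef : ∀ (n : ℕ) (hn : 2 ≤ n), linfDefect P ℓ n hn = 0) {n : ℕ} {d : ℤ} {s t : LTerm n d}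
    (h : LRel s t) : LTerm.eval P ℓ s = LTerm.eval P ℓ t := by
  induction h with
  | refl => rfl
  | symm _ ih => exact ih.symm
  | trans _ _ ih ih' => exact ih.trans ih'
  | add_congr _ _ ih ih' => simp only [LTerm.eval, ih, ih']
  | neg_congr _ ih => simp only [LTerm.eval, ih]
  | act_congr _ _ ih => simp only [LTerm.eval, ih]
  | comp_congr _ _ _ _ _ ih ih' => simp only [LTerm.eval, ih, ih']
  | bd_congr _ _ ih => simp only [LTerm.eval, ih]
  | add_assoc => exact _root_.add_assoc _ _ _
  | add_comm => exact _root_.add_comm _ _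
  | zero_add => exact _root_.zero_add _
  | neg_add => exact _root_.neg_add_cancel _
  | act_add => exact hP.act_add _ _ _
  | act_one => exact hP.act_one _
  | act_mul => exact hP.act_mul _ _ _
  | comp_add_left => exact hP.comp_add_left _ _ _ _ _ _
  | comp_add_right => exact hP.comp_add_right _ _ _ _ _ _
  | one_comp => exact hP.one_comp _ _ _ _
  | comp_one => exact hP.comp_one _ _ _ _
  | comp_seq h₁ h₂ h₃ h₄ g₁ g₂ g₃ g₄ => exact hP.comp_seq h₁ h₂ h₃ h₄ g₁ g₂ g₃ g₄ _ _ _ _ _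
  | comp_par h₁ h₂ h₃ h₄ g₁ g₂ g₃ g₄ i j i' j' hij hj hi =>
    rw [LTerm.eval_signed]
    exact hP.comp_par h₁ h₂ h₃ h₄ g₁ g₂ g₃ g₄ i j i' j' hij hj hi _ _ _
  | comp_act hl hf i σ τ ρ hρ hρ' => exact hP.comp_act hl hf i σ τ ρ hρ hρ' _ _
  | bd_add => exact hP.bd_add _ _ _
  | bd_bd => exact hP.bd_bd _ _ _
  | bd_act => exact hP.bd_act _ _ _
  | bd_comp hl hf hd' he' hf' h₁ h₂ i s t =>
    rw [LTerm.eval.eq_4 P ℓ, LTerm.eval_signed]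
    exact hP.bd_comp hl hf hd' he' hf' h₁ h₂ i _ _
  | gen_act n hn σ =>
    rw [LTerm.eval_signed]
    exact hact n hn σ
  | gen_defect n hn =>
    rw [LTerm.eval_defect]
    exact hdef n hn

/-- Evaluation of formal expressions descends to the quotient. A homomorphism commutes with all
operations from which expressions are built, so by induction it is determined by its values on
generators. -/
theorem existsUnique_hom (hP : IsDGOperad P)
    (hact : ∀ (n : ℕ) (hn : 2 ≤ n) (σ : Equiv.Perm (Fin n)),
      P.act σ (ℓ n hn) = Equiv.Perm.sign σ • ℓ n hn)
    (hdef : ∀ (n : ℕ) (hn : 2 ≤ n), linfDefect P ℓ n hn = 0) :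
    ∃! K : DGOperadHom linf P, ∀ (n : ℕ) (hn : 2 ≤ n),
      K.toFun n ((n : ℤ) - 2) (ell n hn) = ℓ n hn := by
  let F : ∀ (n : ℕ) (d : ℤ), LGroup n d →+ P.carrier n d := fun n d =>
    { toFun := Quotient.lift (LTerm.eval P ℓ) fun _ _ h => LRel.eval_eq hP hact hdef h
      map_zero' := rfl
      map_add' := by rintro ⟨s⟩ ⟨t⟩; rfl }
  refine ⟨{ toFun := F
            map_one := rfl
            map_act := by rintro n d σ ⟨t⟩; rfl
            map_comp := by rintro m n l d e f hl hf i ⟨s⟩ ⟨t⟩; rfl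
            map_bd := by rintro n d e h ⟨t⟩; rfl }, fun n hn => rfl, ?_⟩
  intro K hK
  have key : ∀ {n : ℕ} {d : ℤ} (t : LTerm n d),
      K.toFun n d (LGroup.mk t) = LTerm.eval P ℓ t := by
    intro n d t
    induction t with
    | gen n hn => exact hK n hn
    | one => exact K.map_one
    | zero => exact map_zero (K.toFun _ _)
    | add s t ih ih' =>
      exact (map_add (K.toFun _ _) (LGroup.mk s) (LGroup.mk t)).trans (congrArg₂ (· + ·) ih ih')
    | neg t ih => exact (map_neg (K.toFun _ _) (LGroup.mk t)).trans (congrArg Neg.neg ih)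
    | act σ t ih => exact (K.map_act σ (LGroup.mk t)).trans (congrArg _ ih)
    | comp hl hf i s t ih ih' =>
      exact (K.map_comp hl hf i (LGroup.mk s) (LGroup.mk t)).trans (congrArg₂ _ ih ih')
    | bd h t ih => exact (K.map_bd h (LGroup.mk t)).trans (congrArg _ ih)
  have : K.toFun = F := by
    funext n d
    ext ⟨t⟩
    exact key t
  cases K
  simp only at this
  subst this
  rfl

end Universal

/-! ## Signs of lists and permutations -/

section Signs

variable {n : ℕ}

/-- The product over pairs is the form in which the sign can be compared with the sign of a
permutation. -/
theorem listSign_map_finRange (f : Fin n → ℕ) :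
    listSign ((List.finRange n).map f) = ∏ u, ∏ v ∈ Finset.Ioi u, if f v < f u then -1 else 1 := by
  have key : ∀ L : List (Fin n), L.Pairwise (· < ·) → listSign (L.map f) =
      ∏ u ∈ L.toFinset, ∏ v ∈ L.toFinset with u < v, if f v < f u then -1 else 1 := by
    intro L hL
    induction L with
    | nil => rfl
    | cons a L ih =>
      rw [List.pairwise_cons] at hL
      have ha : a ∉ L.toFinset := fun h => (hL.1 a (List.mem_toFinset.1 h)).false
      have hnd : L.Nodup := hL.2.imp ne_of_lt
      rw [List.map_cons, listSign, ih hL.2, List.toFinset_cons, Finset.prod_insert ha]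
      congr 1
      · have : (insert a L.toFinset).filter (fun v => a < v) = L.toFinset := by
          ext v
          simp only [Finset.mem_filter, Finset.mem_insert, List.mem_toFinset]
          constructor
          · rintro ⟨rfl | h, h'⟩
            · exact absurd h' (lt_irrefl _)
            · exact h
          · exact fun h => ⟨Or.inr h, hL.1 v h⟩
        rw [this, Finset.prod_ite, Finset.prod_const_one, mul_one, Finset.prod_const,
          List.countP_map, List.countP_eq_length_filter]
        congr 1
        rw [← List.toFinset_card_of_nodup (hnd.filter _), List.toFinset_filter]
        simp
      · refine Finset.prod_congr rfl fun u hu => ?_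
        congr 1
        ext v
        simp only [Finset.mem_filter, Finset.mem_insert]
        constructor
        · exact fun h => ⟨Or.inr h.1, h.2⟩
        · rintro ⟨rfl | h, h'⟩
          · exact absurd h' (hL.1 u (List.mem_toFinset.1 hu)).asymm
          · exact ⟨h, h'⟩
  rw [key _ (List.sortedLT_finRange n).pairwise]
  simp only [List.toFinset_finRange]
  refine Finset.prod_congr rfl fun u _ => ?_
  congr 1
  ext v
  simp

theorem listSign_map_perm (f : Fin n → ℕ) (hf : Function.Injective f) (σ : Equiv.Perm (Fin n)) :
    listSign ((List.finRange n).map fun u => f (σ u)) =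
      Equiv.Perm.sign σ * listSign ((List.finRange n).map f) := by
  -- The value `0` on ties makes `F` antisymmetric without exception, as the product formula for
  -- signs requires; ties never occur in the products considered.
  let F : Fin n → Fin n → ℤ := fun u v => if f v < f u then -1 else if f u < f v then 1 else 0
  have hF : ∀ (τ : Equiv.Perm (Fin n)) (u : Fin n), ∀ v ∈ Finset.Ioi u,
      (if f (τ v) < f (τ u) then -1 else 1) = F (τ u) (τ v) := by
    intro τ u v hv
    have : f (τ u) ≠ f (τ v) := fun e => (Finset.mem_Ioi.1 hv).ne (τ.injective (hf e))
    simp only [F]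
    split_ifs <;> first | rfl | omega
  have h₁ := Equiv.Perm.prod_Ioi_comp_eq_sign_mul_prod (R := ℤ) σ (f := F) fun u v => by
    simp only [F]
    split_ifs <;> first | rfl | omega
  have h₂ : ∀ (u : Fin n), ∀ v ∈ Finset.Ioi u, (if f v < f u then -1 else 1) = F u v := hF 1
  rw [listSign_map_finRange, listSign_map_finRange,
    Finset.prod_congr rfl fun u _ => Finset.prod_congr rfl (hF σ u),
    Finset.prod_congr rfl fun u _ => Finset.prod_congr rfl (h₂ u)]
  simpa using h₁

theorem idxOf_map_symm (σ : Equiv.Perm (Fin n)) (L : List (Fin n)) (u : Fin n) :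
    (L.map σ.symm).idxOf u = L.idxOf (σ u) := by
  induction L with
  | nil => rfl
  | cons a L ih =>
    by_cases h : a = σ u
    · subst h
      simp
    · have h' : σ.symm a ≠ u := fun e => h (by rw [← e, Equiv.apply_symm_apply])
      rw [List.map_cons, List.idxOf_cons_ne _ h', List.idxOf_cons_ne _ h, ih]

theorem Quilt.sgnK_relabel (σ : Equiv.Perm (Fin n)) (Q : Quilt n) :
    (Q.relabel σ).sgnK = Equiv.Perm.sign σ * Q.sgnK := by
  have : ∀ u, (Q.relabel σ).word.letters.idxOf u = Q.word.letters.idxOf (σ u) :=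
    fun u => idxOf_map_symm σ _ u
  rw [Quilt.sgnK, Quilt.sgnK]
  simp only [this]
  rw [listSign_map_perm (fun u => Q.word.letters.idxOf u) (fun u v h =>
    (List.idxOf_inj (Q.word.surjective u)).1 h)]
  ring

theorem Quilt.relabel_relabel (σ τ : Equiv.Perm (Fin n)) (Q : Quilt n) :
    (Q.relabel σ).relabel τ = Q.relabel (σ * τ) := by
  refine Quilt.ext (Word.ext ?_) rfl
  simp only [Quilt.relabel, Word.relabel, List.map_map]
  rfl

theorem Quilt.relabel_one (Q : Quilt n) : Q.relabel 1 = Q := by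
  refine Quilt.ext (Word.ext ?_) rfl
  simp [Quilt.relabel, Word.relabel, Equiv.Perm.one_def]

/-- Relabelling as a permutation of the set of quilts. -/
def GQuilt.relabelEquiv {d : ℤ} (σ : Equiv.Perm (Fin n)) : GQuilt n d ≃ GQuilt n d where
  toFun := GQuilt.relabel σ
  invFun := GQuilt.relabel σ⁻¹
  left_inv Q := Subtype.ext (by
    simp only [GQuilt.relabel]
    rw [Quilt.relabel_relabel, mul_inv_cancel, Quilt.relabel_one])
  right_inv Q := Subtype.ext (by
    simp only [GQuilt.relabel]
    rw [Quilt.relabel_relabel, inv_mul_cancel, Quilt.relabel_one])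

theorem evalAt_L0 (φ : List (Fin n) → PTree n → ℤ) : evalAt φ (L0 n) =
    ∑ Q : GQuilt n ((n : ℤ) - 2), Q.1.sgnK * φ Q.1.word.letters Q.1.tree :=
  (pair_sum φ _ _).trans (Finset.sum_congr rfl fun Q _ => pair_single _ _ _)

/-- Relabelling is a bijection of the maximal quilts that multiplies `sgnK` by the sign of `σ`. -/
theorem L0_act (σ : Equiv.Perm (Fin n)) :
    quiltOperad.act σ (L0 n) = Equiv.Perm.sign σ • L0 n := by
  refine evalAt_ext fun φ => ?_
  rw [evalAt_act, evalAt_units_smul]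
  rw [evalAt_L0, evalAt_L0, Finset.mul_sum]
  refine Eq.trans ?_ (Equiv.sum_comp (GQuilt.relabelEquiv σ) _)
  refine Finset.sum_congr rfl fun Q _ => ?_
  have h₁ : (GQuilt.relabelEquiv σ Q).1 = Q.1.relabel σ := rfl
  rw [h₁, Quilt.sgnK_relabel, ← mul_assoc, ← mul_assoc, ← Units.val_mul, Int.units_mul_self,
    Units.val_one, one_mul]
  rfl

end Signs
end QuiltOp

namespace QuiltOp

/-! ## Cuts of reduced lists

A list without interlacing traverses a planar forest. A cut of the list is a place between two
consecutive letters, of which the first does not occur later and the second does not occur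
earlier. -/

section Cuts

set_option linter.unusedSectionVars false

variable {α : Type*} [DecidableEq α]

/-- The suffixes of `L` that follow the cuts of `P.reverse ++ L` inside `L`. -/
def cuts : List α → List α → List (List α)
  | _, [] => []
  | _, [_] => []
  | P, c :: b :: L =>
    (if c ∉ b :: L ∧ b ∉ c :: P then [b :: L] else []) ++ cuts (c :: P) (b :: L)

/-- The number of letters of `L` that have occurred before in `P` or in `L`. -/
def repeats : List α → List α → ℕ
  | _, [] => 0
  | P, b :: L => (if b ∈ P then 1 else 0) + repeats (b :: P) L

/-- The number of caesuras of `M ++ N` in `M`. -/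
def caesurasBefore : List α → List α → ℕ
  | [], _ => 0
  | a :: M, N => (if a ∈ M ++ N then 1 else 0) + caesurasBefore M N

theorem caesurasBefore_append (M M' N : List α) :
    caesurasBefore (M ++ M') N = caesurasBefore M (M' ++ N) + caesurasBefore M' N := by
  induction M with
  | nil => simp [caesurasBefore]
  | cons a M ih => simp [caesurasBefore, ih, add_assoc]

theorem mem_cuts {P L s : List α} : s ∈ cuts P L ↔ ∃ A c b B, L = A ++ c :: b :: B ∧
    c ∉ b :: B ∧ b ∉ P.reverse ++ (A ++ [c]) ∧ s = b :: B := by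
  induction L generalizing P with
  | nil => simp [cuts]
  | cons a L ih =>
    cases L with
    | nil =>
      simp only [cuts, List.not_mem_nil, false_iff]
      rintro ⟨A, c, b, B, h, -⟩
      have := congrArg List.length h
      simp at this
      omega
    | cons d L =>
      rw [cuts, List.mem_append, ih]
      constructor
      · rintro (h | ⟨A, c, b, B, h₁, h₂, h₃, h₄⟩)
        · split_ifs at h with hc
          · exact ⟨[], a, d, L, rfl, hc.1, by simpa [or_comm] using hc.2, by simpa using h⟩
          · simp at h
        · exact ⟨a :: A, c, b, B, by rw [h₁]; rfl, h₂, by simpa using h₃, h₄⟩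
      · rintro ⟨A, c, b, B, h₁, h₂, h₃, rfl⟩
        cases A with
        | nil =>
          simp only [List.nil_append, List.cons.injEq] at h₁
          obtain ⟨rfl, rfl, rfl⟩ := h₁
          refine Or.inl ?_
          rw [if_pos ⟨h₂, by simpa [or_comm] using h₃⟩]
          simp
        | cons a' A =>
          simp only [List.cons_append, List.cons.injEq] at h₁
          obtain ⟨rfl, h₁⟩ := h₁
          exact Or.inr ⟨A, c, b, B, h₁, h₂, by simpa using h₃, rfl⟩

/-- A caesura `c` directly followed by a repeated `b` would give the pattern `b c b c`. -/
theorem Reduced.not_both {P L : List α} {b c : α} (h : Reduced (P.reverse ++ c :: b :: L))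
    (hc : c ∈ b :: L) : b ∉ c :: P := by
  have hne : c ≠ b := by
    have := (List.isChain_append.1 h.chain).2.1
    exact (List.isChain_cons_cons.1 this).1
  intro hb
  have hb : b ∈ P := by simpa [hne.symm] using hb
  have hc : c ∈ L := by simpa [hne] using hc
  refine h.noInterlacing b c hne.symm ?_
  have h₁ : [b].Sublist P.reverse := by simpa using hb
  exact h₁.append (show [c, b, c].Sublist (c :: b :: L) by simpa using hc)

/-- Each pair of consecutive letters is of exactly one of three kinds: the first letter is a
caesura, the second is a repetition, or there is a cut between them. The first two exclude each
other by `Reduced.not_both`. -/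
theorem length_cuts {P L : List α} {c : α} (h : Reduced (P.reverse ++ c :: L)) :
    (cuts P (c :: L)).length + caesuras (c :: L) + repeats (c :: P) L = L.length := by
  induction L generalizing P c with
  | nil => simp [cuts, caesuras, repeats]
  | cons b L ih =>
    have ih := ih (P := c :: P) (c := b) (by simpa using h)
    rw [cuts, caesuras, repeats, List.length_append, List.length_cons, ← ih]
    by_cases hc : c ∈ b :: L
    · have hb := h.not_both hc
      simp only [hc, hb, not_true_eq_false, false_and, if_true, if_false, List.length_nil]
      omega
    · by_cases hb : b ∈ c :: P
      · simp only [hc, hb, not_true_eq_false, and_false, if_true, if_false, List.length_nil]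
        omega
      · simp only [hc, hb, not_false_eq_true, and_self, if_true, if_false, List.length_singleton]
        omega

theorem repeats_add_card (P L : List α) :
    repeats P L + (P ++ L).toFinset.card = P.toFinset.card + L.length := by
  induction L generalizing P with
  | nil => simp [repeats]
  | cons b L ih =>
    have ih := ih (b :: P)
    have : (b :: P ++ L).toFinset = (P ++ b :: L).toFinset := by
      ext x
      simp only [List.mem_toFinset, List.mem_append, List.mem_cons]
      tauto
    rw [this] at ih
    rw [repeats, List.length_cons]
    by_cases hb : b ∈ P
    · have : (b :: P).toFinset = P.toFinset := by simp [hb]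
      rw [this] at ih
      simp only [hb, if_true]
      omega
    · have : (b :: P).toFinset.card = P.toFinset.card + 1 := by simp [hb]
      rw [this] at ih
      simp only [hb, if_false]
      omega

/-- The number of cuts is one less than the number of distinct letters minus the number of
caesuras. -/
theorem Reduced.length_cuts {L : List α} (h : Reduced L) (hL : L ≠ []) :
    (cuts [] L).length + caesuras L + 1 = L.toFinset.card := by
  obtain ⟨c, L, rfl⟩ := List.exists_cons_of_ne_nil hL
  have h₁ := QuiltOp.length_cuts (P := []) h
  have h₂ := repeats_add_card [c] L
  have h₃ := caesuras_add_card (c :: L)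
  simp only [List.cons_append, List.nil_append, List.toFinset_cons, List.toFinset_nil,
    insert_empty_eq, Finset.card_singleton, List.length_cons] at h₁ h₂ h₃ ⊢
  omega

theorem caesura_or_repeat {P L : List α} {b c : α} (h : Reduced (P.reverse ++ c :: b :: L))
    (hcut : c ∉ b :: L → b ∈ P.reverse ++ ([] ++ [c])) :
    (if c ∈ b :: L then 1 else 0) + (if b ∈ c :: P then 1 else 0) = 1 := by
  by_cases hc : c ∈ b :: L
  · rw [if_pos hc, if_neg (h.not_both hc)]
  · have := hcut hc
    rw [if_neg hc, if_pos (by simpa [or_comm] using this)]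

/-- Where there are no cuts, every letter is a caesura or is followed by a repetition. -/
theorem caesurasBefore_add_repeats {P M N : List α} {c y : α}
    (h : Reduced (P.reverse ++ (c :: M ++ y :: N)))
    (hcut : ∀ A x b B, c :: M ++ y :: N = A ++ x :: b :: B → A.length ≤ M.length →
      x ∉ b :: B → b ∈ P.reverse ++ (A ++ [x])) :
    caesurasBefore (c :: M) (y :: N) + repeats (c :: P) (M ++ [y]) = M.length + 1 := by
  induction M generalizing P c with
  | nil =>
    have := caesura_or_repeat h (hcut [] c y N rfl (Nat.zero_le _))
    simp only [caesurasBefore, repeats, List.nil_append, List.length_nil] at this ⊢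
    omega
  | cons d M ih =>
    have ih := ih (P := c :: P) (c := d) (by simpa using h) (fun A x b B hA hlen hx => by
      have := hcut (c :: A) x b B (by rw [List.cons_append, hA]; rfl) (by simpa using hlen) hx
      simpa using this)
    have : (if c ∈ d :: (M ++ y :: N) then 1 else 0) + (if d ∈ c :: P then 1 else 0) = 1 :=
      caesura_or_repeat h (hcut [] c d (M ++ y :: N) rfl (Nat.zero_le _))
    have e : repeats (c :: P) (d :: M ++ [y]) =
        (if d ∈ c :: P then 1 else 0) + repeats (d :: c :: P) (M ++ [y]) := rfl
    rw [e, caesurasBefore, List.length_cons, ← ih]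
    simp only [List.cons_append] at this ⊢
    omega

/-- A reduced list without cuts is closed. -/
theorem Reduced.getLast_eq_head {a : α} {L : List α} (h : Reduced (a :: L))
    (hcut : cuts [] (a :: L) = []) : ∃ S, a :: L = S ++ [a] := by
  by_contra hne
  push Not at hne
  -- Consider the letter `z` after the last `a`. If it is new there is a cut before it; if it has
  -- occurred, then `a z a z` is a pattern of the list.
  obtain ⟨A, B, hAB, ha⟩ : ∃ A B, a :: L = A ++ a :: B ∧ a ∉ B := by
    obtain ⟨B, A, h₁, h₂⟩ := List.eq_append_cons_of_mem
      (List.mem_reverse.2 (List.mem_cons_self (a := a) (l := L)))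
    refine ⟨A.reverse, B.reverse, ?_, by simpa using h₂⟩
    rw [← List.reverse_reverse (a :: L), h₁]
    simp
  cases B with
  | nil => exact hne A hAB
  | cons z B =>
    have hz : z ∈ A := by
      by_contra hz
      have : z :: B ∈ cuts [] (a :: L) := by
        refine mem_cuts.2 ⟨A, a, z, B, hAB, ha, ?_, rfl⟩
        have : z ≠ a := fun e => ha (by simp [e])
        simpa [this] using hz
      rw [hcut] at this
      simp at this
    cases A with
    | nil => simp at hz
    | cons a' A =>
      simp only [List.cons_append, List.cons.injEq] at hAB
      obtain ⟨rfl, rfl⟩ := hAB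
      have hne : a ≠ z := fun e => ha (by simp [e])
      refine h.noInterlacing a z hne (List.Sublist.cons_cons _ ?_)
      have h₁ : [z].Sublist A := by simpa [hne.symm] using hz
      exact h₁.append (show [a, z].Sublist (a :: z :: B) by simp)

end Cuts
end QuiltOp

namespace QuiltOp

/-! ### Reduced lists with exactly one cut -/

section CutData

set_option linter.unusedSectionVars false

variable {α : Type*} [DecidableEq α]

theorem pair_sublist_append {x y : α} {A B : List α} (hx : x ∈ A) (hy : y ∈ B) :
    [x, y].Sublist (A ++ B) :=
  (List.singleton_sublist.2 hx).append (List.singleton_sublist.2 hy)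

theorem sublist_of_closed {c x : α} {S : List α} (h₁ : ∃ S', S = c :: S') (h₂ : ∃ S', S = S' ++ [c])
    (hx : x ∈ S) (hne : x ≠ c) : [c, x, c].Sublist S := by
  obtain ⟨S₁, rfl⟩ := h₁
  obtain ⟨S₂, h₂⟩ := h₂
  cases S₂ with
  | nil => simp_all
  | cons d S₂ =>
    simp only [List.cons_append, List.cons.injEq] at h₂
    obtain ⟨-, rfl⟩ := h₂
    have : x ∈ S₂ := by simpa [hne] using hx
    exact List.Sublist.cons_cons _ (pair_sublist_append this (List.mem_singleton_self c))

theorem append_cons_inj_of_notMem {x : α} {A A' B B' : List α} (h : A ++ x :: B = A' ++ x :: B')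
    (hB : x ∉ B) (hB' : x ∉ B') : A = A' ∧ B = B' := by
  rcases List.append_eq_append_iff.1 h with ⟨C, rfl, h⟩ | ⟨C, rfl, h⟩ <;> cases C <;> simp_all

theorem exists_last_mem {x : α} {L : List α} (h : x ∈ L) : ∃ A B, L = A ++ x :: B ∧ x ∉ B := by
  obtain ⟨B, A, h₁, h₂⟩ := List.eq_append_cons_of_mem (List.mem_reverse.2 h)
  refine ⟨A.reverse, B.reverse, ?_, by simpa using h₂⟩
  rw [← List.reverse_reverse L, h₁]
  simp

theorem exists_concat_of_append_eq {c : α} {A G S : List α} (h : A ++ [c] = G ++ S) (hS : S ≠ []) :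
    ∃ S', S = S' ++ [c] ∧ A = G ++ S' := by
  rcases List.eq_nil_or_concat' S with rfl | ⟨S', d, rfl⟩
  · exact absurd rfl hS
  · rw [← List.append_assoc] at h
    obtain ⟨h₁, h₂⟩ := List.append_inj' h rfl
    simp only [List.cons.injEq, and_true] at h₂
    exact ⟨S', by rw [h₂], h₁⟩

/-- The only cut of the reduced list `F` lies between `G ++ S` and `T ++ H`, where `S` consists
of the letters from the first to the last `c`, and `T` of those from the first to the last `b`. -/
structure CutData (F G S T H : List α) (c b : α) : Prop where
  eq : F = (G ++ S) ++ (T ++ H)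
  red : Reduced F
  headS : ∃ S', S = c :: S'
  lastS : ∃ S', S = S' ++ [c]
  headT : ∃ T', T = b :: T'
  lastT : ∃ T', T = T' ++ [b]
  notMem_G : c ∉ G
  notMem_TH : c ∉ T ++ H
  notMem_GS : b ∉ G ++ S
  notMem_H : b ∉ H
  unique : ∀ A x y B, F = A ++ x :: y :: B → x ∉ y :: B → y ∉ A ++ [x] →
    A ++ [x] = G ++ S ∧ y :: B = T ++ H

theorem Reduced.exists_cutData {F : List α} (hF : Reduced F) (h : (cuts [] F).length = 1) :
    ∃ G S T H c b, CutData F G S T H c b := by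
  obtain ⟨s, hs⟩ := List.length_eq_one_iff.1 h
  obtain ⟨A, c, b, B, h₁, h₂, h₃, -⟩ := mem_cuts.1 (show s ∈ cuts [] F by simp [hs])
  have hun : ∀ A' x y B', F = A' ++ x :: y :: B' → x ∉ y :: B' → y ∉ A' ++ [x] →
      A' ++ [x] = A ++ [c] ∧ y :: B' = b :: B := by
    intro A' x y B' e hx hy
    have m₁ : y :: B' ∈ cuts [] F := mem_cuts.2 ⟨A', x, y, B', e, hx, by simpa using hy, rfl⟩
    have m₂ : b :: B ∈ cuts [] F := mem_cuts.2 ⟨A, c, b, B, h₁, h₂, by simpa using h₃, rfl⟩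
    rw [hs, List.mem_singleton] at m₁ m₂
    have e₂ : y :: B' = b :: B := m₁.trans m₂.symm
    refine ⟨?_, e₂⟩
    have : (A' ++ [x]) ++ (y :: B') = (A ++ [c]) ++ (b :: B) := by
      simpa using e.symm.trans h₁
    rw [e₂] at this
    exact List.append_cancel_right this
  obtain ⟨G, S', hGS, hG⟩ := List.eq_append_cons_of_mem (show c ∈ A ++ [c] by simp)
  obtain ⟨T', H, hTH, hH⟩ := exists_last_mem (show b ∈ b :: B by simp)
  obtain ⟨S₂, hS₂, -⟩ := exists_concat_of_append_eq hGS (by simp)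
  have hTH' : b :: B = (T' ++ [b]) ++ H := by simpa using hTH
  refine ⟨G, c :: S', T' ++ [b], H, c, b, ?_, hF, ⟨_, rfl⟩, ⟨_, hS₂⟩, ?_, ⟨_, rfl⟩, hG,
    hTH' ▸ h₂, hGS ▸ by simpa using h₃, hH, ?_⟩
  · rw [← hGS, ← hTH', h₁]
    simp
  · cases T' with
    | nil => exact ⟨[], rfl⟩
    | cons d T' =>
      simp only [List.cons_append, List.cons.injEq] at hTH
      exact ⟨T' ++ [b], by rw [hTH.1]; rfl⟩
  · rw [← hGS, ← hTH']
    exact hun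

namespace CutData

variable {F G S T H : List α} {c b : α} (h : CutData F G S T H c b)
include h

theorem c_mem : c ∈ S := by
  obtain ⟨S', rfl⟩ := h.headS
  simp

theorem b_mem : b ∈ T := by
  obtain ⟨S', rfl⟩ := h.headT
  simp

theorem c_ne_b : c ≠ b := fun e => h.notMem_GS (e ▸ List.mem_append_right _ h.c_mem)

/-- A letter of `S` other than `c` lies between two letters `c`, so another occurrence outside `S`
would be interlaced with `c`. The next three lemmas rest on the same argument, for `S` or for `T`.
-/
theorem notMem_right {x : α} (hx : x ∈ S) : x ∉ T ++ H := by
  intro hx'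
  by_cases hne : x = c
  · exact h.notMem_TH (hne ▸ hx')
  · refine h.red.noInterlacing c x (Ne.symm hne) ?_
    rw [h.eq]
    exact ((sublist_of_closed h.headS h.lastS hx hne).trans (List.sublist_append_right G S)).append
      (List.singleton_sublist.2 hx')

theorem notMem_left {x : α} (hx : x ∈ T) : x ∉ G ++ S := by
  intro hx'
  by_cases hne : x = b
  · exact h.notMem_GS (hne ▸ hx')
  · refine h.red.noInterlacing x b hne ?_
    rw [h.eq]
    exact (List.singleton_sublist.2 hx').append
      ((sublist_of_closed h.headT h.lastT hx hne).trans (List.sublist_append_left T H))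

theorem notMem_G_of_mem_S {x : α} (hx : x ∈ S) : x ∉ G := by
  intro hx'
  by_cases hne : x = c
  · exact h.notMem_G (hne ▸ hx')
  · refine h.red.noInterlacing x c hne ?_
    rw [h.eq]
    exact ((List.singleton_sublist.2 hx').append
      (sublist_of_closed h.headS h.lastS hx hne)).trans (List.sublist_append_left _ _)

theorem notMem_H_of_mem_T {x : α} (hx : x ∈ T) : x ∉ H := by
  intro hx'
  by_cases hne : x = b
  · exact h.notMem_H (hne ▸ hx')
  · refine h.red.noInterlacing b x (Ne.symm hne) ?_
    rw [h.eq]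
    exact ((sublist_of_closed h.headT h.lastT hx hne).append
      (List.singleton_sublist.2 hx')).trans (List.sublist_append_right _ _)

/-- If the last letter of `G` did not recur in `H`, there would be a second cut, between `G` and
`S`. Similarly the first letter of `H` occurs in `G`. If these two letters were different they would
be interlaced. -/
theorem outer : (G = [] ∧ H = []) ∨ ∃ u G' H', G = G' ++ [u] ∧ H = u :: H' := by
  obtain ⟨S', hS'⟩ := h.headS
  obtain ⟨T', hT'⟩ := h.lastT
  have hcG := h.notMem_G
  have hcTH := h.notMem_TH
  have hbGS := h.notMem_GS
  have hbH := h.notMem_H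
  have key₁ : ∀ G' u, G = G' ++ [u] → u ∈ H := by
    intro G' u hG
    by_contra hu
    have huG : u ∈ G := by simp [hG]
    have huT : u ∉ T := fun hu => h.notMem_left hu (List.mem_append_left _ huG)
    have huS : u ∉ S := fun hu => h.notMem_G_of_mem_S hu huG
    have := (h.unique G' u c (S' ++ (T ++ H)) (by rw [h.eq, hG, hS']; simp)
      (by simp only [List.mem_cons, List.mem_append]
          rintro (rfl | h' | h' | h')
          · exact hcG huG
          · exact huS (by simp [hS', h'])
          · exact huT h'
          · exact hu h') (by rw [← hG]; exact hcG)).2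
    have : c ∈ T ++ H := by rw [← this]; simp
    exact hcTH this
  have key₂ : ∀ u H', H = u :: H' → u ∈ G := by
    intro u H' hH
    by_contra hu
    have huH : u ∈ H := by simp [hH]
    have huT : u ∉ T := fun hu => h.notMem_H_of_mem_T hu huH
    have huS : u ∉ S := fun hu => h.notMem_right hu (List.mem_append_right _ huH)
    have := (h.unique ((G ++ S) ++ T') b u H' (by rw [h.eq, hH, hT']; simp)
      (by rw [← hH]; exact hbH) (by
        rw [List.append_assoc, ← hT']
        simp only [List.mem_append]
        tauto)).1
    have : b ∈ G ++ S := by rw [← this]; simp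
    exact hbGS this
  rcases List.eq_nil_or_concat' G with hG | ⟨G', u, hG⟩
  · left
    refine ⟨hG, ?_⟩
    cases hH : H with
    | nil => rfl
    | cons w H' =>
      have := key₂ w H' hH
      rw [hG] at this
      simp at this
  · right
    have hu := key₁ G' u hG
    cases hH : H with
    | nil => rw [hH] at hu; simp at hu
    | cons w H' =>
      have hw := key₂ w H' hH
      by_cases e : w = u
      · exact ⟨u, G', H', hG, by rw [e]⟩
      · exfalso
        have hw' : w ∈ G' := by simpa [hG, e] using hw
        have hu' : u ∈ H' := by simpa [hH, Ne.symm e] using hu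
        refine h.red.noInterlacing w u e ?_
        have e₁ : [w, u].Sublist (G' ++ [u]) := pair_sublist_append hw' (by simp)
        have e₂ : [w, u].Sublist (w :: H') := by simpa using hu'
        rw [h.eq, hG, hH]
        exact (e₁.trans (List.sublist_append_left _ _)).append
          (e₂.trans (List.sublist_append_right _ _))

/-- Before the cut, the number of caesuras is determined by the number of distinct letters. -/
theorem caesurasBefore_add_one {P N : List α} {y : α} (hF : F = P ++ y :: N)
    (hP : P.length < (G ++ S).length) :
    caesurasBefore P (y :: N) + 1 = (P ++ [y]).toFinset.card := by
  cases P with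
  | nil => simp [caesurasBefore]
  | cons x M =>
    have h₁ := caesurasBefore_add_repeats (P := []) (M := M) (N := N) (c := x) (y := y)
      (by simpa [hF] using h.red) (fun A z w B e hlen hz => by
        by_contra hw
        have := (h.unique A z w B (by rw [hF, ← e]) hz (by simpa using hw)).1
        rw [← this] at hP
        simp at hP
        omega)
    have h₂ := repeats_add_card [x] (M ++ [y])
    simp only [List.cons_append, List.nil_append, List.toFinset_cons, List.toFinset_nil,
      insert_empty_eq, Finset.card_singleton, List.length_append, List.length_cons,
      List.length_nil] at h₁ h₂ ⊢
    omega

theorem card_left : (G ++ S).toFinset.card = G.toFinset.card + S.toFinset.card := by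
  rw [List.toFinset_append, Finset.card_union_of_disjoint]
  rw [Finset.disjoint_left]
  intro x hx hx'
  exact h.notMem_G_of_mem_S (List.mem_toFinset.1 hx') (List.mem_toFinset.1 hx)

/-- This count and the next two are the exponents in the signs of the three deletions that lead to
`F`: of a first `b`, of a last `c`, and of a letter at the cut. -/
theorem caesurasBefore_G : caesurasBefore G (S ++ (T ++ H)) = G.toFinset.card := by
  obtain ⟨S', hS'⟩ := h.headS
  have := h.caesurasBefore_add_one (P := G) (y := c) (N := S' ++ (T ++ H))
    (by rw [h.eq, hS']; simp) (by rw [hS']; simp)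
  have e : (G ++ [c]).toFinset.card = G.toFinset.card + 1 := by
    rw [List.toFinset_append, Finset.card_union_of_disjoint]
    · simp
    · simpa using h.notMem_G
  rw [hS', List.cons_append]
  omega

theorem caesurasBefore_concat {S' : List α} (hS : S = S' ++ [c]) :
    caesurasBefore (G ++ S') (c :: (T ++ H)) + 1 = (G ++ S).toFinset.card := by
  rw [h.caesurasBefore_add_one (P := G ++ S') (y := c) (N := T ++ H) (by rw [h.eq, hS]; simp)
    (by rw [hS]; simp), hS, List.append_assoc]

theorem caesurasBefore_left :
    caesurasBefore (G ++ S) (T ++ H) + 1 = (G ++ S).toFinset.card := by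
  obtain ⟨S', hS'⟩ := h.lastS
  rw [← h.caesurasBefore_concat hS', hS', ← List.append_assoc, caesurasBefore_append]
  have := h.notMem_TH
  simp [caesurasBefore] at this ⊢
  tauto

end CutData

end CutData
end QuiltOp

namespace QuiltOp

/-! ### The reduced lists with a given one-cut list as a face -/

section Faces

set_option linter.unusedSectionVars false

variable {α : Type*} [DecidableEq α]

theorem triple_sublist_append {x y z : α} {A B C : List α} (hx : x ∈ A) (hy : y ∈ B)
    (hz : z ∈ C) : [x, y, z].Sublist (A ++ B ++ C) :=
  (pair_sublist_append hx hy).append (List.singleton_sublist.2 hz)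

theorem quadruple_sublist_append {x y z w : α} {A B C D : List α} (hx : x ∈ A) (hy : y ∈ B)
    (hz : z ∈ C) (hw : w ∈ D) : [x, y, z, w].Sublist (A ++ B ++ C ++ D) :=
  (triple_sublist_append hx hy hz).append (List.singleton_sublist.2 hw)

theorem Reduced.interlacing {L A B C D : List α} {x y : α} (hL : Reduced L) (hxy : x ≠ y)
    (e : L = A ++ B ++ C ++ D) (hx : x ∈ A) (hy : y ∈ B) (hx' : x ∈ C) (hy' : y ∈ D) : False :=
  hL.noInterlacing x y hxy (e ▸ quadruple_sublist_append hx hy hx' hy')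

theorem Reduced.ne {L A B : List α} {x y : α} (hL : Reduced L) (e : L = A ++ x :: y :: B) :
    x ≠ y := by
  have := hL.chain
  rw [e] at this
  exact (List.isChain_cons_cons.1 (List.isChain_append.1 this).2.1).1

namespace CutData

variable {F G S T H : List α} {c b : α} (h : CutData F G S T H c b)
include h

/-- The reduced lists of which `F` is a face. -/
theorem face_cases {K : List α} (hK : Reduced K) (hf : IsFace K F) :
    (∃ u G' H', G = G' ++ [u] ∧ H = u :: H' ∧ K = (G ++ S) ++ u :: (T ++ H)) ∨
      K = G ++ b :: (S ++ (T ++ H)) ∨ K = ((G ++ S) ++ T) ++ c :: H := by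
  obtain ⟨A, x, B, rfl, hF, hx⟩ := hf
  have hFeq := h.eq
  by_cases hA : x ∈ A
  · by_cases hB : x ∈ B
    · left
      obtain ⟨A', y, rfl⟩ : ∃ A' y, A = A' ++ [y] := by
        rcases List.eq_nil_or_concat' A with rfl | h
        · simp at hA
        · exact h
      obtain ⟨z, B', rfl⟩ : ∃ z B', B = z :: B' := by
        cases B with
        | nil => simp at hB
        | cons z B' => exact ⟨z, B', rfl⟩
      have hyx : y ≠ x := hK.ne (A := A') (B := z :: B') (by simp)
      have hxz : x ≠ z := hK.ne (A := A' ++ [y]) (B := B') (by simp)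
      have hxA : x ∈ A' := by simpa [hyx.symm] using hA
      have hxB : x ∈ B' := by simpa [hxz] using hB
      have hy : y ∉ z :: B' := fun hy =>
        hK.interlacing hyx.symm (A := A') (B := [y]) (C := [x]) (D := z :: B') (by simp) hxA
          (by simp) (by simp) hy
      have hz : z ∉ A' ++ [y] := fun hz =>
        hK.interlacing hxz.symm (A := A' ++ [y]) (B := [x]) (C := [z]) (D := B') (by simp) hz
          (by simp) (by simp) hxB
      obtain ⟨e₁, e₂⟩ := h.unique A' y z B' (by rw [hF]; simp) hy hz
      rw [e₁] at hA
      rw [e₂] at hB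
      have hS : x ∉ S := fun hS => h.notMem_right hS hB
      have hT : x ∉ T := fun hT => h.notMem_left hT hA
      have hG : x ∈ G := by simpa [hS] using hA
      have hH : x ∈ H := by simpa [hT] using hB
      rcases h.outer with ⟨rfl, -⟩ | ⟨u, G', H', hG', hH'⟩
      · simp at hG
      · refine ⟨u, G', H', hG', hH', ?_⟩
        have : x = u := by
          by_contra hne
          have hxG : x ∈ G' := by simpa [hG', hne] using hG
          refine hK.interlacing hne (A := G') (B := [u] ++ S) (C := [x]) (D := T ++ H) ?_ hxG
            (by simp) (by simp) (by simp [hH'])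
          rw [e₁, e₂, hG']
          simp
        rw [e₁, e₂, this]
    -- Here `x` is a new last occurrence. What lies between it and the previous `x` is closed off,
    -- so the previous `x` stands immediately before the cut; hence `x = c`, and `x` must come right
    -- after `T`.
    · right; right
      obtain ⟨A', C, rfl, hC⟩ := exists_last_mem hA
      obtain ⟨s, C', rfl⟩ : ∃ s C', C = s :: C' := by
        cases C with
        | nil => exact absurd rfl (hK.ne (A := A') (x := x) (y := x) (B := B) (by simp))
        | cons s C' => exact ⟨s, C', rfl⟩
      have hsx : x ≠ s := fun e => hC (by simp [e])
      obtain ⟨e₁, e₂⟩ := h.unique A' x s (C' ++ B) (by rw [hF]; simp)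
        (by simp only [List.mem_cons, List.mem_append] at hC ⊢; tauto) (by
          intro hs
          have hs : s ∈ A' := by simpa [hsx.symm] using hs
          exact hK.interlacing hsx.symm (A := A') (B := [x]) (C := s :: C') (D := x :: B)
            (by simp) hs (by simp) (by simp) (by simp))
      obtain ⟨S', hS'⟩ := h.lastS
      have hxc : x = c := by
        rw [hS', ← List.append_assoc] at e₁
        simpa using (List.append_inj' e₁ rfl).2
      obtain ⟨T', hT'⟩ := h.headT
      have hsb : s = b := by
        rw [hT'] at e₂
        simp only [List.cons_append, List.cons.injEq] at e₂
        exact e₂.1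
      subst hxc hsb
      have hbB : s ∉ B := fun hb =>
        hK.interlacing hsx (A := A' ++ [x]) (B := s :: C') (C := [x]) (D := B)
          (by simp) (by simp) (by simp) (by simp) hb
      obtain ⟨E, hE⟩ : ∃ E, s :: C' = T ++ E ∧ H = E ++ B := by
        have e₃ : (s :: C') ++ B = T ++ H := by simpa using e₂
        rcases List.append_eq_append_iff.1 e₃ with ⟨E, hE, hB⟩ | ⟨E, hE, hB⟩
        · rcases List.eq_nil_or_concat' E with rfl | ⟨E', d, rfl⟩
          · exact ⟨[], by simpa using hE.symm, by simpa using hB.symm⟩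
          · obtain ⟨T₂, hT₂⟩ := h.lastT
            rw [hT₂, ← List.append_assoc] at hE
            have := (List.append_inj' hE rfl).2
            simp only [List.cons.injEq, and_true] at this
            exact absurd (by rw [hB, this]; simp) hbB
        · exact ⟨E, hE, hB⟩
      cases E with
      | nil =>
        simp only [List.append_nil, List.nil_append] at hE
        rw [← hE.1, hE.2, ← e₁]
        simp
      | cons w E =>
        exfalso
        rcases h.outer with ⟨-, hH⟩ | ⟨u, G', H', hG', hH'⟩
        · rw [hE.2] at hH
          simp at hH
        · have huw : u = w := by
            have := hE.2
            rw [hH'] at this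
            simp only [List.cons_append, List.cons.injEq] at this
            exact this.1
          have huG : u ∈ G := by simp [hG']
          have hux : u ≠ x := fun e => h.notMem_G (e ▸ huG)
          have huA : u ∈ A' := by
            have : u ∈ A' ++ [x] := by rw [e₁]; exact List.mem_append_left _ huG
            simpa [hux] using this
          refine hK.interlacing hux (A := A') (B := [x]) (C := s :: C') (D := x :: B)
            (by simp) huA (by simp) ?_ (by simp)
          rw [hE.1, huw]
          simp
  -- Here `x` is a new first occurrence. The next `x` stands immediately after the cut; hence `x =
  -- b`, and `x` must come right before `S`.
  · right; left
    have hB : x ∈ B := by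
      rw [hF] at hx
      simpa [hA] using hx
    obtain ⟨C, B', rfl, hC⟩ := List.eq_append_cons_of_mem hB
    obtain ⟨C', s, rfl⟩ : ∃ C' s, C = C' ++ [s] := by
      rcases List.eq_nil_or_concat' C with rfl | h
      · exact absurd rfl (hK.ne (A := A) (x := x) (y := x) (B := B') (by simp))
      · exact h
    have hsx : x ≠ s := fun e => hC (by simp [e])
    obtain ⟨e₁, e₂⟩ := h.unique (A ++ C') s x B' (by rw [hF]; simp) (by
          intro hs
          have hs : s ∈ B' := by simpa [hsx.symm] using hs
          exact hK.interlacing hsx (A := A ++ [x]) (B := C' ++ [s]) (C := [x]) (D := B')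
            (by simp) (by simp) (by simp) (by simp) hs)
        (by simp only [List.mem_cons, List.mem_append] at hC ⊢; tauto)
    obtain ⟨S', hS'⟩ := h.lastS
    have hsc : s = c := by
      rw [hS', ← List.append_assoc] at e₁
      simpa using (List.append_inj' e₁ rfl).2
    obtain ⟨T', hT'⟩ := h.headT
    have hxb : x = b := by
      rw [hT'] at e₂
      simp only [List.cons_append, List.cons.injEq] at e₂
      exact e₂.1
    subst hsc hxb
    have hcA : s ∉ A := fun hs =>
      hK.interlacing hsx.symm (A := A) (B := [x]) (C := C' ++ [s]) (D := x :: B')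
        (by simp) hs (by simp) (by simp) (by simp)
    obtain ⟨E, hE⟩ : ∃ E, C' ++ [s] = E ++ S ∧ G = A ++ E := by
      have e₃ : A ++ (C' ++ [s]) = G ++ S := by simpa using e₁
      rcases List.append_eq_append_iff.1 e₃ with ⟨E, hE, hB⟩ | ⟨E, hE, hB⟩
      · exact ⟨E, hB, hE⟩
      · cases E with
        | nil => exact ⟨[], by simpa using hB.symm, by simpa using hE.symm⟩
        | cons d E =>
          obtain ⟨S₂, hS₂⟩ := h.headS
          rw [hS₂] at hB
          simp only [List.cons_append, List.cons.injEq] at hB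
          exact absurd (by rw [hE, hB.1]; simp) hcA
    rcases List.eq_nil_or_concat' E with rfl | ⟨E, w, rfl⟩
    · simp only [List.append_nil, List.nil_append] at hE
      rw [hE.1, hE.2, ← e₂]
    · exfalso
      rcases h.outer with ⟨hG, -⟩ | ⟨u, G', H', hG', hH'⟩
      · rw [hE.2] at hG
        simp at hG
      · have huw : u = w := by
          have := hE.2
          rw [hG', ← List.append_assoc] at this
          simpa using (List.append_inj' this rfl).2
        have huH : u ∈ H := by simp [hH']
        have hux : u ≠ x := fun e => h.notMem_H (e ▸ huH)
        have huB : u ∈ B' := by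
          have : u ∈ x :: B' := by rw [e₂]; exact List.mem_append_right _ huH
          simpa [hux] using this
        refine hK.interlacing hux.symm (A := A ++ [x]) (B := C' ++ [s]) (C := [x]) (D := B')
          (by simp) (by simp) ?_ (by simp) huB
        rw [hE.1, huw]
        simp

end CutData

/-- Without consecutive repetitions, different deletions give different lists, so only one term
survives. The deleted letter is a caesura, and its number gives the sign. -/
theorem faceSum_single_of_mem {A B : List α} {x : α} (hc : (A ++ x :: B).IsChain (· ≠ ·))
    (hx : x ∈ B) : faceSum (A ++ x :: B) (fun M => if M = A ++ B then 1 else 0) =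
      (-1) ^ (caesurasBefore A (x :: B) + 1) := by
  induction A with
  | nil =>
    simp only [List.nil_append] at hc ⊢
    have hne : ∀ M, x :: M ≠ B := by
      rintro M rfl
      exact (List.isChain_cons_cons.1 hc).1 rfl
    have h₃ : faceSum B (fun M => if x :: M = B then (1 : ℤ) else 0) = 0 := by
      simp only [hne, if_false]
      exact faceSum_zero B
    rw [faceSum, h₃]
    simp [hx, hne, caesurasBefore]
  | cons a A ih =>
    rw [List.cons_append] at hc ⊢
    have ih := ih hc.tail
    have h₁ : A ++ x :: B ≠ a :: A ++ B := by
      intro e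
      cases hL : A ++ x :: B with
      | nil => simp at hL
      | cons d L =>
        rw [hL] at hc e
        simp only [List.cons_append, List.cons.injEq] at e
        exact (List.isChain_cons_cons.1 hc).1 e.1.symm
    have h₂ : (A ++ x :: B).count a = 1 → a :: (A ++ x :: B).erase a ≠ a :: A ++ B := by
      intro hca e
      simp only [List.cons_append, List.cons.injEq, true_and] at e
      have := congrArg (List.count a) e
      rw [List.count_erase_self, hca, List.count_append] at this
      rw [List.count_append, List.count_cons] at hca
      by_cases hxa : x = a
      · subst hxa
        have := List.count_pos_iff.2 hx
        simp at hca
        omega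
      · simp [hxa] at hca
        omega
    have h₃ : (fun M => if a :: M = a :: A ++ B then (1 : ℤ) else 0) =
        fun M => if M = A ++ B then 1 else 0 := by
      funext M
      simp
    rw [faceSum, h₃, ih, caesurasBefore]
    have h₄ : (if (A ++ x :: B).count a = 1 then
        (if a :: (A ++ x :: B).erase a = a :: A ++ B then (1 : ℤ) else 0) else 0) = 0 := by
      split_ifs with e e'
      · exact absurd e' (h₂ e)
      · rfl
      · rfl
    rw [h₄, if_neg h₁, ← pow_add]
    simp [add_assoc]

/-- Again a single term survives. The deleted letter is a last occurrence whose previous one has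
number `caesurasBefore A _ + 1`, and the definition of the sign adds one more. -/
theorem faceSum_single_last {A S B : List α} {x : α}
    (hc : (A ++ x :: (S ++ x :: B)).IsChain (· ≠ ·)) (hS : x ∉ S) (hB : x ∉ B) :
    faceSum (A ++ x :: (S ++ x :: B)) (fun M => if M = A ++ x :: (S ++ B) then 1 else 0) =
      (-1) ^ caesurasBefore A (x :: (S ++ x :: B)) := by
  induction A with
  | nil =>
    simp only [List.nil_append] at hc ⊢
    have h₁ : S ++ x :: B ≠ x :: (S ++ B) := by
      intro e
      rw [e] at hc
      exact (List.isChain_cons_cons.1 hc).1 rfl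
    have h₂ : (S ++ x :: B).count x = 1 := by
      rw [List.count_append, List.count_cons_self, List.count_eq_zero.2 hS,
        List.count_eq_zero.2 hB]
    have h₃ : (S ++ x :: B).erase x = S ++ B := by
      rw [List.erase_append_right _ hS, List.erase_cons_head]
    have h₄ : faceSum (S ++ x :: B) (fun M => if x :: M = x :: (S ++ B) then (1 : ℤ) else 0)
        = 0 := by
      refine (faceSum_congr (ψ := fun _ => 0) fun M hM => if_neg fun e => ?_).trans
        (faceSum_zero _)
      have := (hM.mem_iff x).2 (by simp)
      rw [(List.cons.inj e).2] at this
      simp [hS, hB] at this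
    rw [faceSum, h₄, if_neg h₁, if_pos h₂, h₃]
    simp [caesurasBefore]
  | cons a A ih =>
    rw [List.cons_append] at hc ⊢
    have ih := ih hc.tail
    have h₁ : A ++ x :: (S ++ x :: B) ≠ a :: A ++ x :: (S ++ B) := by
      intro e
      cases hL : A ++ x :: (S ++ x :: B) with
      | nil => simp at hL
      | cons d L =>
        rw [hL] at hc e
        simp only [List.cons_append, List.cons.injEq] at e
        exact (List.isChain_cons_cons.1 hc).1 e.1.symm
    have h₂ : (A ++ x :: (S ++ x :: B)).count a = 1 →
        a :: (A ++ x :: (S ++ x :: B)).erase a ≠ a :: A ++ x :: (S ++ B) := by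
      intro hca e
      simp only [List.cons_append, List.cons.injEq, true_and] at e
      have := congrArg (List.count a) e
      rw [List.count_erase_self, hca] at this
      by_cases hxa : x = a
      · subst hxa
        simp at this
      · simp [List.count_append, hxa] at hca this
        omega
    have h₃ : (fun M => if a :: M = a :: A ++ x :: (S ++ B) then (1 : ℤ) else 0) =
        fun M => if M = A ++ x :: (S ++ B) then 1 else 0 := by
      funext M
      simp
    rw [faceSum, h₃, ih, caesurasBefore]
    have h₄ : (if (A ++ x :: (S ++ x :: B)).count a = 1 then
        (if a :: (A ++ x :: (S ++ x :: B)).erase a = a :: A ++ x :: (S ++ B) then (1 : ℤ) else 0)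
        else 0) = 0 := by
      split_ifs with e e'
      · exact absurd e' (h₂ e)
      · rfl
      · rfl
    rw [h₄, if_neg h₁, ← pow_add]
    simp

end Faces
end QuiltOp

namespace QuiltOp

/-! ### Inserting letters into lists; comparing signs of orders -/

section Insertions

set_option linter.unusedSectionVars false

variable {α : Type*} [DecidableEq α]

theorem sublist_insert {l A B : List α} {x : α} (h : l.Sublist (A ++ x :: B)) :
    l.Sublist (A ++ B) ∨ ∃ l₁ l₂, l = l₁ ++ x :: l₂ ∧ l₁.Sublist A ∧ l₂.Sublist B := by
  obtain ⟨l₁, l₂, rfl, h₁, h₂⟩ := List.sublist_append_iff.1 h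
  rcases List.sublist_cons_iff.1 h₂ with h₂ | ⟨r, rfl, h₂⟩
  · exact Or.inl (h₁.append h₂)
  · exact Or.inr ⟨l₁, r, rfl, h₁, List.cons_sublist_cons.1 (by assumption)⟩

theorem mem_left_of_pair_sublist {p q : α} {A B : List α} (h : [p, q].Sublist (A ++ B))
    (hq : q ∉ B) : p ∈ A := by
  obtain ⟨l₁, l₂, e, h₁, h₂⟩ := List.sublist_append_iff.1 h
  rcases l₁ with _ | ⟨a, l₁⟩
  · simp only [List.nil_append] at e
    exact absurd (h₂.subset (by simp [← e])) hq
  · simp only [List.cons_append, List.cons.injEq] at e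
    exact h₁.subset (by simp [e.1])

theorem mem_right_of_pair_sublist {p q : α} {A B : List α} (h : [p, q].Sublist (A ++ B))
    (hp : p ∉ A) : q ∈ B := by
  obtain ⟨l₁, l₂, e, h₁, h₂⟩ := List.sublist_append_iff.1 h
  rcases l₁ with _ | ⟨a, l₁⟩
  · simp only [List.nil_append] at e
    exact h₂.subset (by simp [← e])
  · simp only [List.cons_append, List.cons.injEq] at e
    exact absurd (h₁.subset (by simp [e.1])) hp

theorem isChain_insert {A B : List α} {x : α} (h : (A ++ B).IsChain (· ≠ ·))
    (hA : ∀ A' y, A = A' ++ [y] → y ≠ x) (hB : ∀ y B', B = y :: B' → x ≠ y) :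
    (A ++ x :: B).IsChain (· ≠ ·) := by
  rw [List.isChain_append] at h ⊢
  refine ⟨h.1, ?_, ?_⟩
  · rw [List.isChain_cons]
    refine ⟨fun y hy => ?_, h.2.1⟩
    cases B with
    | nil => simp at hy
    | cons z B =>
      simp only [List.head?_cons, Option.mem_def, Option.some.injEq] at hy
      exact hB y B (by rw [hy])
  · intro y hy z hz
    simp only [List.head?_cons, Option.mem_def, Option.some.injEq] at hz
    subst hz
    obtain ⟨A', rfl⟩ := List.getLast?_eq_some_iff.1 hy
    exact hA A' y rfl

theorem idxOf_insert_lt_iff {A B : List α} {x : α} (hx : x ∈ A) (a b : α) :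
    (A ++ x :: B).idxOf a < (A ++ x :: B).idxOf b ↔ (A ++ B).idxOf a < (A ++ B).idxOf b := by
  have key : ∀ a ∉ A, x ≠ a := fun a ha e => ha (e ▸ hx)
  have hlt : ∀ a ∈ A, A.idxOf a < A.length := fun a ha => List.idxOf_lt_length_of_mem ha
  simp only [List.idxOf_append]
  by_cases ha : a ∈ A <;> by_cases hb : b ∈ A <;> simp only [ha, hb, if_true, if_false]
  · rw [List.idxOf_cons_ne _ (key b hb)]
    have := hlt a ha
    omega
  · rw [List.idxOf_cons_ne _ (key a ha)]
    have := hlt b hb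
    omega
  · rw [List.idxOf_cons_ne _ (key a ha), List.idxOf_cons_ne _ (key b hb)]
    omega

theorem listSign_congr {ι : Type*} {L : List ι} {f g : ι → ℕ}
    (h : ∀ a ∈ L, ∀ b ∈ L, f a < f b ↔ g a < g b) : listSign (L.map f) = listSign (L.map g) := by
  induction L with
  | nil => rfl
  | cons a L ih =>
    rw [List.map_cons, List.map_cons, listSign, listSign,
      ih fun a ha b hb => h a (by simp [ha]) b (by simp [hb]), List.countP_map, List.countP_map]
    congr 2
    refine List.countP_congr fun b hb => ?_
    simpa using h b (by simp [hb]) a (by simp)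

/-- Listing the items in another order changes both signs by the same factor. This makes it possible
to move one distinguished item to the front before comparing two orders. -/
theorem listSign_mul_perm {ι : Type*} {L M : List ι} (h : L.Perm M) {f g : ι → ℕ}
    (hL : (L.map f).Nodup) (hM : (L.map g).Nodup) :
    listSign (L.map f) * listSign (L.map g) = listSign (M.map f) * listSign (M.map g) := by
  induction h with
  | nil => rfl
  | cons a h ih =>
    simp only [List.map_cons, List.nodup_cons, listSign] at hL hM ⊢
    have e₁ := (h.map f).countP_eq (p := fun x => decide (x < f a))
    have e₂ := (h.map g).countP_eq (p := fun x => decide (x < g a))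
    rw [e₁, e₂, mul_mul_mul_comm, ih hL.2 hM.2, mul_mul_mul_comm]
  | swap a b L =>
    simp only [List.map_cons, List.nodup_cons, listSign, List.mem_cons, not_or,
      List.countP_cons] at hL hM ⊢
    have e₁ := hL.1.1
    have e₂ := hM.1.1
    have key : ∀ x y : ℕ, x ≠ y → (-1 : ℤ) ^ (if x < y then 1 else 0) =
        -(-1) ^ (if y < x then 1 else 0) := by
      intro x y hxy
      rcases lt_or_gt_of_ne hxy with h | h
      · simp [h, h.le]
      · simp [h, h.le]
    simp only [decide_eq_true_eq, pow_add]
    rw [key _ _ e₁, key _ _ e₂]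
    ring
  | trans h₁ h₂ ih₁ ih₂ =>
    rw [ih₁ hL hM, ih₂ ((h₁.map f).nodup_iff.1 hL) ((h₁.map g).nodup_iff.1 hM)]

end Insertions

/-! ### Inserting letters into the words of quilts -/

section Quilts

variable {n : ℕ}

/-- The absence of interlacing is automatic: `u v u v` would put `v` to the left of `u` and `u` to
the left of `v`. -/
theorem exists_quilt {K : List (Fin n)} {T : PTree n} (hc : K.IsChain (· ≠ ·)) (hs : ∀ u, u ∈ K)
    (hv : ∀ u v, [u, v].Sublist K → ¬ T.lt v u)
    (hh : ∀ u v, [u, v, u].Sublist K → T.left v u ∨ v = u) :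
    ∃ Q : Quilt n, Q.word.letters = K ∧ Q.tree = T := by
  refine ⟨⟨⟨K, hs, (isChain_ne_iff K).1 hc, fun u v huv h => ?_⟩, T, hv, hh⟩, rfl, rfl⟩
  have h₁ := (hh u v ((by simp : [u, v, u].Sublist [u, v, u, v]).trans h)).resolve_right huv.symm
  have h₂ := (hh v u ((by simp : [v, u, v].Sublist [u, v, u, v]).trans h)).resolve_right huv
  exact PTree.left_asymm h₁ h₂

/-- Only patterns that use the new letter need to be checked. It is first or last in a pattern of
two letters (`v₁`, `v₂`), and first, middle or last in one of three (`h₁`, `h₂`, `h₃`). -/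
theorem exists_quilt_insert (R : Quilt n) {A B : List (Fin n)} {x : Fin n}
    (e : R.word.letters = A ++ B) (hA : ∀ A' y, A = A' ++ [y] → y ≠ x)
    (hB : ∀ y B', B = y :: B' → x ≠ y)
    (v₁ : ∀ q ∈ B, ¬ R.tree.lt q x) (v₂ : ∀ p ∈ A, ¬ R.tree.lt x p)
    (h₁ : ∀ q, [q, x].Sublist B → R.tree.left q x ∨ q = x)
    (h₂ : ∀ p ∈ A, p ∈ B → R.tree.left x p ∨ x = p)
    (h₃ : ∀ q, [x, q].Sublist A → R.tree.left q x ∨ q = x) :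
    ∃ Q : Quilt n, Q.word.letters = A ++ x :: B ∧ Q.tree = R.tree := by
  refine exists_quilt (isChain_insert (e ▸ R.word.reduced.chain) hA hB) (fun u => ?_) ?_ ?_
  · have := R.word.surjective u
    rw [e] at this
    simp only [List.mem_append, List.mem_cons] at this ⊢
    tauto
  · intro u v h
    rcases sublist_insert h with h | ⟨l₁, l₂, hl, s₁, s₂⟩
    · exact R.vert u v (e ▸ h)
    · rcases l₁ with _ | ⟨a, _ | ⟨b, l₁⟩⟩ <;>
        simp only [List.nil_append, List.cons_append, List.cons.injEq] at hl
      · obtain ⟨rfl, rfl⟩ := hl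
        exact v₁ v (by simpa using s₂)
      · obtain ⟨rfl, rfl, -⟩ := hl
        exact v₂ u (by simpa using s₁)
      · simp at hl
  · intro u v h
    rcases sublist_insert h with h | ⟨l₁, l₂, hl, s₁, s₂⟩
    · exact R.horiz u v (e ▸ h)
    · rcases l₁ with _ | ⟨a, _ | ⟨b, _ | ⟨d, l₁⟩⟩⟩ <;>
        simp only [List.nil_append, List.cons_append, List.cons.injEq] at hl
      · obtain ⟨rfl, rfl⟩ := hl
        exact h₁ v s₂
      · obtain ⟨rfl, rfl, rfl⟩ := hl
        exact h₂ u (by simpa using s₁) (by simpa using s₂)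
      · obtain ⟨rfl, rfl, rfl, -⟩ := hl
        exact h₃ v s₁
      · simp at hl

/-- A letter in front of the root would violate the vertical condition, and a vertex between two
occurrences of the root would be to the left of its own ancestor. -/
theorem Quilt.exists_letters_eq (Q : Quilt n) (r : Fin n) (hr : ∀ u, Q.tree.le r u) :
    ∃ F, Q.word.letters = r :: F ∧ r ∉ F := by
  cases hL : Q.word.letters with
  | nil => exact absurd hL (Q.word.ne_nil r)
  | cons a F =>
    have har : a = r := by
      by_contra hne
      have : r ∈ F := by
        have := Q.word.surjective r
        rw [hL] at this
        simpa [Ne.symm hne] using this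
      exact Q.vert a r (by rw [hL]; simpa using this) ⟨hr a, Ne.symm hne⟩
    subst har
    refine ⟨F, rfl, fun ha => ?_⟩
    cases F with
    | nil => simp at ha
    | cons x F =>
      have hne : a ≠ x := Q.word.reduced.ne (A := []) (by rw [hL]; rfl)
      have : a ∈ F := by simpa [hne] using ha
      rcases Q.horiz a x (by rw [hL]; simpa using this) with h | h
      · exact (PTree.left_not_le h).2 (hr x)
      · exact hne h.symm

end Quilts
end QuiltOp

namespace QuiltOp

/-! ### The maximal quilts with a given one-cut quilt as a face -/

section QuiltCut

variable {n : ℕ}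

/-- A quilt with root `r` whose word, without the root, has exactly one cut. -/
structure Quilt.HasCut (R : Quilt n) (r : Fin n) (G S T H : List (Fin n)) (c b : Fin n) :
    Prop where
  letters : R.word.letters = r :: ((G ++ S) ++ (T ++ H))
  root : ∀ u, R.tree.le r u
  notMem : r ∉ (G ++ S) ++ (T ++ H)
  cutData : CutData ((G ++ S) ++ (T ++ H)) G S T H c b

namespace Quilt.HasCut

variable {R : Quilt n} {r c b : Fin n} {G S T H : List (Fin n)} (h : R.HasCut r G S T H c b)
include h

theorem sublist {l : List (Fin n)} (hl : l.Sublist ((G ++ S) ++ (T ++ H))) :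
    l.Sublist R.word.letters := by
  rw [h.letters]
  exact hl.cons r

theorem mem {x : Fin n} (hx : x ≠ r) : x ∈ G ∨ x ∈ S ∨ x ∈ T ∨ x ∈ H := by
  have := R.word.surjective x
  rw [h.letters] at this
  simp only [List.mem_cons, hx, List.mem_append, false_or] at this
  tauto

theorem left_c {x : Fin n} (hx : x ∈ S) (hne : x ≠ c) : R.tree.left x c :=
  (R.horiz c x (h.sublist (((sublist_of_closed h.cutData.headS h.cutData.lastS hx hne).trans
    (List.sublist_append_right G S)).trans (List.sublist_append_left _ _)))).resolve_right hne

theorem left_b {x : Fin n} (hx : x ∈ T) (hne : x ≠ b) : R.tree.left x b :=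
  (R.horiz b x (h.sublist (((sublist_of_closed h.cutData.headT h.cutData.lastT hx hne).trans
    (List.sublist_append_left T H)).trans (List.sublist_append_right _ _)))).resolve_right hne

theorem not_lt_right {p q : Fin n} (hp : p ∈ G ++ S) (hq : q ∈ T ++ H) : ¬ R.tree.lt q p :=
  R.vert p q (h.sublist (pair_sublist_append hp hq))

theorem not_lt_GS {p q : Fin n} (hp : p ∈ G) (hq : q ∈ S) : ¬ R.tree.lt q p :=
  R.vert p q (h.sublist ((pair_sublist_append hp hq).trans (List.sublist_append_left _ _)))

theorem not_lt_TH {p q : Fin n} (hp : p ∈ T) (hq : q ∈ H) : ¬ R.tree.lt q p :=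
  R.vert p q (h.sublist ((pair_sublist_append hp hq).trans (List.sublist_append_right _ _)))

theorem not_lt_root (p : Fin n) : ¬ R.tree.lt p r := fun hp =>
  hp.2 (PTree.le_antisymm' hp.1 (h.root p))

/-- The letter `u` that ends `G` and starts `H` is inserted between two of its occurrences, so the
conditions that it imposes are already imposed by the word of `R`. -/
theorem exists_outer_iff :
    (∃ Q : Quilt n, ∃ u G' H', G = G' ++ [u] ∧ H = u :: H' ∧
      Q.word.letters = r :: ((G ++ S) ++ u :: (T ++ H)) ∧ Q.tree = R.tree) ↔ G ≠ [] := by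
  constructor
  · rintro ⟨-, u, G', H', rfl, -⟩
    simp
  · intro hG
    rcases h.cutData.outer with ⟨rfl, -⟩ | ⟨u, G', H', hG', hH'⟩
    · exact absurd rfl hG
    · have huG : u ∈ G := by simp [hG']
      have huH : u ∈ H := by simp [hH']
      have hur : r ≠ u := fun e => h.notMem (by simp [e, huG])
      have hK := exists_quilt_insert R (A := r :: (G ++ S)) (B := T ++ H) (x := u)
        (by rw [h.letters]; rfl) ?_ ?_ ?_ ?_ ?_ ?_ ?_
      · obtain ⟨Q, hQ, hT⟩ := hK
        exact ⟨Q, u, G', H', hG', hH', by simpa using hQ, hT⟩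
      · rintro A' y e rfl
        obtain ⟨S', hS'⟩ := h.cutData.lastS
        rw [hS', ← List.append_assoc, ← List.cons_append] at e
        have := (List.append_inj' e rfl).2
        simp only [List.cons.injEq, and_true] at this
        exact h.cutData.notMem_G (this ▸ huG)
      · rintro y B' e rfl
        obtain ⟨T', hT'⟩ := h.cutData.headT
        rw [hT', List.cons_append] at e
        exact h.cutData.notMem_GS (by rw [(List.cons.inj e).1]; simp [huG])
      · exact fun q hq => R.vert u q (h.sublist (pair_sublist_append (by simp [huG]) hq))
      · intro p hp
        rcases List.mem_cons.1 hp with rfl | hp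
        · exact h.not_lt_root u
        · exact h.not_lt_right hp (by simp [huH])
      · intro q hq
        exact R.horiz u q (h.sublist
          ((List.singleton_sublist.2 (by simp [huG] : u ∈ G ++ S)).append hq))
      · intro p hp hp'
        rcases List.mem_cons.1 hp with rfl | hp
        · exact absurd (List.mem_append_right _ hp') h.notMem
        · have hpS : p ∉ S := fun hS => h.cutData.notMem_right hS hp'
          have hpT : p ∉ T := fun hT => h.cutData.notMem_left hT hp
          have hpG : p ∈ G := by simpa [hpS] using hp
          by_cases hpu : u = p
          · exact Or.inr hpu
          · have hpG' : p ∈ G' := by simpa [hG', Ne.symm hpu] using hpG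
            have e₁ : [p, u].Sublist (G ++ S) := by
              rw [hG']
              exact (pair_sublist_append hpG' (by simp)).trans (List.sublist_append_left _ _)
            exact R.horiz p u (h.sublist (e₁.append (List.singleton_sublist.2 hp')))
      · intro q hq
        have hq : [u, q].Sublist (G ++ S) := by
          rcases List.sublist_cons_iff.1 hq with hq | ⟨l, e, -⟩
          · exact hq
          · exact absurd (List.cons.inj e).1.symm hur
        exact R.horiz u q (h.sublist
          (hq.append (List.singleton_sublist.2 (by simp [huH] : u ∈ T ++ H))))

/-- The additional `b` encloses `S`, and the pattern `b c b` forces `c` to the left of `b`.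
Conversely all vertices of `S` other than `c` are to the left of `c`, hence of `b`, so no other
condition arises. -/
theorem exists_left_iff :
    (∃ Q : Quilt n, Q.word.letters = r :: (G ++ b :: (S ++ (T ++ H))) ∧ Q.tree = R.tree) ↔
      R.tree.left c b := by
  have hcb := h.cutData.c_ne_b
  have hc := h.cutData.c_mem
  have hb := h.cutData.b_mem
  have hbG : b ∉ r :: G := by
    have h₁ := h.notMem
    have h₂ := h.cutData.notMem_GS
    simp only [List.mem_append, List.mem_cons] at h₁ h₂ ⊢
    rintro (rfl | hG) <;> tauto
  constructor
  · rintro ⟨Q, hQ, hT⟩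
    rw [← hT]
    refine (Q.horiz b c ?_).resolve_right hcb
    rw [hQ]
    refine List.Sublist.cons _ (List.Sublist.trans ?_ (List.sublist_append_right _ _))
    exact List.Sublist.cons_cons b
      ((pair_sublist_append hc hb).trans (by simp))
  · intro hl
    refine exists_quilt_insert R (A := r :: G) (B := S ++ (T ++ H)) (x := b)
        (by rw [h.letters]; simp) ?_ ?_ ?_ ?_ ?_ ?_ ?_
    · rintro A' y e rfl
      exact hbG (by simp [e])
    · rintro y B' e rfl
      obtain ⟨S', hS'⟩ := h.cutData.headS
      rw [hS', List.cons_append] at e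
      exact hcb (List.cons.inj e).1
    · rintro q hq ⟨hqb, hne⟩
      rcases List.mem_append.1 hq with hq | hq
      · by_cases hqc : q = c
        · exact (PTree.left_not_le hl).1 (hqc ▸ hqb)
        · exact (PTree.left_not_le (R.tree.left_trans _ _ _ (h.left_c hq hqc) hl)).1 hqb
      · rcases List.mem_append.1 hq with hq | hq
        · exact (PTree.left_not_le (h.left_b hq hne)).1 hqb
        · exact h.not_lt_TH hb hq ⟨hqb, hne⟩
    · intro p hp
      rcases List.mem_cons.1 hp with rfl | hp
      · exact h.not_lt_root b
      · exact h.not_lt_right (by simp [hp]) (by simp [hb])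
    · intro q hq
      rw [← List.append_assoc] at hq
      rcases List.mem_append.1 (mem_left_of_pair_sublist hq h.cutData.notMem_H) with hq | hq
      · by_cases hqc : q = c
        · exact Or.inl (hqc ▸ hl)
        · exact Or.inl (R.tree.left_trans _ _ _ (h.left_c hq hqc) hl)
      · by_cases hqb : q = b
        · exact Or.inr hqb
        · exact Or.inl (h.left_b hq hqb)
    · intro p hp hp'
      rcases List.mem_cons.1 hp with rfl | hp
      · exact absurd (by simpa using Or.inr hp') h.notMem
      · have hpS : p ∉ S := fun hS => h.cutData.notMem_G_of_mem_S hS hp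
        have hpT : p ∉ T := fun hT => h.cutData.notMem_left hT (by simp [hp])
        have hpH : p ∈ H := by simpa [hpS, hpT] using hp'
        refine R.horiz p b (h.sublist ?_)
        exact (List.singleton_sublist.2 (by simp [hp] : p ∈ G ++ S)).append
          (pair_sublist_append hb hpH)
    · intro q hq
      exact absurd (hq.subset (by simp)) hbG

/-- The additional `c` encloses `T`; the pattern `c b c` forces `b` to the left of `c`, and the
other vertices of `T` are to the left of `b`. -/
theorem exists_right_iff :
    (∃ Q : Quilt n, Q.word.letters = r :: (((G ++ S) ++ T) ++ c :: H) ∧ Q.tree = R.tree) ↔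
      R.tree.left b c := by
  have hcb := h.cutData.c_ne_b
  have hc := h.cutData.c_mem
  have hb := h.cutData.b_mem
  have hcH : c ∉ H := fun hH => h.cutData.notMem_TH (by simp [hH])
  have hrc : r ≠ c := fun e => h.notMem (by simp [e, hc])
  constructor
  · rintro ⟨Q, hQ, hT⟩
    rw [← hT]
    refine (Q.horiz c b ?_).resolve_right hcb.symm
    rw [hQ]
    refine List.Sublist.cons _ ?_
    exact (pair_sublist_append (List.mem_append_right G hc) hb).append (by simp : [c].Sublist _)
  · intro hl
    refine exists_quilt_insert R (A := r :: ((G ++ S) ++ T)) (B := H) (x := c)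
        (by rw [h.letters]; simp) ?_ ?_ ?_ ?_ ?_ ?_ ?_
    · rintro A' y e rfl
      obtain ⟨T', hT'⟩ := h.cutData.lastT
      rw [hT', ← List.append_assoc, ← List.cons_append] at e
      have := (List.append_inj' e rfl).2
      simp only [List.cons.injEq, and_true] at this
      exact hcb this.symm
    · rintro y B' rfl rfl
      exact hcH (by simp)
    · exact fun q hq => h.not_lt_right (by simp [hc]) (by simp [hq])
    · intro p hp
      rcases List.mem_cons.1 hp with rfl | hp
      · exact h.not_lt_root c
      · rcases List.mem_append.1 hp with hp | hp
        · rcases List.mem_append.1 hp with hp | hp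
          · exact h.not_lt_GS hp hc
          · by_cases hpc : p = c
            · exact fun e => e.2 hpc.symm
            · exact fun e => (PTree.left_not_le (h.left_c hp hpc)).2 e.1
        · intro e
          by_cases hpb : p = b
          · exact (PTree.left_not_le hl).2 (hpb ▸ e.1)
          · exact (PTree.left_not_le (R.tree.left_trans _ _ _ (h.left_b hp hpb) hl)).2 e.1
    · intro q hq
      exact absurd (hq.subset (by simp)) hcH
    · intro p hp hp'
      rcases List.mem_cons.1 hp with rfl | hp
      · exact absurd (by simp [hp']) h.notMem
      · have hpS : p ∉ S := fun hS => h.cutData.notMem_right hS (by simp [hp'])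
        have hpT : p ∉ T := fun hT => h.cutData.notMem_H_of_mem_T hT hp'
        have hpG : p ∈ G := by simpa [hpS, hpT] using hp
        refine R.horiz p c (h.sublist ?_)
        exact (pair_sublist_append hpG hc).append
          (List.singleton_sublist.2 (by simp [hp'] : p ∈ T ++ H))
    · intro q hq
      rw [List.append_assoc, ← List.cons_append] at hq
      have hcG : c ∉ r :: G := by
        have := h.cutData.notMem_G
        simp [hrc.symm, this]
      rcases List.mem_append.1 (mem_right_of_pair_sublist hq hcG) with hq | hq
      · by_cases hqc : q = c
        · exact Or.inr hqc
        · exact Or.inl (h.left_c hq hqc)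
      · by_cases hqb : q = b
        · exact Or.inl (hqb ▸ hl)
        · exact Or.inl (R.tree.left_trans _ _ _ (h.left_b hq hqb) hl)

end Quilt.HasCut

end QuiltCut
end QuiltOp

namespace QuiltOp

/-! ### The coefficient of a one-cut quilt in the boundary of `L0` -/

section FaceSigns

set_option linter.unusedSectionVars false

theorem caesurasBefore_congr {α : Type*} [DecidableEq α] (M : List α) {N N' : List α}
    (h : ∀ x, x ∈ N ↔ x ∈ N') : caesurasBefore M N = caesurasBefore M N' := by
  induction M with
  | nil => rfl
  | cons a M ih => simp only [caesurasBefore, List.mem_append, h, ih]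

variable {n : ℕ}

theorem Quilt.sgnK_congr {Q R : Quilt n} (h : ∀ a b, Q.word.letters.idxOf a <
    Q.word.letters.idxOf b ↔ R.word.letters.idxOf a < R.word.letters.idxOf b) :
    Q.sgnK = R.sgnK := by
  rw [Quilt.sgnK, Quilt.sgnK, listSign_congr fun a _ b _ => h a b]

theorem Quilt.nodup_map_idxOf (Q : Quilt n) :
    ((List.finRange n).map fun u => Q.word.letters.idxOf u).Nodup :=
  (List.nodup_finRange n).map fun u _ h => (List.idxOf_inj (Q.word.surjective u)).1 h

/-- The effect on the sign of moving the first occurrence of a vertex across other vertices. -/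
theorem Quilt.sgnK_move {Q R : Quilt n} {A S B : List (Fin n)} {b : Fin n}
    (hQ : Q.word.letters = A ++ b :: (S ++ b :: B)) (hR : R.word.letters = A ++ (S ++ b :: B))
    (hA : b ∉ A) (hS : b ∉ S) (hAS : ∀ x ∈ S, x ∉ A) :
    Q.sgnK = (-1) ^ S.toFinset.card * R.sgnK := by
  have hltA : ∀ a ∈ A, A.idxOf a < A.length := fun a ha => List.idxOf_lt_length_of_mem ha
  have hltS : ∀ a ∈ S, S.idxOf a < S.length := fun a ha => List.idxOf_lt_length_of_mem ha
  have e₁ : ∀ a, a ≠ b → ∀ a', a' ≠ b → (Q.word.letters.idxOf a < Q.word.letters.idxOf a' ↔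
      R.word.letters.idxOf a < R.word.letters.idxOf a') := by
    intro a ha a' ha'
    rw [hQ, hR]
    simp only [List.idxOf_append, List.idxOf_cons_ne _ (Ne.symm ha),
      List.idxOf_cons_ne _ (Ne.symm ha')]
    have := hltA a
    have := hltA a'
    clear hltA hltS
    split_ifs <;> grind
  have e₂ : ∀ a, a ≠ b → (Q.word.letters.idxOf a < Q.word.letters.idxOf b ↔ a ∈ A) := by
    intro a ha
    rw [hQ, List.idxOf_append_of_notMem hA, List.idxOf_cons_self]
    have := hltA a
    by_cases haA : a ∈ A
    · simp [List.idxOf_append, haA, this haA]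
    · simp [List.idxOf_append, haA]
  have e₃ : ∀ a, a ≠ b → (R.word.letters.idxOf a < R.word.letters.idxOf b ↔ a ∈ A ∨ a ∈ S) := by
    intro a ha
    rw [hR, List.idxOf_append_of_notMem hA, List.idxOf_append_of_notMem hS, List.idxOf_cons_self]
    have h₁ := hltA a
    have h₂ := hltS a
    by_cases haA : a ∈ A
    · have := h₁ haA
      simp only [List.idxOf_append, haA, if_true, true_or, iff_true]
      omega
    · by_cases haS : a ∈ S
      · have := h₂ haS
        simp only [List.idxOf_append, haA, haS, if_true, if_false, or_true, iff_true]
        omega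
      · simp only [List.idxOf_append, haA, haS, if_false, or_self, iff_false]
        omega
  have hp : (List.finRange n).Perm (b :: (List.finRange n).erase b) :=
    List.perm_cons_erase (List.mem_finRange b)
  -- With `b` listed first, the remaining vertices have the same relative order in both words, and
  -- the signs differ only by inversions that involve `b`. These are counted by the vertices before
  -- `b`, among which those of `S` make the difference.
  have key := listSign_mul_perm hp Q.nodup_map_idxOf R.nodup_map_idxOf
  have hne : ∀ a ∈ (List.finRange n).erase b, a ≠ b := fun a ha =>
    ((List.nodup_finRange n).mem_erase_iff.1 ha).1
  rw [List.map_cons, List.map_cons, listSign, listSign, List.countP_map, List.countP_map,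
    listSign_congr (f := fun u => Q.word.letters.idxOf u) (g := fun u => R.word.letters.idxOf u)
      fun a ha a' ha' => e₁ a (hne a ha) a' (hne a' ha'), mul_mul_mul_comm, listSign_mul_self,
    mul_one] at key
  have c₁ : ((List.finRange n).erase b).countP
      ((fun x => decide (x < Q.word.letters.idxOf b)) ∘ fun u => Q.word.letters.idxOf u) =
      ((List.finRange n).erase b).countP (fun a => decide (a ∈ A)) :=
    List.countP_congr fun a ha => by simpa using e₂ a (hne a ha)
  have c₂ : ((List.finRange n).erase b).countP
      ((fun x => decide (x < R.word.letters.idxOf b)) ∘ fun u => R.word.letters.idxOf u) =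
      ((List.finRange n).erase b).countP (fun a => decide (a ∈ A)) +
      ((List.finRange n).erase b).countP (fun a => decide (a ∈ S)) := by
    rw [List.countP_congr (q := fun a => decide (a ∈ A ∨ a ∈ S))
      fun a ha => by simpa using e₃ a (hne a ha)]
    induction (List.finRange n).erase b with
    | nil => rfl
    | cons a L ih =>
      simp only [List.countP_cons, ih, decide_eq_true_eq]
      have := hAS a
      by_cases h₁ : a ∈ A <;> by_cases h₂ : a ∈ S <;> simp_all <;> omega
  have c₃ : ((List.finRange n).erase b).countP (fun a => decide (a ∈ S)) = S.toFinset.card := by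
    rw [List.countP_eq_length_filter,
      ← List.toFinset_card_of_nodup (((List.nodup_finRange n).erase b).filter _)]
    congr 1
    ext a
    simp only [List.mem_toFinset, List.mem_filter, (List.nodup_finRange n).mem_erase_iff,
      List.mem_finRange, and_true, decide_eq_true_eq]
    exact ⟨fun h => h.2, fun h => ⟨fun e => hS (e ▸ h), h⟩⟩
  rw [c₁, c₂, c₃, pow_add, ← mul_assoc, ← mul_pow, neg_one_mul, neg_neg, one_pow, one_mul] at key
  have sq := listSign_mul_self ((List.finRange n).map fun u => R.word.letters.idxOf u)
  rw [Quilt.sgnK, Quilt.sgnK]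
  linear_combination (-1) ^ (1 + n * (n - 1) / 2) *
    listSign ((List.finRange n).map fun u => R.word.letters.idxOf u) * key -
    (-1) ^ (1 + n * (n - 1) / 2) *
    listSign ((List.finRange n).map fun u => Q.word.letters.idxOf u) * sq

theorem faceSum_cons_of_notMem {α : Type*} [DecidableEq α] {a : α} {L : List α} (h : a ∉ L)
    (φ : List α → ℤ) : faceSum (a :: L) φ = faceSum L fun M => φ (a :: M) := by
  rw [faceSum, if_neg h, if_neg (count_ne_one h), if_neg h]
  simp

namespace Quilt.HasCut

variable {R : Quilt n} {r c b : Fin n} {G S T H : List (Fin n)} (h : R.HasCut r G S T H c b)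
include h

/-- The order of first occurrences is unchanged. The deleted letter is a caesura, preceded by one
caesura fewer than there are vertices in `G ++ S`. -/
theorem faceSum_outer {Q : Quilt n} {u : Fin n} {G' H' : List (Fin n)} (hG : G = G' ++ [u])
    (hH : H = u :: H') (hQ : Q.word.letters = r :: ((G ++ S) ++ u :: (T ++ H))) :
    Q.sgnK * faceSum Q.word.letters (fun M => if M = R.word.letters then 1 else 0) =
      (-1) ^ (G ++ S).toFinset.card * R.sgnK := by
  have huH : u ∈ T ++ H := by simp [hH]
  have e : Q.word.letters = (r :: (G ++ S)) ++ u :: (T ++ H) := hQ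
  have e' : R.word.letters = (r :: (G ++ S)) ++ (T ++ H) := h.letters
  have hs : Q.sgnK = R.sgnK := Quilt.sgnK_congr fun x y => by
    rw [e, e']
    exact idxOf_insert_lt_iff (by simp [hG]) x y
  have hr : r ∉ (G ++ S) ++ u :: (T ++ H) := by
    have h₁ := h.notMem
    have h₂ : r ≠ u := fun e => h₁ (by simp [e, hG])
    simp only [List.mem_append, List.mem_cons] at h₁ ⊢
    tauto
  rw [e, e', faceSum_single_of_mem (e ▸ Q.word.reduced.chain) huH, caesurasBefore,
    if_neg (by simpa using hr), caesurasBefore_congr (N' := T ++ H), ← h.cutData.caesurasBefore_left, hs]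
  · ring
  · intro x
    simp only [List.mem_cons, or_iff_right_iff_imp]
    rintro rfl
    exact huH

/-- Moving the first `b` across `S` changes the order of first occurrences by one transposition for
each vertex of `S`. As a caesura, the deleted letter has number one more than the number of vertices
of `G`. -/
theorem faceSum_left {Q : Quilt n} (hQ : Q.word.letters = r :: (G ++ b :: (S ++ (T ++ H)))) :
    Q.sgnK * faceSum Q.word.letters (fun M => if M = R.word.letters then 1 else 0) =
      -((-1) ^ (G ++ S).toFinset.card * R.sgnK) := by
  have hbT := h.cutData.b_mem
  have e : Q.word.letters = (r :: G) ++ b :: (S ++ (T ++ H)) := hQ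
  have e' : R.word.letters = (r :: G) ++ (S ++ (T ++ H)) := by rw [h.letters]; simp
  have hr := h.notMem
  have hrb : r ≠ b := fun e => hr (by simp [e, hbT])
  have hbGS := h.cutData.notMem_GS
  obtain ⟨T', hT'⟩ := h.cutData.headT
  have hs : Q.sgnK = (-1) ^ S.toFinset.card * R.sgnK := by
    refine Quilt.sgnK_move (A := r :: G) (B := T' ++ H) (b := b) (by rw [e, hT']; simp)
      (by rw [e', hT']; simp) ?_ ?_ ?_
    · simp only [List.mem_append, List.mem_cons] at hbGS ⊢
      rintro (h | h)
      · exact hrb h.symm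
      · exact hbGS (Or.inl h)
    · exact fun h => hbGS (List.mem_append_right _ h)
    · intro x hx hx'
      rcases List.mem_cons.1 hx' with rfl | hx'
      · exact hr (by simp [hx])
      · exact h.cutData.notMem_G_of_mem_S hx hx'
  rw [e, e', faceSum_single_of_mem (e ▸ Q.word.reduced.chain) (by simp [hbT]), caesurasBefore,
    if_neg, caesurasBefore_congr (N' := S ++ (T ++ H)), h.cutData.caesurasBefore_G, hs,
    h.cutData.card_left]
  · ring
  · intro x
    simp only [List.mem_cons, or_iff_right_iff_imp]
    rintro rfl
    simp [hbT]
  · simp only [List.mem_append, List.mem_cons] at hr ⊢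
    tauto

/-- The order of first occurrences is unchanged. The deleted letter is a last occurrence, and its
previous one, at the end of `S`, is a caesura whose number is the number of vertices of `G ++ S`. -/
theorem faceSum_right {Q : Quilt n} (hQ : Q.word.letters = r :: (((G ++ S) ++ T) ++ c :: H)) :
    Q.sgnK * faceSum Q.word.letters (fun M => if M = R.word.letters then 1 else 0) =
      -((-1) ^ (G ++ S).toFinset.card * R.sgnK) := by
  have hc := h.cutData.c_mem
  have hcTH := h.cutData.notMem_TH
  obtain ⟨S', hS'⟩ := h.cutData.lastS
  have e : Q.word.letters = (r :: (G ++ S')) ++ c :: (T ++ c :: H) := by rw [hQ, hS']; simp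
  have e' : R.word.letters = (r :: (G ++ S')) ++ c :: (T ++ H) := by rw [h.letters, hS']; simp
  have hr := h.notMem
  have hs : Q.sgnK = R.sgnK := Quilt.sgnK_congr fun x y => by
    have e₁ : Q.word.letters = (r :: ((G ++ S) ++ T)) ++ c :: H := hQ
    have e₂ : R.word.letters = (r :: ((G ++ S) ++ T)) ++ H := by rw [h.letters]; simp
    rw [e₁, e₂]
    exact idxOf_insert_lt_iff (by simp [hc]) x y
  rw [e, e', faceSum_single_last (e ▸ Q.word.reduced.chain)
      (fun h => hcTH (List.mem_append_left _ h)) (fun h => hcTH (List.mem_append_right _ h)),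
    caesurasBefore, if_neg, caesurasBefore_congr (N' := c :: (T ++ H)),
    ← h.cutData.caesurasBefore_concat hS', hs]
  · ring
  · intro x
    simp only [List.mem_cons, List.mem_append]
    tauto
  · rw [hS'] at hr
    have hrc : r ≠ c := fun e => hr (by simp [e])
    simp only [List.mem_append, List.mem_cons] at hr ⊢
    tauto

open Classical in
/-- The coefficient of `R` in the boundary of the sum of all maximal quilts. -/
theorem evalAt_bd_L0 (hR : R.deg = (n : ℤ) - 3) :
    evalAt (fun W T => if W = R.word.letters ∧ T = R.tree then 1 else 0)
      (quiltOperad.bd (e := (n : ℤ) - 3) (by omega) (L0 n)) =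
    (-1) ^ (G ++ S).toFinset.card * R.sgnK * ((if G = [] then 0 else 1) -
      (if R.tree.left c b then 1 else 0) - (if R.tree.left b c then 1 else 0)) := by
  set ε : ℤ := (-1) ^ (G ++ S).toFinset.card * R.sgnK with hε
  have hcb := h.cutData.c_ne_b
  obtain ⟨S', hS'⟩ := h.cutData.headS
  obtain ⟨T', hT'⟩ := h.cutData.headT
  -- The three ways to close the cut. They exclude each other, and each is realised by at most one
  -- quilt.
  let P₁ : Quilt n → Prop := fun Q => ∃ u G' H', G = G' ++ [u] ∧ H = u :: H' ∧
      Q.word.letters = r :: ((G ++ S) ++ u :: (T ++ H)) ∧ Q.tree = R.tree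
  let P₂ : Quilt n → Prop := fun Q =>
    Q.word.letters = r :: (G ++ b :: (S ++ (T ++ H))) ∧ Q.tree = R.tree
  let P₃ : Quilt n → Prop := fun Q =>
    Q.word.letters = r :: (((G ++ S) ++ T) ++ c :: H) ∧ Q.tree = R.tree
  have h₁₂ : ∀ Q, P₁ Q → ¬ P₂ Q := by
    rintro Q ⟨u, G', H', -, -, e, -⟩ ⟨e', -⟩
    rw [e, hS'] at e'
    simp [hcb] at e'
  have h₂₃ : ∀ Q, P₂ Q → ¬ P₃ Q := by
    rintro Q ⟨e, -⟩ ⟨e', -⟩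
    rw [e, hS'] at e'
    simp [hcb.symm] at e'
  have h₁₃ : ∀ Q, P₁ Q → ¬ P₃ Q := by
    rintro Q ⟨u, G', H', hG, -, e, -⟩ ⟨e', -⟩
    rw [e, hT'] at e'
    have hub : u ≠ b := fun e => h.cutData.notMem_GS (by simp [hG, e])
    simp [hub] at e'
  have hterm : ∀ Q : Quilt n, Q.sgnK * faceSum Q.word.letters
      (fun M => if M = R.word.letters ∧ Q.tree = R.tree then 1 else 0) =
      (if P₁ Q then ε else 0) + (if P₂ Q then -ε else 0) + (if P₃ Q then -ε else 0) := by
    intro Q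
    by_cases hT : Q.tree = R.tree
    · simp only [hT, and_true]
      by_cases q₁ : P₁ Q
      · rw [if_pos q₁, if_neg (h₁₂ Q q₁), if_neg (h₁₃ Q q₁), add_zero, add_zero]
        obtain ⟨u, G', H', hG, hH, hQ, -⟩ := q₁
        exact h.faceSum_outer hG hH hQ
      by_cases q₂ : P₂ Q
      · rw [if_neg q₁, if_pos q₂, if_neg (h₂₃ Q q₂), zero_add, add_zero]
        exact h.faceSum_left q₂.1
      by_cases q₃ : P₃ Q
      · rw [if_neg q₁, if_neg q₂, if_pos q₃, zero_add, zero_add]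
        exact h.faceSum_right q₃.1
      rw [if_neg q₁, if_neg q₂, if_neg q₃]
      -- A quilt of none of the three kinds does not have the word of `R` as a face, by
      -- `CutData.face_cases` for the word without its root.
      obtain ⟨K, hK, hrK⟩ := Q.exists_letters_eq r (by rw [hT]; exact h.root)
      have hred := Q.word.reduced
      rw [hK] at hred
      rw [hK, faceSum_cons_of_notMem hrK, faceSum_congr (ψ := fun _ => 0), faceSum_zero]
      · simp
      · intro M hM
        refine if_neg fun e => ?_
        rw [h.letters] at e
        rw [(List.cons.inj e).2] at hM
        rcases h.cutData.face_cases hred.tail hM with ⟨u, G', H', hG, hH, rfl⟩ | rfl | rfl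
        · exact q₁ ⟨u, G', H', hG, hH, hK, hT⟩
        · exact q₂ ⟨hK, hT⟩
        · exact q₃ ⟨hK, hT⟩
    · rw [if_neg (fun q => hT q.choose_spec.choose_spec.choose_spec.2.2.2),
        if_neg (fun q => hT q.2), if_neg (fun q => hT q.2)]
      simp only [hT, and_false, if_false, faceSum_zero]
      simp
  have hdeg : ∀ Q : Quilt n, Q.word.letters.length = R.word.letters.length + 1 →
      Q.deg = (n : ℤ) - 2 := by
    intro Q hQ
    rw [Quilt.deg] at hR ⊢
    omega
  have hex : ∀ P : Quilt n → Prop, (∀ Q, P Q → Q.word.letters.length =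
      R.word.letters.length + 1) → ((∃ Q : GQuilt n ((n : ℤ) - 2), P Q.1) ↔ ∃ Q, P Q) :=
    fun P hP => ⟨fun ⟨Q, hQ⟩ => ⟨Q.1, hQ⟩, fun ⟨Q, hQ⟩ => ⟨⟨Q, hdeg Q (hP Q hQ)⟩, hQ⟩⟩
  rw [evalAt_bd, evalAt_L0, Finset.sum_congr rfl fun Q _ => hterm Q.1,
    Finset.sum_add_distrib, Finset.sum_add_distrib,
    sum_ite_exists (p := fun Q : GQuilt n ((n : ℤ) - 2) => P₁ Q.1),
    sum_ite_exists (p := fun Q : GQuilt n ((n : ℤ) - 2) => P₂ Q.1),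
    sum_ite_exists (p := fun Q : GQuilt n ((n : ℤ) - 2) => P₃ Q.1)]
  · have e₁ := (hex P₁ (by
      rintro Q ⟨u, G', H', -, -, hQ, -⟩
      rw [hQ, h.letters]
      simp
      omega)).trans h.exists_outer_iff
    have e₂ := (hex P₂ (by
      rintro Q ⟨hQ, -⟩
      rw [hQ, h.letters]
      simp
      omega)).trans h.exists_left_iff
    have e₃ := (hex P₃ (by
      rintro Q ⟨hQ, -⟩
      rw [hQ, h.letters]
      simp
      omega)).trans h.exists_right_iff
    simp only [e₁, e₂, e₃, ne_eq]
    split_ifs <;> ring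
  · exact fun Q Q' hQ hQ' => GQuilt.ext' (hQ.1.trans hQ'.1.symm) (hQ.2.trans hQ'.2.symm)
  · exact fun Q Q' hQ hQ' => GQuilt.ext' (hQ.1.trans hQ'.1.symm) (hQ.2.trans hQ'.2.symm)
  · rintro Q Q' ⟨u, G', H', hG, -, hQ, hT⟩ ⟨u', G'', H'', hG', -, hQ', hT'⟩
    obtain rfl : u = u' := by
      rw [hG] at hG'
      simpa using (List.append_inj' hG' rfl).2
    exact GQuilt.ext' (hQ.trans hQ'.symm) (hT.trans hT'.symm)

end Quilt.HasCut

end FaceSigns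
end QuiltOp

namespace QuiltOp

/-! ### The blocks of labels that occur in compositions of maximal quilts -/

section DestutterSplit

set_option linter.unusedSectionVars false

variable {α : Type*} [DecidableEq α]

theorem mem_destutter_iff {L : List α} {x : α} : x ∈ L.destutter (· ≠ ·) ↔ x ∈ L :=
  ⟨fun h => (List.destutter_sublist _ L).subset h, fun h =>
    List.singleton_sublist.1 (sublist_destutter (List.isChain_singleton x)
      (List.singleton_sublist.2 h))⟩

/-- If a vertex occurs only at the start after elimination of consecutive repetitions, then all
its occurrences are at the start. -/
theorem exists_split_of_destutter {L V : List α} {i : α} (h : L.destutter (· ≠ ·) = i :: V)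
    (hi : i ∉ V) : ∃ L₁ L₂, L = L₁ ++ [i] ++ L₂ ∧ (∀ x ∈ L₁, x = i) ∧ i ∉ L₂ ∧
      L₂.destutter (· ≠ ·) = V := by
  induction L with
  | nil => simp at h
  | cons a L ih =>
    by_cases hL : L.head? = some a
    · obtain ⟨M, hM⟩ := List.head?_eq_some_iff.1 ((head?_destutter L).trans hL)
      rw [destutter_cons_of_head hM, ← hM] at h
      obtain ⟨L₁, L₂, rfl, h₁, h₂⟩ := ih h
      refine ⟨a :: L₁, L₂, rfl, ?_, h₂⟩
      simp only [List.mem_cons, forall_eq_or_imp]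
      refine ⟨?_, h₁⟩
      cases L₁ with
      | nil => simpa using hL.symm
      | cons d L₁ =>
        have hd : d = a := by simpa using hL
        rw [← hd]
        exact h₁ d (by simp)
    · rw [destutter_cons_of_ne (fun b hb e => hL (by rw [e]; exact hb))] at h
      obtain ⟨rfl, rfl⟩ := List.cons.inj h
      exact ⟨[], L, rfl, by simp, fun h => hi (mem_destutter_iff.2 h), rfl⟩

end DestutterSplit

variable {m n l : ℕ}

/-- The count of `Reduced.length_cuts`, applied to the word without its root: there remain `n - 1`
vertices, and the root is not a caesura. Thus maximal quilts have no cut, and those one degree below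
have exactly one. -/
theorem Quilt.length_cuts (Q : Quilt n) {r : Fin n} {F : List (Fin n)} (hn : 2 ≤ n)
    (hQ : Q.word.letters = r :: F) (hr : r ∉ F) :
    ((cuts [] F).length : ℤ) + Q.deg = (n : ℤ) - 2 := by
  have hcard : F.toFinset.card + 1 = n := by
    have : insert r F.toFinset = (Finset.univ : Finset (Fin n)) := by
      ext x
      have := Q.word.surjective x
      rw [hQ] at this
      simpa using this
    rw [← Finset.card_insert_of_notMem (by simpa using hr), this]
    simp
  have hF : F ≠ [] := by
    rintro rfl
    simp at hcard
    omega
  have hred := Q.word.reduced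
  rw [hQ] at hred
  have h₁ := hred.tail.length_cuts hF
  have h₂ := Q.deg_eq
  rw [hQ, caesuras, if_neg hr] at h₂
  omega

namespace Quilt.IsExt

variable {hl : l + 1 = m + n} {i : Fin m} {P : Quilt m} {Q : Quilt n} {R : Quilt l}
  (he : Quilt.IsExt hl i P Q R)
include he

theorem listExt : ListExt i (blockOut hl i) (blockIn hl i) P.word.letters Q.word.letters
    R.word.letters :=
  (isWordExt_iff_listExt hl i _ _ _).1 he.1

theorem map_sublist {L : List (Fin m)} (hL : L.IsChain (· ≠ ·))
    (h : L.Sublist (R.word.letters.map (blockOut hl i))) : L.Sublist P.word.letters := by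
  rw [← he.listExt.quot]
  exact sublist_destutter hL h

variable {r c b : Fin l} {G S T H : List (Fin l)} (h : R.HasCut r G S T H c b)
include h

/-- If the block contains the root, then `i` is the root of `P` and occurs only at the start of its
word. Hence the block letters form an initial segment of the word of `R`, and the place where it
ends is a cut. A letter common to `G` and `H` would lie both in and outside the block. -/
theorem block_eq_of_root (hm : 2 ≤ m) (hn : 2 ≤ n) (hr : blockOut hl i r = i) :
    G = [] ∧ ∀ x, blockOut hl i x = i ↔ x = r ∨ x ∈ S := by
  obtain ⟨j₀, hj₀⟩ := (blockOut_eq_self_iff hl i r).1 hr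
  have hroot : ∀ u, P.tree.le i u := by
    intro u
    have := he.2.le_out (h.root (blockSec hl i j₀ u))
    rwa [hr, blockOut_blockSec] at this
  obtain ⟨V, hV, hiV⟩ := P.exists_letters_eq i hroot
  have hq := he.listExt.quot
  rw [hV] at hq
  obtain ⟨L₁, L₂, hX, h₁, h₂, -⟩ := exists_split_of_destutter hq hiV
  obtain ⟨X₁, X₂, hX, hX₁, rfl⟩ := List.map_eq_append_iff.1 hX
  have h₁ : ∀ x ∈ X₁, blockOut hl i x = i := by
    intro x hx
    have : blockOut hl i x ∈ L₁ ++ [i] := hX₁ ▸ List.mem_map_of_mem hx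
    rcases List.mem_append.1 this with h | h
    · exact h₁ _ h
    · simpa using h
  have h₂ : ∀ x ∈ X₂, blockOut hl i x ≠ i := fun x hx e =>
    h₂ (List.mem_map.2 ⟨x, hx, e⟩)
  cases X₁ with
  | nil => simp at hX₁
  | cons r' F₁ =>
    rw [h.letters, List.cons_append] at hX
    obtain ⟨rfl, hF⟩ := List.cons.inj hX
    have hmem : ∀ x, blockOut hl i x = i → x = r ∨ x ∈ F₁ := by
      intro x hx
      have := R.word.surjective x
      rw [h.letters, hF] at this
      simp only [List.mem_cons, List.mem_append] at this
      rcases this with h | h | h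
      · exact Or.inl h
      · exact Or.inr h
      · exact absurd hx (h₂ x h)
    obtain ⟨F₁, y, rfl⟩ : ∃ F y, F₁ = F ++ [y] := by
      rcases List.eq_nil_or_concat' F₁ with rfl | h
      · exfalso
        obtain ⟨j, hj⟩ : ∃ j : Fin n, j ≠ j₀ := by
          have : Nontrivial (Fin n) := Fin.nontrivial_iff_two_le.2 hn
          exact exists_ne j₀
        rcases hmem (blockIn hl i j) (blockOut_blockIn hl i j) with e | e
        · exact hj (blockIn_injective hl i (e.trans hj₀.symm))
        · simp at e
      · exact h
    obtain ⟨z, X₂, rfl⟩ : ∃ z X, X₂ = z :: X := by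
      cases X₂ with
      | nil =>
        exfalso
        obtain ⟨v, hv⟩ : ∃ v : Fin m, v ≠ i := by
          have : Nontrivial (Fin m) := Fin.nontrivial_iff_two_le.2 hm
          exact exists_ne i
        have := R.word.surjective (blockSec hl i j₀ v)
        rw [h.letters, hF] at this
        refine hv ?_
        rw [← blockOut_blockSec hl i j₀ v]
        exact h₁ _ (by simpa using this)
      | cons z X => exact ⟨z, X, rfl⟩
    obtain ⟨e₁, e₂⟩ := h.cutData.unique F₁ y z X₂ (by rw [hF]; simp)
      (fun hy => h₂ y hy (h₁ y (by simp)))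
      (fun hz => h₂ z (by simp) (h₁ z (List.mem_cons_of_mem _ hz)))
    have hG : G = [] := by
      rcases h.cutData.outer with ⟨hG, -⟩ | ⟨u, G', H', hG, hH⟩
      · exact hG
      · exfalso
        refine h₂ u ?_ (h₁ u (List.mem_cons_of_mem _ ?_))
        · rw [e₂, hH]
          simp
        · rw [e₁, hG]
          simp
    refine ⟨hG, fun x => ⟨fun hx => ?_, fun hx => ?_⟩⟩
    · have := hmem x hx
      rwa [e₁, hG] at this
    · refine h₁ x ?_
      rw [e₁, hG]
      simpa using hx

/-- As `Q` is maximal, its word is its root `w₀` followed by a list without cuts, which begins and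
ends with the same `w₁`. In `R`, the place after the last `w₀` is a cut, so `w₀` and `w₁` become `c`
and `b`, and the rest of the block lies in `T`. Conversely, a vertex of `T` outside the block lies
between letters of the block; in `P` it is then to the left of `i`, so it is no descendant of `c`.
-/
theorem block_eq_of_not_root (hn : 2 ≤ n) (hQ : Q.deg = (n : ℤ) - 2)
    (hr : blockOut hl i r ≠ i) : R.tree.le c b ∧
      ∀ x, blockOut hl i x = i ↔ x = c ∨ (x ∈ T ∧ R.tree.le c x) := by
  have hw₀ := Q.tree.rootVertex_le
  set w₀ := Q.tree.rootVertex
  obtain ⟨W, hW, hwW⟩ := Q.exists_letters_eq w₀ hw₀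
  have hcuts : cuts [] W = [] := by
    have := Q.length_cuts hn hW hwW
    exact List.length_eq_zero_iff.1 (by omega)
  have hsub := he.listExt.sub
  have hinj := blockIn_injective hl i
  rw [hW, List.map_cons] at hsub
  obtain ⟨L₁, L₂, hX, h₁, h₂, h₃⟩ := exists_split_of_destutter hsub (by
    rw [List.mem_map_of_injective hinj]
    exact hwW)
  have hblock : ∀ x, blockOut hl i x = i → x ∈ L₁ ++ [blockIn hl i w₀] ++ L₂ := by
    intro x hx
    rw [← hX]
    simpa [hx] using R.word.surjective x
  obtain ⟨A, B, hAB, hB⟩ := exists_last_mem (R.word.surjective (blockIn hl i w₀))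
  rw [hAB, List.filter_append, List.filter_cons_of_pos (by simp [blockOut_blockIn])] at hX
  obtain ⟨hA', hB'⟩ := append_cons_inj_of_notMem (by simpa using hX)
    (fun e => hB (List.mem_filter.1 e).1) h₂
  obtain ⟨w₁, W', rfl⟩ : ∃ w W', W = w :: W' := by
    cases W with
    | nil =>
      exfalso
      obtain ⟨j, hj⟩ : ∃ j : Fin n, j ≠ w₀ := by
        have : Nontrivial (Fin n) := Fin.nontrivial_iff_two_le.2 hn
        exact exists_ne w₀
      have := Q.word.surjective j
      rw [hW] at this
      exact hj (by simpa using this)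
    | cons w W' => exact ⟨w, W', rfl⟩
  have hred : Reduced (w₁ :: W') := by
    have := Q.word.reduced
    rw [hW] at this
    exact this.tail
  obtain ⟨L₂, rfl⟩ : ∃ L, L₂ = blockIn hl i w₁ :: L := by
    cases L₂ with
    | nil => simp at h₃
    | cons d L =>
      have := head?_destutter (d :: L)
      rw [h₃] at this
      simp only [List.map_cons, List.head?_cons, Option.some.injEq] at this
      exact ⟨L, by rw [this]⟩
  obtain ⟨Y, B', rfl, hY, hb, hL₂⟩ := List.filter_eq_cons_iff.1 hB'
  have hne : w₀ ≠ w₁ := fun e => hwW (by simp [e])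
  -- If other letters came between `w₀` and `w₁`, the gap condition would make these two equal.
  obtain rfl : Y = [] := by
    by_contra hY'
    refine hne (he.listExt.gap w₀ w₁ Y hY' (fun y hy => by simpa using hY y hy) ?_)
    exact ⟨A, B', by rw [hAB]; simp⟩
  rw [List.nil_append] at hAB hB hB'
  cases A with
  | nil =>
    exfalso
    rw [h.letters, List.nil_append] at hAB
    refine hr ?_
    rw [(List.cons.inj hAB).1, blockOut_blockIn]
  | cons r' A =>
    rw [h.letters, List.cons_append] at hAB
    obtain ⟨rfl, hF⟩ := List.cons.inj hAB
    obtain ⟨e₁, e₂⟩ := h.cutData.unique A (blockIn hl i w₀) (blockIn hl i w₁) B' hF hB (by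
      intro hmem
      have hne' : blockIn hl i w₁ ≠ blockIn hl i w₀ := fun e => hne (hinj e).symm
      refine hne' (h₁ _ ?_)
      rw [← hA']
      have : blockIn hl i w₁ ∈ A := by simpa [hne'] using hmem
      simp [this, blockOut_blockIn])
    have hc : blockIn hl i w₀ = c := by
      obtain ⟨S', hS'⟩ := h.cutData.lastS
      rw [hS', ← List.append_assoc] at e₁
      simpa using (List.append_inj' e₁ rfl).2
    have hb : blockIn hl i w₁ = b := by
      obtain ⟨T', hT'⟩ := h.cutData.headT
      rw [hT'] at e₂
      exact (List.cons.inj e₂).1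
    have hle : ∀ x, blockOut hl i x = i → R.tree.le c x := by
      intro x hx
      obtain ⟨j, rfl⟩ := (blockOut_eq_self_iff hl i x).1 hx
      rw [← hc]
      exact ((he.2.isExtOrder hw₀).le_sub w₀ j).1 (hw₀ j)
    have hbb : blockOut hl i b = i := by rw [← hb, blockOut_blockIn]
    have hcc : blockOut hl i c = i := by rw [← hc, blockOut_blockIn]
    refine ⟨hle b hbb, fun x => ⟨fun hx => ?_, ?_⟩⟩
    · by_cases hxc : x = c
      · exact Or.inl hxc
      refine Or.inr ⟨?_, hle x hx⟩
      by_cases hxb : x = b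
      · exact hxb ▸ h.cutData.b_mem
      obtain ⟨S₀, hS₀⟩ := hred.getLast_eq_head hcuts
      have hxL : x ∈ blockIn hl i w₁ :: L₂ := by
        have := hblock x hx
        simp only [List.mem_append, List.mem_singleton] at this
        rcases this with (h | h) | h
        · exact absurd ((h₁ x h).trans hc) hxc
        · exact absurd (h.trans hc) hxc
        · exact h
      have hxW : x ∈ ((S₀ ++ [w₁]).map (blockIn hl i)) := by
        rw [← hS₀, ← h₃, mem_destutter_iff]
        exact hxL
      rw [List.map_append, List.map_cons, List.map_nil, hb] at hxW
      have hpair : [x, b].Sublist ((S₀ ++ [w₁]).map (blockIn hl i)) := by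
        rw [List.map_append, List.map_cons, List.map_nil, hb]
        exact pair_sublist_append (by simpa [hxb] using hxW) (by simp)
      refine mem_left_of_pair_sublist (A := T) (B := H) ?_ h.cutData.notMem_H
      rw [← e₂]
      refine hpair.trans ?_
      rw [← hS₀, ← h₃, ← hB']
      exact (List.destutter_sublist _ _).trans List.filter_sublist
    · rintro (rfl | ⟨hxT, hcx⟩)
      · exact hcc
      · by_contra hx
        have hxb : x ≠ b := fun e => hx (e ▸ hbb)
        have h₄ : [c, x, b].Sublist ((G ++ S) ++ (T ++ H)) :=
          (List.singleton_sublist.2 (List.mem_append_right G h.cutData.c_mem)).append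
            (((List.sublist_cons_self b [x, b]).trans
              (sublist_of_closed h.cutData.headT h.cutData.lastT hxT hxb)).trans
              (List.sublist_append_left _ _))
        have h₅ : [i, blockOut hl i x, i].Sublist P.word.letters := by
          refine he.map_sublist (by simp [hx, Ne.symm hx]) ?_
          have := (h.sublist h₄).map (blockOut hl i)
          simpa [hcc, hbb] using this
        have h₆ := (P.horiz _ _ h₅).resolve_right hx
        exact (PTree.left_not_le (he.2.left_quot x c (by rwa [hcc]))).2 hcx

end Quilt.IsExt

end QuiltOp

namespace QuiltOp

/-! ### Recovering the two factors of a composition from a block -/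

variable {m n l : ℕ}

theorem exists_map_eq {α β : Type*} {g : α → β} {L : List β} (h : ∀ x ∈ L, ∃ j, g j = x) :
    ∃ W : List α, W.map g = L := by
  induction L with
  | nil => exact ⟨[], rfl⟩
  | cons a L ih =>
    obtain ⟨W, rfl⟩ := ih fun x hx => h x (List.mem_cons_of_mem _ hx)
    obtain ⟨j, rfl⟩ := h a (by simp)
    exact ⟨j :: W, rfl⟩

theorem pair_sublist_of_triple_left {α : Type*} {x y z : α} {A B : List α}
    (h : [x, y, z].Sublist (A ++ B)) (hz : z ∉ B) : [x, y].Sublist A := by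
  obtain ⟨l₁, l₂, e, h₁, h₂⟩ := List.sublist_append_iff.1 h
  rcases List.eq_nil_or_concat' l₂ with rfl | ⟨l₂, d, rfl⟩
  · rw [List.append_nil] at e
    exact (by simp : [x, y].Sublist [x, y, z]).trans (e ▸ h₁)
  · rw [← List.append_assoc] at e
    have := (List.append_inj' (show [x, y] ++ [z] = _ from e) rfl).2
    simp only [List.cons.injEq, and_true] at this
    exact absurd (h₂.subset (by simp [this])) hz

/-- A criterion for a block of labels of a quilt to come from an extension. -/
theorem exists_isExt (hl : l + 1 = m + n) (i : Fin m) (w₀ : Fin n) (R : Quilt l)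
    (hw : ∀ j, R.tree.le (blockIn hl i w₀) (blockIn hl i j))
    (hconv : ∀ j k, R.tree.le (blockIn hl i w₀) k → R.tree.le k (blockIn hl i j) →
      blockOut hl i k = i)
    (ha : ∀ w v w', blockOut hl i v ≠ i →
      [blockIn hl i w, v, blockIn hl i w'].Sublist R.word.letters →
      R.tree.left v (blockIn hl i w₀))
    (hb : ∀ v w, blockOut hl i v ≠ i → [v, blockIn hl i w, v].Sublist R.word.letters →
      R.tree.left (blockIn hl i w₀) v)
    (hc : ∀ v w, blockOut hl i v ≠ i → [v, blockIn hl i w].Sublist R.word.letters →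
      ¬ R.tree.le (blockIn hl i w₀) v)
    (hd : ∀ w v, blockOut hl i v ≠ i → [blockIn hl i w, v].Sublist R.word.letters →
      ¬ R.tree.le v (blockIn hl i w₀))
    (hgap : ∀ (r s : Fin n) (Y : List (Fin l)), Y ≠ [] → (∀ y ∈ Y, blockOut hl i y ≠ i) →
      (blockIn hl i r :: (Y ++ [blockIn hl i s])) <:+: R.word.letters → r = s) :
    ∃ (P : Quilt m) (Q : Quilt n), Quilt.IsExt hl i P Q R ∧ P.deg + Q.deg = R.deg := by
  have hinj := blockIn_injective hl i
  have hsec : ∀ k, blockOut hl i k ≠ i → blockSec hl i w₀ (blockOut hl i k) = k :=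
    fun k hk => blockSec_blockOut hl i w₀ hk
  have hself := blockSec_self hl i w₀
  obtain ⟨W, hW⟩ : ∃ W : List (Fin n), W.map (blockIn hl i) =
      (R.word.letters.filter fun x => blockOut hl i x = i).destutter (· ≠ ·) := by
    refine exists_map_eq fun x hx => (blockOut_eq_self_iff hl i x).1 ?_
    simpa using (List.mem_filter.1 (mem_destutter_iff.1 hx)).2
  have hWsub : ∀ L : List (Fin n), L.Sublist W → (L.map (blockIn hl i)).Sublist R.word.letters :=
    fun L hL => (hL.map _).trans
      (hW ▸ (List.destutter_sublist _ _).trans List.filter_sublist)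
  -- The inner factor is the restriction of `R` to the block, with repetitions eliminated.
  obtain ⟨Q, hQ, hQT⟩ : ∃ Q : Quilt n, Q.word.letters = W ∧
      Q.tree = R.tree.restrict (blockIn hl i) hinj w₀ hw := by
    refine exists_quilt ?_ (fun u => ?_) (fun u v h h' => ?_) (fun u v h => ?_)
    · have : (W.map (blockIn hl i)).IsChain (· ≠ ·) := hW ▸ List.isChain_destutter _ _
      rw [List.isChain_map] at this
      exact this.imp fun a b h e => h (e ▸ rfl)
    · have : blockIn hl i u ∈ W.map (blockIn hl i) := by
        rw [hW, mem_destutter_iff, List.mem_filter]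
        exact ⟨R.word.surjective _, by simp [blockOut_blockIn]⟩
      exact (List.mem_map_of_injective hinj).1 this
    · exact R.vert _ _ (hWsub _ h) ⟨(PTree.restrict_le v u).1 h'.1, fun e => h'.2 (hinj e)⟩
    · exact (R.horiz _ _ (hWsub _ h)).imp id fun e => hinj e
  have hroot : ∀ s, R.tree.le (blockSec hl i w₀ (blockOut hl i R.tree.rootVertex))
      (blockSec hl i w₀ s) := by
    intro s
    by_cases hk : blockOut hl i R.tree.rootVertex = i
    · obtain ⟨j, hj⟩ := (blockOut_eq_self_iff hl i _).1 hk
      rw [hk, hself]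
      exact PTree.le_trans (hw j) (hj ▸ R.tree.rootVertex_le _)
    · rw [hsec _ hk]
      exact R.tree.rootVertex_le _
  have hlift : ∀ L : List (Fin m), L.Sublist ((R.word.letters.map (blockOut hl i)).destutter
      (· ≠ ·)) → ∃ M : List (Fin l), M.Sublist R.word.letters ∧ L = M.map (blockOut hl i) :=
    fun L hL => List.sublist_map_iff.1 (hL.trans (List.destutter_sublist _ _))
  -- In the outer factor the root `w₀` represents the block. Patterns of its word are lifted to `R`;
  -- those outside the block are governed by the conditions on `R`, and the mixed ones by `ha`,
  -- `hb`, `hc` and `hd`.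
  obtain ⟨P, hP, hPT⟩ : ∃ P : Quilt m,
      P.word.letters = (R.word.letters.map (blockOut hl i)).destutter (· ≠ ·) ∧
      P.tree = R.tree.restrict (blockSec hl i w₀) (blockSec_injective hl i w₀) _ hroot := by
    refine exists_quilt (List.isChain_destutter _ _) (fun u => ?_) (fun u v h h' => ?_)
      (fun u v h => ?_)
    · rw [mem_destutter_iff]
      exact List.mem_map.2 ⟨blockSec hl i w₀ u, R.word.surjective _, blockOut_blockSec hl i w₀ u⟩
    · obtain ⟨M, hM, e⟩ := hlift _ h
      obtain ⟨x, y, rfl⟩ : ∃ x y, M = [x, y] := by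
        have := congrArg List.length e
        simp only [List.length_map] at this
        exact List.length_eq_two.1 this.symm
      simp only [List.map_cons, List.map_nil, List.cons.injEq, and_true] at e
      obtain ⟨rfl, rfl⟩ := e
      obtain ⟨h₁, h₂⟩ := h'
      rw [PTree.restrict_le] at h₁
      by_cases hx : blockOut hl i x = i <;> by_cases hy : blockOut hl i y = i
      · exact h₂ (hy.trans hx.symm)
      · obtain ⟨j, rfl⟩ := (blockOut_eq_self_iff hl i x).1 hx
        rw [hsec y hy, hx, hself] at h₁
        exact hd j y hy hM h₁
      · obtain ⟨j, rfl⟩ := (blockOut_eq_self_iff hl i y).1 hy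
        rw [hsec x hx, hy, hself] at h₁
        exact hc x j hx hM h₁
      · rw [hsec x hx, hsec y hy] at h₁
        exact R.vert x y hM ⟨h₁, fun e => h₂ (by rw [e])⟩
    · obtain ⟨M, hM, e⟩ := hlift _ h
      obtain ⟨x, y, z, rfl⟩ : ∃ x y z, M = [x, y, z] := by
        have := congrArg List.length e
        simp only [List.length_map] at this
        exact List.length_eq_three.1 this.symm
      simp only [List.map_cons, List.map_nil, List.cons.injEq, and_true] at e
      obtain ⟨rfl, rfl, hz⟩ := e
      rw [PTree.restrict_left]
      by_cases hx : blockOut hl i x = i <;> by_cases hy : blockOut hl i y = i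
      · exact Or.inr (hy.trans hx.symm)
      · obtain ⟨j, rfl⟩ := (blockOut_eq_self_iff hl i x).1 hx
        obtain ⟨k, rfl⟩ := (blockOut_eq_self_iff hl i z).1 (hz.symm.trans hx)
        rw [hsec y hy, hx, hself]
        exact Or.inl (ha j y k hy hM)
      · obtain rfl : x = z := by rw [← hsec x hx, hz, hsec z (hz ▸ hx)]
        obtain ⟨j, rfl⟩ := (blockOut_eq_self_iff hl i y).1 hy
        rw [hsec x hx, hy, hself]
        exact Or.inl (hb x j hx hM)
      · obtain rfl : x = z := by rw [← hsec x hx, hz, hsec z (hz ▸ hx)]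
        rw [hsec x hx, hsec y hy]
        exact (R.horiz x y hM).imp id fun e => by rw [e]
  have hQw : ∀ s, Q.tree.le w₀ s := fun s => by
    rw [hQT, PTree.restrict_le]
    exact hw s
  have hT : PTree.IsExt hl i P.tree Q.tree R.tree := by
    refine PTree.IsExtOrder.isExt (r := w₀) ⟨fun s t => ?_, fun s t => ?_, fun x y => ?_,
      fun x y => ?_, fun s t k h₁ h₂ => hconv t k (PTree.le_trans (hw s) h₁) h₂⟩ hQw
    · rw [hQT, PTree.restrict_le]
    · rw [hQT, PTree.restrict_left]
    · rw [hPT, PTree.restrict_le]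
    · rw [hPT, PTree.restrict_left]
  have hE : IsWordExt hl i P.word.letters Q.word.letters R.word.letters :=
    (isWordExt_iff_listExt hl i _ _ _).2 ⟨by rw [hQ, hW], hgap, hP.symm⟩
  refine ⟨P, Q, ⟨hE, hT⟩, ?_⟩
  have := ((isWordExt_iff hl i w₀ P.word Q.word R.word.reduced.chain).1 hE).caesuras
    (separated_block hl i w₀)
  rw [if_pos (P.word.surjective i)] at this
  rw [Quilt.deg_eq, Quilt.deg_eq, Quilt.deg_eq, this]
  push_cast
  rfl

namespace Quilt.HasCut

variable {R : Quilt l} {r c b : Fin l} {G S T H : List (Fin l)} (h : R.HasCut r G S T H c b)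
  (hl : l + 1 = m + n) (i : Fin m)
include h

theorem pair_sublist {x y : Fin l} (hxy : [x, y].Sublist R.word.letters) (hx : x ≠ r) :
    [x, y].Sublist ((G ++ S) ++ (T ++ H)) := by
  rw [h.letters] at hxy
  rcases List.sublist_cons_iff.1 hxy with hxy | ⟨L, e, -⟩
  · exact hxy
  · exact absurd (List.cons.inj e).1 hx

/-- The block is an initial segment of the word, so no block letter comes after another letter. Most
conditions of the criterion are then vacuous. -/
theorem exists_isExt_of_root (hG : G = []) (hB : ∀ x, blockOut hl i x = i ↔ x = r ∨ x ∈ S) :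
    ∃ (P : Quilt m) (Q : Quilt n), Quilt.IsExt hl i P Q R ∧ P.deg + Q.deg = R.deg := by
  obtain ⟨w₀, hw₀⟩ := (blockOut_eq_self_iff hl i r).1 ((hB r).2 (Or.inl rfl))
  have hH : H = [] := by
    rcases h.cutData.outer with ⟨-, hH⟩ | ⟨u, G', H', hG', -⟩
    · exact hH
    · rw [hG'] at hG
      simp at hG
  have hpair : ∀ v j, blockOut hl i v ≠ i → ¬ [v, blockIn hl i j].Sublist R.word.letters := by
    intro v j hv hs
    have hj := (hB _).1 (blockOut_blockIn hl i j)
    rw [Ne, hB, not_or] at hv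
    have hs := h.pair_sublist hs hv.1
    have hjTH := mem_right_of_pair_sublist hs (by simpa [hG] using hv.2)
    rcases hj with hj | hj
    · exact h.notMem (hj ▸ List.mem_append_right _ hjTH)
    · exact h.cutData.notMem_right hj hjTH
  refine exists_isExt hl i w₀ R (fun j => hw₀ ▸ h.root _) (fun j k _ h₂ => ?_)
    (fun w v w' hv hs => ?_) (fun v w hv hs => ?_) (fun v w hv hs => ?_)
    (fun w v hv _ hle => ?_) (fun w w' Y hY hYi hs => ?_)
  · rw [hB]
    by_contra hk
    rw [not_or] at hk
    have hkT : k ∈ T ++ H := by simpa [hG, hk.2] using h.mem hk.1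
    rcases (hB _).1 (blockOut_blockIn hl i j) with hj | hj
    · exact hk.1 (PTree.le_antisymm' (hj ▸ h₂) (h.root k))
    · refine h.not_lt_right (List.mem_append_right G hj) hkT ⟨h₂, ?_⟩
      rintro rfl
      exact hk.2 hj
  · exact absurd ((List.sublist_cons_self _ _).trans hs) (hpair v w' hv)
  · exact absurd ((by simp : [v, blockIn hl i w].Sublist [v, blockIn hl i w, v]).trans hs)
      (hpair v w hv)
  · exact absurd hs (hpair v w hv)
  · rw [hw₀] at hle
    exact hv ((hB v).2 (Or.inl (PTree.le_antisymm' hle (h.root v))))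
  · obtain ⟨y, Y, rfl⟩ := List.exists_cons_of_ne_nil hY
    refine absurd ?_ (hpair y w' (hYi y (by simp)))
    refine List.Sublist.trans ?_ hs.sublist
    simp

/-- The conditions rest on two facts. A vertex outside the block that occurs before `H` is not a
descendant of `c` (`hnle`). One that occurs in `T` is to the left of `b`, and therefore, as `c ≤ b`,
to the left of `c` (`hstar`). The gap condition is the delicate one: an interruption between two
different block letters would produce a second cut or an interlaced pair. -/
theorem exists_isExt_of_le (hcb : R.tree.le c b)
    (hB : ∀ x, blockOut hl i x = i ↔ x = c ∨ (x ∈ T ∧ R.tree.le c x)) :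
    ∃ (P : Quilt m) (Q : Quilt n), Quilt.IsExt hl i P Q R ∧ P.deg + Q.deg = R.deg := by
  have hD := h.cutData
  obtain ⟨w₀, hw₀⟩ := (blockOut_eq_self_iff hl i c).1 ((hB c).2 (Or.inl rfl))
  have hbb : blockOut hl i b = i := (hB b).2 (Or.inr ⟨hD.b_mem, hcb⟩)
  have hcr : c ≠ r := fun e => h.notMem (by simp [← e, hD.c_mem])
  have hblk : ∀ j, blockIn hl i j = c ∨ (blockIn hl i j ∈ T ∧ R.tree.le c (blockIn hl i j)) :=
    fun j => (hB _).1 (blockOut_blockIn hl i j)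
  have hle : ∀ j, R.tree.le c (blockIn hl i j) := fun j =>
    (hblk j).elim (fun e => e ▸ R.tree.le_refl c) fun e => e.2
  have hne : ∀ j, blockIn hl i j ≠ r := fun j e =>
    (hblk j).elim (fun e' => hcr (e'.symm.trans e)) fun e' => h.notMem (by simp [← e, e'.1])
  have hnotH : ∀ j, blockIn hl i j ∉ H := fun j hj =>
    (hblk j).elim (fun e => hD.notMem_TH (by simp [← e, hj])) fun e =>
      hD.notMem_H_of_mem_T e.1 hj
  have hnotG : ∀ j, blockIn hl i j ∉ G := fun j hj =>
    (hblk j).elim (fun e => hD.notMem_G (e ▸ hj)) fun e =>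
      hD.notMem_left e.1 (List.mem_append_left _ hj)
  have hvc : ∀ v, blockOut hl i v ≠ i → v ≠ c := fun v hv e => hv ((hB v).2 (Or.inl e))
  have hassoc : R.word.letters = (r :: ((G ++ S) ++ T)) ++ H := by rw [h.letters]; simp
  have hnle : ∀ v, blockOut hl i v ≠ i → v ∈ r :: ((G ++ S) ++ T) → ¬ R.tree.le c v := by
    intro v hv hm hcv
    have hvc := hvc v hv
    simp only [List.mem_cons, List.mem_append] at hm
    rcases hm with rfl | (hm | hm) | hm
    · exact hcr (PTree.le_antisymm' hcv (h.root c))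
    · exact h.not_lt_GS hm hD.c_mem ⟨hcv, hvc.symm⟩
    · exact (PTree.left_not_le (h.left_c hm hvc)).2 hcv
    · exact hv ((hB v).2 (Or.inr ⟨hm, hcv⟩))
  have hstar : ∀ v, blockOut hl i v ≠ i → v ∈ T → R.tree.left v c := by
    intro v hv hvT
    have hvb : v ≠ b := fun e => hv (e ▸ hbb)
    have hlb := h.left_b hvT hvb
    rcases PTree.left_or (T := R.tree) c v with hcv | hcv | hcv | hcv
    · exact absurd hcv (hnle v hv (by simp [hvT]))
    · exact absurd (PTree.le_trans hcv hcb) (PTree.left_not_le hlb).1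
    · exact (PTree.left_asymm hlb
        (PTree.left_of_le_of_left hcv hcb (R.tree.le_refl v))).elim
    · exact hcv
  have hbefore : ∀ v j, [v, blockIn hl i j].Sublist R.word.letters →
      v ∈ r :: ((G ++ S) ++ T) := by
    intro v j hs
    rw [hassoc] at hs
    exact mem_left_of_pair_sublist hs (hnotH j)
  have hbetween : ∀ w v w', blockOut hl i v ≠ i →
      [blockIn hl i w, v, blockIn hl i w'].Sublist R.word.letters → R.tree.left v c := by
    intro w v w' hv hs
    have hvr : v ≠ r := by
      rintro rfl
      have := h.pair_sublist ((by simp : [blockIn hl i w, v].Sublist _).trans hs) (hne w)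
      exact h.notMem (this.subset (by simp))
    rw [hassoc] at hs
    have hs := pair_sublist_of_triple_left hs (hnotH w')
    rw [List.append_assoc, ← List.cons_append] at hs
    rcases List.mem_append.1 (mem_right_of_pair_sublist hs (by simp [hne w, hnotG w])) with hm | hm
    · exact h.left_c hm (hvc v hv)
    · exact hstar v hv hm
  have hnlc : ∀ w v, blockOut hl i v ≠ i → [blockIn hl i w, v].Sublist R.word.letters →
      ¬ R.tree.le v c := by
    intro w v hv hs hvc'
    refine R.vert _ _ hs ⟨PTree.le_trans hvc' (hle w), ?_⟩
    rintro rfl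
    exact hv (blockOut_blockIn hl i w)
  refine exists_isExt hl i w₀ R (fun j => hw₀ ▸ hle j) (fun j k h₁ h₂ => ?_)
    (fun w v w' hv hs => hw₀ ▸ hbetween w v w' hv hs) (fun v w hv hs => ?_)
    (fun v w hv hs => hw₀ ▸ hnle v hv (hbefore v w hs))
    (fun w v hv hs => hw₀ ▸ hnlc w v hv hs) (fun s t Y hY hYi hs => ?_)
  · rw [hw₀] at h₁
    by_contra hk
    have hkc := hvc k hk
    by_cases hkH : k ∈ r :: ((G ++ S) ++ T)
    · exact hnle k hk hkH h₁
    · have hkH' : k ∈ H := by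
        have := R.word.surjective k
        rw [hassoc] at this
        exact (List.mem_append.1 this).resolve_left hkH
      rcases hblk j with e | e
      · exact hkc (PTree.le_antisymm' (e ▸ h₂) h₁)
      · refine h.not_lt_TH e.1 hkH' ⟨h₂, ?_⟩
        rintro rfl
        exact hnotH j hkH'
  · rw [hw₀]
    have hwv : blockIn hl i w ≠ v := by
      rintro rfl
      exact hv (blockOut_blockIn hl i w)
    have hl := (R.horiz _ _ hs).resolve_right hwv
    rcases PTree.left_or (T := R.tree) c v with hcv | hcv | hcv | hcv
    · exact absurd hcv (hnle v hv (hbefore v w ((by simp : [v, _].Sublist [v, _, v]).trans hs)))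
    · exact absurd (PTree.le_trans hcv (hle w)) (PTree.left_not_le hl).2
    · exact hcv
    · exact (PTree.left_asymm hl
        (PTree.left_of_le_of_left hcv (R.tree.le_refl v) (hle w))).elim
  · by_contra hst
    have hst' : blockIn hl i s ≠ blockIn hl i t := fun e => hst (blockIn_injective hl i e)
    obtain ⟨A, B, hAB⟩ := hs
    cases A with
    | nil =>
      rw [h.letters] at hAB
      exact hne s (List.cons.inj hAB).1
    | cons r' A =>
      have hF : (G ++ S) ++ (T ++ H) =
          A ++ blockIn hl i s :: (Y ++ blockIn hl i t :: B) := by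
        rw [h.letters] at hAB
        have := (List.cons.inj hAB).2
        rw [← this]
        simp
      have hsub : ∀ {L : List (Fin l)}, L.Sublist (A ++ blockIn hl i s :: (Y ++ blockIn hl i t :: B)) →
          L.Sublist R.word.letters := fun hL => h.sublist (hF ▸ hL)
      have hYne : ∀ y ∈ Y, ∀ j, blockIn hl i j ≠ y := by
        rintro y hy j rfl
        exact hYi _ hy (blockOut_blockIn hl i j)
      have hbetw : ∀ y ∈ Y, R.tree.left y c := fun y hy => hbetween s y t (hYi y hy)
        (hsub (List.Sublist.trans (List.Sublist.cons_cons _ (pair_sublist_append hy (by simp)))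
          (List.sublist_append_right _ _)))
      have htT : ∀ j, blockIn hl i j ∈ G ++ S → blockIn hl i j = c := fun j hj =>
        (hblk j).resolve_right fun e => hD.notMem_left e.1 hj
      obtain ⟨y, Y', hY'⟩ := List.exists_cons_of_ne_nil hY
      have hy : y ∈ Y := by simp [hY']
      -- If the letter before the interruption is `c`, it is the last one, and `b`, a letter of the
      -- block, follows immediately.
      by_cases hsc : blockIn hl i s = c
      · have htc : blockIn hl i t ∈ T := ((hblk t).resolve_left fun e => hst' (hsc.trans e.symm)).1
        obtain ⟨S', hS'⟩ := hD.lastS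
        have e₁ : (G ++ S') ++ c :: (T ++ H) = A ++ c :: (Y ++ blockIn hl i t :: B) := by
          rw [← hsc, ← hF, hsc, hS']
          simp
        have e₂ := (append_cons_inj_of_notMem e₁ hD.notMem_TH (by
          intro hcm
          rcases List.mem_append.1 hcm with hcm | hcm
          · exact hYne c hcm s hsc
          · have hcm : c ∈ B := by simpa [← hsc, hst'] using hcm
            have : [blockIn hl i t, c].Sublist ((G ++ S) ++ (T ++ H)) := by
              rw [hF]
              refine List.Sublist.trans ?_ (List.sublist_append_right _ _)
              refine List.Sublist.cons _ (List.Sublist.trans ?_ (List.sublist_append_right _ _))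
              exact List.Sublist.cons_cons _ (List.singleton_sublist.2 hcm)
            exact hD.notMem_TH (mem_right_of_pair_sublist this (hD.notMem_left htc)))).2
        obtain ⟨T', hT'⟩ := hD.headT
        rw [hT', hY'] at e₂
        exact hYi y hy ((List.cons.inj e₂).1 ▸ hbb)
      · have hsT : blockIn hl i s ∈ T := ((hblk s).resolve_left hsc).1
        have hsGS := hD.notMem_left hsT
        -- Otherwise there would be a second cut after this letter, unless the next letter `y`
        -- occurs earlier; but then `y` encloses a block letter and would also have to be to the
        -- right of the block.
        have hsB : blockIn hl i s ∈ B := by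
          by_contra hsB
          have hyA : y ∈ A ++ [blockIn hl i s] := by
            by_contra hyA
            have := (hD.unique A _ y (Y' ++ blockIn hl i t :: B) (by rw [hF, hY']; rfl) (by
              have h₁ : blockIn hl i s ∉ Y := fun hm => hYne _ hm s rfl
              rw [hY'] at h₁
              simp only [List.mem_cons, List.mem_append] at h₁ ⊢
              tauto) hyA).1
            exact hsGS (this ▸ by simp)
          have hyA : y ∈ A := by
            have := (hYne y hy s).symm
            simpa [this] using hyA
          have hyy : [y, blockIn hl i s, y].Sublist R.word.letters := by
            refine hsub ((List.singleton_sublist.2 hyA).append ?_)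
            exact List.Sublist.cons_cons _ (List.singleton_sublist.2 (by simp [hy]))
          exact PTree.left_asymm ((R.horiz _ _ hyy).resolve_right (hYne y hy s))
            (PTree.left_of_le_of_left (hbetw y hy) (R.tree.le_refl y) (hle s))
        obtain ⟨Y₂, z, hz⟩ : ∃ Y₂ z, Y = Y₂ ++ [z] :=
          (List.eq_nil_or_concat' Y).resolve_left hY
        have hzY : z ∈ Y := by simp [hz]
        have hzB : z ∉ blockIn hl i t :: B := by
          intro hzB
          have hzB : z ∈ B := by
            have := (hYne z hzY t).symm
            simpa [this] using hzB
          have hzz : [z, blockIn hl i t, z].Sublist R.word.letters := by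
            refine hsub (List.Sublist.trans ?_ (List.sublist_append_right _ _))
            refine List.Sublist.cons _ ((List.singleton_sublist.2 hzY).append ?_)
            exact List.Sublist.cons_cons _ (List.singleton_sublist.2 hzB)
          exact PTree.left_asymm ((R.horiz _ _ hzz).resolve_right (hYne z hzY t))
            (PTree.left_of_le_of_left (hbetw z hzY) (R.tree.le_refl z) (hle t))
        -- Likewise the letter after the interruption occurs before it, as otherwise there is a
        -- second cut in front of it. The two block letters are then interlaced.
        have htA : blockIn hl i t ∈ A := by
          by_contra htA
          have h₁ : blockIn hl i t ∉ Y := fun hm => hYne _ hm t rfl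
          have := (hD.unique (A ++ blockIn hl i s :: Y₂) z (blockIn hl i t) B
            (by rw [hF, hz]; simp) hzB (by
              rw [hz] at h₁
              simp only [List.mem_append, List.mem_cons] at h₁ ⊢
              have := Ne.symm hst'
              tauto)).1
          exact hsGS (this ▸ by simp)
        refine R.word.no_interlacing (blockIn hl i t) (blockIn hl i s) (Ne.symm hst') (hsub ?_)
        refine (List.singleton_sublist.2 htA).append (List.Sublist.cons_cons _ ?_)
        refine List.Sublist.trans ?_ (List.sublist_append_right _ _)
        exact List.Sublist.cons_cons _ (List.singleton_sublist.2 hsB)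

end Quilt.HasCut

end QuiltOp

namespace QuiltOp

/-! ### Signs of lists and orders of first occurrence -/

section ListSigns

set_option linter.unusedSectionVars false

theorem listSign_append (A B : List ℕ) : listSign (A ++ B) =
    listSign A * listSign B * (-1) ^ (A.map fun a => B.countP (· < a)).sum := by
  induction A with
  | nil => simp [listSign]
  | cons a A ih =>
    rw [List.cons_append, listSign, ih, listSign, List.countP_append, List.map_cons, List.sum_cons,
      pow_add, pow_add]
    ring

theorem listSign_of_pairwise {L : List ℕ} (h : L.Pairwise (· < ·)) : listSign L = 1 := by
  induction L with
  | nil => rfl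
  | cons a L ih =>
    rw [List.pairwise_cons] at h
    have : L.countP (· < a) = 0 :=
      List.countP_eq_zero.2 fun b hb => by simpa using (h.1 b hb).le
    rw [listSign, ih h.2, this]
    simp

variable {α β : Type*} [DecidableEq α] [DecidableEq β]

/-- Eliminating consecutive repetitions preserves the order of first occurrences, so the orders in
the two factors can be read off from the extension. -/
theorem idxOf_destutter_lt_iff (L : List α) (a b : α) :
    (L.destutter (· ≠ ·)).idxOf a < (L.destutter (· ≠ ·)).idxOf b ↔ L.idxOf a < L.idxOf b := by
  induction L with
  | nil => simp
  | cons x L ih =>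
    by_cases hL : L.head? = some x
    · obtain ⟨M, hM⟩ := List.head?_eq_some_iff.1 ((head?_destutter L).trans hL)
      obtain ⟨L', rfl⟩ := List.head?_eq_some_iff.1 hL
      rw [destutter_cons_of_head hM, ← hM, ih]
      by_cases ha : x = a <;> by_cases hb : x = b
      · simp [← ha, ← hb]
      · simp [← ha, List.idxOf_cons_ne _ hb]
      · simp [← hb]
      · simp [List.idxOf_cons_ne _ ha, List.idxOf_cons_ne _ hb]
    · rw [destutter_cons_of_ne (fun b hb e => hL (by rw [e]; exact hb))]
      by_cases ha : x = a <;> by_cases hb : x = b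
      · simp [← ha, ← hb]
      · simp [← ha, List.idxOf_cons_ne _ hb]
      · simp [← hb]
      · simpa [List.idxOf_cons_ne _ ha, List.idxOf_cons_ne _ hb] using ih

theorem idxOf_filter_lt_iff (L : List α) (p : α → Bool) {a b : α} (ha : p a) (hb : p b) :
    (L.filter p).idxOf a < (L.filter p).idxOf b ↔ L.idxOf a < L.idxOf b := by
  induction L with
  | nil => simp
  | cons x L ih =>
    by_cases hx : p x
    · rw [List.filter_cons_of_pos hx]
      by_cases ha : x = a <;> by_cases hb : x = b
      · simp [← ha, ← hb]
      · simp [← ha, List.idxOf_cons_ne _ hb]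
      · simp [← hb]
      · simpa [List.idxOf_cons_ne _ ha, List.idxOf_cons_ne _ hb] using ih
    · have hxa : x ≠ a := by
        rintro rfl
        exact hx ha
      have hxb : x ≠ b := by
        rintro rfl
        exact hx hb
      rw [List.filter_cons_of_neg hx, ih, List.idxOf_cons_ne _ hxa, List.idxOf_cons_ne _ hxb]
      omega

theorem idxOf_map_of_injective {g : α → β} (hg : Function.Injective g) (L : List α) (a : α) :
    (L.map g).idxOf (g a) = L.idxOf a := by
  induction L with
  | nil => rfl
  | cons x L ih =>
    by_cases hx : x = a
    · simp [hx]
    · rw [List.map_cons, List.idxOf_cons_ne _ hx, List.idxOf_cons_ne _ fun e => hx (hg e), ih]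

theorem pairwise_downOrder {n : ℕ} (L : List (Fin n)) :
    (downOrder L).Pairwise fun a b => L.idxOf a < L.idxOf b := by
  induction L with
  | nil => simp [downOrder]
  | cons x L ih =>
    rw [downOrder_cons, List.pairwise_cons]
    constructor
    · intro b hb
      have : b ≠ x := of_decide_eq_true (List.mem_filter.1 hb).2
      simp [List.idxOf_cons_ne _ this.symm]
    · refine List.Pairwise.imp_of_mem ?_ (ih.filter _)
      intro a b ha hb hab
      have ha : a ≠ x := of_decide_eq_true (List.mem_filter.1 ha).2
      have hb : b ≠ x := of_decide_eq_true (List.mem_filter.1 hb).2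
      simpa [List.idxOf_cons_ne _ ha.symm, List.idxOf_cons_ne _ hb.symm] using hab

theorem countP_map_univ {n : ℕ} (f : Fin n → ℕ) (t : ℕ) :
    ((List.finRange n).map f).countP (· < t) = (Finset.univ.filter fun w => f w < t).card := by
  rw [List.countP_map, List.countP_eq_length_filter,
    ← List.toFinset_card_of_nodup ((List.nodup_finRange n).filter _)]
  congr 1
  ext
  simp

theorem posOver_eq_idxOf {γ : Type*} (p : γ → α) (X : List γ) (v : α) :
    posOver p X v = (X.map p).idxOf v := by
  rw [posOver, List.idxOf, List.findIdx_map]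
  congr 1

end ListSigns

/-! ### Interposed vertices of maximal quilts -/

section MaximalQuilts

variable {n : ℕ}

theorem Quilt.exists_letters_eq_cons_cons (Q : Quilt n) (hn : 2 ≤ n) :
    ∃ a b L, Q.word.letters = a :: b :: L ∧ a ∉ b :: L := by
  obtain ⟨F, hF, hr⟩ := Q.exists_letters_eq _ Q.tree.rootVertex_le
  cases F with
  | nil =>
    exfalso
    obtain ⟨j, hj⟩ : ∃ j : Fin n, j ≠ Q.tree.rootVertex := by
      have : Nontrivial (Fin n) := Fin.nontrivial_iff_two_le.2 hn
      exact exists_ne _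
    have := Q.word.surjective j
    rw [hF] at this
    exact hj (by simpa using this)
  | cons b L => exact ⟨_, b, L, hF, hr⟩

/-- All vertices of a maximal quilt except for the first two are interposed. -/
theorem Quilt.mem_interposedList (Q : Quilt n) (hQ : Q.deg = (n : ℤ) - 2) {a b : Fin n}
    {L : List (Fin n)} (e : Q.word.letters = a :: b :: L) (ha : a ∉ b :: L) (v : Fin n) :
    v ∈ interposedList Q.word.letters ↔ v ≠ a ∧ v ≠ b := by
  classical
  have hred := Q.word.reduced
  have hI := hred.interposedList
  have hnd : (interposedList Q.word.letters).Nodup := (nodup_downOrder _).filter _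
  have hlen : (interposedList Q.word.letters).length + 2 = n := by
    have := Q.deg_eq
    rw [hI, length_afterCaesuras]
    omega
  have hab : a ≠ b := fun e => ha (by simp [e])
  have hsub : (interposedList Q.word.letters).toFinset ⊆ (Finset.univ.erase a).erase b := by
    intro x hx
    rw [List.mem_toFinset, hI, e] at hx
    rw [e] at hred
    refine Finset.mem_erase.2 ⟨?_, Finset.mem_erase.2 ⟨?_, Finset.mem_univ x⟩⟩
    · rintro rfl
      rw [afterCaesuras, if_neg ha] at hx
      exact hred.tail.head_notMem (by simpa using hx)
    · rintro rfl
      exact hred.head_notMem hx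
  -- The degree counts the interposed vertices. In a maximal quilt there are `n - 2` of them, as
  -- many as there are candidates.
  have heq := Finset.eq_of_subset_of_card_le hsub (by
    rw [List.toFinset_card_of_nodup hnd, Finset.card_erase_of_mem, Finset.card_erase_of_mem]
    · simp
      omega
    · simp
    · simp [hab.symm])
  rw [← List.mem_toFinset, heq]
  simp [and_comm]

end MaximalQuilts

/-! ### Orders of first occurrence in an extension -/

section ExtSigns

variable {n k l : ℕ}

theorem finRange_add (e₁ : Fin k → Fin l) (e₂ : Fin n → Fin l) (hl : l = k + n)
    (h₁ : ∀ a, (e₁ a).1 = a.1) (h₂ : ∀ a, (e₂ a).1 = k + a.1) :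
    List.finRange l = (List.finRange k).map e₁ ++ (List.finRange n).map e₂ := by
  subst hl
  refine List.ext_getElem (by simp) fun j h h' => ?_
  ext
  rw [List.getElem_append]
  split_ifs with hj
  · simp [h₁]
  · simp only [List.length_map, List.length_finRange] at hj
    simp [h₂]
    omega

theorem posOver_block_of_ne (hl : l + 1 = k + 1 + n) (X : List (Fin l)) (r : Fin n) {v : Fin (k + 1)} (hv : v ≠ Fin.last k) :
    posOver (blockOut hl (Fin.last k)) X v =
      X.idxOf (blockSec hl (Fin.last k) r v) := by
  rw [posOver, List.idxOf]
  congr 1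
  funext x
  rw [Bool.beq_eq_decide_eq]
  refine decide_eq_decide.2 ⟨?_, ?_⟩
  · rintro rfl
    exact (blockSec_blockOut hl _ r hv).symm
  · rintro rfl
    exact blockOut_blockSec hl _ r v

namespace Quilt.IsExt

variable {hl : l + 1 = k + 1 + n} {P : Quilt (k + 1)} {Q : Quilt n} {R : Quilt l}
  (he : Quilt.IsExt hl (Fin.last k) P Q R)
include he

theorem idxOf_right (w w' : Fin n) : R.word.letters.idxOf (blockIn hl (Fin.last k) w) <
    R.word.letters.idxOf (blockIn hl (Fin.last k) w') ↔
    Q.word.letters.idxOf w < Q.word.letters.idxOf w' := by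
  have hinj := blockIn_injective hl (Fin.last k)
  rw [← idxOf_map_of_injective hinj Q.word.letters, ← idxOf_map_of_injective hinj Q.word.letters,
    ← he.listExt.sub, idxOf_destutter_lt_iff, idxOf_filter_lt_iff]
  · simp [blockOut_blockIn]
  · simp [blockOut_blockIn]

theorem posOver_lt_iff (v v' : Fin (k + 1)) :
    posOver (blockOut hl (Fin.last k)) R.word.letters v <
      posOver (blockOut hl (Fin.last k)) R.word.letters v' ↔
    P.word.letters.idxOf v < P.word.letters.idxOf v' := by
  rw [← he.listExt.quot, idxOf_destutter_lt_iff, posOver_eq_idxOf, posOver_eq_idxOf]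

theorem posOver_last {q₀ : Fin n} (hq : ∀ w, Q.word.letters.idxOf q₀ ≤ Q.word.letters.idxOf w) :
    posOver (blockOut hl (Fin.last k)) R.word.letters (Fin.last k) =
      R.word.letters.idxOf (blockIn hl (Fin.last k) q₀) := by
  have hle : ∀ w, posOver (blockOut hl (Fin.last k)) R.word.letters (Fin.last k) ≤
      R.word.letters.idxOf (blockIn hl (Fin.last k) w) := by
    intro w
    refine List.findIdx_le_findIdx fun x _ hx => ?_
    have : x = blockIn hl (Fin.last k) w := by simpa using hx
    simp [this, blockOut_blockIn]
  refine le_antisymm (hle q₀) ?_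
  have hlt : posOver (blockOut hl (Fin.last k)) R.word.letters (Fin.last k) <
      R.word.letters.length :=
    (hle q₀).trans_lt (List.idxOf_lt_length_of_mem (R.word.surjective _))
  have hx := List.findIdx_getElem (w := hlt)
  obtain ⟨w, hw⟩ := (blockOut_eq_self_iff hl (Fin.last k) _).1 (of_decide_eq_true hx)
  have h₁ : R.word.letters.idxOf (blockIn hl (Fin.last k) w) ≤
      posOver (blockOut hl (Fin.last k)) R.word.letters (Fin.last k) := by
    by_contra hlt'
    rw [not_le] at hlt'
    have := List.not_of_lt_findIdx hlt'
    simp only [hw, posOver, beq_eq_false_iff_ne] at this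
    exact this rfl
  have h₂ : ¬ R.word.letters.idxOf (blockIn hl (Fin.last k) w) <
      R.word.letters.idxOf (blockIn hl (Fin.last k) q₀) := by
    rw [he.idxOf_right, not_lt]
    exact hq w
  omega

end Quilt.IsExt

end ExtSigns
end QuiltOp

namespace QuiltOp

/-! ### Signs of the composition terms -/

theorem neg_one_pow_eq {a b c : ℕ} (h : a + b = 2 * c) : (-1 : ℤ) ^ a = (-1) ^ b := by
  rcases neg_one_pow_eq_or ℤ b with hb | hb <;>
  · have : (-1 : ℤ) ^ a * (-1) ^ b = 1 := by rw [← pow_add, h, pow_mul]; simp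
    rw [hb] at this ⊢
    linarith

/-- This compares the normalising exponents of `sgnK` for the composite and for its two factors. -/
theorem triangle_add {k n l : ℕ} (hl : l = k + n) (hn : 1 ≤ n) : l * (l - 1) / 2 =
    (k + 1) * (k + 1 - 1) / 2 + n * (n - 1) / 2 + k * (n - 1) := by
  obtain ⟨n, rfl⟩ : ∃ n', n = n' + 1 := ⟨n - 1, by omega⟩
  obtain ⟨x, hx⟩ := Nat.even_mul_succ_self k
  obtain ⟨y, hy⟩ := Nat.even_mul_succ_self n
  have e₁ : l * (l - 1) = 2 * (x + y + k * n) := by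
    have : l - 1 = k + n := by omega
    rw [this, hl]
    linear_combination hx + hy
  have e₂ : (k + 1) * (k + 1 - 1) = 2 * x := by
    rw [Nat.add_sub_cancel]
    linear_combination hx
  have e₃ : (n + 1) * (n + 1 - 1) = 2 * y := by
    rw [Nat.add_sub_cancel]
    linear_combination hy
  rw [e₁, e₂, e₃, Nat.add_sub_cancel]
  omega

variable {n k l : ℕ}

/-- Parity bookkeeping. `E` compares the order of the composite with those of the factors, `X` is
the exponent of the extension sign, `N` that of the desired sign, and `k * n` is the exponent `(p -
1) q` of the `L∞` relation. -/
theorem sgnK_mul_sgnK {P : Quilt (k + 1)} {Q : Quilt n} {R : Quilt l} (hl : l = k + n)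
    (hn : 1 ≤ n) {E N X c : ℕ}
    (h : listSign ((List.finRange l).map fun u => R.word.letters.idxOf u) =
      listSign ((List.finRange (k + 1)).map fun u => P.word.letters.idxOf u) *
      listSign ((List.finRange n).map fun u => Q.word.letters.idxOf u) * (-1) ^ E)
    (hc : X + (k * n + N + k * (n - 1) + E + 1) = 2 * c) :
    P.sgnK * Q.sgnK * (-1) ^ X = (-1) ^ (k * n) * ((-1) ^ N * R.sgnK) := by
  rw [Quilt.sgnK, Quilt.sgnK, Quilt.sgnK, h, triangle_add hl hn]
  generalize (k + 1) * (k + 1 - 1) / 2 = x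
  generalize n * (n - 1) / 2 = y
  generalize listSign _ = s
  generalize listSign _ = t
  have : (-1 : ℤ) ^ ((1 + x) + (1 + y) + X) =
      (-1) ^ (k * n + N + (1 + (x + y + k * (n - 1))) + E) :=
    neg_one_pow_eq (c := x + y + 1 + c) (by linear_combination hc)
  simp only [pow_add (-1 : ℤ)] at this ⊢
  linear_combination s * t * this

namespace Quilt.IsExt

variable {hl : l + 1 = k + 1 + n} {P : Quilt (k + 1)} {Q : Quilt n} {R : Quilt l}
  (he : Quilt.IsExt hl (Fin.last k) P Q R)
include he

/-- The block consists of the last labels, and its first vertex `q₀` stands where the label `k` of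
`P` does. The inversions of `R` beyond those of `P` and `Q` thus pair an outer vertex with an
earlier block vertex other than `q₀`. -/
theorem listSign_eq {q₀ : Fin n} (hq : ∀ w, Q.word.letters.idxOf q₀ ≤ Q.word.letters.idxOf w) :
    listSign ((List.finRange l).map fun u => R.word.letters.idxOf u) =
      listSign ((List.finRange (k + 1)).map fun u => P.word.letters.idxOf u) *
      listSign ((List.finRange n).map fun u => Q.word.letters.idxOf u) *
      (-1) ^ ∑ a : Fin k, (Finset.univ.filter fun w => w ≠ q₀ ∧
        R.word.letters.idxOf (blockIn hl (Fin.last k) w) <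
          posOver (blockOut hl (Fin.last k)) R.word.letters a.castSucc).card := by
  set p := posOver (blockOut hl (Fin.last k)) R.word.letters with hp
  set g := fun w => R.word.letters.idxOf (blockIn hl (Fin.last k) w) with hg
  have e₁ : List.finRange l = (List.finRange k).map
      (fun a => blockSec hl (Fin.last k) q₀ a.castSucc) ++
      (List.finRange n).map (blockIn hl (Fin.last k)) := by
    refine finRange_add _ _ (by omega) (fun a => ?_) fun a => blockIn_val hl _ a
    have := a.2
    rw [blockSec_val, if_neg, if_pos] <;> (simp; try omega)
  have e₂ : List.finRange (k + 1) = (List.finRange k).map Fin.castSucc ++ [Fin.last k] := by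
    rw [finRange_add (n := 1) Fin.castSucc (fun _ => Fin.last k) rfl (fun _ => rfl)
      (fun a => by simp)]
    simp
  have e₃ : (fun a : Fin k => R.word.letters.idxOf (blockSec hl (Fin.last k) q₀ a.castSucc)) =
      fun a => p a.castSucc := by
    funext a
    exact (posOver_block_of_ne hl _ q₀ (Fin.castSucc_lt_last a).ne).symm
  have e₄ : listSign ((List.finRange (k + 1)).map fun u => P.word.letters.idxOf u) =
      listSign ((List.finRange (k + 1)).map p) :=
    listSign_congr fun a _ b _ => (he.posOver_lt_iff a b).symm
  have e₅ : listSign ((List.finRange n).map fun u => Q.word.letters.idxOf u) =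
      listSign ((List.finRange n).map g) :=
    listSign_congr fun a _ b _ => (he.idxOf_right a b).symm
  have e₆ : ∀ t, ((List.finRange n).map g).countP (· < t) = (if p (Fin.last k) < t then 1 else 0) +
      (Finset.univ.filter fun w => w ≠ q₀ ∧ g w < t).card := by
    intro t
    rw [countP_map_univ, hp, he.posOver_last hq, ← Finset.filter_filter, Finset.filter_ne' _ q₀,
      Finset.filter_erase]
    by_cases ht : g q₀ < t
    · rw [if_pos ht, Finset.card_erase_of_mem (by simpa using ht)]
      have : 0 < (Finset.univ.filter fun w => g w < t).card :=
        Finset.card_pos.2 ⟨q₀, by simpa using ht⟩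
      omega
    · rw [if_neg ht, Finset.erase_eq_of_notMem (by simpa using ht), zero_add]
  rw [e₄, e₅, e₁, e₂, List.map_append, List.map_append, List.map_map, List.map_map, List.map_map,
    listSign_append, listSign_append, List.map_map, List.map_map]
  simp only [Function.comp_def, List.map_cons, List.map_nil, e₃]
  change _ * listSign ((List.finRange n).map g) * (-1) ^ ((List.finRange k).map fun a =>
    ((List.finRange n).map g).countP (· < p a.castSucc)).sum = _
  rw [← Fin.sum_univ_def, ← Fin.sum_univ_def]
  simp only [e₆, Finset.sum_add_distrib]
  have e₇ : ∀ t, [p (Fin.last k)].countP (· < t) = if p (Fin.last k) < t then 1 else 0 := by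
    intro t
    simp [List.countP_cons]
  simp only [e₇, listSign, List.countP_nil]
  ring

/-- In maximal quilts all vertices but the first two are interposed. Within each factor they are
already in the order of `R`, so only inversions between the factors count. -/
theorem extSign_eq_pow (hP : P.deg = ((k + 1 : ℕ) : ℤ) - 2) (hQ : Q.deg = (n : ℤ) - 2)
    {p₀ p₁ : Fin (k + 1)} {q₀ q₁ : Fin n} {V : List (Fin (k + 1))} {W : List (Fin n)}
    (eP : P.word.letters = p₀ :: p₁ :: V) (hp : p₀ ∉ p₁ :: V)
    (eQ : Q.word.letters = q₀ :: q₁ :: W) (hq : q₀ ∉ q₁ :: W) :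
    extSign hl (Fin.last k) P.word.letters Q.word.letters R.word.letters =
      (-1) ^ ∑ v ∈ Finset.univ.filter (fun v => v ≠ p₀ ∧ v ≠ p₁),
        (Finset.univ.filter fun w => (w ≠ q₀ ∧ w ≠ q₁) ∧
          R.word.letters.idxOf (blockIn hl (Fin.last k) w) <
            posOver (blockOut hl (Fin.last k)) R.word.letters v).card := by
  have hIP : (interposedList P.word.letters).Pairwise fun a b =>
      P.word.letters.idxOf a < P.word.letters.idxOf b := (pairwise_downOrder _).filter _
  have hIQ : (interposedList Q.word.letters).Pairwise fun a b =>
      Q.word.letters.idxOf a < Q.word.letters.idxOf b := (pairwise_downOrder _).filter _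
  have hndP : (interposedList P.word.letters).Nodup := (nodup_downOrder _).filter _
  have hndQ : (interposedList Q.word.letters).Nodup := (nodup_downOrder _).filter _
  have s₁ : listSign ((interposedList P.word.letters).map
      (posOver (blockOut hl (Fin.last k)) R.word.letters)) = 1 := by
    refine listSign_of_pairwise (List.pairwise_map.2 (hIP.imp fun {a b} h => ?_))
    exact (he.posOver_lt_iff a b).2 h
  have s₂ : listSign ((interposedList Q.word.letters).map
      fun w => R.word.letters.idxOf (blockIn hl (Fin.last k) w)) = 1 := by
    refine listSign_of_pairwise (List.pairwise_map.2 (hIQ.imp fun {a b} h => ?_))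
    exact (he.idxOf_right a b).2 h
  have e₁ : (interposedList P.word.letters).toFinset =
      Finset.univ.filter fun v => v ≠ p₀ ∧ v ≠ p₁ := by
    ext v
    rw [List.mem_toFinset, P.mem_interposedList hP eP hp]
    simp
  rw [extSign]
  change listSign ((interposedList P.word.letters).map
      (posOver (blockOut hl (Fin.last k)) R.word.letters) ++ _) = _
  rw [listSign_append, s₁, s₂, one_mul, one_mul, List.map_map, ← e₁, List.sum_toFinset _ hndP]
  congr 3
  funext v
  rw [Function.comp_apply, List.countP_map, List.countP_eq_length_filter,
    ← List.toFinset_card_of_nodup (hndQ.filter _)]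
  congr 1
  ext w
  simp only [List.mem_toFinset, List.mem_filter, Q.mem_interposedList hQ eQ hq,
    Finset.mem_filter, Finset.mem_univ, true_and, Function.comp_apply, decide_eq_true_eq]

variable {r c b : Fin l} {G S T H : List (Fin l)} (h : R.HasCut r G S T H c b)
  (hP : P.deg = ((k + 1 : ℕ) : ℤ) - 2) (hQ : Q.deg = (n : ℤ) - 2) (hk : 1 ≤ k) (hn : 2 ≤ n)
include h hP hQ hk hn

/-- The whole block precedes all other vertices, so every pair is an inversion: there are `(k - 1) *
(n - 2)` for the extension sign and `k * (n - 1)` for the orders. Moreover `S` has `n - 1` vertices.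
-/
theorem sign_of_root (hG : G = []) (hB : ∀ x, blockOut hl (Fin.last k) x = Fin.last k ↔
      x = r ∨ x ∈ S) :
    P.sgnK * Q.sgnK * extSign hl (Fin.last k) P.word.letters Q.word.letters R.word.letters =
      (-1) ^ (k * n) * ((-1) ^ (G ++ S).toFinset.card * R.sgnK) := by
  obtain ⟨p₀, p₁, V, eP, hp⟩ := P.exists_letters_eq_cons_cons (by omega)
  obtain ⟨q₀, q₁, W, eQ, hq⟩ := Q.exists_letters_eq_cons_cons hn
  have hq01 : q₀ ≠ q₁ := fun e => hq (by simp [e])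
  have hp01 : p₀ ≠ p₁ := fun e => hp (by simp [e])
  have hp₀ : p₀ = Fin.last k := by
    have := head?_destutter (R.word.letters.map (blockOut hl (Fin.last k)))
    rw [he.listExt.quot, eP, h.letters] at this
    simp only [List.head?_cons, List.map_cons, Option.some.injEq] at this
    rw [this]
    exact (hB r).2 (Or.inl rfl)
  have hlt : ∀ v, v ≠ Fin.last k → ∀ w, R.word.letters.idxOf (blockIn hl (Fin.last k) w) <
      posOver (blockOut hl (Fin.last k)) R.word.letters v := by
    intro v hv w
    have e : R.word.letters = (r :: S) ++ (T ++ H) := by rw [h.letters, hG]; rfl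
    rw [posOver_block_of_ne hl _ q₀ hv]
    have h₁ : blockIn hl (Fin.last k) w ∈ r :: S := by
      have := (hB _).1 (blockOut_blockIn hl (Fin.last k) w)
      simpa using this
    have h₂ : blockSec hl (Fin.last k) q₀ v ∉ r :: S := by
      intro hm
      refine hv ?_
      rw [← blockOut_blockSec hl (Fin.last k) q₀ v, hB]
      simpa using hm
    rw [e, List.idxOf_append_of_mem h₁, List.idxOf_append_of_notMem h₂]
    have := List.idxOf_lt_length_of_mem h₁
    omega
  have c₁ : ∑ v ∈ Finset.univ.filter (fun v => v ≠ p₀ ∧ v ≠ p₁),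
        (Finset.univ.filter fun w => (w ≠ q₀ ∧ w ≠ q₁) ∧
          R.word.letters.idxOf (blockIn hl (Fin.last k) w) <
            posOver (blockOut hl (Fin.last k)) R.word.letters v).card = (k - 1) * (n - 2) := by
    have cp : (Finset.univ.filter fun v : Fin (k + 1) => v ≠ p₀ ∧ v ≠ p₁).card = k - 1 := by
      rw [← Finset.filter_filter, Finset.filter_ne' _ p₀, Finset.filter_ne' _ p₁,
        Finset.card_erase_of_mem (by simp [hp01.symm]), Finset.card_erase_of_mem (by simp)]
      simp
    have cq : (Finset.univ.filter fun w : Fin n => w ≠ q₀ ∧ w ≠ q₁).card = n - 2 := by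
      rw [← Finset.filter_filter, Finset.filter_ne' _ q₀, Finset.filter_ne' _ q₁,
        Finset.card_erase_of_mem (by simp [hq01.symm]), Finset.card_erase_of_mem (by simp)]
      simp
      omega
    rw [← cp, ← cq, ← smul_eq_mul, ← Finset.sum_const]
    refine Finset.sum_congr rfl fun v hv => ?_
    have hv : v ≠ Fin.last k := hp₀ ▸ (Finset.mem_filter.1 hv).2.1
    simp only [hlt v hv, and_true]
  have c₂ : ∑ a : Fin k, (Finset.univ.filter fun w => w ≠ q₀ ∧
        R.word.letters.idxOf (blockIn hl (Fin.last k) w) <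
          posOver (blockOut hl (Fin.last k)) R.word.letters a.castSucc).card = k * (n - 1) := by
    have cq : (Finset.univ.filter fun w : Fin n => w ≠ q₀).card = n - 1 := by
      rw [Finset.filter_ne' _ q₀, Finset.card_erase_of_mem (by simp)]
      simp
    simp only [hlt _ (Fin.castSucc_lt_last _).ne, and_true, cq, Finset.sum_const,
      Finset.card_univ, Fintype.card_fin, smul_eq_mul]
  have c₃ : (G ++ S).toFinset.card = n - 1 := by
    have : (Finset.univ : Finset (Fin n)).map ⟨_, blockIn_injective hl (Fin.last k)⟩ =
        insert r S.toFinset := by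
      ext x
      simp only [Finset.mem_map, Finset.mem_univ, true_and, Function.Embedding.coeFn_mk,
        Finset.mem_insert, List.mem_toFinset]
      rw [← blockOut_eq_self_iff, hB]
    have e := congrArg Finset.card this
    rw [Finset.card_map, Finset.card_insert_of_notMem (fun hm => h.notMem (by
      simp [List.mem_toFinset.1 hm]))] at e
    simp only [Finset.card_univ, Fintype.card_fin] at e
    rw [hG, List.nil_append]
    omega
  have hlR := he.listSign_eq (q₀ := q₀) (fun w => by simp [eQ])
  rw [c₂] at hlR
  rw [he.extSign_eq_pow hP hQ eP hp eQ hq, c₁, c₃]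
  refine sgnK_mul_sgnK (c := (k * n - k - 1) + k * (n - 1) + 2) (by omega) (by omega) hlR ?_
  obtain ⟨k, rfl⟩ : ∃ k', k = k' + 1 := ⟨k - 1, by omega⟩
  obtain ⟨n, rfl⟩ : ∃ n', n = n' + 2 := ⟨n - 2, by omega⟩
  have : (k + 1) * (n + 2) - (k + 1) - 1 = k * n + k + n := by
    rw [Nat.sub_sub]
    exact Nat.sub_eq_of_eq_add (by ring)
  rw [this]
  simp only [Nat.add_sub_cancel, Nat.reduceSubDiff]
  ring

/-- The first two block vertices are `c` and `b`. The inversions that enter the extension sign and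
those that enter the comparison of orders differ only by pairs with `b`, that is, by the number of
outer vertices after `b`. Together with the number of vertices of `G ++ S` this gives `k`. -/
theorem sign_of_le (hB : ∀ x, blockOut hl (Fin.last k) x = Fin.last k ↔
      x = c ∨ (x ∈ T ∧ R.tree.le c x)) (hcb : R.tree.le c b) :
    P.sgnK * Q.sgnK * extSign hl (Fin.last k) P.word.letters Q.word.letters R.word.letters =
      (-1) ^ (k * n) * -((-1) ^ (G ++ S).toFinset.card * R.sgnK) := by
  obtain ⟨p₀, p₁, V, eP, hp⟩ := P.exists_letters_eq_cons_cons (by omega)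
  obtain ⟨q₀, q₁, W, eQ, hq⟩ := Q.exists_letters_eq_cons_cons hn
  have hD := h.cutData
  have hcr : c ≠ r := fun e => h.notMem (by simp [← e, hD.c_mem])
  have hq₀ : ∀ w, Q.word.letters.idxOf q₀ ≤ Q.word.letters.idxOf w := fun w => by simp [eQ]
  have hq01 : q₀ ≠ q₁ := fun e => hq (by simp [e])
  set p := posOver (blockOut hl (Fin.last k)) R.word.letters with hpdef
  set pos := fun w => R.word.letters.idxOf (blockIn hl (Fin.last k) w) with hpos
  have e : R.word.letters = (r :: (G ++ S)) ++ (T ++ H) := h.letters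
  have hbpos : R.word.letters.idxOf b = (r :: (G ++ S)).length := by
    obtain ⟨T', hT'⟩ := hD.headT
    have hbr : b ∉ r :: (G ++ S) := by
      rw [List.mem_cons, not_or]
      exact ⟨fun e => h.notMem (by simp [← e, hD.b_mem]), hD.notMem_GS⟩
    rw [e, List.idxOf_append_of_notMem hbr, hT']
    simp
  have hleft : ∀ x, x ∈ r :: (G ++ S) → R.word.letters.idxOf x < R.word.letters.idxOf b := by
    intro x hx
    rw [hbpos, e, List.idxOf_append_of_mem hx]
    exact List.idxOf_lt_length_of_mem hx
  have hright : ∀ x, x ∉ r :: (G ++ S) → R.word.letters.idxOf b ≤ R.word.letters.idxOf x := by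
    intro x hx
    rw [hbpos, e, List.idxOf_append_of_notMem hx]
    omega
  have hTleft : ∀ x ∈ T, x ∉ r :: (G ++ S) := by
    intro x hx
    rw [List.mem_cons, not_or]
    exact ⟨fun e => h.notMem (by simp [← e, hx]), hD.notMem_left hx⟩
  have hcleft : c ∈ r :: (G ++ S) := by simp [hD.c_mem]
  have hblk : ∀ w, blockIn hl (Fin.last k) w = c ∨ blockIn hl (Fin.last k) w ∈ T := fun w =>
    ((hB _).1 (blockOut_blockIn hl _ w)).imp id And.left
  have hgq₀ : blockIn hl (Fin.last k) q₀ = c := by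
    obtain ⟨w, hw⟩ := (blockOut_eq_self_iff hl _ c).1 ((hB c).2 (Or.inl rfl))
    refine (hblk q₀).resolve_right fun hT => ?_
    have h₁ := (he.idxOf_right w q₀).not.2 (not_lt.2 (hq₀ w))
    rw [hw] at h₁
    have h₂ := hleft c hcleft
    have h₃ := hright _ (hTleft _ hT)
    omega
  have hgq₁ : blockIn hl (Fin.last k) q₁ = b := by
    obtain ⟨w, hw⟩ := (blockOut_eq_self_iff hl _ b).1 ((hB b).2 (Or.inr ⟨hD.b_mem, hcb⟩))
    by_cases hwq : w = q₁
    · rw [← hwq, hw]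
    have hwq₀ : w ≠ q₀ := fun e => hD.c_ne_b (by rw [← hgq₀, ← hw, e])
    have h₁ := (he.idxOf_right q₁ w).2 (by
      rw [eQ, List.idxOf_cons_ne _ hq01, List.idxOf_cons_ne _ hwq₀.symm,
        List.idxOf_cons_ne _ (Ne.symm hwq)]
      simp)
    rw [hw] at h₁
    refine absurd h₁ (not_lt.2 (hright _ (hTleft _ ((hblk q₁).resolve_left fun e => ?_))))
    exact hq01 (blockIn_injective hl _ (hgq₀.trans e.symm))
  have hlast : p (Fin.last k) = pos q₀ := he.posOver_last hq₀
  -- The vertices `p₀`, `p₁` and `Fin.last k` contribute no inversions, so the sum may run over all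
  -- outer labels.
  have hzero : ∀ v, v = p₀ ∨ v = p₁ ∨ v = Fin.last k →
      (Finset.univ.filter fun w => (w ≠ q₀ ∧ w ≠ q₁) ∧ pos w < p v).card = 0 := by
    intro v hv
    rw [Finset.card_eq_zero, Finset.filter_eq_empty_iff]
    rintro w - ⟨-, hlt⟩
    have h₁ : p (Fin.last k) ≤ pos w := by
      rw [hlast]
      exact not_lt.1 ((he.idxOf_right w q₀).not.2 (not_lt.2 (hq₀ w)))
    have h₂ := (he.posOver_lt_iff (Fin.last k) v).1 (h₁.trans_lt hlt)
    rcases hv with rfl | rfl | rfl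
    · simp [eP] at h₂
    · have hp₀ : p₀ ≠ Fin.last k := by
        intro hp₀
        have := head?_destutter (R.word.letters.map (blockOut hl (Fin.last k)))
        rw [he.listExt.quot, eP, h.letters] at this
        simp only [List.head?_cons, List.map_cons, Option.some.injEq] at this
        rcases (hB r).1 (this.symm.trans hp₀) with hr | hr
        · exact hcr hr.symm
        · exact h.notMem (by simp [hr.1])
      have hp01 : p₀ ≠ v := fun e => hp (by simp [e])
      rw [eP, List.idxOf_cons_ne _ hp₀, List.idxOf_cons_ne _ hp01] at h₂
      simp at h₂
    · exact lt_irrefl _ h₂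
  have hext := he.extSign_eq_pow hP hQ eP hp eQ hq
  rw [Finset.sum_filter_of_ne (fun v _ hv => ⟨fun e => hv (hzero v (Or.inl e)),
    fun e => hv (hzero v (Or.inr (Or.inl e)))⟩), Fin.sum_univ_castSucc,
    hzero _ (Or.inr (Or.inr rfl)), add_zero] at hext
  have hlR := he.listSign_eq hq₀
  have hsplit : ∀ t, (Finset.univ.filter fun w => w ≠ q₀ ∧ pos w < t).card =
      (Finset.univ.filter fun w => (w ≠ q₀ ∧ w ≠ q₁) ∧ pos w < t).card +
        if pos q₁ < t then 1 else 0 := by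
    intro t
    have e₁ : (Finset.univ.filter fun w => (w ≠ q₀ ∧ w ≠ q₁) ∧ pos w < t) =
        (Finset.univ.filter fun w => w ≠ q₀ ∧ pos w < t).erase q₁ := by
      ext w
      simp only [Finset.mem_filter, Finset.mem_univ, true_and, Finset.mem_erase]
      tauto
    rw [e₁]
    by_cases ht : pos q₁ < t
    · rw [if_pos ht, Finset.card_erase_add_one (by simp [hq01.symm, ht])]
    · rw [if_neg ht, Finset.erase_eq_of_notMem (by simp [ht]), add_zero]
  -- The outer vertices before `b` are `r` and those of `G ++ S`, except `c`, which lies in the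
  -- block.
  have hM : (G ++ S).toFinset.card + ∑ a : Fin k, (if pos q₁ < p a.castSucc then 1 else 0) = k := by
    have hpa : ∀ a : Fin k, p a.castSucc =
        R.word.letters.idxOf (blockSec hl (Fin.last k) q₀ a.castSucc) := fun a =>
      posOver_block_of_ne hl _ q₀ (Fin.castSucc_lt_last a).ne
    have hiff : ∀ a : Fin k, pos q₁ < p a.castSucc ↔
        blockSec hl (Fin.last k) q₀ a.castSucc ∉ r :: (G ++ S) := by
      intro a
      rw [hpa]
      change R.word.letters.idxOf (blockIn hl _ q₁) < _ ↔ _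
      rw [hgq₁]
      refine ⟨fun hlt hm => absurd (hleft _ hm) (by omega), fun hm => ?_⟩
      refine lt_of_le_of_ne (hright _ hm) fun e => ?_
      have := (List.idxOf_inj (R.word.surjective b)).1 e
      refine (Fin.castSucc_lt_last a).ne ?_
      rw [← blockOut_blockSec hl (Fin.last k) q₀ a.castSucc, ← this]
      exact (hB b).2 (Or.inr ⟨hD.b_mem, hcb⟩)
    have hinj : Function.Injective fun a : Fin k => blockSec hl (Fin.last k) q₀ a.castSucc :=
      (blockSec_injective hl _ q₀).comp (Fin.castSucc_injective k)
    have himg : (Finset.univ.filter fun a : Fin k =>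
        blockSec hl (Fin.last k) q₀ a.castSucc ∈ r :: (G ++ S)).map ⟨_, hinj⟩ =
        (r :: (G ++ S)).toFinset.erase c := by
      ext x
      simp only [Finset.mem_map, Finset.mem_filter, Finset.mem_univ, true_and,
        Function.Embedding.coeFn_mk, Finset.mem_erase, List.mem_toFinset]
      constructor
      · rintro ⟨a, ha, rfl⟩
        refine ⟨fun e => (Fin.castSucc_lt_last a).ne ?_, ha⟩
        rw [← blockOut_blockSec hl (Fin.last k) q₀ a.castSucc, e]
        exact (hB c).2 (Or.inl rfl)
      · rintro ⟨hxc, hx⟩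
        have hx' : blockOut hl (Fin.last k) x ≠ Fin.last k := fun e =>
          ((hB x).1 e).elim hxc fun e => hTleft x e.1 hx
        obtain ⟨a, ha⟩ := Fin.exists_castSucc_eq.2 hx'
        have hsec := blockSec_blockOut hl _ q₀ hx'
        exact ⟨a, by rw [ha, hsec]; exact hx, by rw [ha, hsec]⟩
    have hcard := congrArg Finset.card himg
    have hrGS : r ∉ (G ++ S).toFinset := fun hm =>
      h.notMem (List.mem_append_left _ (List.mem_toFinset.1 hm))
    rw [Finset.card_map, Finset.card_erase_of_mem (List.mem_toFinset.2 hcleft), List.toFinset_cons,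
      Finset.card_insert_of_notMem hrGS, Nat.add_sub_cancel] at hcard
    simp only [hiff]
    rw [← hcard, ← Finset.card_filter, Finset.card_filter_add_card_filter_not]
    simp
  simp only [← hpdef] at hlR hext
  change listSign _ = _ * (-1) ^ ∑ a : Fin k,
    (Finset.univ.filter fun w => w ≠ q₀ ∧ pos w < p a.castSucc).card at hlR
  simp only [hsplit, Finset.sum_add_distrib] at hlR
  rw [hext]
  change _ * (-1) ^ (∑ a : Fin k,
    (Finset.univ.filter fun w => (w ≠ q₀ ∧ w ≠ q₁) ∧ pos w < p a.castSucc).card) = _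
  have hneg : -((-1 : ℤ) ^ (G ++ S).toFinset.card * R.sgnK) =
      (-1) ^ ((G ++ S).toFinset.card + 1) * R.sgnK := by ring
  rw [hneg]
  refine sgnK_mul_sgnK (c := (∑ a : Fin k, (Finset.univ.filter fun w => (w ≠ q₀ ∧ w ≠ q₁) ∧
    pos w < p a.castSucc).card) + k * (n - 1) + k + 1) (by omega) (by omega) hlR ?_
  have hkn : k * n = k * (n - 1) + k := by
    obtain ⟨n, rfl⟩ : ∃ n', n = n' + 1 := ⟨n - 1, by omega⟩
    rw [Nat.add_sub_cancel]
    ring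
  omega

end Quilt.IsExt

end QuiltOp

namespace QuiltOp

/-! ### Shuffles and subsets -/

section Shuffles

variable {n k q : ℕ}

/-- Two shuffles with the same final block differ by a strictly increasing permutation, which is the
identity. -/
theorem shuffles_unique {B : Finset (Fin n)} {σ τ : Equiv.Perm (Fin n)} (hσ : σ ∈ shuffles n k)
    (hτ : τ ∈ shuffles n k) (hσB : ∀ y, k ≤ (σ.symm y).1 ↔ y ∈ B)
    (hτB : ∀ y, k ≤ (τ.symm y).1 ↔ y ∈ B) : σ = τ := by
  simp only [shuffles, Finset.mem_filter, Finset.mem_univ, true_and] at hσ hτ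
  have hk : ∀ i : Fin n, k ≤ (σ.symm (τ i)).1 ↔ k ≤ i.1 := fun i => by
    rw [hσB, ← hτB, Equiv.symm_apply_apply]
  have hmono : StrictMono (τ.trans σ.symm) := by
    intro i j hij
    have hle : i.1 < j.1 := hij
    have hi := hk i
    have hj := hk j
    by_contra hn
    rcases (not_lt.1 hn).eq_or_lt with e | hlt
    · exact hij.ne' ((τ.trans σ.symm).injective e)
    · have hlt' : (σ.symm (τ j)).1 < (σ.symm (τ i)).1 := hlt
      have h₁ : τ j < τ i := by
        rcases lt_or_ge i.1 k with h | h
        · simpa using hσ.1 _ _ hlt (show (σ.symm (τ i)).1 < k by omega)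
        · simpa using hσ.2 _ _ (show k ≤ (σ.symm (τ j)).1 by omega) hlt
      have h₂ : τ i < τ j := by
        rcases lt_or_ge j.1 k with h' | h'
        · exact hτ.1 _ _ hij h'
        · exact hτ.2 _ _ (by omega) hij
      exact lt_asymm h₁ h₂
  ext i : 1
  have := congrFun hmono.eq_id i
  exact (Equiv.symm_apply_eq σ).1 this |>.symm

/-- The shuffle lists first the complement of `B` and then `B`, each in increasing order. -/
theorem exists_shuffle (B : Finset (Fin (k + q))) (hB : B.card = q) :
    ∃ σ ∈ shuffles (k + q) k, ∀ y, k ≤ (σ.symm y).1 ↔ y ∈ B := by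
  have hc : Bᶜ.card = k := by rw [Finset.card_compl, Fintype.card_fin]; omega
  have hcc : Bᶜᶜ.card = q := by rwa [compl_compl]
  have hl : ∀ a : Fin k, finSumFinEquiv.symm.trans (finSumEquivOfFinset hc hcc)
      (Fin.castAdd q a) = Bᶜ.orderEmbOfFin hc a := fun a => by simp
  have hr : ∀ a : Fin q, finSumFinEquiv.symm.trans (finSumEquivOfFinset hc hcc)
      (Fin.natAdd k a) = Bᶜᶜ.orderEmbOfFin hcc a := fun a => by simp
  refine ⟨finSumFinEquiv.symm.trans (finSumEquivOfFinset hc hcc), ?_, ?_⟩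
  · simp only [shuffles, Finset.mem_filter, Finset.mem_univ, true_and]
    refine ⟨fun i j => ?_, fun i j => ?_⟩
    · refine Fin.addCases (fun a => ?_) (fun a => ?_) j
      · refine Fin.addCases (fun b => ?_) (fun b => ?_) i
        · intro h _
          rw [hl, hl]
          exact (Bᶜ.orderEmbOfFin hc).strictMono h
        · intro h
          have : k + b.1 < a.1 := h
          omega
      · intro _ h
        have : k + a.1 < k := h
        omega
    · refine Fin.addCases (fun a => ?_) (fun a => ?_) i
      · intro h
        have : k ≤ a.1 := h
        omega
      · refine Fin.addCases (fun b => ?_) (fun b => ?_) j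
        · intro _ h
          have : k + a.1 < b.1 := h
          omega
        · intro _ h
          rw [hr, hr]
          exact (Bᶜᶜ.orderEmbOfFin hcc).strictMono ((Fin.natAdd_lt_natAdd_iff k).1 h)
  · intro y
    obtain ⟨i, rfl⟩ := (finSumFinEquiv.symm.trans (finSumEquivOfFinset hc hcc)).surjective y
    rw [Equiv.symm_apply_apply]
    revert i
    refine Fin.addCases (fun a => ?_) (fun a => ?_)
    · have := Finset.mem_compl.1 (Bᶜ.orderEmbOfFin_mem hc a)
      rw [hl]
      simp [this]
    · rw [hr]
      simp

theorem card_of_shuffle {B : Finset (Fin n)} {σ : Equiv.Perm (Fin n)}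
    (h : ∀ y, k ≤ (σ.symm y).1 ↔ y ∈ B) : B.card = n - k := by
  have : B = (Finset.univ.filter fun i : Fin n => k ≤ i.1).map σ.toEmbedding := by
    ext y
    simp [← h, Finset.mem_map_equiv]
  rw [this, Finset.card_map]
  have h₁ := Finset.card_filter_add_card_filter_not (s := Finset.univ) fun i : Fin n => i.1 < k
  have h₂ : (Finset.univ.filter fun i : Fin n => i.1 < k).card = min n k :=
    Fin.card_filter_val_lt
  simp only [not_lt, Finset.card_univ, Fintype.card_fin] at h₁
  omega

open Classical in
-- The cardinality of `B` determines `p` and `q`, and `B` itself then determines the shuffle. The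
-- double sum of the `L∞` relation is therefore a sum over the possible blocks.
theorem sum_shuffles (B : Finset (Fin n)) (h₁ : 2 ≤ B.card) (h₂ : B.card + 1 ≤ n) :
    ∑ x ∈ arityPairs n, ∑ σ ∈ shuffles n (x.1 - 1),
      (if ∀ y, x.1 - 1 ≤ (σ.symm y).1 ↔ y ∈ B then (1 : ℤ) else 0) = 1 := by
  rw [Finset.sum_eq_single (n + 1 - B.card, B.card)]
  · obtain ⟨q, hq⟩ : ∃ q, B.card = q := ⟨_, rfl⟩
    obtain ⟨k, rfl⟩ : ∃ k, n = k + q := ⟨n - q, by omega⟩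
    have e : k + q + 1 - q - 1 = k := by omega
    dsimp only
    rw [hq, e]
    obtain ⟨σ, hσ, hB⟩ := exists_shuffle B hq
    rw [Finset.sum_eq_single_of_mem σ hσ, if_pos hB]
    intro τ hτ hne
    exact if_neg fun h => hne (shuffles_unique hτ hσ h hB)
  · rintro ⟨p, q⟩ hx hne
    have hs := arityPairs_spec hx
    refine Finset.sum_eq_zero fun σ _ => if_neg fun h => hne ?_
    have := card_of_shuffle h
    ext <;> dsimp at this hs ⊢ <;> omega
  · intro h
    refine absurd ?_ h
    simp only [arityPairs, Finset.mem_filter, Finset.mem_product, Finset.mem_range]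
    omega

end Shuffles

/-! ### Relabelling of one-cut quilts -/

section CutMap

variable {n : ℕ} {F G S T H : List (Fin n)} {c b : Fin n}

theorem CutData.map (h : CutData F G S T H c b) (σ : Equiv.Perm (Fin n)) :
    CutData (F.map σ) (G.map σ) (S.map σ) (T.map σ) (H.map σ) (σ c) (σ b) where
  eq := by rw [h.eq]; simp
  red := ⟨by
      have := h.red.chain
      rw [List.isChain_map]
      exact this.imp fun _ _ hab e => hab (σ.injective e), fun u v huv hs =>
      h.red.noInterlacing (σ.symm u) (σ.symm v) (fun e => huv (σ.symm.injective e))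
        (by simpa using hs.map σ.symm)⟩
  headS := h.headS.imp' (List.map σ) (by rintro _ rfl; simp)
  lastS := h.lastS.imp' (List.map σ) (by rintro _ rfl; simp)
  headT := h.headT.imp' (List.map σ) (by rintro _ rfl; simp)
  lastT := h.lastT.imp' (List.map σ) (by rintro _ rfl; simp)
  notMem_G := by simpa using h.notMem_G
  notMem_TH := by simpa using h.notMem_TH
  notMem_GS := by simpa using h.notMem_GS
  notMem_H := by simpa using h.notMem_H
  unique A x y B e hx hy := by
    have e' : F = A.map σ.symm ++ σ.symm x :: σ.symm y :: B.map σ.symm := by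
      simpa using congrArg (List.map σ.symm) e
    have := h.unique _ _ _ _ e' (by simpa [Equiv.symm_apply_eq] using hx)
      (by simpa [Equiv.symm_apply_eq] using hy)
    have h₁ := congrArg (List.map σ) this.1
    have h₂ := congrArg (List.map σ) this.2
    simp only [List.map_append, List.map_cons, List.map_map, Equiv.self_comp_symm, List.map_id,
      Equiv.apply_symm_apply, List.map_nil] at h₁ h₂
    exact ⟨h₁, h₂⟩

theorem Quilt.HasCut.relabel {R : Quilt n} {r : Fin n} (h : R.HasCut r G S T H c b)
    (σ : Equiv.Perm (Fin n)) : (R.relabel σ).HasCut (σ.symm r) (G.map σ.symm) (S.map σ.symm)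
      (T.map σ.symm) (H.map σ.symm) (σ.symm c) (σ.symm b) where
  letters := by simp [Quilt.relabel, Word.relabel, h.letters]
  root u := (PTree.relabel_le σ _ _).2 (by simpa using h.root (σ u))
  notMem := by simpa using h.notMem
  cutData := by simpa using h.cutData.map σ.symm

end CutMap

/-! ### The coefficient of a one-cut quilt in a composition -/

section Coefficient

open Classical in
theorem sum_sum_ite {α β : Type*} [Fintype α] [Fintype β] {p : α → β → Prop} (f : α → β → ℤ)
    (v : ℤ) (hv : ∀ a b, p a b → f a b = v)
    (hu : ∀ a b a' b', p a b → p a' b' → a = a' ∧ b = b') :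
    ∑ a, ∑ b, (if p a b then f a b else 0) = if ∃ a b, p a b then v else 0 := by
  split_ifs with h
  · obtain ⟨a, b, hab⟩ := h
    rw [Finset.sum_eq_single_of_mem a (Finset.mem_univ _),
      Finset.sum_eq_single_of_mem b (Finset.mem_univ _), if_pos hab, hv a b hab]
    · exact fun b' _ hne => if_neg fun h => hne (hu _ _ _ _ h hab).2
    · exact fun a' _ hne => Finset.sum_eq_zero fun b' _ =>
        if_neg fun h => hne (hu _ _ _ _ h hab).1
  · exact Finset.sum_eq_zero fun a _ => Finset.sum_eq_zero fun b _ =>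
      if_neg fun hab => h ⟨a, b, hab⟩

theorem Quilt.IsExt.unique {m n l : ℕ} {hl : l + 1 = m + n} {i : Fin m} {P P' : Quilt m}
    {Q Q' : Quilt n} {R : Quilt l} (h : Quilt.IsExt hl i P Q R) (h' : Quilt.IsExt hl i P' Q' R) :
    P = P' ∧ Q = Q' := by
  have ht := h.2.quot_unique h'.2
  refine ⟨Quilt.ext (Word.ext ?_) ht.1, Quilt.ext (Word.ext ?_) ht.2⟩
  · rw [← h.1.quot, h'.1.quot]
  · refine List.map_injective_iff.2 (blockIn_injective hl i) ?_
    rw [← h.1.sub, h'.1.sub]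

open Classical in
theorem evalAt_comp_L0 {m n l : ℕ} (hl : l + 1 = m + n) (i : Fin m) {f : ℤ}
    (hf : ((m : ℤ) - 2) + ((n : ℤ) - 2) = f) (R : Quilt l) (hR : R.deg = f) :
    evalAt (fun W T => if W = R.word.letters ∧ T = R.tree then 1 else 0)
      (quiltOperad.comp hl hf i (L0 m) (L0 n)) =
    ∑ P : GQuilt m ((m : ℤ) - 2), ∑ Q : GQuilt n ((n : ℤ) - 2),
      if Quilt.IsExt hl i P.1 Q.1 R then P.1.sgnK * Q.1.sgnK *
        extSign hl i P.1.word.letters Q.1.word.letters R.word.letters else 0 := by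
  rw [evalAt_comp, evalAt_L0]
  refine Finset.sum_congr rfl fun P _ => ?_
  rw [evalAt_L0, Finset.mul_sum]
  refine Finset.sum_congr rfl fun Q _ => ?_
  have h₁ := pair_quiltComp hl i P.1 Q.1 (f := f) (by rw [P.2, Q.2, hf])
    fun W T => if W = R.word.letters ∧ T = R.tree then 1 else 0
  have h₂ := pair_indicator ⟨R, hR⟩ (Quilt.comp hl f i P.1 Q.1)
  dsimp only at h₁ h₂
  rw [h₂] at h₁
  rw [← h₁, Quilt.comp, Finsupp.finsetSum_apply, Finset.sum_eq_single_of_mem ⟨R, hR⟩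
    (Finset.mem_univ _)]
  · split_ifs <;> simp [mul_assoc]
  · intro R' _ hne
    split_ifs
    · exact Finsupp.single_eq_of_ne (Ne.symm hne)
    · rfl

variable {k n l : ℕ} {R : Quilt l} {r c b : Fin l} {G S T H : List (Fin l)}

open Classical in
-- At most one pair of factors yields `R`. Whether the block contains the root decides which of the
-- two descriptions of the block applies, and with it the sign.
theorem Quilt.HasCut.evalAt_comp_L0 (h : R.HasCut r G S T H c b) (hl : l + 1 = k + 1 + n)
    (hk : 1 ≤ k) (hn : 2 ≤ n) {f : ℤ} (hf : (((k + 1 : ℕ) : ℤ) - 2) + ((n : ℤ) - 2) = f)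
    (hR : R.deg = f) :
    evalAt (fun W T => if W = R.word.letters ∧ T = R.tree then 1 else 0)
      (quiltOperad.comp hl hf (Fin.last k) (L0 (k + 1)) (L0 n)) =
    (-1) ^ (k * n) * ((-1) ^ (G ++ S).toFinset.card * R.sgnK *
      ((if G = [] ∧ ∀ x, k ≤ x.1 ↔ x = r ∨ x ∈ S then 1 else 0) -
      (if R.tree.le c b ∧ ∀ x, k ≤ x.1 ↔ x = c ∨ (x ∈ T ∧ R.tree.le c x) then 1 else 0))) := by
  have hblk : ∀ x : Fin l, blockOut hl (Fin.last k) x = Fin.last k ↔ k ≤ x.1 := by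
    intro x
    rw [blockOut_eq_self_iff]
    constructor
    · rintro ⟨j, rfl⟩
      simp [blockIn_val]
    · intro hx
      exact ⟨⟨x.1 - k, by omega⟩, Fin.ext (by simp [blockIn_val]; omega)⟩
  have hmax : ∀ {m : ℕ} (P : Quilt m), 2 ≤ m → P.deg ≤ (m : ℤ) - 2 := fun P hm => by
    obtain ⟨F, hF, hr⟩ := P.exists_letters_eq _ P.tree.rootVertex_le
    have := P.length_cuts hm hF hr
    omega
  -- The degrees of the factors are bounded by the maximal ones and add up to their sum, so both
  -- factors are maximal.
  have hgr : (∃ (P : Quilt (k + 1)) (Q : Quilt n), Quilt.IsExt hl (Fin.last k) P Q R ∧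
      P.deg + Q.deg = R.deg) → ∃ (P : GQuilt (k + 1) (((k + 1 : ℕ) : ℤ) - 2))
        (Q : GQuilt n ((n : ℤ) - 2)), Quilt.IsExt hl (Fin.last k) P.1 Q.1 R := by
    rintro ⟨P, Q, he, hd⟩
    have h₁ := hmax P (by omega)
    have h₂ := hmax Q hn
    exact ⟨⟨P, by omega⟩, ⟨Q, by omega⟩, he⟩
  have hu : ∀ (P : GQuilt (k + 1) (((k + 1 : ℕ) : ℤ) - 2)) (Q : GQuilt n ((n : ℤ) - 2))
      (P' : GQuilt (k + 1) (((k + 1 : ℕ) : ℤ) - 2)) (Q' : GQuilt n ((n : ℤ) - 2)),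
      Quilt.IsExt hl (Fin.last k) P.1 Q.1 R → Quilt.IsExt hl (Fin.last k) P'.1 Q'.1 R →
      P = P' ∧ Q = Q' := fun P Q P' Q' he he' =>
    ⟨Subtype.ext (he.unique he').1, Subtype.ext (he.unique he').2⟩
  rw [QuiltOp.evalAt_comp_L0 hl _ hf R hR]
  simp only [← hblk]
  by_cases hr : blockOut hl (Fin.last k) r = Fin.last k
  · rw [if_neg (c := R.tree.le c b ∧ _), sum_sum_ite _ ((-1) ^ (k * n) *
      ((-1) ^ (G ++ S).toFinset.card * R.sgnK)) (fun P Q he => ?_) hu]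
    · have hiff : (∃ (P : GQuilt (k + 1) (((k + 1 : ℕ) : ℤ) - 2)) (Q : GQuilt n ((n : ℤ) - 2)),
          Quilt.IsExt hl (Fin.last k) P.1 Q.1 R) ↔ G = [] ∧ ∀ x,
            blockOut hl (Fin.last k) x = Fin.last k ↔ x = r ∨ x ∈ S :=
        ⟨fun ⟨_, _, he⟩ => he.block_eq_of_root h (by omega) hn hr,
          fun ⟨hG, hB⟩ => hgr (h.exists_isExt_of_root hl _ hG hB)⟩
      simp only [hiff]
      split_ifs <;> ring
    · obtain ⟨hG, hB⟩ := he.block_eq_of_root h (by omega) hn hr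
      exact he.sign_of_root h P.2 Q.2 hk hn hG hB
    · rintro ⟨-, hB⟩
      have hc := h.cutData.c_mem
      rcases (hB r).1 hr with e | e
      · exact h.notMem (by simp [e, hc])
      · exact h.notMem (by simp [e.1])
  · rw [if_neg (c := G = [] ∧ _), sum_sum_ite _ ((-1) ^ (k * n) *
      -((-1) ^ (G ++ S).toFinset.card * R.sgnK)) (fun P Q he => ?_) hu]
    · have hiff : (∃ (P : GQuilt (k + 1) (((k + 1 : ℕ) : ℤ) - 2)) (Q : GQuilt n ((n : ℤ) - 2)),
          Quilt.IsExt hl (Fin.last k) P.1 Q.1 R) ↔ R.tree.le c b ∧ ∀ x,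
            blockOut hl (Fin.last k) x = Fin.last k ↔ x = c ∨ (x ∈ T ∧ R.tree.le c x) :=
        ⟨fun ⟨_, Q, he⟩ => he.block_eq_of_not_root h hn Q.2 hr,
          fun ⟨hcb, hB⟩ => hgr (h.exists_isExt_of_le hl _ hcb hB)⟩
      simp only [hiff]
      split_ifs <;> ring
    · obtain ⟨hcb, hB⟩ := he.block_eq_of_not_root h hn Q.2 hr
      exact he.sign_of_le h P.2 Q.2 hk hn hB hcb
    · exact fun hB => hr ((hB.2 r).2 (Or.inl rfl))

end Coefficient

end QuiltOp

namespace QuiltOp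

/-! ### The `L∞` relations for `L0` -/

section Defect

variable {n : ℕ} {R : Quilt n} {r c b : Fin n} {G S T H : List (Fin n)}
  (h : R.HasCut r G S T H c b)
include h

open Classical in
-- The coefficient of `R` after the action of `σ⁻¹` is that of the relabelled quilt `R.relabel σ`
-- before it. The sign of `σ` in `linfSign` cancels the one from `sgnK`, and `(-1) ^ (k * q)` occurs
-- twice.
theorem Quilt.HasCut.evalAt_act_comp_L0 {p q : ℕ} (hpq : p + q = n + 1) (hp : 2 ≤ p)
    (hq : 2 ≤ q) (hf : ((p : ℤ) - 2) + ((q : ℤ) - 2) = (n : ℤ) - 3) (hR : R.deg = (n : ℤ) - 3)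
    (σ : Equiv.Perm (Fin n)) :
    linfSign p q σ * evalAt (fun W T => if W = R.word.letters ∧ T = R.tree then 1 else 0)
      (quiltOperad.act σ⁻¹ (quiltOperad.comp (m := p) (n := q) hpq.symm hf
        ⟨p - 1, by omega⟩ (L0 p) (L0 q))) =
    (-1) ^ (G ++ S).toFinset.card * R.sgnK *
      ((if G = [] then if ∀ y, p - 1 ≤ (σ.symm y).1 ↔ y ∈ insert r S.toFinset then 1 else 0
        else 0) - (if R.tree.le c b then if ∀ y, p - 1 ≤ (σ.symm y).1 ↔
          y ∈ insert c (T.toFinset.filter fun x => R.tree.le c x) then 1 else 0 else 0)) := by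
  obtain ⟨k, rfl⟩ : ∃ k, p = k + 1 := ⟨p - 1, by omega⟩
  have hL : ∀ L : List (Fin n), (L.map σ.symm).map (σ⁻¹ : Equiv.Perm (Fin n)).symm = L ∧
      (L.map (σ⁻¹ : Equiv.Perm (Fin n)).symm).map σ.symm = L := fun L => by
    rw [List.map_map, List.map_map]
    exact ⟨(List.map_congr_left fun x _ => σ.apply_symm_apply x).trans L.map_id,
      (List.map_congr_left fun x _ => σ.symm_apply_apply x).trans L.map_id⟩
  have hφ : (fun (W : List (Fin n)) (T : PTree n) => if W.map (σ⁻¹ : Equiv.Perm (Fin n)).symm =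
      R.word.letters ∧ T.relabel σ⁻¹ = R.tree then (1 : ℤ) else 0) = fun W T =>
      if W = (R.relabel σ).word.letters ∧ T = (R.relabel σ).tree then 1 else 0 := by
    funext W T
    refine if_congr (and_congr ?_ ?_) rfl rfl
    · refine ⟨fun e => ?_, ?_⟩
      · change W = R.word.letters.map σ.symm
        rw [← e, (hL W).2]
      · rintro rfl
        exact (hL R.word.letters).1
    · refine ⟨fun e => ?_, ?_⟩
      · change T = R.tree.relabel σ
        rw [← e, PTree.relabel_relabel, inv_mul_cancel]
        rfl
      · rintro rfl
        change (R.tree.relabel σ).relabel σ⁻¹ = _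
        rw [PTree.relabel_relabel, mul_inv_cancel]
        rfl
  have hdeg : (R.relabel σ).deg = (n : ℤ) - 3 := (GQuilt.relabel σ ⟨R, hR⟩).2
  have key := (h.relabel σ).evalAt_comp_L0 hpq.symm (by omega) hq hf hdeg
  have hcard : ((G.map σ.symm ++ S.map σ.symm).toFinset).card = (G ++ S).toFinset.card := by
    rw [← List.map_append, ← Finset.card_image_of_injective (G ++ S).toFinset σ.symm.injective]
    congr 1
    ext x
    simp only [List.mem_toFinset, List.mem_map, Finset.mem_image]
  have h₁ : (∀ x : Fin n, k ≤ x.1 ↔ x = σ.symm r ∨ x ∈ S.map σ.symm) ↔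
      ∀ y, k + 1 - 1 ≤ (σ.symm y).1 ↔ y ∈ insert r S.toFinset := by
    rw [σ.symm.surjective.forall]
    simp
  have h₂ : (∀ x : Fin n, k ≤ x.1 ↔ x = σ.symm c ∨
      (x ∈ T.map σ.symm ∧ (R.relabel σ).tree.le (σ.symm c) x)) ↔
      ∀ y, k + 1 - 1 ≤ (σ.symm y).1 ↔
        y ∈ insert c (T.toFinset.filter fun x => R.tree.le c x) := by
    have hle : ∀ u v, (R.relabel σ).tree.le u v ↔ R.tree.le (σ u) (σ v) := R.tree.relabel_le σ
    rw [σ.symm.surjective.forall]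
    simp [hle]
  have h₃ : (R.relabel σ).tree.le (σ.symm c) (σ.symm b) ↔ R.tree.le c b := by
    refine (R.tree.relabel_le σ _ _).trans ?_
    simp
  rw [evalAt_act, hφ]
  refine (congrArg _ key).trans ?_
  simp only [hcard, Quilt.sgnK_relabel, h₁, h₂, h₃, List.map_eq_nil_iff]
  have hs : (Equiv.Perm.sign σ : ℤ) * Equiv.Perm.sign σ = 1 := by
    rw [← Units.val_mul, Int.units_mul_self, Units.val_one]
  have hpow : ((-1 : ℤ) ^ (k * q)) * (-1) ^ (k * q) = 1 := by
    rw [← mul_pow]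
    simp
  have hsgn : ((linfSign (k + 1) q σ : ℤˣ) : ℤ) = (-1) ^ (k * q) * Equiv.Perm.sign σ := by
    simp [linfSign]
  rw [hsgn, ite_and, ite_and]
  linear_combination ((-1) ^ (G ++ S).toFinset.card * R.sgnK *
      ((if G = [] then if ∀ y, k + 1 - 1 ≤ (σ.symm y).1 ↔ y ∈ insert r S.toFinset then 1 else 0
        else 0) - (if R.tree.le c b then if ∀ y, k + 1 - 1 ≤ (σ.symm y).1 ↔
          y ∈ insert c (T.toFinset.filter fun x => R.tree.le c x) then 1 else 0 else 0))) *
      (hs * (-1) ^ (k * q) * (-1) ^ (k * q) + hpow)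

open Classical in
-- The first closing of the cut is possible iff `G` is nonempty, and the block with the root iff `G`
-- is empty, so together they contribute `1`. The other three terms contribute `-1` together, by the
-- trichotomy of relations between `c` and `b`.
theorem Quilt.HasCut.evalAt_linfDefect (hn : 2 ≤ n) (hR : R.deg = (n : ℤ) - 3) :
    evalAt (fun W T => if W = R.word.letters ∧ T = R.tree then 1 else 0)
      (linfDefect quiltOperad (fun k _ => L0 k) n hn) = 0 := by
  have hcS := h.cutData.c_mem
  have hbT := h.cutData.b_mem
  have hcb := h.cutData.c_ne_b
  have hrc : r ≠ c := fun e => h.notMem (by simp [e, hcS])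
  have hrb : r ≠ b := fun e => h.notMem (by simp [e, hbT])
  have hcard : ∀ {B : Finset (Fin n)} {x y z : Fin n}, x ∈ B → y ∈ B → x ≠ y → z ∉ B →
      2 ≤ B.card ∧ B.card + 1 ≤ n := fun {B x y z} hx hy hxy hz =>
    ⟨Finset.one_lt_card.2 ⟨x, hx, y, hy, hxy⟩, by
      have := Finset.card_le_univ (insert z B)
      rwa [Finset.card_insert_of_notMem hz, Fintype.card_fin] at this⟩
  have h₁ := hcard (B := insert r S.toFinset) (x := r) (y := c) (z := b) (by simp) (by simp [hcS])
    hrc (by simpa [hrb.symm] using fun e => h.cutData.notMem_GS (List.mem_append_right _ e))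
  have hsum : ∑ x ∈ (arityPairs n).attach, ∑ σ ∈ shuffles n (x.1.1 - 1),
      (-1) ^ (G ++ S).toFinset.card * R.sgnK *
        ((if G = [] then if ∀ y, x.1.1 - 1 ≤ (σ.symm y).1 ↔ y ∈ insert r S.toFinset then 1 else 0
          else 0) - (if R.tree.le c b then if ∀ y, x.1.1 - 1 ≤ (σ.symm y).1 ↔
            y ∈ insert c (T.toFinset.filter fun x => R.tree.le c x) then 1 else 0 else 0)) =
      (-1) ^ (G ++ S).toFinset.card * R.sgnK *
        ((if G = [] then 1 else 0) - (if R.tree.le c b then 1 else 0)) := by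
    refine (Finset.sum_attach (arityPairs n) fun x => ∑ σ ∈ shuffles n (x.1 - 1),
      (-1) ^ (G ++ S).toFinset.card * R.sgnK *
        ((if G = [] then if ∀ y, x.1 - 1 ≤ (σ.symm y).1 ↔ y ∈ insert r S.toFinset then 1 else 0
          else 0) - (if R.tree.le c b then if ∀ y, x.1 - 1 ≤ (σ.symm y).1 ↔
            y ∈ insert c (T.toFinset.filter fun x => R.tree.le c x) then 1 else 0 else 0))).trans ?_
    simp only [← Finset.mul_sum, Finset.sum_sub_distrib]
    congr 2
    · split_ifs
      · exact sum_shuffles _ h₁.1 h₁.2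
      · simp
    · split_ifs with hle
      · have h₂ := hcard (B := insert c (T.toFinset.filter fun x => R.tree.le c x)) (x := c)
          (y := b) (z := r) (by simp) (by simp [hbT, hle]) hcb (by
            simpa [hrc] using fun e => absurd (by simp [e]) h.notMem)
        exact sum_shuffles _ h₂.1 h₂.2
      · simp
  rw [linfDefect, evalAt_add, h.evalAt_bd_L0 hR, evalAt_sum]
  -- In the word `c` precedes `b`, so the vertical condition excludes this case.
  have hb : ¬ R.tree.le b c := fun e =>
    h.not_lt_right (List.mem_append_right _ hcS) (List.mem_append_left _ hbT) ⟨e, hcb.symm⟩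
  have hterm : ∑ x ∈ (arityPairs n).attach,
      evalAt (fun W T => if W = R.word.letters ∧ T = R.tree then 1 else 0)
        (∑ σ ∈ shuffles n (x.1.1 - 1), linfSign x.1.1 x.1.2 σ • quiltOperad.act σ⁻¹
          (quiltOperad.comp (m := x.1.1) (n := x.1.2) (arityPairs_spec x.2).1.symm
            (by have := (arityPairs_spec x.2).1; omega)
            ⟨x.1.1 - 1, by have := (arityPairs_spec x.2).2.1; omega⟩
            (L0 x.1.1) (L0 x.1.2)) : quiltOperad.carrier n ((n : ℤ) - 3)) =
      (-1) ^ (G ++ S).toFinset.card * R.sgnK *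
        ((if G = [] then 1 else 0) - (if R.tree.le c b then 1 else 0)) := by
    rw [← hsum]
    refine Finset.sum_congr rfl fun x _ => ?_
    rw [evalAt_sum]
    refine Finset.sum_congr rfl fun σ _ => ?_
    rw [evalAt_units_smul]
    have hx := arityPairs_spec x.2
    exact h.evalAt_act_comp_L0 hx.1 hx.2.1 hx.2.2 _ hR σ
  refine (congrArg _ hterm).trans ?_
  rcases PTree.left_or (T := R.tree) c b with e | e | e | e
  · rw [if_neg fun e' => (PTree.left_not_le e').1 e, if_neg fun e' => (PTree.left_not_le e').2 e,
      if_pos e]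
    split_ifs <;> ring
  · exact absurd e hb
  · rw [if_pos e, if_neg fun e' => PTree.left_asymm e e', if_neg (PTree.left_not_le e).1]
    split_ifs <;> ring
  · rw [if_pos e, if_neg fun e' => PTree.left_asymm e e', if_neg (PTree.left_not_le e).2]
    split_ifs <;> ring

end Defect

theorem linfDefect_L0 (n : ℕ) (hn : 2 ≤ n) :
    linfDefect quiltOperad (fun k _ => L0 k) n hn = 0 := by
  refine evalAt_ext_indicator fun Q => ?_
  rw [evalAt_zero]
  have hr := Q.1.tree.rootVertex_le
  obtain ⟨F, hF, hrF⟩ := Q.1.exists_letters_eq _ hr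
  have hlen := Q.1.length_cuts hn hF hrF
  have hred := Q.1.word.reduced
  rw [hF] at hred
  rw [Q.2] at hlen
  -- The degree `n - 3` leaves exactly one cut.
  obtain ⟨G, S, T, H, c, b, hD⟩ := hred.tail.exists_cutData (by omega)
  have e := hD.eq
  exact Quilt.HasCut.evalAt_linfDefect ⟨hF.trans (by rw [e]), hr, e ▸ hrF, e ▸ hD⟩ hn Q.2

end QuiltOp

open QuiltOp in
theorem mainTheorem3 :
    IsDGOperad quiltOperad ∧
    (∀ (n : ℕ) (hn : 2 ≤ n), linfDefect quiltOperad (fun k _ => L0 k) n hn = 0) ∧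
    ∃! K : DGOperadHom linf quiltOperad,
      ∀ (n : ℕ) (hn : 2 ≤ n), K.toFun n ((n : ℤ) - 2) (ell n hn) = L0 n :=
  ⟨quiltOperad_isDGOperad, linfDefect_L0,
    existsUnique_hom quiltOperad_isDGOperad (fun _ _ σ => L0_act σ) linfDefect_L0⟩
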